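/- Let $n\ge 1$, $d\ge 2$, and let $a=2^{i_1}+\dots+2^{i_d}$ with integers $i_1>i_2>\dots>i_d=0$ (so $a\ge 3$ is odd). Let $\alpha$ be an integer with $$2n\le\alpha\le 2an-(d-1)-\sum_{k=1}^d i_k .$$ **Notions.** $C_m$ is the cycle on $\mathbb Z/m\mathbb Z$, $Q_N$ is the hypercube on $\{0,1\}^N$. A decomposition of a graph $G$ into cycles $C_L$ is a family of pairwise edge-disjoint cycles of length $L$ in $G$ whose union is $G$. The anchored product $(G_1,S_1)\boxplus\dots\boxplus(G_d,S_d)$, $S_k\subseteq V(G_k)$, has as vertices the tuples $(x_1,\dots,x_d)$, $x_k\in V(G_k)$, with $x_j\in S_j$ for all but at most one $j$; $x$ and $y$ are adjacent iff for some $k$, $x_ky_k\in E(G_k)$ and $x_j=y_j\in S_j$ for all $j\neq k$. (The order of the factors only names the coordinates.) Put $e_k=n2^{i_k+1}-i_k$, $z_k=2^{e_k}$, and let $S_k\subseteq V(C_{2^{n2^{i_k+1}}})$ consist of every $2^{i_k}$-th vertex, i.e. of the multiples of $2^{i_k}$. The vertex $(u_k)_k$ of the underlying torus $T=C_{z_1}\square\dots\square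 C_{z_d}$ corresponds to the vertex $(2^{i_k}u_k)_k$ of the anchored product, and an edge of $T$ along the $k$-th factor corresponds to a path of $2^{i_k}$ edges of the anchored product along its $k$-th factor (subdivision). **Lock-and-Key cycles.** Coordinates $(j_1,\dots,j_d)$ on $T$ are taken in $\mathbb Z/z_1\times\mathbb Z/z_d\times\mathbb Z/z_2\times\dots\times\mathbb Z/z_{d-1}$. Let $\alpha_k=\sum_{j<k}e_j+e_d-(k-1)$; $\eta_k=1$ if $d\ge k$ and $0$ otherwise; $\eta_{\alpha_k}=1$ if $\alpha>\alpha_k$ and $0$ otherwise; $A_1=\eta_{\alpha_1}$; $A_2=1$ if $\alpha\ge\alpha_2$ and $0$ otherwise; $A_3=2^{(1-A_2)(\alpha-\alpha_1)+A_2(\alpha_2-\alpha_1)+1}$; $A_k=2^{(1-\eta_{\alpha_{k-1}})(\alpha-\alpha_{k-2})\eta_{\alpha_{k-2}}+\eta_{\alpha_{k-1}}(\alpha_{k-1}-\alpha_{k-2})}$ for $4\le k\le d+1$. The cycles are numbered by the integers $0\le\ell\le z_1/A_3-1$, $0\le\gamma\le1$, $0\le t\le 2^{(1-A_1)\eta_3}-1$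 and, for $1\le k\le d-2$, $0\le p_k\le 2^{\eta_{\alpha_{k+1}}}-1$ and $0\le s_k\le z_{k+1}/(A_{k+3}2^{\eta_{\alpha_{k+1}}+\epsilon_k})-1$ with $\epsilon_1=1-A_1$ and $\epsilon_k=0$ for $k\ge2$ (for $d=2$ put $s_1=0$). Admissible moves are the $m\in\{0,1\}^d$ with $m_1=\dots=m_d$, or $m_2\ne m_1=m_3=\dots=m_d$, or $m_1=\dots=m_k\neq m_{k+1}=\dots=m_d$ for some $2\le k\le d-1$. Let $\Pi_1=\prod_j m_j$, $\Pi_0=\prod_j(1-m_j)$, $\chi=\Pi_0-\Pi_1$. For $k\ge3$ let $m_k^-$ and $m_k^{--}$ be the entries one and two places before $m_k$ in the list $m_2,m_1,m_3,m_4,\dots,m_d$. Let $r_2\in\{0,1\}$ be the residue of $x_2$ modulo $2$, $X_k=\prod_{j=3}^{k+2}\lfloor (x_j+1)/A_{j+1}\rfloor$, $\Psi_k=\prod_{j=3}^{k+2}(1-\lceil x_j/A_{j+1}\rceil)$, $R_k=(1-r_2)X_{k-2}+r_2\Psi_{k-2}$ and $\Sigma_k=(1-r_2)m_{k+1}+r_2(1-m_{k+1})$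 for $k\ge2$, $R_1=\eta_3((1-\eta_{\alpha_2})+\eta_{\alpha_2}((1-r_2)X_{d-2}+r_2\Psi_{d-2}))+(1-\eta_3)$, $$r_1=\Big\lfloor\tfrac{2x_1+4}{A_3}\Big\rfloor\big((1-\eta_3)(1-m_2)m_1+\eta_3(1-\eta_4)(1-m_1)m_3+\eta_4m_d(1-m_{d-1})\big),$$ $D=(1-\eta_3)(1-A_2)\gamma$, $E=(1-\eta_3)(1-A_2)+\eta_3(1-A_1)$, $F=(1-\eta_3)A_2+\eta_3A_1$, $G=(1-\eta_3)+\eta_3(1-A_1)$. The edge set of the cycle with the given parameters consists of the edges $\{j,j+\delta\}$ for the following $j,\delta$, where $m$ runs over all admissible moves, $0\le x_1\le A_3/2-2$, $0\le x_2\le z_d2^{A_2-2}-1$, and $0\le x_k\le A_{k+1}-1$ for $3\le k\le d$ (where they occur), and $k\ge3$ in the last lines: *Set 1 (only if $A_1=1$):* $j_1=\ell A_3+DA_3-D+\eta_3(1-A_2)+(-1)^{D}(m_1+2x_1+2\eta_3m_d(1-m_1))$, $\delta_1=(-1)^D|m_2-m_1|$; $j_2=m_2+\gamma+\eta_3(1-A_2)(s_1+1)+(4-2A_2)x_2$,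 $\delta_2=\chi$; $j_k=p_{k-2}+s_{k-2}A_{k+1}2^{\eta_{\alpha_{k-1}}}+(1-A_2)+(-1)^{1-A_2}m_k+2x_k$, $\delta_k=(-1)^{1-A_2}(m_k^--m_k)$. *Set 2 (only if $A_1=1$, $A_2=0$):* $j_1=(\ell+1-(1-\eta_3)\gamma)A_3-(1-\eta_3)\gamma+(-1)^{(1-\eta_3)\gamma+1}\big(2+m_2+2m_1(1-m_2)+2x_1+\eta_3(2m_d(1-m_1)-r_1(A_3-1))\big)$, $\delta_1=(-1)^{(1-\eta_3)\gamma+1}|\chi|$; $j_2=2+\gamma+(1-\eta_3)m_1+\eta_3(1+s_1+m_d-r_1)+4x_2$, $\delta_2=(-1)^{r_1}\big((1-\eta_3)(m_2-m_1)+\eta_3(1-\eta_4)(m_1-m_3)+\eta_4(m_{d-1}-m_d)\big)$; $j_k=s_{k-2}+m_k^-+r_1$, $\delta_k=m_k^{--}-m_k^-$. *Set 3:* $j_1=(\ell+1-E\gamma)A_3-E\gamma+t+(-1)^{E\gamma}\big(-2+m_1+E(1-m_2)m_1+\eta_3(2m_d(1-m_1)-A_1(1-A_2)(A_3-2)(1-m_d))\big)$,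 $\delta_1=(-1)^{E\gamma}\big((1-m_1)m_2+E\,\Pi_1+F(1-m_2)m_1\big)$; $j_2=m_2+\gamma+(4-2A_2)x_2+(E+2F)(1-m_2)m_1+\eta_3\big(A_1(1-A_2)s_1+2((1-m_1)m_d-\eta_{\alpha_2}(1-R_1)(m_1(1-m_2)+m_d(1-m_1)))\big)$, $\delta_2=\Pi_0+E(1-m_2)m_1+(-1)^{R_1+1}F\,\Pi_1$; with $\epsilon=1-A_1$ for $k=3$ and $\epsilon=0$ for $k\ge4$: $j_k=p_{k-2}+s_{k-2}A_{k+1}2^{\eta_{\alpha_{k-1}}+\epsilon}+((-1)^{\epsilon\gamma}-2\eta_{\alpha_{k-1}}r_2\Psi_{k-3})m_k+2x_k+2\eta_{k+1}\eta_{\alpha_{k-1}}(1-R_1)((1-r_2)X_{k-3}-r_2\Psi_{k-3})(1-m_k)m_d$, $\delta_k=(-1)^{\eta_{\alpha_{k-1}}((1-R_1)R_{k-1}\Sigma_{k-1}+R_1r_2)+\epsilon\gamma}(m_k^--m_k)$. *Set 4 (only if $A_2=0$):* $j_1=(\ell+1-G\gamma)A_3-G\gamma+t+(-1)^{G\gamma+1}(m_1+m_1(1-m_2)+2\eta_3(1-m_1)m_d)$,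 $\delta_1=(-1)^{G\gamma+1}(m_2(1-m_1)+\Pi_1)$; $j_2=2+m_1+\eta_3A_1(s_1+(1-m_1)m_d+m_d)+\gamma+m_2(1-m_1)+4x_2+2\eta_3(1-A_1)(1-m_1)m_d$, $\delta_2=(-1)^{A_1((1-\eta_3)m_1+\eta_3m_d)}\big(\Pi_0+(1-A_1)(1-m_2)m_1+A_1((1-\eta_3)(1-m_2)m_1+\eta_3(1-\eta_4)(1-m_1)m_3+\eta_4(1-m_{d-1})m_d)\big)$; with $\epsilon$ as in Set 3: $j_k=s_{k-2}2^{\epsilon}+(-1)^{\epsilon\gamma}(1-A_1)m_k+A_1m_k^-m_k$, $\delta_k=(-1)^{\epsilon\gamma}(1-A_1)(m_k^--m_k)+A_1(m_k^{--}-m_k)m_k^-$. **Claim.** 1. These edge sets are the edge sets of the cycles of a decomposition of the torus $T$ into cycles of length $d\,2^\alpha$ (distinct parameters giving edge-disjoint cycles), and each cycle has exactly $2^\alpha$ edges along every one of the $d$ factors. 2. Their subdivisions form a decomposition (the Lock-and-Key decomposition) of the anchored product of the pairs $(C_{2^{n2^{i_k+1}}},S_k)$, $1\le k\le d$, into cycles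 $C_{a\cdot2^\alpha}$. 3. The hypercube $Q_{2an}$ has a decomposition into $n2^{2an-\alpha}$ cycles of length $a\cdot 2^\alpha$. -/

import Mathlib

/-! ### Cycle decompositions, cycles, tori, hypercubes, anchored products -/

/-- `E` is the edge set of a cycle of length `L` of the graph `G`. -/
def IsCycleEdgeSet {V : Type*} (G : SimpleGraph V) (L : ℕ) (E : Set (Sym2 V)) : Prop :=
  ∃ (v : V) (w : G.Walk v v), w.IsCycle ∧ w.length = L ∧ {e | e ∈ w.edges} = E

/-- The family `E` consists of the edge sets of pairwise edge-disjoint cycles of length `L`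
whose union is the whole graph `G` (all edges and all vertices). -/
def IsCycleDecomposition {V ι : Type*} (G : SimpleGraph V) (L : ℕ) (E : ι → Set (Sym2 V)) :
    Prop :=
  (∀ c, IsCycleEdgeSet G L (E c)) ∧
  (∀ c c', c ≠ c' → Disjoint (E c) (E c')) ∧
  (⋃ c, E c) = G.edgeSet ∧
  ∀ v, ∃ c, ∃ e ∈ E c, v ∈ e

/-- The hypercube `Q_N`: two 0-1 vectors are adjacent iff they differ in exactly one component. -/
def hypercube (N : ℕ) : SimpleGraph (Fin N → Bool) where
  Adj x y := hammingDist x y = 1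
  symm := ⟨fun x y h => by rw [hammingDist_comm]; exact h⟩
  loopless := ⟨fun x h => by simp at h⟩

/-- The cycle `C_m` on the vertex set `ℤ/mℤ` (used for `m ≥ 3` only). -/
def cyc (m : ℕ) : SimpleGraph (ZMod m) := SimpleGraph.circulantGraph {1}

/-- The Cartesian product of a family of graphs. -/
def cartesianProduct {ι : Type*} {V : ι → Type*} (G : ∀ k, SimpleGraph (V k)) :
    SimpleGraph (∀ k, V k) where
  Adj x y := ∃ k, (G k).Adj (x k) (y k) ∧ ∀ j, j ≠ k → x j = y j
  symm := ⟨fun _ _ ⟨k, h, h'⟩ => ⟨k, h.symm, fun j hj => (h' j hj).symm⟩⟩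
  loopless := ⟨fun _ ⟨_, h, _⟩ => h.ne rfl⟩

/-- The vertex set of the anchored product of the pairs `(G k, S k)`: at most one
coordinate lies outside its representing set. -/
def AnchoredVertex {ι : Type*} {V : ι → Type*} (S : ∀ k, Set (V k)) : Type _ :=
  {x : ∀ k, V k // ∃ k, ∀ j, j ≠ k → x j ∈ S j}

/-- The anchored product of the pairs `(G k, S k)`. For two factors the vertices are the pairs
with `x 1 ∈ S 1` or `x 2 ∈ S 2`, and the edges run along one factor, the other coordinate being
a fixed member of its representing set; for more factors this is the iterated product, the
representing set of a partial product being the product of the representing sets. -/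
def anchoredProduct {ι : Type*} {V : ι → Type*} (G : ∀ k, SimpleGraph (V k))
    (S : ∀ k, Set (V k)) : SimpleGraph (AnchoredVertex S) where
  Adj x y := ∃ k, (G k).Adj (x.1 k) (y.1 k) ∧ ∀ j, j ≠ k → x.1 j = y.1 j ∧ x.1 j ∈ S j
  symm := ⟨fun _ _ ⟨k, h, h'⟩ =>
    ⟨k, h.symm, fun j hj => ⟨(h' j hj).1.symm, (h' j hj).1 ▸ (h' j hj).2⟩⟩⟩
  loopless := ⟨fun _ ⟨_, h, _⟩ => h.ne rfl⟩

/-- Every `q`-th vertex of the cycle `C_m`, starting with `0`. -/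
def everyNth (m q : ℕ) : Set (ZMod m) := Set.range fun t : ℕ => ((q * t : ℕ) : ZMod m)

/-! ### The Lock-and-Key edge sets

All sequences (`e`, `p`, `s`, `m`, `x`, coordinates) are indexed from `1`. The torus has `d`
factors `C_{z_1}, …, C_{z_d}` with `z_k = 2 ^ e k`. The coordinates `j_1, …, j_d` below
refer to the factors in the order `z_1, z_d, z_2, …, z_{d-1}`. -/

namespace LockAndKey

section

variable (d : ℕ) (e : ℕ → ℕ) (α : ℕ)

/-- The length `z_k` of the `k`-th factor. -/
def z (k : ℕ) : ℤ := 2 ^ e k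

/-- The threshold `α_k = e_1 + ⋯ + e_{k-1} + e_d - (k-1)`. -/
def level (k : ℕ) : ℤ := (∑ j ∈ Finset.Icc 1 (k - 1), (e j : ℤ)) + e d - ((k : ℤ) - 1)

/-- `η_k`: is `d ≥ k`? -/
def η (k : ℕ) : ℤ := if k ≤ d then 1 else 0

/-- `η_{α_k}`: is `α > α_k`? -/
def ηα (k : ℕ) : ℤ := if level d e k < α then 1 else 0

def A₁ : ℤ := ηα d e α 1

def A₂ : ℤ := if level d e 2 < α + 1 then 1 else 0

/-- `A_k` for `3 ≤ k ≤ d + 1`. -/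
def A (k : ℕ) : ℤ :=
  if k = 3 then
    2 ^ ((1 - A₂ d e α) * (α - level d e 1) + A₂ d e α * (level d e 2 - level d e 1) + 1).toNat
  else
    2 ^ ((1 - ηα d e α (k - 1)) * (α - level d e (k - 2)) * ηα d e α (k - 2)
      + ηα d e α (k - 1) * (level d e (k - 1) - level d e (k - 2))).toNat

/-- The parameters that number the cycles. -/
structure Param where
  l : ℤ
  γ : ℤ
  t : ℤ
  p : ℕ → ℤ
  s : ℕ → ℤ

/-- The range of the parameters; `p_k` and `s_k` are present for `1 ≤ k ≤ d - 2` only, and are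
set to `0` otherwise. -/
def Admissible (P : Param) : Prop :=
  (0 ≤ P.l ∧ P.l ≤ z e 1 / A d e α 3 - 1) ∧
  (0 ≤ P.γ ∧ P.γ ≤ 1) ∧
  (0 ≤ P.t ∧ P.t ≤ 2 ^ ((1 - A₁ d e α) * η d 3).toNat - 1) ∧
  (∀ k, 1 ≤ k → k ≤ d - 2 → 0 ≤ P.p k ∧ P.p k ≤ 2 ^ (ηα d e α (k + 1)).toNat - 1) ∧
  (1 ≤ d - 2 → 0 ≤ P.s 1 ∧
    P.s 1 ≤ z e 2 / (A d e α 4 * 2 ^ (ηα d e α 2 + (1 - A₁ d e α)).toNat) - 1) ∧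
  (∀ k, 2 ≤ k → k ≤ d - 2 → 0 ≤ P.s k ∧
    P.s k ≤ z e (k + 1) / (A d e α (k + 3) * 2 ^ (ηα d e α (k + 1)).toNat) - 1) ∧
  (∀ k, k < 1 ∨ d - 2 < k → P.p k = 0 ∧ P.s k = 0)

/-- The 0-1 vectors `(m_1, …, m_d)` that occur: all entries equal; or only `m_2` different from
the others; or `m_1 = ⋯ = m_k ≠ m_{k+1} = ⋯ = m_d` for some `2 ≤ k ≤ d - 1`. -/
def IsMove (m : ℕ → ℤ) : Prop :=
  (∀ k, 1 ≤ k → k ≤ d → m k = 0 ∨ m k = 1) ∧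
  ((∀ k, 1 ≤ k → k ≤ d → m k = m 1) ∨
   (m 2 ≠ m 1 ∧ ∀ k, 3 ≤ k → k ≤ d → m k = m 1) ∨
   (∃ k, 2 ≤ k ∧ k ≤ d - 1 ∧ (∀ j, 1 ≤ j → j ≤ k → m j = m 1) ∧ m k ≠ m (k + 1) ∧
      ∀ j, k + 1 ≤ j → j ≤ d → m j = m (k + 1)))

/-- `(-1) ^ c`. -/
def sgn (c : ℤ) : ℤ := if c % 2 = 0 then 1 else -1

/-- `∏ m_j`. -/
def allOne (m : ℕ → ℤ) : ℤ := ∏ j ∈ Finset.Icc 1 d, m j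

/-- `∏ (1 - m_j)`. -/
def allZero (m : ℕ → ℤ) : ℤ := ∏ j ∈ Finset.Icc 1 d, (1 - m j)

/-- `χ` is `1` at `(0, …, 0)`, `-1` at `(1, …, 1)` and `0` elsewhere. -/
def χ (m : ℕ → ℤ) : ℤ := allZero d m - allOne d m

/-- The entry before `m_k` (`k ≥ 3`) in the list `m_2, m_1, m_3, m_4, …, m_d`. -/
def prev (m : ℕ → ℤ) (k : ℕ) : ℤ := if k = 3 then m 1 else m (k - 1)

/-- The entry two places before `m_k` (`k ≥ 3`) in the list `m_2, m_1, m_3, m_4, …, m_d`. -/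
def prev2 (m : ℕ → ℤ) (k : ℕ) : ℤ := if k = 3 then m 2 else if k = 4 then m 1 else m (k - 2)

variable (P : Param) (m x : ℕ → ℤ)

/-! Each of the four sets is given by the first vertex `j` of an edge and by the difference
between its two vertices (of which exactly one component is nonzero, namely `±1`). -/

/-- Set 1: first vertex. -/
def start₁ (k : ℕ) : ℤ :=
  if k = 1 then
    (P.l + (1 - η d 3) * (1 - A₂ d e α) * P.γ) * A d e α 3 - (1 - η d 3) * (1 - A₂ d e α) * P.γ
      + η d 3 * (1 - A₂ d e α)
      + sgn ((1 - η d 3) * (1 - A₂ d e α) * P.γ)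
        * (m 1 + 2 * x 1 + 2 * η d 3 * m d * (1 - m 1))
  else if k = 2 then
    m 2 + P.γ + η d 3 * (1 - A₂ d e α) * (P.s 1 + 1) + (4 - 2 * A₂ d e α) * x 2
  else
    P.p (k - 2) + P.s (k - 2) * A d e α (k + 1) * 2 ^ (ηα d e α (k - 1)).toNat
      + (1 - A₂ d e α) + sgn (1 - A₂ d e α) * m k + 2 * x k

/-- Set 1: difference. -/
def step₁ (k : ℕ) : ℤ :=
  if k = 1 then sgn ((1 - η d 3) * (1 - A₂ d e α) * P.γ) * |m 2 - m 1|
  else if k = 2 then χ d m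
  else sgn (1 - A₂ d e α) * (prev m k - m k)

def r₁ : ℤ :=
  ((2 * x 1 + 4) / A d e α 3) *
    ((1 - η d 3) * (1 - m 2) * m 1 + η d 3 * (1 - η d 4) * (1 - m 1) * m 3
      + η d 4 * m d * (1 - m (d - 1)))

/-- Set 2: first vertex. -/
def start₂ (k : ℕ) : ℤ :=
  if k = 1 then
    (P.l + 1 - (1 - η d 3) * P.γ) * A d e α 3 - (1 - η d 3) * P.γ
      + sgn ((1 - η d 3) * P.γ + 1)
        * (2 + m 2 + 2 * m 1 * (1 - m 2) + 2 * x 1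
          + η d 3 * (2 * m d * (1 - m 1) - r₁ d e α m x * (A d e α 3 - 1)))
  else if k = 2 then
    2 + P.γ + (1 - η d 3) * m 1 + η d 3 * (1 + P.s 1 + m d - r₁ d e α m x) + 4 * x 2
  else P.s (k - 2) + prev m k + r₁ d e α m x

/-- Set 2: difference. -/
def step₂ (k : ℕ) : ℤ :=
  if k = 1 then sgn ((1 - η d 3) * P.γ + 1) * |χ d m|
  else if k = 2 then
    sgn (r₁ d e α m x) * ((1 - η d 3) * (m 2 - m 1) + η d 3 * (1 - η d 4) * (m 1 - m 3)
      + η d 4 * (m (d - 1) - m d))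
  else prev2 m k - prev m k

def r₂ : ℤ := x 2 - 2 * (x 2 / 2)

/-- `X_k = ∏_{j=3}^{k+2} ⌊(x_j + 1) / A_{j+1}⌋`. -/
def X (k : ℕ) : ℤ := ∏ j ∈ Finset.Icc 3 (k + 2), ((x j + 1) / A d e α (j + 1))

/-- `Ψ_k = ∏_{j=3}^{k+2} (1 - ⌈x_j / A_{j+1}⌉)`. -/
def Ψ (k : ℕ) : ℤ := ∏ j ∈ Finset.Icc 3 (k + 2), (1 - -(-x j / A d e α (j + 1)))

def R₁ : ℤ :=
  η d 3 * ((1 - ηα d e α 2)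
    + ηα d e α 2 * ((1 - r₂ x) * X d e α x (d - 2) + r₂ x * Ψ d e α x (d - 2)))
  + (1 - η d 3)

/-- `R_k` for `2 ≤ k ≤ d - 1`. -/
def R (k : ℕ) : ℤ := (1 - r₂ x) * X d e α x (k - 2) + r₂ x * Ψ d e α x (k - 2)

/-- `S_k` for `2 ≤ k ≤ d - 1`. -/
def S (k : ℕ) : ℤ := (1 - r₂ x) * m (k + 1) + r₂ x * (1 - m (k + 1))

def E₃ : ℤ := (1 - η d 3) * (1 - A₂ d e α) + η d 3 * (1 - A₁ d e α)

def F₃ : ℤ := (1 - η d 3) * A₂ d e α + η d 3 * A₁ d e α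

/-- Set 3: first vertex. In coordinate `k ≥ 3` the last summand (the shift that a staircase move
has already made) is governed by `η_{α_{k-1}}`, the condition for staircase moves along `j_k`. -/
def start₃ (k : ℕ) : ℤ :=
  if k = 1 then
    (P.l + 1 - E₃ d e α * P.γ) * A d e α 3 - E₃ d e α * P.γ + P.t
      + sgn (E₃ d e α * P.γ)
        * (-2 + m 1 + E₃ d e α * (1 - m 2) * m 1
          + η d 3 * (2 * m d * (1 - m 1)
            - A₁ d e α * (1 - A₂ d e α) * (A d e α 3 - 2) * (1 - m d)))
  else if k = 2 then
    m 2 + P.γ + (4 - 2 * A₂ d e α) * x 2 + E₃ d e α * (1 - m 2) * m 1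
      + 2 * F₃ d e α * (1 - m 2) * m 1
      + η d 3 * (A₁ d e α * (1 - A₂ d e α) * P.s 1
        + 2 * ((1 - m 1) * m d
          - ηα d e α 2 * (1 - R₁ d e α x) * (m 1 * (1 - m 2) + m d * (1 - m 1))))
  else if k = 3 then
    P.p 1 + P.s 1 * A d e α 4 * 2 ^ (ηα d e α 2 + (1 - A₁ d e α)).toNat
      + (sgn ((1 - A₁ d e α) * P.γ) - 2 * ηα d e α 2 * r₂ x * Ψ d e α x 0) * m 3 + 2 * x 3
      + 2 * η d 4 * ηα d e α 2 * (1 - R₁ d e α x)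
        * ((1 - r₂ x) * X d e α x 0 - r₂ x * Ψ d e α x 0) * (1 - m 3) * m d
  else
    P.p (k - 2) + P.s (k - 2) * A d e α (k + 1) * 2 ^ (ηα d e α (k - 1)).toNat
      + (1 - 2 * ηα d e α (k - 1) * r₂ x * Ψ d e α x (k - 3)) * m k + 2 * x k
      + 2 * η d (k + 1) * ηα d e α (k - 1) * (1 - R₁ d e α x)
        * ((1 - r₂ x) * X d e α x (k - 3) - r₂ x * Ψ d e α x (k - 3)) * (1 - m k) * m d

/-- Set 3: difference. -/
def step₃ (k : ℕ) : ℤ :=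
  if k = 1 then
    sgn (E₃ d e α * P.γ)
      * ((1 - m 1) * m 2 + E₃ d e α * allOne d m + F₃ d e α * (1 - m 2) * m 1)
  else if k = 2 then
    allZero d m + E₃ d e α * (1 - m 2) * m 1
      + sgn (R₁ d e α x + 1) * F₃ d e α * allOne d m
  else if k = 3 then
    sgn (ηα d e α 2 * ((1 - R₁ d e α x) * R d e α x 2 * S m x 2 + R₁ d e α x * r₂ x)
      + (1 - A₁ d e α) * P.γ) * (m 1 - m 3)
  else
    sgn (ηα d e α (k - 1)
      * ((1 - R₁ d e α x) * R d e α x (k - 1) * S m x (k - 1) + R₁ d e α x * r₂ x))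
      * (m (k - 1) - m k)

def G₄ : ℤ := (1 - η d 3) + η d 3 * (1 - A₁ d e α)

/-- Set 4: first vertex. -/
def start₄ (k : ℕ) : ℤ :=
  if k = 1 then
    (P.l + 1 - G₄ d e α * P.γ) * A d e α 3 - G₄ d e α * P.γ + P.t
      + sgn (G₄ d e α * P.γ + 1)
        * (m 1 + m 1 * (1 - m 2) + 2 * η d 3 * (1 - m 1) * m d)
  else if k = 2 then
    2 + m 1 + η d 3 * A₁ d e α * (P.s 1 + (1 - m 1) * m d + m d) + P.γ + m 2 * (1 - m 1)
      + 4 * x 2 + 2 * η d 3 * (1 - A₁ d e α) * (1 - m 1) * m d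
  else if k = 3 then
    P.s 1 * 2 ^ (1 - A₁ d e α).toNat + sgn ((1 - A₁ d e α) * P.γ) * (1 - A₁ d e α) * m 3
      + A₁ d e α * m 1 * m 3
  else
    P.s (k - 2) + (1 - A₁ d e α) * m k + A₁ d e α * m (k - 1) * m k

/-- Set 4: difference. -/
def step₄ (k : ℕ) : ℤ :=
  if k = 1 then sgn (G₄ d e α * P.γ + 1) * (m 2 * (1 - m 1) + allOne d m)
  else if k = 2 then
    sgn (A₁ d e α * ((1 - η d 3) * m 1 + η d 3 * m d))
      * (allZero d m + (1 - A₁ d e α) * (1 - m 2) * m 1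
        + A₁ d e α * ((1 - η d 3) * (1 - m 2) * m 1 + η d 3 * (1 - η d 4) * (1 - m 1) * m 3
          + η d 4 * (1 - m (d - 1)) * m d))
  else if k = 3 then
    sgn ((1 - A₁ d e α) * P.γ) * (1 - A₁ d e α) * (m 1 - m 3) + A₁ d e α * (m 2 - m 3) * m 1
  else
    (1 - A₁ d e α) * (m (k - 1) - m k) + A₁ d e α * (prev2 m k - m k) * m (k - 1)

/-- The range of `x_1` in sets 1 and 2. -/
def Range₁ : Prop := 0 ≤ x 1 ∧ x 1 ≤ A d e α 3 / 2 - 2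

/-- The range `0 ≤ x_2 ≤ z_d 2^{A_2 - 2} - 1` in sets 1 and 3 (in sets 2 and 4, which are used
for `A_2 = 0` only, this is `0 ≤ x_2 ≤ z_d / 4 - 1`). -/
def Range₂ : Prop := 0 ≤ x 2 ∧ x 2 ≤ z e d * 2 ^ (A₂ d e α).toNat / 4 - 1

/-- The range of `x_3, …, x_d` in sets 1 and 3. -/
def Range₃ : Prop := ∀ k, 3 ≤ k → k ≤ d → 0 ≤ x k ∧ x k ≤ A d e α (k + 1) - 1

/-- `(j, δ)` is the first vertex and the difference of an edge of the cycle with parameters `P`.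
Set 1 is used if `A_1 = 1`, set 2 if `A_1 = 1` and `A_2 = 0`, set 4 if `A_2 = 0`. -/
def IsArc (j δ : ℕ → ℤ) : Prop :=
  ∃ m x : ℕ → ℤ, IsMove d m ∧ Range₂ d e α x ∧
    ((A₁ d e α = 1 ∧ Range₁ d e α x ∧ Range₃ d e α x ∧
        j = start₁ d e α P m x ∧ δ = step₁ d e α P m) ∨
     (A₁ d e α = 1 ∧ A₂ d e α = 0 ∧ Range₁ d e α x ∧
        j = start₂ d e α P m x ∧ δ = step₂ d e α P m x) ∨
     (Range₃ d e α x ∧ j = start₃ d e α P m x ∧ δ = step₃ d e α P m x) ∨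
     (A₂ d e α = 0 ∧ j = start₄ d e α P m x ∧ δ = step₄ d e α P m))

/-- The position of the factor `C_{z_{k+1}}` in the order `z_1, z_d, z_2, …, z_{d-1}`. -/
def pos (k : Fin d) : ℕ := if k.val = 0 then 1 else if k.val + 1 = d then 2 else k.val + 2

/-- The vertex of the torus with coordinates `j_1, …, j_d`, the coordinate of each factor
`C_z` being read modulo `z`. -/
def vertex (j : ℕ → ℤ) : ∀ k : Fin d, ZMod (2 ^ e (k + 1)) := fun k => (j (pos d k) : ZMod _)

/-- The torus `C_{z_1} □ ⋯ □ C_{z_d}`. -/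
def torus : SimpleGraph (∀ k : Fin d, ZMod (2 ^ e (k + 1))) :=
  cartesianProduct fun k => cyc (2 ^ e (k + 1))

/-- The edge set of the Lock-and-Key cycle with parameters `P` on the torus. -/
def edges : Set (Sym2 (∀ k : Fin d, ZMod (2 ^ e (k + 1)))) :=
  {a | ∃ j δ : ℕ → ℤ, IsArc d e α P j δ ∧
    a = s(vertex d e j, vertex d e fun k => j k + δ k)}

/-- The admissible parameters: one for each cycle of the Lock-and-Key decomposition. -/
def Index : Type := {P : Param // Admissible d e α P}

end

/-- The edges that the set `E` of edges of the torus becomes when every edge along the `k`-th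
factor is subdivided into `q k` edges: the vertex `u` of the torus becomes the vertex
`(q k * u k)` of the anchored product of the cycles `C_{y k}`, anchored at every `q k`-th vertex,
and the edge from `u` to `u + 1` along factor `k` becomes the path of the `q k` edges along
factor `k` from `q k * u k` to `q k * (u k + 1)`. -/
def subdivide {d : ℕ} {z y q : Fin d → ℕ} (E : Set (Sym2 (∀ k, ZMod (z k)))) :
    Set (Sym2 (AnchoredVertex fun k => everyNth (y k) (q k))) :=
  {a | ∃ (u : ∀ k, ZMod (z k)) (k : Fin d) (r : ℕ)
      (v w : AnchoredVertex fun k => everyNth (y k) (q k)),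
    s(u, u + Pi.single k 1) ∈ E ∧ r < q k ∧
    v.1 k = ((q k * (u k).val + r : ℕ) : ZMod (y k)) ∧
    w.1 k = ((q k * (u k).val + r + 1 : ℕ) : ZMod (y k)) ∧
    (∀ l, l ≠ k → v.1 l = ((q l * (u l).val : ℕ) : ZMod (y l)) ∧ w.1 l = v.1 l) ∧
    a = s(v, w)}

/-- The number of edges of `E` along the `k`-th factor of the torus (whose cycles have length at
least 3). -/
noncomputable def numAlong {d : ℕ} {z : Fin d → ℕ} (E : Set (Sym2 (∀ k, ZMod (z k))))
    (k : Fin d) : ℕ :=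
  {u : ∀ k, ZMod (z k) | s(u, u + Pi.single k 1) ∈ E}.ncard

end LockAndKey

/-! ### Cycles from periodic sequences -/

section Sequences

variable {V : Type*} {G : SimpleGraph V}

/-- The walk along the first `n` steps of a sequence of successively adjacent vertices. -/
def seqWalk (a : ℕ → V) (h : ∀ t, G.Adj (a t) (a (t + 1))) : ∀ n, G.Walk (a 0) (a n)
  | 0 => .nil
  | n + 1 => (seqWalk a h n).concat (h n)

theorem seqWalk_length (a : ℕ → V) (h : ∀ t, G.Adj (a t) (a (t + 1))) (n : ℕ) :
    (seqWalk a h n).length = n := by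
  induction n with
  | zero => rfl
  | succ n ih => simp [seqWalk, ih]

theorem seqWalk_edges (a : ℕ → V) (h : ∀ t, G.Adj (a t) (a (t + 1))) (n : ℕ) :
    (seqWalk a h n).edges = (List.range n).map fun t => s(a t, a (t + 1)) := by
  induction n with
  | zero => rfl
  | succ n ih => simp [seqWalk, ih, SimpleGraph.Walk.edges_concat, List.range_succ]

theorem seqWalk_support (a : ℕ → V) (h : ∀ t, G.Adj (a t) (a (t + 1))) (n : ℕ) :
    (seqWalk a h n).support = (List.range (n + 1)).map a := by
  induction n with
  | zero => rfl
  | succ n ih =>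
    rw [seqWalk, SimpleGraph.Walk.support_concat, ih, List.range_succ (n := n + 1)]
    simp

/-- A periodic sequence of pairwise different vertices has pairwise different edges. -/
theorem seq_edge_injective {L : ℕ} (hL : 3 ≤ L) (a : ℕ → V) (hper : ∀ t, a (t + L) = a t)
    (hinj : ∀ s t, s < L → t < L → a s = a t → s = t) {s t : ℕ} (hs : s < L) (ht : t < L)
    (h : s(a s, a (s + 1)) = s(a t, a (t + 1))) : s = t := by
  have key : ∀ s t, s < L → t ≤ L → a s = a t → s = t ∨ (s = 0 ∧ t = L) := by
    intro s t hs ht h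
    rcases ht.lt_or_eq with ht | rfl
    · exact Or.inl (hinj s t hs ht h)
    · have h0 := hper 0
      rw [Nat.zero_add] at h0
      exact Or.inr ⟨hinj s 0 hs (by omega) (h.trans h0), rfl⟩
  rcases Sym2.eq_iff.1 h with ⟨h1, _⟩ | ⟨h1, h2⟩
  · exact hinj s t hs ht h1
  · rcases key s (t + 1) hs (by omega) h1 with h3 | h3 <;>
      rcases key t (s + 1) ht (by omega) h2.symm with h4 | h4 <;> omega

/-- A periodic sequence of successively adjacent vertices, pairwise different within a period,
runs through a cycle. -/
theorem isCycleEdgeSet_of_seq {L : ℕ} (hL : 3 ≤ L) (a : ℕ → V)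
    (hadj : ∀ t, G.Adj (a t) (a (t + 1))) (hper : ∀ t, a (t + L) = a t)
    (hinj : ∀ s t, s < L → t < L → a s = a t → s = t) :
    IsCycleEdgeSet G L {e | ∃ t < L, e = s(a t, a (t + 1))} := by
  have h0 : a L = a 0 := by simpa using hper 0
  refine ⟨a 0, (seqWalk a hadj L).copy rfl h0, ?_, ?_, ?_⟩
  · rw [SimpleGraph.Walk.isCycle_def]
    refine ⟨⟨?_⟩, ?_, ?_⟩
    · rw [SimpleGraph.Walk.edges_copy, seqWalk_edges]
      refine (List.nodup_map_iff_inj_on List.nodup_range).2 fun s hs t ht h => ?_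
      exact seq_edge_injective hL a hper hinj (List.mem_range.1 hs) (List.mem_range.1 ht) h
    · intro h
      have := congrArg SimpleGraph.Walk.length h
      simp [seqWalk_length] at this
      omega
    · rw [SimpleGraph.Walk.support_copy, seqWalk_support, List.range_succ_eq_map]
      simp only [List.map_cons, List.map_map, List.tail_cons]
      refine (List.nodup_map_iff_inj_on List.nodup_range).2 fun s hs t ht h => ?_
      have hs := List.mem_range.1 hs
      have ht := List.mem_range.1 ht
      simp only [Function.comp, Nat.succ_eq_add_one] at h
      by_cases h1 : s + 1 = L <;> by_cases h2 : t + 1 = L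
      · omega
      · rw [h1, h0] at h
        have := hinj 0 (t + 1) (by omega) (by omega) h
        omega
      · rw [h2, h0] at h
        have := hinj (s + 1) 0 (by omega) (by omega) h
        omega
      · have := hinj (s + 1) (t + 1) (by omega) (by omega) h
        omega
  · simp [seqWalk_length]
  · ext e
    simp only [SimpleGraph.Walk.edges_copy, seqWalk_edges, List.mem_map, List.mem_range,
      Set.mem_ofPred_eq]
    exact ⟨fun ⟨t, h, h'⟩ => ⟨t, h, h'.symm⟩, fun ⟨t, h, h'⟩ => ⟨t, h, h'.symm⟩⟩

end Sequences

/-! ### Adjacency in a product of cycles -/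

section Torus

variable {d : ℕ} {z : Fin d → ℕ}

theorem cyc_adj_iff {m : ℕ} (hm : 2 ≤ m) (x y : ZMod m) :
    (cyc m).Adj x y ↔ y = x + 1 ∨ x = y + 1 := by
  have : Fact (1 < m) := ⟨by omega⟩
  have h1 : (1 : ZMod m) ≠ 0 := one_ne_zero
  simp only [cyc, SimpleGraph.circulantGraph_adj, Set.mem_singleton_iff]
  constructor
  · rintro ⟨_, h | h⟩
    · exact Or.inr (by rw [← h]; ring)
    · exact Or.inl (by rw [← h]; ring)
  · rintro (rfl | rfl)
    · exact ⟨by simp, Or.inr (by ring)⟩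
    · exact ⟨by simp, Or.inl (by ring)⟩

theorem cartesianProduct_cyc_adj_single (hz : ∀ k, 2 ≤ z k) (x : ∀ k, ZMod (z k)) (k : Fin d) :
    (cartesianProduct fun k => cyc (z k)).Adj x (x + Pi.single k 1) := by
  refine ⟨k, (cyc_adj_iff (hz k) _ _).2 (Or.inl (by simp)), fun j hj => by simp [hj]⟩

theorem cartesianProduct_cyc_edge (hz : ∀ k, 2 ≤ z k) (e : Sym2 (∀ k, ZMod (z k)))
    (he : e ∈ (cartesianProduct fun k => cyc (z k)).edgeSet) :
    ∃ x k, e = s(x, x + Pi.single k 1) := by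
  induction e using Sym2.ind with
  | _ x y =>
    obtain ⟨k, h, h'⟩ : ∃ k, (cyc (z k)).Adj (x k) (y k) ∧ ∀ j, j ≠ k → x j = y j := he
    rcases (cyc_adj_iff (hz k) _ _).1 h with h | h
    · refine ⟨x, k, ?_⟩
      have : y = x + Pi.single k 1 := by
        funext j
        by_cases hj : j = k
        · subst hj; simp [h]
        · simp [hj, h' j hj]
      rw [this]
    · refine ⟨y, k, ?_⟩
      have : x = y + Pi.single k 1 := by
        funext j
        by_cases hj : j = k
        · subst hj; simp [h]
        · simp [hj, h' j hj]
      rw [this, Sym2.eq_swap]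

theorem torus_edge_injective (hz : ∀ k, 3 ≤ z k) {x y : ∀ k, ZMod (z k)} {k l : Fin d}
    (h : s(x, x + Pi.single k 1) = s(y, y + Pi.single l 1)) : k = l ∧ x = y := by
  have h1 : (1 : ZMod (z k)) ≠ 0 := by
    have : Fact (1 < z k) := ⟨by have := hz k; omega⟩
    exact one_ne_zero
  have h2 : (1 + 1 : ZMod (z k)) ≠ 0 := by
    intro h
    have h3 : ((2 : ℕ) : ZMod (z k)) = 0 := by push_cast; rw [← h]; norm_num
    rw [ZMod.natCast_eq_zero_iff] at h3
    have := Nat.le_of_dvd (by norm_num) h3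
    have := hz k
    omega
  rcases Sym2.eq_iff.1 h with ⟨rfl, h⟩ | ⟨h, h'⟩
  · refine ⟨?_, rfl⟩
    by_contra hk
    have := congrFun h k
    simp [hk, h1] at this
  · exfalso
    subst h
    have h3 := congrFun h' k
    by_cases hk : k = l
    · subst hk
      simp only [Pi.add_apply, Pi.single_eq_same] at h3
      apply h2
      have : y k + (1 + 1) = y k := by rw [← add_assoc]; exact h3
      simpa using this
    · simp [hk, h1] at h3

end Torus

/-! ### Passes

A pass is a sequence of `d` steps on a torus with `d` factors, one along every factor. -/

section Pass

variable {d : ℕ} {z : Fin d → ℕ} {ι : Type*}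

/-- The vertex reached after `q` steps of a pass from `x` to `y`, `pl k` being the number of
steps that precede the step along factor `k`. -/
def passMix (pl : Fin d → ℕ) (x y : ∀ k, ZMod (z k)) (q : ℕ) : ∀ k, ZMod (z k) :=
  fun k => if pl k < q then y k else x k

/-- The vertex sequence of a sequence of passes. -/
def passSeq (pl : ℕ → Fin d → ℕ) (b : ℕ → ∀ k, ZMod (z k)) (t : ℕ) : ∀ k, ZMod (z k) :=
  passMix (pl (t / d)) (b (t / d)) (b (t / d + 1)) (t % d)

/-- Families of closed sequences of `M` passes. -/
structure PassFamily (z : Fin d → ℕ) (ι : Type*) (M : ℕ) where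
  b : ι → ℕ → ∀ k, ZMod (z k)
  pl : ℕ → Fin d → ℕ
  pl_lt : ∀ n k, pl n k < d
  pl_inj : ∀ n, Function.Injective (pl n)
  step : ∀ c n k, b c (n + 1) k = b c n k + 1 ∨ b c n k = b c (n + 1) k + 1
  b_per : ∀ c n, b c (n + M) = b c n
  pl_per : ∀ n, pl (n + M) = pl n

namespace PassFamily

variable {M : ℕ} (F : PassFamily z ι M)

/-- The vertex sequence of the member `c` of the family. -/
def a (c : ι) : ℕ → ∀ k, ZMod (z k) := passSeq F.pl (F.b c)

theorem exists_pl (n : ℕ) {q : ℕ} (hq : q < d) : ∃ k, F.pl n k = q := by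
  have hinj : Function.Injective fun k => (⟨F.pl n k, F.pl_lt n k⟩ : Fin d) :=
    fun k l h => F.pl_inj n (Fin.mk.inj_iff.1 h)
  obtain ⟨k, hk⟩ := (Finite.injective_iff_surjective.1 hinj) ⟨q, hq⟩
  exact ⟨k, congrArg Fin.val hk⟩

theorem a_mix (c : ι) (n : ℕ) {q : ℕ} (hq : q ≤ d) (hd : 0 < d) :
    F.a c (d * n + q) = passMix (F.pl n) (F.b c n) (F.b c (n + 1)) q := by
  rcases hq.lt_or_eq with hq | rfl
  · have h1 : (d * n + q) / d = n := by
      rw [Nat.mul_add_div hd, Nat.div_eq_of_lt hq, add_zero]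
    have h2 : (d * n + q) % d = q := by rw [Nat.mul_add_mod, Nat.mod_eq_of_lt hq]
    simp only [a, passSeq, h1, h2]
  · have h1 : (q * n + q) / q = n + 1 := by
      rw [← Nat.mul_succ, Nat.mul_div_cancel_left _ hd]
    have h2 : (q * n + q) % q = 0 := by rw [← Nat.mul_succ, Nat.mul_mod_right]
    simp only [a, passSeq, h1, h2]
    funext k
    simp [passMix, F.pl_lt n k]

theorem a_tail (hd : 0 < d) (c : ι) (n : ℕ) (k : Fin d) : F.a c (d * n + F.pl n k) k = F.b c n k := by
  rw [F.a_mix c n (F.pl_lt n k).le hd]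
  simp [passMix]

theorem a_head (hd : 0 < d) (c : ι) (n : ℕ) (k : Fin d) :
    F.a c (d * n + F.pl n k + 1) k = F.b c (n + 1) k := by
  rw [add_assoc, F.a_mix c n (F.pl_lt n k) hd]
  simp [passMix]

theorem a_off (hd : 0 < d) (c : ι) (n : ℕ) (k : Fin d) {l : Fin d} (hl : l ≠ k) :
    F.a c (d * n + F.pl n k + 1) l = F.a c (d * n + F.pl n k) l := by
  rw [add_assoc, F.a_mix c n (F.pl_lt n k) hd, F.a_mix c n (F.pl_lt n k).le hd]
  have : F.pl n l ≠ F.pl n k := fun h => hl (F.pl_inj n h)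
  have h2 : F.pl n l < F.pl n k + 1 ↔ F.pl n l < F.pl n k := by omega
  simp [passMix, h2]

theorem exists_time (hd : 0 < d) (t : ℕ) : ∃ n k, t = d * n + F.pl n k ∧ n = t / d := by
  obtain ⟨k, hk⟩ := F.exists_pl (t / d) (Nat.mod_lt t hd)
  exact ⟨t / d, k, by rw [hk, Nat.div_add_mod], rfl⟩

theorem a_per (hd : 0 < d) (c : ι) (t : ℕ) : F.a c (t + d * M) = F.a c t := by
  obtain ⟨n, k, rfl, -⟩ := F.exists_time hd t
  have h1 : d * n + F.pl n k + d * M = d * (n + M) + F.pl n k := by ring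
  rw [h1, F.a_mix c (n + M) (F.pl_lt n k).le hd, F.a_mix c n (F.pl_lt n k).le hd, F.pl_per,
    F.b_per, show n + M + 1 = n + 1 + M by ring, F.b_per]

/-- Every step changes one coordinate by `1` or `-1`. -/
theorem a_step (hd : 0 < d) (c : ι) (n : ℕ) (k : Fin d) :
    F.a c (d * n + F.pl n k + 1) = F.a c (d * n + F.pl n k) + Pi.single k 1 ∨
      F.a c (d * n + F.pl n k) = F.a c (d * n + F.pl n k + 1) + Pi.single k 1 := by
  rcases F.step c n k with h | h
  · left
    funext l
    by_cases hl : l = k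
    · subst hl; rw [Pi.add_apply, F.a_head hd, F.a_tail hd, Pi.single_eq_same, h]
    · rw [Pi.add_apply, F.a_off hd c n k hl, Pi.single_eq_of_ne hl, add_zero]
  · right
    funext l
    by_cases hl : l = k
    · subst hl; rw [Pi.add_apply, F.a_head hd, F.a_tail hd, Pi.single_eq_same, h]
    · rw [Pi.add_apply, F.a_off hd c n k hl, Pi.single_eq_of_ne hl, add_zero]

/-- The lower vertex of the edge along factor `k` of the `n`-th pass. -/
theorem exists_lower (hd : 0 < d) (c : ι) (n : ℕ) (k : Fin d) :
    ∃ x, s(F.a c (d * n + F.pl n k), F.a c (d * n + F.pl n k + 1)) = s(x, x + Pi.single k 1) := by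
  rcases F.a_step hd c n k with h | h
  · exact ⟨_, by rw [← h]⟩
  · exact ⟨_, by rw [← h, Sym2.eq_swap]⟩

/-- The edge set of the member `c` of the family. -/
def edgesOf (c : ι) : Set (Sym2 (∀ k, ZMod (z k))) :=
  {e | ∃ t < d * M, e = s(F.a c t, F.a c (t + 1))}

theorem adj (hd : 0 < d) (hz : ∀ k, 3 ≤ z k) (c : ι) (t : ℕ) :
    (cartesianProduct fun k => cyc (z k)).Adj (F.a c t) (F.a c (t + 1)) := by
  obtain ⟨n, k, rfl, -⟩ := F.exists_time hd t
  have hz' : ∀ k, 2 ≤ z k := fun k => by have := hz k; omega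
  rcases F.a_step hd c n k with h | h
  · rw [h]; exact cartesianProduct_cyc_adj_single hz' _ k
  · rw [h]
    exact (cartesianProduct_cyc_adj_single hz' _ k).symm

theorem time_lt {n k : ℕ} (hn : n < M) (hk : k < d) : d * n + k < d * M := by
  calc d * n + k < d * n + d := by omega
    _ = d * (n + 1) := by ring
    _ ≤ d * M := Nat.mul_le_mul_left _ hn

/-- A family of closed sequences of passes that have no vertex twice, have no edges in common
and cover the torus is a cycle decomposition. -/
theorem isCycleDecomposition (hd : 2 ≤ d) (hM : 2 ≤ M) (hz : ∀ k, 3 ≤ z k)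
    (hinj : ∀ c s t, s < d * M → t < d * M → F.a c s = F.a c t → s = t)
    (hdisj : ∀ c c', c ≠ c' → Disjoint (F.edgesOf c) (F.edgesOf c'))
    (hcov : ∀ x k, ∃ c, s(x, x + Pi.single k 1) ∈ F.edgesOf c) :
    IsCycleDecomposition (cartesianProduct fun k => cyc (z k)) (d * M) F.edgesOf ∧
      ∀ c k, LockAndKey.numAlong (F.edgesOf c) k = M := by
  have hd0 : 0 < d := by omega
  have hL : 3 ≤ d * M := by nlinarith
  have hz' : ∀ k, 2 ≤ z k := fun k => by have := hz k; omega
  refine ⟨⟨fun c => ?_, hdisj, ?_, fun v => ?_⟩, fun c k => ?_⟩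
  · exact isCycleEdgeSet_of_seq hL _ (F.adj hd0 hz c) (F.a_per hd0 c) (hinj c)
  · ext e
    simp only [Set.mem_iUnion]
    constructor
    · rintro ⟨c, t, -, rfl⟩
      exact F.adj hd0 hz c t
    · intro he
      obtain ⟨x, k, rfl⟩ := cartesianProduct_cyc_edge hz' e he
      exact hcov x k
  · obtain ⟨c, h⟩ := hcov v ⟨0, hd0⟩
    exact ⟨c, _, h, Sym2.mem_mk_left _ _⟩
  · choose low hlow using fun n => F.exists_lower hd0 c n k
    have hset : {u | s(u, u + Pi.single k 1) ∈ F.edgesOf c} = low '' (Finset.range M : Set ℕ) := by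
      ext u
      simp only [Set.mem_ofPred_eq, Set.mem_image, Finset.coe_range, Set.mem_Iio]
      constructor
      · rintro ⟨t, ht, h⟩
        obtain ⟨n, l, rfl, hn⟩ := F.exists_time hd0 t
        obtain ⟨x, hx⟩ := F.exists_lower hd0 c n l
        rw [hx] at h
        obtain ⟨rfl, rfl⟩ := torus_edge_injective hz h
        refine ⟨n, ?_, ?_⟩
        · rw [hn]; exact Nat.div_lt_of_lt_mul ht
        · rw [hlow] at hx
          exact (torus_edge_injective hz hx).2
      · rintro ⟨n, hn, rfl⟩
        exact ⟨_, time_lt hn (F.pl_lt n k), (hlow n).symm⟩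
    rw [LockAndKey.numAlong, hset, Set.InjOn.ncard_image, Set.ncard_coe_finset, Finset.card_range]
    intro n hn n' hn' h
    simp only [Finset.coe_range, Set.mem_Iio] at hn hn'
    have h1 := (hlow n).trans ((congrArg (fun x => s(x, x + Pi.single k 1)) h).trans (hlow n').symm)
    have h2 := seq_edge_injective hL _ (F.a_per hd0 c) (hinj c) (time_lt hn (F.pl_lt n k))
      (time_lt hn' (F.pl_lt n' k)) h1
    have h3 := congrArg (· / d) h2
    simp only [Nat.mul_add_div hd0, Nat.div_eq_of_lt (F.pl_lt _ _), add_zero] at h3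
    exact h3

end PassFamily

/-- A family of closed sequences of passes for which the direction of every step is a function
of the current vertex, which does not depend on the coordinate that the step changes. -/
structure StageFamily (z : Fin d → ℕ) (ι : Type*) (M : ℕ) extends PassFamily z ι M where
  flag : (∀ k, ZMod (z k)) → Bool
  ord : Bool → Fin d → ℕ
  sg : Fin d → (∀ k, ZMod (z k)) → Bool
  ord_lt : ∀ f k, ord f k < d
  ord_inj : ∀ f, Function.Injective (ord f)
  ord_off : ∀ k x y, (∀ l, l ≠ k → x l = y l) → ord (flag x) k = ord (flag y) k
  sg_off : ∀ k x y, (∀ l, l ≠ k → x l = y l) → sg k x = sg k y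
  pl_eq : ∀ c n k, ord (flag (toPassFamily.a c (d * n + pl n k))) k = pl n k
  step_eq : ∀ c n k, b c (n + 1) k =
    b c n k + if sg k (toPassFamily.a c (d * n + pl n k)) then 1 else -1
  b_inj : ∀ c c' n n', n < M → n' < M → b c n = b c' n' → c = c' ∧ n = n'
  b_surj : ∀ x, ∃ c, ∃ n < M, b c n = x

namespace StageFamily

variable {M : ℕ} (F : StageFamily z ι M)

theorem eq_of_update {m : ℕ} {x y : ZMod m} {s : Bool}
    (h : x + (if s then 1 else -1) = y + if s then 1 else -1) : x = y := by
  exact add_right_cancel h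

theorem head_eq (hd : 0 < d) (c : ι) (n : ℕ) (k : Fin d) :
    F.a c (d * n + F.pl n k + 1) k = F.a c (d * n + F.pl n k) k +
      if F.sg k (F.a c (d * n + F.pl n k)) then 1 else -1 := by
  rw [F.a_head hd, F.a_tail hd, F.step_eq]

/-- The stage maps are injective. -/
theorem a_inj (hd : 0 < d) {q : ℕ} (hq : q ≤ d) : ∀ {c c' : ι} {n n' : ℕ}, n < M → n' < M →
    F.a c (d * n + q) = F.a c' (d * n' + q) → c = c' ∧ n = n' := by
  induction q with
  | zero =>
    intro c c' n n' hn hn' h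
    rw [F.a_mix _ _ (Nat.zero_le _) hd, F.a_mix _ _ (Nat.zero_le _) hd] at h
    refine F.b_inj c c' n n' hn hn' ?_
    funext k
    simpa [passMix] using congrFun h k
  | succ q ih =>
    intro c c' n n' hn hn' h
    refine ih (by omega) hn hn' ?_
    obtain ⟨k, hk⟩ := F.exists_pl n (q := q) (by omega)
    obtain ⟨k', hk'⟩ := F.exists_pl n' (q := q) (by omega)
    have h1 := F.pl_eq c n k
    have h2 := F.pl_eq c' n' k'
    rw [F.ord_off k _ (F.a c (d * n + F.pl n k + 1)) fun l hl => (F.a_off hd c n k hl).symm,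
      hk, add_assoc] at h1
    rw [F.ord_off k' _ (F.a c' (d * n' + F.pl n' k' + 1))
      fun l hl => (F.a_off hd c' n' k' hl).symm, hk', add_assoc, ← h] at h2
    obtain rfl : k = k' := F.ord_inj _ (h1.trans h2.symm)
    have hoff : ∀ l, l ≠ k → F.a c (d * n + q) l = F.a c' (d * n' + q) l := by
      intro l hl
      have h3 := F.a_off hd c n k hl
      have h4 := F.a_off hd c' n' k hl
      rw [hk, add_assoc] at h3
      rw [hk', add_assoc] at h4
      rw [← h3, ← h4, h]
    funext l
    by_cases hl : l = k
    · subst hl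
      have h3 := F.head_eq hd c n l
      have h4 := F.head_eq hd c' n' l
      rw [hk, add_assoc] at h3
      rw [hk', add_assoc, ← h, h3, F.sg_off l _ _ hoff] at h4
      exact eq_of_update h4
    · exact hoff l hl

/-- Edges of members of the family determine the member and the pass. -/
theorem edge_inj (hd : 0 < d) (hz : ∀ k, 3 ≤ z k) {c c' : ι} {n n' : ℕ} {k k' : Fin d}
    (hn : n < M) (hn' : n' < M)
    (h : s(F.a c (d * n + F.pl n k), F.a c (d * n + F.pl n k + 1)) =
      s(F.a c' (d * n' + F.pl n' k'), F.a c' (d * n' + F.pl n' k' + 1))) :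
    c = c' ∧ n = n' ∧ k = k' := by
  obtain ⟨x, hx⟩ := F.exists_lower hd c n k
  obtain ⟨y, hy⟩ := F.exists_lower hd c' n' k'
  obtain ⟨rfl, rfl⟩ := torus_edge_injective hz (hx.symm.trans (h.trans hy))
  have hoff : ∀ l, l ≠ k → F.a c (d * n + F.pl n k) l = F.a c' (d * n' + F.pl n' k) l := by
    intro l hl
    rcases Sym2.eq_iff.1 h with ⟨h1, _⟩ | ⟨h1, _⟩
    · rw [h1]
    · rw [h1, F.a_off hd c' n' k hl]
  have h1 := F.pl_eq c n k
  rw [F.ord_off k _ _ hoff, F.pl_eq c' n' k] at h1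
  have hsg := F.sg_off k _ _ hoff
  have h3 := F.head_eq hd c n k
  have h4 := F.head_eq hd c' n' k
  rw [hsg] at h3
  have htail : F.a c (d * n + F.pl n k) = F.a c' (d * n' + F.pl n' k) := by
    rcases Sym2.eq_iff.1 h with ⟨h5, _⟩ | ⟨h5, h6⟩
    · exact h5
    · exfalso
      rw [h6] at h3
      rw [← h5, h3] at h4
      have h7 : (1 + 1 : ZMod (z k)) = 0 := by
        split_ifs at h4 with hs
        · rw [add_assoc] at h4; simpa using h4
        · have : (-1 + -1 : ZMod (z k)) = 0 := by rw [add_assoc] at h4; simpa using h4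
          linear_combination -this
      have h8 : ((2 : ℕ) : ZMod (z k)) = 0 := by push_cast; rw [← h7]; norm_num
      rw [ZMod.natCast_eq_zero_iff] at h8
      have := Nat.le_of_dvd (by norm_num) h8
      have := hz k
      omega
  rw [← h1] at htail
  obtain ⟨h5, h6⟩ := F.a_inj hd (F.pl_lt n' k).le hn hn' htail
  exact ⟨h5, h6, rfl⟩

theorem step_parity (hz2 : ∀ k, 2 ∣ z k) (c : ι) (n : ℕ) (k : Fin d) :
    ZMod.castHom (hz2 k) (ZMod 2) (F.b c n k) = ZMod.castHom (hz2 k) (ZMod 2) (F.b c 0 k) + n := by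
  induction n with
  | zero => simp
  | succ n ih =>
    rw [F.step_eq, map_add, ih]
    split_ifs
    · push_cast; rw [map_one]; ring
    · push_cast; rw [map_neg, map_one]
      have : (-1 : ZMod 2) = 1 := by decide
      rw [this]; ring

theorem a_injOn (hd : 0 < d) (hz2 : ∀ k, 2 ∣ z k) (last : Fin d) (hlast : ∀ n, F.pl n last = d - 1)
    (hpl : ∀ n n' : ℕ, (n : ZMod 2) = n' → F.pl n = F.pl n') (c : ι) (s t : ℕ) (hs : s < d * M)
    (ht : t < d * M) (h : F.a c s = F.a c t) : s = t := by
  obtain ⟨n, k, rfl, hn⟩ := F.exists_time hd s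
  obtain ⟨n', k', rfl, hn'⟩ := F.exists_time hd t
  replace hn : n < M := by rw [hn]; exact Nat.div_lt_of_lt_mul hs
  replace hn' : n' < M := by rw [hn']; exact Nat.div_lt_of_lt_mul ht
  have hmix := h
  rw [F.a_mix c n (F.pl_lt n k).le hd, F.a_mix c n' (F.pl_lt n' k').le hd] at hmix
  have hnn : (n : ZMod 2) = n' := by
    have h1 := congrFun hmix last
    have h2 := F.pl_lt n k
    have h3 := F.pl_lt n' k'
    simp only [passMix, hlast] at h1
    rw [if_neg (by omega), if_neg (by omega)] at h1
    have h4 := congrArg (ZMod.castHom (hz2 last) (ZMod 2)) h1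
    rw [F.step_parity hz2 c n, F.step_parity hz2 c n'] at h4
    exact add_left_cancel h4
  have hp := hpl n n' hnn
  have main : ∀ {n n' : ℕ} {k k' : Fin d}, (n : ZMod 2) = n' → F.pl n = F.pl n' →
      F.pl n k < F.pl n' k' → passMix (F.pl n) (F.b c n) (F.b c (n + 1)) (F.pl n k) ≠
        passMix (F.pl n') (F.b c n') (F.b c (n' + 1)) (F.pl n' k') := by
    intro n n' k k' hnn hp hlt hmix
    have h1 := congrFun hmix k
    simp only [passMix, lt_irrefl, if_false] at h1
    rw [← hp] at hlt h1
    rw [if_pos hlt] at h1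
    have h4 := congrArg (ZMod.castHom (hz2 k) (ZMod 2)) h1
    rw [F.step_parity hz2 c n, F.step_parity hz2 c (n' + 1)] at h4
    have h5 := add_left_cancel h4
    rw [hnn] at h5
    push_cast at h5
    simp at h5
  rcases lt_trichotomy (F.pl n k) (F.pl n' k') with hlt | heq | hlt
  · exact (main hnn hp hlt hmix).elim
  · rw [heq] at h ⊢
    rw [(F.a_inj hd (F.pl_lt n' k').le hn hn' h).2]
  · exact (main hnn.symm hp.symm hlt hmix.symm).elim

/-- The cycles of a stage family decompose the torus. -/
theorem isCycleDecomposition (hd : 2 ≤ d) (hM : 2 ≤ M) (hz : ∀ k, 3 ≤ z k) (hz2 : ∀ k, 2 ∣ z k)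
    (last : Fin d) (hlast : ∀ n, F.pl n last = d - 1)
    (hpl : ∀ n n' : ℕ, (n : ZMod 2) = n' → F.pl n = F.pl n') :
    IsCycleDecomposition (cartesianProduct fun k => cyc (z k)) (d * M) F.edgesOf ∧
      ∀ c k, LockAndKey.numAlong (F.edgesOf c) k = M := by
  have hd0 : 0 < d := by omega
  refine F.toPassFamily.isCycleDecomposition hd hM hz (F.a_injOn hd0 hz2 last hlast hpl)
    (fun c c' hc => Set.disjoint_left.2 ?_) (fun x k => ?_)
  · rintro e ⟨t, ht, rfl⟩ ⟨t', ht', h⟩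
    obtain ⟨n, k, rfl, hn⟩ := F.exists_time hd0 t
    obtain ⟨n', k', rfl, hn'⟩ := F.exists_time hd0 t'
    replace hn : n < M := by rw [hn]; exact Nat.div_lt_of_lt_mul ht
    replace hn' : n' < M := by rw [hn']; exact Nat.div_lt_of_lt_mul ht'
    exact hc (F.edge_inj hd0 hz hn hn' h).1
  · have hne : ∀ k, NeZero (z k) := fun k => ⟨by have := hz k; omega⟩
    have hsurj : ∀ q, q ≤ d → ∀ y, ∃ c, ∃ n < M, F.a c (d * n + q) = y := by
      intro q hq
      let f : ι × Fin M → ∀ k, ZMod (z k) := fun p => F.b p.1 p.2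
      let g : ι × Fin M → ∀ k, ZMod (z k) := fun p => F.a p.1 (d * p.2 + q)
      have hf : Function.Bijective f := by
        constructor
        · intro p p' h
          obtain ⟨h1, h2⟩ := F.b_inj _ _ _ _ p.2.2 p'.2.2 h
          exact Prod.ext h1 (Fin.ext h2)
        · intro y
          obtain ⟨c, n, hn, h⟩ := F.b_surj y
          exact ⟨(c, ⟨n, hn⟩), h⟩
      have hg : Function.Injective g := by
        intro p p' h
        obtain ⟨h1, h2⟩ := F.a_inj hd0 hq p.2.2 p'.2.2 h
        exact Prod.ext h1 (Fin.ext h2)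
      have hg' : Function.Surjective g := by
        have h1 : Function.Injective (g ∘ (Equiv.ofBijective f hf).symm) :=
          hg.comp (Equiv.injective _)
        have h2 := Finite.injective_iff_surjective.1 h1
        exact Function.Surjective.of_comp h2
      intro y
      obtain ⟨p, hp⟩ := hg' y
      exact ⟨p.1, p.2, p.2.2, hp⟩
    set y := if F.sg k x then x else x + Pi.single k 1 with hy
    have hoff : ∀ l, l ≠ k → x l = y l := by
      intro l hl
      rw [hy]
      split_ifs
      · rfl
      · simp [hl]
    obtain ⟨c, n, hn, h⟩ := hsurj _ (F.ord_lt (F.flag y) k).le y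
    obtain ⟨l, hl⟩ := F.exists_pl n (F.ord_lt (F.flag y) k)
    have hpl := F.pl_eq c n l
    rw [hl, h] at hpl
    obtain rfl : l = k := F.ord_inj _ hpl
    rw [← hl] at h
    refine ⟨c, _, PassFamily.time_lt hn (F.pl_lt n l), ?_⟩
    have hhead : F.a c (d * n + F.pl n l + 1) = y + Pi.single l (if F.sg l x then 1 else -1) := by
      funext j
      by_cases hj : j = l
      · subst hj
        rw [F.head_eq hd0, h, F.sg_off j _ _ hoff]
        simp
      · rw [F.a_off hd0 c n l hj, h]
        simp [hj]
    rw [hhead, h, hy]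
    split_ifs
    · rfl
    · rw [Sym2.eq_swap, add_assoc, ← Pi.single_add]
      simp

end StageFamily

end Pass

namespace LockAndKey

/-! ### Positions and integer coordinates -/

/-- The number of the factor that the position `p` refers to. -/
def fac (d p : ℕ) : ℕ := if p = 1 then 1 else if p = 2 then d else p - 1

theorem pos_mem {d : ℕ} (hd : 2 ≤ d) (k : Fin d) : 1 ≤ pos d k ∧ pos d k ≤ d := by
  have := k.2
  unfold pos
  split_ifs <;> omega

theorem fac_pos {d : ℕ} (hd : 2 ≤ d) (k : Fin d) : fac d (pos d k) = k + 1 := by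
  have := k.2
  unfold pos fac
  split_ifs <;> omega

theorem pos_injective {d : ℕ} (hd : 2 ≤ d) : Function.Injective (pos d) := by
  intro k l h
  have := fac_pos hd k
  rw [h, fac_pos hd l] at this
  exact Fin.ext (by omega)

theorem exists_pos {d p : ℕ} (hd : 2 ≤ d) (h1 : 1 ≤ p) (h2 : p ≤ d) : ∃ k, pos d k = p := by
  by_cases hp1 : p = 1
  · exact ⟨⟨0, by omega⟩, by simp [pos, hp1]⟩
  · by_cases hp2 : p = 2
    · refine ⟨⟨d - 1, by omega⟩, ?_⟩
      unfold pos
      dsimp only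
      split_ifs <;> omega
    · refine ⟨⟨p - 2, by omega⟩, ?_⟩
      unfold pos
      dsimp only
      split_ifs <;> omega

/-- The length of the factor at position `p`. -/
def len (d : ℕ) (e : ℕ → ℕ) (p : ℕ) : ℤ := 2 ^ e (fac d p)

theorem vertex_eq_iff {d : ℕ} {e : ℕ → ℕ} (hd : 2 ≤ d) {j j' : ℕ → ℤ} :
    vertex d e j = vertex d e j' ↔ ∀ p, 1 ≤ p → p ≤ d → j p ≡ j' p [ZMOD len d e p] := by
  constructor
  · intro h p h1 h2
    obtain ⟨k, rfl⟩ := exists_pos hd h1 h2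
    have := congrFun h k
    simp only [vertex] at this
    rw [ZMod.intCast_eq_intCast_iff] at this
    simpa [len, fac_pos hd k] using this
  · intro h
    funext k
    simp only [vertex]
    rw [ZMod.intCast_eq_intCast_iff]
    have := h (pos d k) (pos_mem hd k).1 (pos_mem hd k).2
    simpa [len, fac_pos hd k] using this

theorem modEq_len_iff {d : ℕ} {e : ℕ → ℕ} (hd : 2 ≤ d) {k : Fin d} {x y : ℤ} :
    x ≡ y [ZMOD len d e (pos d k)] ↔ (x : ZMod (2 ^ e (k + 1))) = y := by
  rw [ZMod.intCast_eq_intCast_iff, len, fac_pos hd k]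
  push_cast
  rfl

/-- The coordinate at position `p`, as an integer from `0` to `len p - 1`. -/
def coord (d : ℕ) (e : ℕ → ℕ) (x : ∀ k : Fin d, ZMod (2 ^ e (k + 1))) (p : ℕ) : ℤ :=
  ∑ k : Fin d, if pos d k = p then ((x k).val : ℤ) else 0

theorem coord_pos {d : ℕ} {e : ℕ → ℕ} (hd : 2 ≤ d) (x : ∀ k : Fin d, ZMod (2 ^ e (k + 1)))
    (k : Fin d) : coord d e x (pos d k) = (x k).val := by
  unfold coord
  rw [Finset.sum_eq_single k]
  · simp
  · intro l _ hl
    rw [if_neg fun h => hl (pos_injective hd h)]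
  · simp

theorem coord_vertex {d : ℕ} {e : ℕ → ℕ} (hd : 2 ≤ d) (j : ℕ → ℤ) {p : ℕ} (h1 : 1 ≤ p)
    (h2 : p ≤ d) : coord d e (vertex d e j) p = j p % len d e p := by
  obtain ⟨k, rfl⟩ := exists_pos hd h1 h2
  rw [coord_pos hd, vertex, ZMod.val_intCast, len, fac_pos hd]
  push_cast
  rfl

theorem vertex_coord {d : ℕ} {e : ℕ → ℕ} (hd : 2 ≤ d) (x : ∀ k : Fin d, ZMod (2 ^ e (k + 1))) :
    vertex d e (coord d e x) = x := by
  funext k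
  rw [vertex, coord_pos hd]
  simp

theorem coord_nonneg {d : ℕ} {e : ℕ → ℕ} (x : ∀ k : Fin d, ZMod (2 ^ e (k + 1))) (p : ℕ) :
    0 ≤ coord d e x p :=
  Finset.sum_nonneg fun k _ => by split_ifs <;> positivity

theorem coord_lt {d : ℕ} {e : ℕ → ℕ} (hd : 2 ≤ d) (x : ∀ k : Fin d, ZMod (2 ^ e (k + 1))) {p : ℕ}
    (h1 : 1 ≤ p) (h2 : p ≤ d) : coord d e x p < len d e p := by
  have := coord_vertex (e := e) hd (coord d e x) h1 h2
  rw [vertex_coord hd] at this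
  rw [this]
  exact Int.emod_lt_of_pos _ (by unfold len; positivity)

/-- The number of steps that precede the step along the factor at position `p` in a pass. -/
def place (f : Bool) (p : ℕ) : ℕ :=
  if p = 1 then (if f then 0 else 1) else if p = 2 then (if f then 1 else 0) else p - 1

theorem place_ge {f : Bool} {p : ℕ} (h3 : 3 ≤ p) : place f p = p - 1 := by
  rw [place, if_neg (by omega), if_neg (by omega)]

theorem place_lt {d : ℕ} (hd : 2 ≤ d) (f : Bool) {p : ℕ} (h2 : p ≤ d) : place f p < d := by
  unfold place
  cases f <;> simp <;> split_ifs <;> omega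

theorem place_inj {f : Bool} {p r : ℕ} (hp : 1 ≤ p) (hr : 1 ≤ r) (h : place f p = place f r) :
    p = r := by
  unfold place at h
  cases f <;> simp at h <;> split_ifs at h <;> omega

/-- The vertex reached after `q` steps of a pass from `j` to `j'`. -/
def mix (f : Bool) (j j' : ℕ → ℤ) (q p : ℕ) : ℤ := if place f p < q then j' p else j p

/-- Integer data of a family of sequences of passes. -/
structure PassData (d : ℕ) (e : ℕ → ℕ) (ι : Type*) (M : ℕ) where
  bz : ι → ℕ → ℕ → ℤ
  fl : ℕ → Bool
  step : ∀ c n p, 1 ≤ p → p ≤ d → bz c (n + 1) p ≡ bz c n p + 1 [ZMOD len d e p] ∨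
    bz c (n + 1) p ≡ bz c n p - 1 [ZMOD len d e p]
  per : ∀ c n p, 1 ≤ p → p ≤ d → bz c (n + M) p ≡ bz c n p [ZMOD len d e p]
  fl_per : ∀ n, fl (n + M) = fl n

/-- Integer data of a stage family. -/
structure StageData (d : ℕ) (e : ℕ → ℕ) (ι : Type*) (M : ℕ) where
  bz : ι → ℕ → ℕ → ℤ
  fl : ℕ → Bool
  flag : (ℕ → ℤ) → Bool
  sg : ℕ → (ℕ → ℤ) → Bool
  flag_off : ∀ p j j', 1 ≤ p → p ≤ d → (∀ r, 1 ≤ r → r ≤ d → r ≠ p → j r = j' r) →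
    place (flag j) p = place (flag j') p
  sg_off : ∀ p j j', 1 ≤ p → p ≤ d → (∀ r, 1 ≤ r → r ≤ d → r ≠ p → j r = j' r) →
    sg p j = sg p j'
  pl_eq : ∀ c n p, 1 ≤ p → p ≤ d →
    place (flag fun r => mix (fl n) (bz c n) (bz c (n + 1)) (place (fl n) p) r % len d e r) p =
      place (fl n) p
  step_eq : ∀ c n p, 1 ≤ p → p ≤ d → bz c (n + 1) p ≡ bz c n p +
    (if sg p fun r => mix (fl n) (bz c n) (bz c (n + 1)) (place (fl n) p) r % len d e r
      then 1 else -1) [ZMOD len d e p]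
  per : ∀ c n p, 1 ≤ p → p ≤ d → bz c (n + M) p ≡ bz c n p [ZMOD len d e p]
  fl_per : ∀ n, fl (n + M) = fl n
  inj : ∀ c c' n n', n < M → n' < M → (∀ p, 1 ≤ p → p ≤ d → bz c n p ≡ bz c' n' p [ZMOD len d e p]) →
    c = c' ∧ n = n'
  surj : ∀ j : ℕ → ℤ, (∀ p, 1 ≤ p → p ≤ d → 0 ≤ j p ∧ j p < len d e p) → ∃ c, ∃ n < M, ∀ p, 1 ≤ p →
    p ≤ d → bz c n p ≡ j p [ZMOD len d e p]

theorem passMix_vertex {d : ℕ} {e : ℕ → ℕ} (f : Bool) (j j' : ℕ → ℤ) (q : ℕ) :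
    passMix (fun k => place f (pos d k)) (vertex d e j) (vertex d e j') q =
      vertex d e (mix f j j' q) := by
  funext k
  simp only [passMix, vertex, mix]
  split_ifs <;> rfl

theorem ite_two {γ : Type*} (a b : γ) : (if 2 = 1 then a else b) = b := rfl

theorem ite_ge {γ : Type*} {p : ℕ} (h : 3 ≤ p) (a b c : γ) :
    (if p = 1 then a else if p = 2 then b else c) = c := by
  rw [if_neg (by omega), if_neg (by omega)]

/-- The integer arc `(j, δ)` is the step `q` of the pass from `b` to `b'`. -/
def ArcMatch (d : ℕ) (e : ℕ → ℕ) (f : Bool) (b b' : ℕ → ℤ) (q : ℕ) (j δ : ℕ → ℤ) : Prop :=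
  ∀ p, 1 ≤ p → p ≤ d → j p ≡ mix f b b' q p [ZMOD len d e p] ∧
    j p + δ p ≡ mix f b b' (q + 1) p [ZMOD len d e p]

theorem ArcMatch.congr {d : ℕ} {e : ℕ → ℕ} {f : Bool} {b b' T : ℕ → ℤ} {q : ℕ} {j δ : ℕ → ℤ}
    (hT : ∀ p, 1 ≤ p → p ≤ d → T p ≡ b' p [ZMOD len d e p])
    (h : ∀ p, 1 ≤ p → p ≤ d → j p = mix f b T q p ∧ j p + δ p = mix f b T (q + 1) p) :
    ArcMatch d e f b b' q j δ := by
  intro p h1 h2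
  have key : ∀ q, mix f b T q p ≡ mix f b b' q p [ZMOD len d e p] := by
    intro q
    unfold mix
    split_ifs
    · exact hT p h1 h2
    · rfl
  obtain ⟨h3, h4⟩ := h p h1 h2
  rw [h3, ← h3, h4, h3]
  exact ⟨key _, key _⟩

theorem ArcMatch.of_eq {d : ℕ} {e : ℕ → ℕ} {f : Bool} {b b' : ℕ → ℤ} {q : ℕ} {j δ : ℕ → ℤ}
    (h : ∀ p, 1 ≤ p → p ≤ d → j p = mix f b b' q p ∧ j p + δ p = mix f b b' (q + 1) p) :
    ArcMatch d e f b b' q j δ :=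
  .congr (fun _ _ _ => rfl) h

namespace PassData

variable {d : ℕ} {e : ℕ → ℕ} {ι : Type*} {M : ℕ}

/-- The family of sequences of passes given by integer data. -/
def toPassFamily (D : PassData d e ι M) (hd : 2 ≤ d) :
    PassFamily (fun k : Fin d => 2 ^ e (k + 1)) ι M where
  b c n := vertex d e (D.bz c n)
  pl n k := place (D.fl n) (pos d k)
  pl_lt n k := place_lt hd _ (pos_mem hd k).2
  pl_inj n k l h := pos_injective hd (place_inj (pos_mem hd k).1 (pos_mem hd l).1 h)
  step c n k := by
    have h := D.step c n (pos d k) (pos_mem hd k).1 (pos_mem hd k).2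
    rw [modEq_len_iff hd, modEq_len_iff hd] at h
    simp only [vertex]
    rcases h with h | h
    · left; rw [h]; push_cast; ring
    · right; rw [h]; push_cast; ring
  b_per c n := (vertex_eq_iff hd).2 (D.per c n)
  pl_per n := by rw [D.fl_per]

theorem a_eq (D : PassData d e ι M) (hd : 2 ≤ d) (c : ι) (n : ℕ) {q : ℕ} (hq : q ≤ d) :
    (D.toPassFamily hd).a c (d * n + q) =
      vertex d e (mix (D.fl n) (D.bz c n) (D.bz c (n + 1)) q) := by
  rw [(D.toPassFamily hd).a_mix c n hq (by omega)]
  exact passMix_vertex _ _ _ _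

theorem edges_eq (D : PassData d e ι M) (hd : 2 ≤ d) {α : ℕ} (c : ι) (P : Param)
    (hto : ∀ j δ, IsArc d e α P j δ → ∃ n < M, ∃ q < d,
      ArcMatch d e (D.fl n) (D.bz c n) (D.bz c (n + 1)) q j δ)
    (hfrom : ∀ n < M, ∀ q < d, ∃ j δ, IsArc d e α P j δ ∧
      ArcMatch d e (D.fl n) (D.bz c n) (D.bz c (n + 1)) q j δ) :
    edges d e α P = (D.toPassFamily hd).edgesOf c := by
  have key : ∀ {n q : ℕ} {j δ : ℕ → ℤ}, q < d →
      ArcMatch d e (D.fl n) (D.bz c n) (D.bz c (n + 1)) q j δ →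
      s(vertex d e j, vertex d e fun k => j k + δ k) =
        s((D.toPassFamily hd).a c (d * n + q), (D.toPassFamily hd).a c (d * n + q + 1)) := by
    intro n q j δ hq h
    rw [add_assoc, D.a_eq hd c n hq.le, D.a_eq hd c n hq,
      (vertex_eq_iff hd).2 fun p h1 h2 => (h p h1 h2).1,
      (vertex_eq_iff hd).2 fun p h1 h2 => (h p h1 h2).2]
  ext a
  constructor
  · rintro ⟨j, δ, h, rfl⟩
    obtain ⟨n, hn, q, hq, h'⟩ := hto j δ h
    exact ⟨_, PassFamily.time_lt hn hq, key hq h'⟩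
  · rintro ⟨t, ht, rfl⟩
    obtain ⟨j, δ, h, h'⟩ := hfrom (t / d) (Nat.div_lt_of_lt_mul ht) (t % d)
      (Nat.mod_lt _ (by omega))
    refine ⟨j, δ, h, ?_⟩
    rw [key (Nat.mod_lt _ (by omega)) h', Nat.div_add_mod]

end PassData

namespace StageData

variable {d : ℕ} {e : ℕ → ℕ} {ι : Type*} {M : ℕ}

/-- The underlying sequences of passes. -/
def toPassData (D : StageData d e ι M) : PassData d e ι M where
  bz := D.bz
  fl := D.fl
  step c n p h1 h2 := by
    have h := D.step_eq c n p h1 h2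
    split_ifs at h
    · exact Or.inl h
    · exact Or.inr h
  per := D.per
  fl_per := D.fl_per

/-- The family of sequences of passes given by integer data. -/
def toPassFamily (D : StageData d e ι M) (hd : 2 ≤ d) :
    PassFamily (fun k : Fin d => 2 ^ e (k + 1)) ι M := D.toPassData.toPassFamily hd

theorem a_eq (D : StageData d e ι M) (hd : 2 ≤ d) (c : ι) (n : ℕ) {q : ℕ} (hq : q ≤ d) :
    (D.toPassFamily hd).a c (d * n + q) =
      vertex d e (mix (D.fl n) (D.bz c n) (D.bz c (n + 1)) q) :=
  D.toPassData.a_eq hd c n hq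

/-- The stage family given by integer data. -/
def toStageFamily (D : StageData d e ι M) (hd : 2 ≤ d) :
    StageFamily (fun k : Fin d => 2 ^ e (k + 1)) ι M where
  toPassFamily := D.toPassFamily hd
  flag x := D.flag (coord d e x)
  ord f k := place f (pos d k)
  sg k x := D.sg (pos d k) (coord d e x)
  ord_lt f k := place_lt hd _ (pos_mem hd k).2
  ord_inj f k l h := pos_injective hd (place_inj (pos_mem hd k).1 (pos_mem hd l).1 h)
  ord_off k x y h := by
    refine D.flag_off _ _ _ (pos_mem hd k).1 (pos_mem hd k).2 fun r h1 h2 hr => ?_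
    obtain ⟨l, rfl⟩ := exists_pos hd h1 h2
    rw [coord_pos hd, coord_pos hd, h l fun hl => hr (by rw [hl])]
  sg_off k x y h := by
    refine D.sg_off _ _ _ (pos_mem hd k).1 (pos_mem hd k).2 fun r h1 h2 hr => ?_
    obtain ⟨l, rfl⟩ := exists_pos hd h1 h2
    rw [coord_pos hd, coord_pos hd, h l fun hl => hr (by rw [hl])]
  pl_eq c n k := by
    have hp := pos_mem hd k
    have h := D.pl_eq c n (pos d k) hp.1 hp.2
    have h2 : (D.toPassFamily hd).pl n k = place (D.fl n) (pos d k) := rfl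
    rw [h2, D.a_eq hd c n (place_lt hd _ hp.2).le, ← h]
    refine D.flag_off _ _ _ hp.1 hp.2 fun r h1 h2 _ => ?_
    rw [coord_vertex hd _ h1 h2, h]
  step_eq c n k := by
    have hp := pos_mem hd k
    have h := D.step_eq c n (pos d k) hp.1 hp.2
    have h2 : (D.toPassFamily hd).pl n k = place (D.fl n) (pos d k) := rfl
    have h3 : D.sg (pos d k) (coord d e ((D.toPassFamily hd).a c (d * n + place (D.fl n) (pos d k))))
        = D.sg (pos d k) fun r =>
          mix (D.fl n) (D.bz c n) (D.bz c (n + 1)) (place (D.fl n) (pos d k)) r % len d e r := by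
      refine D.sg_off _ _ _ hp.1 hp.2 fun r h1 h2 _ => ?_
      rw [D.a_eq hd c n (place_lt hd _ hp.2).le, coord_vertex hd _ h1 h2]
    rw [h2, h3]
    rw [modEq_len_iff hd] at h
    change ((D.bz c (n + 1) (pos d k) : ℤ) : ZMod (2 ^ e (k + 1))) =
      ((D.bz c n (pos d k) : ℤ) : ZMod (2 ^ e (k + 1))) + _
    rw [h]
    split_ifs <;> push_cast <;> rfl
  b_inj c c' n n' hn hn' h := D.inj c c' n n' hn hn' ((vertex_eq_iff hd).1 h)
  b_surj x := by
    obtain ⟨c, n, hn, h⟩ := D.surj (coord d e x)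
      fun p h1 h2 => ⟨coord_nonneg x p, coord_lt hd x h1 h2⟩
    exact ⟨c, n, hn, ((vertex_eq_iff hd).2 h).trans (vertex_coord hd x)⟩

theorem isCycleDecomposition (D : StageData d e ι M) (hd : 2 ≤ d) (hM : 2 ≤ M)
    (he : ∀ k, 1 ≤ k → k ≤ d → 2 ≤ e k) (hfl : ∀ n n', n % 2 = n' % 2 → D.fl n = D.fl n')
    (hfl2 : d = 2 → ∀ n, D.fl n = false) :
    IsCycleDecomposition (torus d e) (d * M) (D.toPassFamily hd).edgesOf ∧
      ∀ c k, numAlong ((D.toPassFamily hd).edgesOf c) k = M := by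
  have hz : ∀ k : Fin d, 4 ≤ 2 ^ e (k + 1) := fun k =>
    le_trans (by norm_num) (Nat.pow_le_pow_right (by norm_num : 0 < 2) (he (k + 1) (by omega) k.2))
  obtain ⟨p, hp1, hp2, hp⟩ : ∃ p, 1 ≤ p ∧ p ≤ d ∧ ∀ n, place (D.fl n) p = d - 1 := by
    by_cases hd2 : d = 2
    · exact ⟨1, by omega, by omega, fun n => by simp [hfl2 hd2, place, hd2]⟩
    · exact ⟨d, by omega, le_rfl, fun n => place_ge (by omega)⟩
  obtain ⟨k, rfl⟩ := exists_pos hd hp1 hp2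
  refine (D.toStageFamily hd).isCycleDecomposition hd hM (fun k => by have := hz k; omega)
    (fun k => dvd_pow_self 2 (by have := he (k + 1) (by omega) k.2; omega)) k hp fun n n' h => ?_
  have h2 : D.fl n = D.fl n' := hfl n n' ((ZMod.natCast_eq_natCast_iff' _ _ _).1 h)
  change (fun k => place (D.fl n) (pos d k)) = fun k => place (D.fl n') (pos d k)
  rw [h2]

end StageData

/-! ### States

The admissible moves form a cyclic sequence of `2 * d` states: first the entries
`m_2, m_1, m_3, …, m_d` become `1` one by one, then they become `0` in the same order. -/

/-- The entry at place `q` in the state `c`. -/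
def stateAt (d c q : ℕ) : ℤ := if q < c ∧ c ≤ q + d then 1 else 0

/-- The move `m` is the state `c`. -/
abbrev IsState (d c : ℕ) (m : ℕ → ℤ) : Prop :=
  ∀ k, 1 ≤ k → k ≤ d → m k = stateAt d c (place false k)

theorem stateAt_cases (d c q : ℕ) :
    (stateAt d c q = 1 ∧ q < c ∧ c ≤ q + d) ∨ (stateAt d c q = 0 ∧ ¬(q < c ∧ c ≤ q + d)) := by
  unfold stateAt
  split_ifs with h
  · exact Or.inl ⟨rfl, h⟩
  · exact Or.inr ⟨rfl, h⟩

theorem place_cases {k : ℕ} (hk : 1 ≤ k) : (k = 1 ∧ place false k = 1) ∨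
    (k = 2 ∧ place false k = 0) ∨ (3 ≤ k ∧ place false k = k - 1) := by
  rcases (by omega : k = 1 ∨ k = 2 ∨ 3 ≤ k) with rfl | rfl | h
  · simp [place]
  · simp [place]
  · right; right
    exact ⟨h, place_ge (by omega)⟩

theorem isMove_iff {d : ℕ} (hd : 2 ≤ d) (m : ℕ → ℤ) :
    IsMove d m ↔ ∃ c < 2 * d, IsState d c m := by
  constructor
  · rintro ⟨h01, h⟩
    have key : ∀ c, (∀ k, 1 ≤ k → k ≤ d →
        (m k = 1 ↔ place false k < c ∧ c ≤ place false k + d)) →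
        IsState d c m := by
      intro c hc k hk hk'
      have h1 := hc k hk hk'
      have h2 := h01 k hk hk'
      have h3 := stateAt_cases d c (place false k)
      omega
    rcases h with h | ⟨h2, h⟩ | ⟨k, hk2, hkd, h1, h2, h3⟩
    · rcases h01 1 le_rfl (by omega) with h1 | h1
      · refine ⟨0, by omega, key _ fun k hk hk' => ?_⟩
        have := h k hk hk'
        omega
      · refine ⟨d, by omega, key _ fun k hk hk' => ?_⟩
        have := h k hk hk'
        have := place_lt hd false hk'
        omega
    · have h2' := h01 2 (by omega) hd
      rcases h01 1 le_rfl (by omega) with h1 | h1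
      · refine ⟨1, by omega, key _ fun k hk hk' => ?_⟩
        rcases place_cases hk with ⟨rfl, h3⟩ | ⟨rfl, h3⟩ | ⟨h3, h4⟩
        · omega
        · omega
        · have := h k h3 hk'
          omega
      · refine ⟨d + 1, by omega, key _ fun k hk hk' => ?_⟩
        rcases place_cases hk with ⟨rfl, h3⟩ | ⟨rfl, h3⟩ | ⟨h3, h4⟩
        · omega
        · omega
        · have := h k h3 hk'
          omega
    · have h4 := h01 (k + 1) (by omega) (by omega)
      have h5 := h1 k (by omega) le_rfl
      rcases h01 1 le_rfl (by omega) with h0 | h0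
      · refine ⟨d + k, by omega, key _ fun r hr hr' => ?_⟩
        have h6 := place_cases hr
        rcases (by omega : r ≤ k ∨ k + 1 ≤ r) with hrk | hrk
        · have := h1 r hr hrk
          omega
        · have := h3 r hrk hr'
          omega
      · refine ⟨k, by omega, key _ fun r hr hr' => ?_⟩
        have h6 := place_cases hr
        rcases (by omega : r ≤ k ∨ k + 1 ≤ r) with hrk | hrk
        · have := h1 r hr hrk
          omega
        · have := h3 r hrk hr'
          omega
  · rintro ⟨c, hc, h⟩
    have key : ∀ k, 1 ≤ k → k ≤ d →
        (m k = 1 ∧ place false k < c ∧ c ≤ place false k + d) ∨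
          (m k = 0 ∧ ¬(place false k < c ∧ c ≤ place false k + d)) := by
      intro k hk hk'
      rw [h k hk hk']
      exact stateAt_cases _ _ _
    have k1 := key 1 le_rfl (by omega)
    have k2 := key 2 (by omega) hd
    have p1 : place false 1 = 1 := rfl
    have p2 : place false 2 = 0 := rfl
    rw [p1] at k1
    rw [p2] at k2
    refine ⟨fun k hk hk' => by have := key k hk hk'; omega, ?_⟩
    rcases (by omega : (c = 0 ∨ c = d) ∨ (c = 1 ∨ c = d + 1) ∨
      (2 ≤ c ∧ c ≤ d - 1) ∨ d + 2 ≤ c) with hc0 | hc0 | ⟨hc1, hc2⟩ | hc1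
    · left
      intro k hk hk'
      have := key k hk hk'
      have := place_lt hd false hk'
      omega
    · right; left
      refine ⟨by omega, fun k hk hk' => ?_⟩
      have := key k (by omega) hk'
      have := place_cases (k := k) (by omega)
      omega
    · right; right
      have hs := key (c + 1) (by omega) (by omega)
      have hs' := place_cases (k := c + 1) (by omega)
      have hc' := key c (by omega) (by omega)
      have hc'' := place_cases (k := c) (by omega)
      refine ⟨c, hc1, hc2, fun j hj hj' => ?_, by omega, fun j hj hj' => ?_⟩
      · have := key j hj (by omega)
        have := place_cases hj
        omega
      · have := key j (by omega) hj'
        have := place_cases (k := j) (by omega)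
        omega
    · right; right
      have hs := key (c - d + 1) (by omega) (by omega)
      have hs' := place_cases (k := c - d + 1) (by omega)
      have hc' := key (c - d) (by omega) (by omega)
      have hc'' := place_cases (k := c - d) (by omega)
      refine ⟨c - d, by omega, by omega, fun j hj hj' => ?_, by omega, fun j hj hj' => ?_⟩
      · have := key j hj (by omega)
        have := place_cases hj
        omega
      · have := key j (by omega) hj'
        have := place_cases (k := j) (by omega)
        omega

theorem isMove_stateAt {d c : ℕ} (hd : 2 ≤ d) (hc : c < 2 * d) :
    IsMove d fun k => stateAt d c (place false k) :=
  (isMove_iff hd _).2 ⟨c, hc, fun _ _ _ => rfl⟩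

section States

variable {d c : ℕ} {m : ℕ → ℤ}

theorem state_one (hd : 2 ≤ d) (h : IsState d c m) :
    m 1 = stateAt d c 1 := h 1 le_rfl (by omega)

theorem state_two (hd : 2 ≤ d) (h : IsState d c m) :
    m 2 = stateAt d c 0 := h 2 (by omega) hd

theorem state_ge (h : IsState d c m) {k : ℕ} (hk : 3 ≤ k) (hk' : k ≤ d) : m k = stateAt d c (k - 1) := by
  rw [h k (by omega) hk', place, if_neg (by omega), if_neg (by omega)]

theorem prev_state (hd : 2 ≤ d) (h : IsState d c m) {k : ℕ} (hk : 3 ≤ k) (hk' : k ≤ d) : prev m k = stateAt d c (k - 2) := by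
  unfold prev
  split_ifs with h3
  · subst h3; exact state_one hd h
  · rw [state_ge h (by omega) (by omega)]; rfl

theorem prev2_state (hd : 2 ≤ d) (h : IsState d c m) {k : ℕ} (hk : 3 ≤ k) (hk' : k ≤ d) : prev2 m k = stateAt d c (k - 3) := by
  unfold prev2
  split_ifs with h3 h4
  · subst h3; exact state_two hd h
  · subst h4; exact state_one hd h
  · rw [state_ge h (by omega) (by omega)]; rfl

theorem exists_place_eq (hd : 2 ≤ d) : ∃ k, 1 ≤ k ∧ k ≤ d ∧ place false k = d - 1 := by
  by_cases hd2 : d = 2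
  · exact ⟨1, by omega, by omega, by simp [place, hd2]⟩
  · exact ⟨d, by omega, le_rfl, place_ge (by omega)⟩

theorem allOne_state (hd : 2 ≤ d)
    (h : IsState d c m) :
    allOne d m = if c = d then 1 else 0 := by
  unfold allOne
  split_ifs with hcd
  · refine Finset.prod_eq_one fun k hk => ?_
    rw [Finset.mem_Icc] at hk
    rw [h k hk.1 hk.2, stateAt, if_pos]
    have := place_lt hd false hk.2
    omega
  · rcases lt_or_gt_of_ne hcd with hlt | hgt
    · obtain ⟨k, hk1, hk2, hk⟩ := exists_place_eq hd
      refine Finset.prod_eq_zero (Finset.mem_Icc.2 ⟨hk1, hk2⟩) ?_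
      rw [h k hk1 hk2, hk, stateAt, if_neg (by omega)]
    · refine Finset.prod_eq_zero (Finset.mem_Icc.2 ⟨by omega, hd⟩) ?_
      rw [state_two hd h, stateAt, if_neg (by omega)]

theorem allZero_state (hd : 2 ≤ d) (hc : c < 2 * d)
    (h : IsState d c m) :
    allZero d m = if c = 0 then 1 else 0 := by
  unfold allZero
  split_ifs with hcd
  · refine Finset.prod_eq_one fun k hk => ?_
    rw [Finset.mem_Icc] at hk
    rw [h k hk.1 hk.2, stateAt, if_neg (by omega)]
    norm_num
  · rcases le_or_gt c d with hlt | hgt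
    · refine Finset.prod_eq_zero (Finset.mem_Icc.2 ⟨by omega, hd⟩) ?_
      rw [state_two hd h, stateAt, if_pos (by omega)]
      norm_num
    · obtain ⟨k, hk1, hk2, hk⟩ := exists_place_eq hd
      refine Finset.prod_eq_zero (Finset.mem_Icc.2 ⟨hk1, hk2⟩) ?_
      rw [h k hk1 hk2, hk, stateAt, if_pos (by omega)]
      norm_num

end States

/-- The edge sets with the parameters `d`, `e`, `α` decompose the torus, and every one of them
has `2 ^ α` edges along every factor. -/
abbrev Decomposes (d : ℕ) (e : ℕ → ℕ) (α : ℕ) : Prop :=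
  IsCycleDecomposition (torus d e) (d * 2 ^ α) (fun P : Index d e α => edges d e α P.1) ∧
    ∀ (P : Index d e α) (k : Fin d), numAlong (edges d e α P.1) k = 2 ^ α

/-! ### The thresholds -/

section Levels

variable {d : ℕ} {e : ℕ → ℕ} {α : ℕ}

theorem level_one : level d e 1 = e d := by simp [level]

theorem level_succ {k : ℕ} (hk : 1 ≤ k) : level d e (k + 1) = level d e k + e k - 1 := by
  obtain ⟨k, rfl⟩ : ∃ l, k = l + 1 := ⟨k - 1, by omega⟩
  simp only [level, Nat.add_sub_cancel]
  rw [Finset.sum_Icc_succ_top (by omega)]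
  push_cast
  ring

theorem level_mono (he : ∀ k, 1 ≤ k → k ≤ d → 2 ≤ e k) {j k : ℕ} (hj : 1 ≤ j) (hjk : j ≤ k)
    (hk : k ≤ d) : level d e j + (k - j : ℤ) ≤ level d e k := by
  induction k, hjk using Nat.le_induction with
  | base => simp
  | succ k hjk ih =>
    have h1 := ih (by omega)
    have h2 := level_succ (d := d) (e := e) (k := k) (by omega)
    have h3 := he k (by omega) (by omega)
    push_cast
    omega

theorem η_of_le {k : ℕ} (h : k ≤ d) : η d k = 1 := by simp [η, h]

theorem η_of_lt {k : ℕ} (h : d < k) : η d k = 0 := by simp [η, h]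

theorem ηα_eq_one {k : ℕ} (h : level d e k < α) : ηα d e α k = 1 := by simp [ηα, h]

theorem ηα_eq_zero {k : ℕ} (h : (α : ℤ) ≤ level d e k) : ηα d e α k = 0 := by simp [ηα, h]

theorem A₂_eq_one (h : level d e 2 ≤ α) : A₂ d e α = 1 := by
  rw [A₂, if_pos]; omega

theorem A₂_eq_zero (h : (α : ℤ) < level d e 2) : A₂ d e α = 0 := by
  rw [A₂, if_neg]; omega

theorem A_eq_one_of_le (he : ∀ k, 1 ≤ k → k ≤ d → 2 ≤ e k) {k : ℕ} (hk : 4 ≤ k) (hkd : k ≤ d + 1)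
    (h : (α : ℤ) ≤ level d e (k - 2)) : A d e α k = 1 := by
  have h1 := level_mono he (j := k - 2) (k := k - 1) (by omega) (by omega) (by omega)
  rw [A, if_neg (by omega), ηα_eq_zero h, ηα_eq_zero (k := k - 1) (by omega)]
  simp

theorem len_one : len d e 1 = z e 1 := rfl

theorem len_two : len d e 2 = z e d := rfl

theorem len_ge {p : ℕ} (hp : 3 ≤ p) : len d e p = z e (p - 1) := by
  rw [len, fac, if_neg (by omega), if_neg (by omega), z]

theorem four_dvd_z {k : ℕ} (h : 2 ≤ e k) : (4 : ℤ) ∣ z e k := by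
  rw [z, show (4 : ℤ) = 2 ^ 2 by norm_num]
  exact pow_dvd_pow _ h

theorem four_dvd_len (hd : 2 ≤ d) (he : ∀ k, 1 ≤ k → k ≤ d → 2 ≤ e k) {p : ℕ} (hp : 1 ≤ p)
    (hpd : p ≤ d) : (4 : ℤ) ∣ len d e p := by
  have : 2 ≤ e (fac d p) := by
    unfold fac
    split_ifs
    · exact he 1 le_rfl (by omega)
    · exact he d (by omega) le_rfl
    · exact he _ (by omega) (by omega)
  exact four_dvd_z this

theorem len_pos (p : ℕ) : 0 < len d e p := by unfold len; positivity

theorem eq_of_modEq_of_lt {N x y : ℤ} (h : x ≡ y [ZMOD N]) (hx : 0 ≤ x) (hx' : x < N) (hy : 0 ≤ y)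
    (hy' : y < N) : x = y := by
  rwa [Int.ModEq, Int.emod_eq_of_lt hx hx', Int.emod_eq_of_lt hy hy'] at h

theorem div_mod_state {c : ℕ} (hc : c < 2 * d) :
    (c < d ∧ c / d = 0 ∧ c % d = c) ∨ (d ≤ c ∧ c / d = 1 ∧ c % d = c - d) := by
  rcases lt_or_ge c d with h | h
  · exact Or.inl ⟨h, Nat.div_eq_of_lt h, Nat.mod_eq_of_lt h⟩
  · refine Or.inr ⟨h, ?_, ?_⟩
    · rw [Nat.div_eq_iff (by omega)]; omega
    · rw [Nat.mod_eq_sub_mod h, Nat.mod_eq_of_lt (by omega)]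

theorem Param.ext' {P P' : Param} (hl : P.l = P'.l) (hγ : P.γ = P'.γ) (ht : P.t = P'.t)
    (hp : P.p = P'.p) (hs : P.s = P'.s) : P = P' := by
  cases P; cases P'; simp_all

end Levels

/-! ### The shortest cycles: `α = e d` -/

namespace Short

section

variable {d : ℕ} {e : ℕ → ℕ} {α : ℕ}

/-- The start of the `n`-th pass. -/
def start (P : Param) (n p : ℕ) : ℤ :=
  if p = 1 then 2 * P.l + P.t + P.γ + sgn P.γ * (if n % 4 = 3 then 1 else (n % 4 : ℕ))
  else if p = 2 then P.γ + n
  else if p = 3 then 2 * P.s 1 + sgn P.γ * (n % 2 : ℕ)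
  else P.s (p - 2) + (n % 2 : ℕ)

structure Hyp (d : ℕ) (e : ℕ → ℕ) (α : ℕ) : Prop where
  hd : 3 ≤ d
  he : ∀ k, 1 ≤ k → k ≤ d → 2 ≤ e k
  hα : (α : ℤ) = e d

namespace Hyp

theorem le_level (H : Hyp d e α) {k : ℕ} (hk : 1 ≤ k) (hkd : k ≤ d) :
    (α : ℤ) + (k - 1) ≤ level d e k := by
  have h := level_mono H.he (le_refl 1) hk hkd
  rw [level_one, ← H.hα] at h
  push_cast at h
  omega

theorem ηα_eq (H : Hyp d e α) {k : ℕ} (hk : 1 ≤ k) (hkd : k ≤ d) : ηα d e α k = 0 :=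
  ηα_eq_zero (by have := H.le_level hk hkd; omega)

theorem A₁_eq (H : Hyp d e α) : A₁ d e α = 0 := H.ηα_eq le_rfl (by have := H.hd; omega)

theorem A₂_eq (H : Hyp d e α) : A₂ d e α = 0 :=
  A₂_eq_zero (by
    have := H.le_level (k := 2) (by omega) (by have := H.hd; omega)
    push_cast at this
    omega)

theorem A_three (H : Hyp d e α) : A d e α 3 = 2 := by
  simp [A, H.A₂_eq, level_one, H.hα]

theorem A_ge (H : Hyp d e α) {k : ℕ} (hk : 4 ≤ k) (hkd : k ≤ d + 1) : A d e α k = 1 :=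
  A_eq_one_of_le H.he hk hkd (by have := H.le_level (k := k - 2) (by omega) (by omega); omega)

theorem admissible_iff (H : Hyp d e α) (P : Param) : Admissible d e α P ↔
      (0 ≤ P.l ∧ 2 * P.l < len d e 1) ∧ (P.γ = 0 ∨ P.γ = 1) ∧ (P.t = 0 ∨ P.t = 1) ∧
      (∀ k, P.p k = 0) ∧ (0 ≤ P.s 1 ∧ 2 * P.s 1 < len d e 3) ∧
      (∀ k, 2 ≤ k → k ≤ d - 2 → 0 ≤ P.s k ∧ P.s k < len d e (k + 2)) ∧
      (∀ k, k < 1 ∨ d - 2 < k → P.s k = 0) := by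
  have hd := H.hd
  have h4 := four_dvd_z (e := e) (H.he 1 le_rfl (by omega))
  have h4' := four_dvd_z (e := e) (H.he 2 (by omega) (by omega))
  unfold Admissible
  rw [H.A₁_eq, H.A_three, η_of_le hd, H.A_ge (le_refl 4) (by omega),
    H.ηα_eq (k := 2) (by omega) (by omega), len_one, len_ge (p := 3) le_rfl]
  simp only [sub_zero, mul_one, one_mul, zero_add, Int.toNat_one, pow_one]
  constructor
  · rintro ⟨hl, hγ, ht, hp, hs1, hs, hoff⟩
    refine ⟨by omega, by omega, by omega, fun k => ?_, ?_, fun k hk hk' => ?_,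
      fun k hk => (hoff k hk).2⟩
    · by_cases hk : 1 ≤ k ∧ k ≤ d - 2
      · have := hp k hk.1 hk.2
        rw [H.ηα_eq (by omega) (by omega)] at this
        simp at this
        omega
      · exact (hoff k (by omega)).1
    · have := hs1 (by omega)
      simp only [Nat.add_one_sub_one]
      omega
    · have := hs k hk hk'
      rw [H.A_ge (by omega) (by omega), H.ηα_eq (by omega) (by omega)] at this
      rw [len_ge (by omega)]
      simp only [Int.toNat_zero, pow_zero, mul_one, Int.ediv_one] at this
      simp only [Nat.reduceSubDiff]
      omega
  · rintro ⟨hl, hγ, ht, hp, hs1, hs, hoff⟩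
    refine ⟨by omega, by omega, by omega, fun k hk hk' => ?_, fun _ => ?_, fun k hk hk' => ?_,
      fun k hk => ⟨hp k, hoff k hk⟩⟩
    · rw [hp k, H.ηα_eq (by omega) (by omega)]
      simp
    · simp only [Nat.add_one_sub_one] at hs1
      omega
    · have := hs k hk hk'
      rw [H.A_ge (by omega) (by omega), H.ηα_eq (by omega) (by omega)]
      rw [len_ge (by omega)] at this
      simp only [Int.toNat_zero, pow_zero, mul_one, Int.ediv_one]
      simp only [Nat.reduceSubDiff] at this
      omega

theorem two_pow_eq (H : Hyp d e α) : ((2 ^ α : ℕ) : ℤ) = len d e 2 := by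
  rw [len_two, z, show α = e d by have := H.hα; omega]
  push_cast
  rfl

theorem four_dvd_two_pow (H : Hyp d e α) : 2 ^ α % 4 = 0 := by
  have := H.he d (by have := H.hd; omega) le_rfl
  have := H.hα
  exact Nat.mod_eq_zero_of_dvd (pow_dvd_pow 2 (by omega : 2 ≤ α))

end Hyp

/-- The sign of a step at the vertex `j`. -/
def sign (p : ℕ) (j : ℕ → ℤ) : Bool :=
  if p = 1 then decide (j 2 % 4 = 0 ∨ j 2 % 4 = 1)
  else if p = 2 then true
  else if p = 3 then decide (j 2 % 2 = 1)
  else decide (j 3 % 2 = 1)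

/-- The family of sequences of passes. -/
def stageData (H : Hyp d e α) : StageData d e (Index d e α) (2 ^ α) where
  bz P := start P.1
  fl n := decide (n % 2 = 1)
  flag j := decide (j 3 % 2 = 1)
  sg := sign
  flag_off p j j' h1 h2 h := by
    have hd := H.hd
    by_cases hp : p = 3
    · simp [place, hp]
    · rw [h 3 (by omega) hd (Ne.symm hp)]
  sg_off p j j' h1 h2 h := by
    have hd := H.hd
    unfold sign
    split_ifs with hp1 hp2 hp3
    · rw [h 2 (by omega) (by omega) (by omega)]
    · rfl
    · rw [h 2 (by omega) (by omega) (by omega)]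
    · rw [h 3 (by omega) (by omega) (by omega)]
  pl_eq P n p h1 h2 := by
    have hd := H.hd
    by_cases hp : 3 ≤ p
    · simp [place, show p ≠ 1 by omega, show p ≠ 2 by omega]
    · have h3 : place (decide (n % 2 = 1)) 3 = 2 := by simp [place]
      have h5 : place (decide (n % 2 = 1)) p ≤ 1 := by unfold place; split_ifs <;> omega
      congr 1
      simp only [mix, h3]
      rw [if_neg (by omega)]
      rw [Int.emod_emod_of_dvd _ (dvd_trans (by norm_num) (four_dvd_len (by omega) H.he (p := 3)
        (by omega) hd) : (2 : ℤ) ∣ _)]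
      obtain ⟨_, hγ, _⟩ := (H.admissible_iff _).1 P.2
      rcases hγ with hγ | hγ <;> simp [start, hγ, sgn] <;> omega
  step_eq P n p h1 h2 := by
    have hd := H.hd
    obtain ⟨_, hγ, _⟩ := (H.admissible_iff _).1 P.2
    have d2 := four_dvd_len (by omega) H.he (p := 2) (by omega) (by omega)
    have d3 := dvd_trans (by norm_num) (four_dvd_len (by omega) H.he (p := 3) (by omega) hd) (a := (2 : ℤ))
    have e4 := fun x : ℤ => Int.emod_emod_of_dvd x d2
    have e2 := fun x : ℤ => Int.emod_emod_of_dvd x (dvd_trans (by norm_num) d2 : (2 : ℤ) ∣ _)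
    have e3 := fun x : ℤ => Int.emod_emod_of_dvd x d3
    refine congrArg (· % _) ?_
    rcases (by omega : p = 1 ∨ p = 2 ∨ p = 3 ∨ 4 ≤ p) with rfl | rfl | rfl | hp
    · rcases (by omega : n % 4 = 0 ∨ n % 4 = 1 ∨ n % 4 = 2 ∨ n % 4 = 3) with h | h | h | h <;>
      rcases hγ with hγ | hγ <;>
      simp [sign, mix, place, start, hγ, sgn, e4, show n % 2 = n % 4 % 2 by omega, h,
        show (n + 1) % 4 = (n % 4 + 1) % 4 by omega] <;> (try split_ifs) <;> omega
    · simp [sign, start]; ring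
    · rcases (by omega : n % 2 = 0 ∨ n % 2 = 1) with h | h <;>
      rcases hγ with hγ | hγ <;>
      simp [sign, mix, place, start, hγ, sgn, e2, h, show (n + 1) % 2 = (n % 2 + 1) % 2 by omega] <;>
        (try split_ifs) <;> omega
    · have q1 : place (decide (n % 2 = 1)) 3 = 2 := rfl
      have q2 : place (decide (n % 2 = 1)) p = p - 1 := place_ge (by omega)
      simp only [sign, mix, q1, q2, ite_ge (show 3 ≤ p by omega),
        if_neg (show p ≠ 3 by omega), if_pos (show 2 < p - 1 by omega), e3]
      rcases (by omega : n % 2 = 0 ∨ n % 2 = 1) with h | h <;>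
      rcases hγ with hγ | hγ <;>
      simp [start, hγ, sgn, h, show (n + 1) % 2 = (n % 2 + 1) % 2 by omega,
        show p ≠ 1 by omega, show p ≠ 2 by omega, show p ≠ 3 by omega]
  per P n p h1 h2 := by
    have h4 := H.four_dvd_two_pow
    have hM := H.two_pow_eq
    have h5 : (n + 2 ^ α) % 4 = n % 4 := by omega
    have h6 : (n + 2 ^ α) % 2 = n % 2 := by omega
    simp only [start, h5, h6]
    by_cases hp2 : p = 2
    · subst hp2
      simp only [OfNat.ofNat_ne_one, if_true, if_false]
      push_cast at hM ⊢
      rw [hM, ← add_assoc]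
      exact Int.add_modEq_right
    · simp only [if_neg hp2]
      rfl
  fl_per n := by
    have h4 := H.four_dvd_two_pow
    rw [show (n + 2 ^ α) % 2 = n % 2 by omega]
  inj P P' n n' hn hn' h := by
    have hd := H.hd
    obtain ⟨hl, hγ, ht, hp, hs1, hs, hoff⟩ := (H.admissible_iff _).1 P.2
    obtain ⟨hl', hγ', ht', hp', hs1', hs', hoff'⟩ := (H.admissible_iff _).1 P'.2
    have hM := H.two_pow_eq
    have d1 := four_dvd_len (by omega) H.he (p := 1) (by omega) (by omega)
    have d2 := four_dvd_len (by omega) H.he (p := 2) (by omega) (by omega)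
    have d3 := four_dvd_len (by omega) H.he (p := 3) (by omega) hd
    have k1 := h 1 (by omega) (by omega)
    have k2 := h 2 (by omega) (by omega)
    have k3 := h 3 (by omega) (by omega)
    simp only [start, if_pos, OfNat.ofNat_ne_one, if_false] at k1 k2 k3
    have g3 := k3.of_dvd (dvd_trans (by norm_num) d3 : (2 : ℤ) ∣ _)
    have g2 := k2.of_dvd (dvd_trans (by norm_num) d2 : (2 : ℤ) ∣ _)
    have hpar : n % 2 = n' % 2 := by
      rcases hγ with hγ | hγ <;> rcases hγ' with hγ' | hγ' <;>
      simp [hγ, hγ', sgn, Int.ModEq] at g3 <;> omega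
    have hγγ : P.1.γ = P'.1.γ := by
      unfold Int.ModEq at g2
      omega
    rw [hγγ] at k1 k2 k3
    have hnn : n = n' := by
      have := eq_of_modEq_of_lt (Int.ModEq.add_left_cancel' _ k2) (by omega) (by omega) (by omega)
        (by omega)
      omega
    subst hnn
    refine ⟨Subtype.ext (Param.ext' ?_ hγγ ?_ ?_ ?_), rfl⟩
    · have := eq_of_modEq_of_lt (Int.ModEq.add_right_cancel' _ (Int.ModEq.add_right_cancel' _ k1))
        (by omega) (by omega) (by omega) (by omega)
      omega
    · have := eq_of_modEq_of_lt (Int.ModEq.add_right_cancel' _ (Int.ModEq.add_right_cancel' _ k1))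
        (by omega) (by omega) (by omega) (by omega)
      omega
    · funext k
      rw [hp, hp']
    · funext k
      rcases (by omega : (k < 1 ∨ d - 2 < k) ∨ k = 1 ∨ (2 ≤ k ∧ k ≤ d - 2)) with hk | rfl | hk
      · rw [hoff k hk, hoff' k hk]
      · have := eq_of_modEq_of_lt (Int.ModEq.add_right_cancel' _ k3) (by omega) (by omega) (by omega)
          (by omega)
        omega
      · have k4 := h (k + 2) (by omega) (by omega)
        simp only [start, ite_ge (show 3 ≤ k + 2 by omega),
          if_neg (show k + 2 ≠ 3 by omega)] at k4
        have := hs k hk.1 hk.2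
        have := hs' k hk.1 hk.2
        exact eq_of_modEq_of_lt (Int.ModEq.add_right_cancel' _ k4) (by omega) (by omega) (by omega)
          (by omega)
  surj j hj := by
    have hd := H.hd
    have hM := H.two_pow_eq
    have d1 := four_dvd_len (by omega) H.he (p := 1) (by omega) (by omega)
    have d2 := four_dvd_len (by omega) H.he (p := 2) (by omega) (by omega)
    have d3 := four_dvd_len (by omega) H.he (p := 3) (by omega) hd
    have j1 := hj 1 (by omega) (by omega)
    have j2 := hj 2 (by omega) (by omega)
    have j3 := hj 3 (by omega) (by omega)
    have l1 := len_pos (d := d) (e := e) 1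
    have l2 := len_pos (d := d) (e := e) 2
    have l3 := len_pos (d := d) (e := e) 3
    set g : ℤ := (j 2 + j 3) % 2 with hg
    obtain ⟨n, hn⟩ : ∃ n : ℕ, (j 2 - g) % len d e 2 = n :=
      Int.eq_ofNat_of_zero_le (Int.emod_nonneg (j 2 - g) l2.ne')
    have hnlt := Int.emod_lt_of_pos (j 2 - g) l2
    set f : ℤ := ((if n % 4 = 3 then 1 else n % 4 : ℕ) : ℤ) with hf
    set y := (j 1 - g - sgn g * f) % len d e 1 with hy
    have y1 := Int.emod_nonneg (j 1 - g - sgn g * f) l1.ne'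
    have y2 := Int.emod_lt_of_pos (j 1 - g - sgn g * f) l1
    set w := (j 3 - sgn g * (n % 2 : ℕ)) % len d e 3 with hw
    have w1 := Int.emod_nonneg (j 3 - sgn g * (n % 2 : ℕ)) l3.ne'
    have w2 := Int.emod_lt_of_pos (j 3 - sgn g * (n % 2 : ℕ)) l3
    have hpar : (n : ℤ) % 2 = (j 2 - g) % 2 := by
      rw [← hn]
      exact Int.emod_emod_of_dvd _ (dvd_trans (by norm_num) d2)
    have hwpar : w % 2 = 0 := by
      rw [hw, Int.emod_emod_of_dvd _ (dvd_trans (by norm_num) d3 : (2 : ℤ) ∣ _)]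
      rcases (by omega : g = 0 ∨ g = 1) with h | h <;> rw [h] <;> simp [sgn] <;> omega
    refine ⟨⟨⟨y / 2, g, y % 2, fun _ => 0, fun k => if k = 1 then w / 2 else
      if 2 ≤ k ∧ k ≤ d - 2 then (j (k + 2) - (n % 2 : ℕ)) % len d e (k + 2) else 0⟩,
      (H.admissible_iff _).2 ?_⟩, n, ?_, ?_⟩
    · refine ⟨?_, ?_, ?_, fun _ => rfl, ?_, fun k hk hk' => ?_, fun k hk => ?_⟩
      · dsimp only; omega
      · dsimp only; omega
      · dsimp only; omega
      · dsimp only; rw [if_pos rfl]; omega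
      · dsimp only
        rw [if_neg (by omega), if_pos ⟨hk, hk'⟩]
        exact ⟨Int.emod_nonneg _ (len_pos _).ne', Int.emod_lt_of_pos _ (len_pos _)⟩
      · dsimp only
        rw [if_neg (by omega), if_neg (by omega)]
    · zify; push_cast at hM; omega
    · intro p hp1 hp2
      rcases (by omega : p = 1 ∨ p = 2 ∨ p = 3 ∨ 4 ≤ p) with rfl | rfl | rfl | hp
      · simp only [start, if_true]
        rw [← hf, show 2 * (y / 2) + y % 2 + g + sgn g * f = y + (g + sgn g * f) by omega, hy]
        refine ((Int.mod_modEq _ _).add_right _).trans (congrArg (· % _) ?_)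
        ring
      · simp only [start, ite_two, if_true]
        rw [← hn]
        refine ((Int.mod_modEq _ _).add_left _).trans (congrArg (· % _) ?_)
        ring
      · simp only [start, ite_ge le_rfl, if_true]
        rw [show 2 * (w / 2) = w by omega, hw]
        refine ((Int.mod_modEq _ _).add_right _).trans (congrArg (· % _) ?_)
        ring
      · simp only [start, ite_ge (show 3 ≤ p by omega),
          if_neg (show p ≠ 3 by omega), if_neg (show p - 2 ≠ 1 by omega),
          if_pos (show 2 ≤ p - 2 ∧ p - 2 ≤ d - 2 by omega), show p - 2 + 2 = p by omega]
        refine ((Int.mod_modEq _ _).add_right _).trans (congrArg (· % _) ?_)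
        ring

theorem arcMatch₃ (H : Hyp d e α) {P : Param} (hP : Admissible d e α P) {m x : ℕ → ℤ} {c X : ℕ} (hc : c < 2 * d)
    (hm : IsState d c m) (hx : x 2 = X) (hx3 : ∀ k, 3 ≤ k → k ≤ d → x k = 0)
    {n q : ℕ} (hn : n = 4 * X + c / d) (hq : q = c % d) :
    ArcMatch d e (decide (n % 2 = 1)) (start P n) (start P (n + 1)) q
      (start₃ d e α P m x) (step₃ d e α P m x) := by
  have hd := H.hd
  obtain ⟨hl, hγ, ht, hp0, hs1, hs, hoff⟩ := (H.admissible_iff _).1 hP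
  refine ArcMatch.of_eq fun p hp hpd => ?_
  have m1 := state_one (by omega) hm
  have m2 := state_two (by omega) hm
  have md := state_ge hm hd le_rfl
  have a1 := allOne_state (by omega) hm
  have a0 := allZero_state (by omega) hc hm
  have e1 := H.A₁_eq
  have e2 := H.A₂_eq
  have e3 := H.A_three
  have e6 := η_of_le hd
  obtain ⟨f, f1, f2, f3, f4, f5, hf⟩ : ∃ f : ℕ, n % 2 = f ∧ n % 4 = f ∧ (n + 1) % 4 = f + 1 ∧
      (n + 1) % 2 = 1 - f ∧ (n : ℤ) = 4 * X + f ∧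
      ((f = 0 ∧ c < d ∧ q = c) ∨ (f = 1 ∧ d ≤ c ∧ q = c - d)) := by
    rcases div_mod_state hc with ⟨g1, g2, g3⟩ | ⟨g1, g2, g3⟩
    · exact ⟨0, by omega, by omega, by omega, by omega, by push_cast; omega,
        Or.inl ⟨rfl, g1, by omega⟩⟩
    · exact ⟨1, by omega, by omega, by omega, by omega, by push_cast; omega,
        Or.inr ⟨rfl, g1, by omega⟩⟩
  rcases (by omega : p = 1 ∨ p = 2 ∨ p = 3 ∨ 4 ≤ p) with rfl | rfl | rfl | h4
  · simp only [start₃, step₃, if_true, E₃, F₃, e1, e2, e3, e6, m1, m2, md, a1, mix, start, f1, f2, f3]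
    rcases stateAt_cases d c 0 with ⟨v0, w0⟩ | ⟨v0, w0⟩ <;> rcases stateAt_cases d c 1 with ⟨v1, w1⟩ | ⟨v1, w1⟩ <;>
    rcases stateAt_cases d c (d - 1) with ⟨vd, wd⟩ | ⟨vd, wd⟩ <;> rcases hf with ⟨rfl, hf⟩ | ⟨rfl, hf⟩ <;> try omega
    all_goals
      rw [v0, v1, vd]
      rcases hγ with hγ | hγ <;> simp [hγ, sgn, place] <;> (try split_ifs) <;> omega
  · have e5 := H.ηα_eq (k := 2) (by omega) (by omega)
    simp only [start₃, step₃, if_true, ite_two, E₃, F₃, e1, e2, e5, e6, m1, m2, md,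
      a0, a1, mix, start, f1, hx]
    rcases stateAt_cases d c 0 with ⟨v0, w0⟩ | ⟨v0, w0⟩ <;> rcases stateAt_cases d c 1 with ⟨v1, w1⟩ | ⟨v1, w1⟩ <;>
    rcases stateAt_cases d c (d - 1) with ⟨vd, wd⟩ | ⟨vd, wd⟩ <;> rcases hf with ⟨rfl, hf⟩ | ⟨rfl, hf⟩ <;> try omega
    all_goals
      rw [v0, v1, vd]
      simp [place, f5]; (try split_ifs) <;> omega
  · have e4 := H.A_ge (le_refl 4) (by omega)
    have e5 := H.ηα_eq (k := 2) (by omega) (by omega)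
    have m3 := state_ge hm (le_refl 3) hd
    simp only [start₃, step₃, if_true, ite_ge le_rfl,
      E₃, F₃, e1, e4, e5, e6, m1, m3, hp0, mix, start, f1, f4, hx3 3 le_rfl hd]
    rcases stateAt_cases d c 2 with ⟨v2, w2⟩ | ⟨v2, w2⟩ <;> rcases stateAt_cases d c 1 with ⟨v1, w1⟩ | ⟨v1, w1⟩ <;>
    rcases hf with ⟨rfl, hf⟩ | ⟨rfl, hf⟩ <;> try omega
    all_goals
      rw [v2, v1]
      rcases hγ with hγ | hγ <;> simp [hγ, sgn, place] <;> (try split_ifs) <;> omega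
  · have e4 := H.A_ge (k := p + 1) (by omega) (by omega)
    have e5 := H.ηα_eq (k := p - 1) (by omega) (by omega)
    have m3 := state_ge hm (k := p - 1) (by omega) (by omega)
    have m4 := state_ge hm (k := p) (by omega) (by omega)
    have hpl : place (decide (f = 1)) p = p - 1 := place_ge (by omega)
    simp only [start₃, step₃, ite_ge (show 3 ≤ p by omega),
      if_neg (show p ≠ 3 by omega), e4, e5, m3, m4, hp0, mix, start, f1, f4, hx3 p (by omega) hpd, hpl]
    rcases stateAt_cases d c (p - 1 - 1) with ⟨v2, w2⟩ | ⟨v2, w2⟩ <;> rcases stateAt_cases d c (p - 1) with ⟨v1, w1⟩ | ⟨v1, w1⟩ <;>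
    rcases hf with ⟨rfl, hf⟩ | ⟨rfl, hf⟩ <;> try omega
    all_goals
      rw [v2, v1]
      simp [sgn]; omega

theorem arcMatch₄ (H : Hyp d e α) {P : Param} (hP : Admissible d e α P) {m x : ℕ → ℤ} {c X : ℕ} (hc : c < 2 * d)
    (hm : IsState d c m) (hx : x 2 = X)
    {n q : ℕ} (hn : n = 4 * X + 2 + c / d) (hq : q = c % d) :
    ArcMatch d e (decide (n % 2 = 1)) (start P n) (start P (n + 1)) q
      (start₄ d e α P m x) (step₄ d e α P m) := by
  have hd := H.hd
  obtain ⟨hl, hγ, ht, hp0, hs1, hs, hoff⟩ := (H.admissible_iff _).1 hP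
  refine ArcMatch.of_eq fun p hp hpd => ?_
  have m1 := state_one (by omega) hm
  have m2 := state_two (by omega) hm
  have md := state_ge hm hd le_rfl
  have a1 := allOne_state (by omega) hm
  have a0 := allZero_state (by omega) hc hm
  have e1 := H.A₁_eq
  have e3 := H.A_three
  have e6 := η_of_le hd
  obtain ⟨f, f1, f2, f3, f4, f5, hf⟩ : ∃ f : ℕ, n % 2 = f ∧ n % 4 = f + 2 ∧ (n + 1) % 4 = 3 - 3 * f ∧
      (n + 1) % 2 = 1 - f ∧ (n : ℤ) = 4 * X + 2 + f ∧
      ((f = 0 ∧ c < d ∧ q = c) ∨ (f = 1 ∧ d ≤ c ∧ q = c - d)) := by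
    rcases div_mod_state hc with ⟨g1, g2, g3⟩ | ⟨g1, g2, g3⟩
    · exact ⟨0, by omega, by omega, by omega, by omega, by push_cast; omega,
        Or.inl ⟨rfl, g1, by omega⟩⟩
    · exact ⟨1, by omega, by omega, by omega, by omega, by push_cast; omega,
        Or.inr ⟨rfl, g1, by omega⟩⟩
  rcases (by omega : p = 1 ∨ p = 2 ∨ p = 3 ∨ 4 ≤ p) with rfl | rfl | rfl | h4
  · simp only [start₄, step₄, if_true, G₄, e1, e3, e6, m1, m2, md, a1, mix, start, f1, f2, f3]
    rcases stateAt_cases d c 0 with ⟨v0, w0⟩ | ⟨v0, w0⟩ <;> rcases stateAt_cases d c 1 with ⟨v1, w1⟩ | ⟨v1, w1⟩ <;>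
    rcases stateAt_cases d c (d - 1) with ⟨vd, wd⟩ | ⟨vd, wd⟩ <;> rcases hf with ⟨rfl, hf⟩ | ⟨rfl, hf⟩ <;> try omega
    all_goals
      rw [v0, v1, vd]
      rcases hγ with hγ | hγ <;> simp [hγ, sgn, place] <;> (try split_ifs) <;> omega
  · simp only [start₄, step₄, if_true, ite_two, e1, e6, m1, m2, md,
      a0, a1, mix, start, f1, hx]
    rcases stateAt_cases d c 0 with ⟨v0, w0⟩ | ⟨v0, w0⟩ <;> rcases stateAt_cases d c 1 with ⟨v1, w1⟩ | ⟨v1, w1⟩ <;>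
    rcases stateAt_cases d c (d - 1) with ⟨vd, wd⟩ | ⟨vd, wd⟩ <;> rcases hf with ⟨rfl, hf⟩ | ⟨rfl, hf⟩ <;> try omega
    all_goals
      rw [v0, v1, vd]
      simp [place, f5, sgn] <;> (try split_ifs) <;> omega
  · have m3 := state_ge hm (le_refl 3) hd
    simp only [start₄, step₄, if_true, ite_ge le_rfl,
      e1, e6, m1, m3, mix, start, f1, f4]
    rcases stateAt_cases d c 2 with ⟨v2, w2⟩ | ⟨v2, w2⟩ <;> rcases stateAt_cases d c 1 with ⟨v1, w1⟩ | ⟨v1, w1⟩ <;>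
    rcases hf with ⟨rfl, hf⟩ | ⟨rfl, hf⟩ <;> try omega
    all_goals
      rw [v2, v1]
      rcases hγ with hγ | hγ <;> simp [hγ, sgn, place] <;> (try split_ifs) <;> omega
  · have m3 := state_ge hm (k := p - 1) (by omega) (by omega)
    have m4 := state_ge hm (k := p) (by omega) (by omega)
    have hpl : place (decide (f = 1)) p = p - 1 := place_ge (by omega)
    simp only [start₄, step₄, ite_ge (show 3 ≤ p by omega),
      if_neg (show p ≠ 3 by omega), m3, m4, e1, mix, start, f1, f4, hpl]
    rcases stateAt_cases d c (p - 1 - 1) with ⟨v2, w2⟩ | ⟨v2, w2⟩ <;> rcases stateAt_cases d c (p - 1) with ⟨v1, w1⟩ | ⟨v1, w1⟩ <;>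
    rcases hf with ⟨rfl, hf⟩ | ⟨rfl, hf⟩ <;> omega

theorem isCycleDecomposition (H : Hyp d e α) : Decomposes d e α := by
  have hd := H.hd
  have h4 := H.four_dvd_two_pow
  have hM := H.two_pow_eq
  have hpos : 0 < 2 ^ α := by positivity
  have hE : ∀ P : Index d e α, edges d e α P.1 =
      ((stageData H).toPassFamily (by omega)).edgesOf P := by
    intro P
    have hr2 : ∀ x, Range₂ d e α x ↔ 0 ≤ x 2 ∧ 4 * x 2 < (2 ^ α : ℕ) := by
      intro x
      rw [hM, Range₂, H.A₂_eq, len_two]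
      have := four_dvd_z (e := e) (H.he d (by omega) le_rfl)
      simp only [Int.toNat_zero, pow_zero, mul_one]
      omega
    refine PassData.edges_eq _ _ P P.1 ?_ ?_
    · rintro j δ ⟨m, x, hm, hx, h⟩
      obtain ⟨c, hc, hm⟩ := (isMove_iff (by omega) m).1 hm
      have hx := (hr2 x).1 hx
      obtain ⟨X, hX⟩ := Int.eq_ofNat_of_zero_le hx.1
      have hcd := div_mod_state hc
      have hA₁ := H.A₁_eq
      rcases h with ⟨h, _⟩ | ⟨h, _⟩ | ⟨h3, rfl, rfl⟩ | ⟨_, rfl, rfl⟩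
      · omega
      · omega
      · refine ⟨4 * X + c / d, by omega, c % d, Nat.mod_lt _ (by omega), ?_⟩
        refine arcMatch₃ H P.2 hc hm hX (fun k hk hk' => ?_) rfl rfl
        have := h3 k hk hk'
        rw [H.A_ge (by omega) (by omega)] at this
        omega
      · exact ⟨4 * X + 2 + c / d, by omega, c % d, Nat.mod_lt _ (by omega),
          arcMatch₄ H P.2 hc hm hX rfl rfl⟩
    · intro n hn q hq
      set c := n % 2 * d + q with hc
      have hn2 : n % 2 = 0 ∨ n % 2 = 1 := by omega
      have hcd : c / d = n % 2 := by
        rw [hc, mul_comm, Nat.mul_add_div (by omega), Nat.div_eq_of_lt hq, add_zero]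
      have hcm : c % d = q := by rw [hc, mul_comm, Nat.mul_add_mod, Nat.mod_eq_of_lt hq]
      have hc2 : c < 2 * d := by rcases hn2 with h | h <;> rw [hc, h] <;> omega
      have hmove := isMove_stateAt (by omega) hc2
      let x : ℕ → ℤ := fun k => if k = 2 then (n / 4 : ℕ) else 0
      have hx2 : x 2 = (n / 4 : ℕ) := rfl
      have hx3 : ∀ k, 3 ≤ k → k ≤ d → x k = 0 := fun k hk _ => if_neg (by omega)
      have hx : Range₂ d e α x := (hr2 x).2 (by rw [hx2]; omega)
      rcases (by omega : n = 4 * (n / 4) + n % 2 ∨ n = 4 * (n / 4) + 2 + n % 2) with h | h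
      · refine ⟨_, _, ⟨_, x, hmove, hx, Or.inr (Or.inr (Or.inl ⟨fun k hk hk' => ?_, rfl, rfl⟩))⟩,
          arcMatch₃ H P.2 hc2 (fun _ _ _ => rfl) hx2 hx3 (by rw [hcd]; exact h) hcm.symm⟩
        rw [hx3 k hk hk', H.A_ge (by omega) (by omega)]
        omega
      · exact ⟨_, _, ⟨_, x, hmove, hx, Or.inr (Or.inr (Or.inr ⟨H.A₂_eq, rfl, rfl⟩))⟩,
          arcMatch₄ H P.2 hc2 (fun _ _ _ => rfl) hx2 (by rw [hcd]; exact h) hcm.symm⟩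
  have := (stageData H).isCycleDecomposition (by omega) (by omega) H.he
    (fun n n' h => by simp only [stageData, h]) (fun h => by omega)
  simp only [Decomposes, hE]
  exact this

end

end Short

/-! ### Cycles of medium length: `e d < α < level 2`, at least three factors -/

namespace Medium

section

variable {d : ℕ} {e : ℕ → ℕ} {α : ℕ}

/-- The parameter `A₃` as a natural number. -/
def wid (d : ℕ) (e : ℕ → ℕ) (α : ℕ) : ℕ := 2 ^ (α - e d + 1)

/-- The relative second coordinate of the start of the `i`-th pass in a period. -/
def lift (B i : ℕ) : ℤ :=
  if i = 0 then 0 else if i ≤ B then (if i % 2 = 1 then 1 else 2) else if i % 2 = 1 then 3 else 4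

/-- The start of the `i`-th pass in the period `X`. -/
def node (B : ℕ) (P : Param) (X i p : ℕ) : ℤ :=
  if p = 1 then P.l * B + (if i ≤ B then (i : ℤ) else 2 * B - i)
  else if p = 2 then P.γ + P.s 1 + 4 * X + lift B i
  else P.s (p - 2) + (i % 2 : ℕ)

/-- The start of the `n`-th pass. -/
def start (B : ℕ) (P : Param) (n p : ℕ) : ℤ := node B P (n / (2 * B)) (n % (2 * B)) p

local notation "W" => wid d e α

theorem start_add {B : ℕ} (hB : 0 < B) (P : Param) (X : ℕ) {i : ℕ} (hi : i ≤ 2 * B) :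
    start B P (2 * B * X + i) = node B P X i := by
  funext p
  rcases hi.lt_or_eq with hi | rfl
  · rw [start, Nat.mul_add_div (by omega), Nat.div_eq_of_lt hi, Nat.mul_add_mod,
      Nat.mod_eq_of_lt hi, add_zero]
  · rw [start, ← Nat.mul_succ, Nat.mul_div_cancel_left _ (by omega), Nat.mul_mod_right]
    simp only [node, lift, Nat.succ_eq_add_one]
    split_ifs <;> push_cast <;> omega

structure Hyp (d : ℕ) (e : ℕ → ℕ) (α : ℕ) : Prop where
  hd : 3 ≤ d
  he : ∀ k, 1 ≤ k → k ≤ d → 2 ≤ e k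
  lo : e d < α
  hi : (α : ℤ) < level d e 2

namespace Hyp

theorem lt_level (H : Hyp d e α) {k : ℕ} (hk : 2 ≤ k) (hkd : k ≤ d) : (α : ℤ) < level d e k := by
  have h := level_mono H.he (by omega) hk hkd
  have := H.hi
  push_cast at h
  omega

theorem A₁_eq (H : Hyp d e α) : A₁ d e α = 1 := ηα_eq_one (by rw [level_one]; exact_mod_cast H.lo)

theorem A₂_eq (H : Hyp d e α) : A₂ d e α = 0 := A₂_eq_zero H.hi

theorem ηα_eq (H : Hyp d e α) {k : ℕ} (hk : 2 ≤ k) (hkd : k ≤ d) : ηα d e α k = 0 :=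
  ηα_eq_zero (H.lt_level hk hkd).le

theorem A_ge (H : Hyp d e α) {k : ℕ} (hk : 4 ≤ k) (hkd : k ≤ d + 1) : A d e α k = 1 :=
  A_eq_one_of_le H.he hk hkd (H.lt_level (by omega) (by omega)).le

theorem A_three (H : Hyp d e α) : A d e α 3 = W := by
  have := H.lo
  simp only [A, H.A₂_eq, level_one, wid, if_true]
  push_cast
  congr 1
  omega

theorem α_le (H : Hyp d e α) : α + 2 ≤ e d + e 1 := by
  have h := H.hi
  rw [level_succ le_rfl, level_one] at h
  omega

theorem wid_dvd (H : Hyp d e α) : 2 * (W : ℤ) ∣ len d e 1 := by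
  have := H.α_le
  have := H.lo
  rw [len_one, z, wid]
  push_cast
  rw [← pow_succ']
  exact pow_dvd_pow _ (by omega)

theorem wid_four (H : Hyp d e α) : 4 ∣ W := by
  have := H.lo
  exact pow_dvd_pow 2 (by omega : 2 ≤ α - e d + 1)

theorem wid_pos (_H : Hyp d e α) : 0 < W := by unfold wid; positivity

theorem two_pow_eq (H : Hyp d e α) : ∃ Y, 2 ^ α = 2 * W * Y ∧ len d e 2 = 4 * (Y : ℤ) := by
  have := H.lo
  have := H.he d (by have := H.hd; omega) le_rfl
  refine ⟨2 ^ (e d - 2), ?_, ?_⟩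
  · rw [wid, ← pow_succ', ← pow_add]
    congr 1
    omega
  · push_cast
    rw [len_two, z, show (4 : ℤ) = 2 ^ 2 by norm_num]
    rw [← pow_add]
    congr 1
    omega

theorem admissible_iff (H : Hyp d e α) (P : Param) : Admissible d e α P ↔
      (0 ≤ P.l ∧ P.l < len d e 1 / W) ∧ (P.γ = 0 ∨ P.γ = 1) ∧ P.t = 0 ∧
      (∀ k, P.p k = 0) ∧
      (∀ k, 1 ≤ k → k ≤ d - 2 → 0 ≤ P.s k ∧ P.s k < len d e (k + 2)) ∧
      (∀ k, k < 1 ∨ d - 2 < k → P.s k = 0) := by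
  have hd := H.hd
  unfold Admissible
  rw [H.A₁_eq, H.A_three, η_of_le H.hd, H.A_ge (le_refl 4) (by omega),
    H.ηα_eq (k := 2) (by omega) (by omega), len_one]
  simp only [sub_self, mul_one, zero_add, Int.toNat_zero, pow_zero, Int.ediv_one]
  constructor
  · rintro ⟨hl, hγ, ht, hp, hs1, hs, hoff⟩
    refine ⟨by omega, by omega, by omega, fun k => ?_, fun k hk hk' => ?_,
      fun k hk => (hoff k hk).2⟩
    · by_cases hk : 1 ≤ k ∧ k ≤ d - 2
      · have := hp k hk.1 hk.2
        rw [H.ηα_eq (by omega) (by omega)] at this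
        simp at this
        omega
      · exact (hoff k (by omega)).1
    · rw [len_ge (by omega)]
      rcases hk.lt_or_eq with hk1 | rfl
      · have := hs k hk1 hk'
        rw [H.A_ge (by omega) (by omega), H.ηα_eq (by omega) (by omega)] at this
        simp only [Int.toNat_zero, pow_zero, mul_one, Int.ediv_one] at this
        simp only [Nat.reduceSubDiff]
        omega
      · have := hs1 (by omega)
        change 0 ≤ P.s 1 ∧ P.s 1 < z e 2
        omega
  · rintro ⟨hl, hγ, ht, hp, hs, hoff⟩
    refine ⟨by omega, by omega, by omega, fun k hk hk' => ?_, fun _ => ?_, fun k hk hk' => ?_,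
      fun k hk => ⟨hp k, hoff k hk⟩⟩
    · rw [hp k, H.ηα_eq (by omega) (by omega)]
      simp
    · have := hs 1 le_rfl (by omega)
      rw [len_ge (by omega)] at this
      change 0 ≤ P.s 1 ∧ P.s 1 < z e 2 at this
      omega
    · have := hs k (by omega) hk'
      rw [H.A_ge (by omega) (by omega), H.ηα_eq (by omega) (by omega)]
      rw [len_ge (by omega)] at this
      simp only [Int.toNat_zero, pow_zero, mul_one, Int.ediv_one]
      simp only [Nat.reduceSubDiff] at this
      omega

end Hyp

/-- The sign of a step at the vertex `j`. -/
def sign (B p : ℕ) (j : ℕ → ℤ) : Bool :=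
  if p = 1 then decide ((j 2 - j 3) % 4 = 1 ∨ (j 2 - j 3) % 4 = 2)
  else if p = 2 then decide (j 1 % B = 0 ∨ j 1 % 2 = 1)
  else decide (j 1 % 2 = 1)

theorem emod_sub_emod_four {x y N N' : ℤ} (h : 4 ∣ N) (h' : 4 ∣ N') :
    (x % N - y % N') % 4 = (x - y) % 4 := by
  rw [Int.sub_emod, Int.emod_emod_of_dvd _ h, Int.emod_emod_of_dvd _ h', ← Int.sub_emod]

theorem exists_pass {B n : ℕ} (hB : 0 < B) : ∃ X i, n = 2 * B * X + i ∧ i < 2 * B :=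
  ⟨n / (2 * B), n % (2 * B), (Nat.div_add_mod _ _).symm, Nat.mod_lt _ (by omega)⟩

theorem node_emod {B : ℕ} (P : Param) (X i : ℕ) :
    node B P X i 1 % B = (if i ≤ B then (i : ℤ) else 2 * B - i) % B := by
  simp only [node, if_true]
  exact Int.mul_add_emod_self_right _ _ _

theorem step_eq (H : Hyp d e α) {P : Param} (hP : Admissible d e α P) (n : ℕ) {p : ℕ} (h1 : 1 ≤ p)
    (h2 : p ≤ d) : start W P (n + 1) p = start W P n p +
      (if sign W p fun r => mix false (start W P n) (start W P (n + 1))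
        (place false p) r % len d e r then 1 else -1) := by
  have hd := H.hd
  obtain ⟨_, hγ, -⟩ := (H.admissible_iff P).1 hP
  have d1 := four_dvd_len (by omega) H.he (p := 1) (by omega) (by omega)
  have d2 := four_dvd_len (by omega) H.he (p := 2) (by omega) (by omega)
  have d3 := four_dvd_len (by omega) H.he (p := 3) (by omega) hd
  have hB4 := H.wid_four
  have hB := H.wid_pos
  have hBd : (W : ℤ) ∣ len d e 1 := dvd_trans (Dvd.intro_left _ rfl) H.wid_dvd
  generalize W = B at *
  have e1 := fun x : ℤ => Int.emod_emod_of_dvd x hBd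
  have e2 := fun x : ℤ => Int.emod_emod_of_dvd x (dvd_trans (by norm_num) d1 : (2 : ℤ) ∣ _)
  obtain ⟨X, i, rfl, hi⟩ := exists_pass (n := n) hB
  rw [add_assoc, start_add hB P X (show i + 1 ≤ _ by omega), start_add hB P X hi.le]
  obtain ⟨b, rfl⟩ := hB4
  rcases (by omega : p = 1 ∨ p = 2 ∨ 3 ≤ p) with rfl | rfl | hp
  · simp only [sign, mix, place, emod_sub_emod_four d2 d3]
    simp [node, lift]
    split_ifs <;> omega
  · have hBm : node (4 * b) P X i 1 % ((4 * b : ℕ) : ℤ) = 0 ↔ i = 0 ∨ i = 4 * b := by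
      rw [node_emod]
      constructor
      · intro h
        split_ifs at h with h3
        · by_contra h4
          rw [Int.emod_eq_of_lt (by omega) (by omega)] at h
          omega
        · rw [Int.emod_eq_of_lt (by omega) (by omega)] at h
          omega
      · rintro (rfl | rfl) <;> simp
    have hB2 : node (4 * b) P X i 1 % 2 = i % 2 := by
      simp only [node, if_true]
      rw [show P.l * ((4 * b : ℕ) : ℤ) = 2 * (P.l * (2 * b)) by push_cast; ring]
      split_ifs <;> omega
    have hs : (if sign (4 * b) 2 fun r => mix false (node (4 * b) P X i) (node (4 * b) P X (i + 1))
        (place false 2) r % len d e r then (1 : ℤ) else -1) =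
        if (i = 0 ∨ i = 4 * b) ∨ (i : ℤ) % 2 = 1 then 1 else -1 := by
      simp only [sign, mix, place]
      simp only [if_true, ite_two, Bool.false_eq_true, if_false,
        if_neg (show ¬ 1 < 0 by omega), e1, e2, hB2, hBm, decide_eq_true_eq]
    rw [hs]
    simp [node, lift]
    split_ifs <;> omega
  · have hB2 : node (4 * b) P X (i + 1) 1 % 2 = (i + 1) % 2 := by
      simp only [node, if_true]
      rw [show P.l * ((4 * b : ℕ) : ℤ) = 2 * (P.l * (2 * b)) by push_cast; ring]
      split_ifs <;> omega
    have hpl := place_ge (f := false) (p := p) (by omega)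
    have hp1 : place false 1 = 1 := rfl
    simp only [sign, mix, hpl, hp1, ite_ge hp,
      if_pos (show 1 < p - 1 by omega), e2, hB2]
    simp only [node, ite_ge hp, decide_eq_true_eq]
    split_ifs <;> omega

theorem start_inj (H : Hyp d e α) {P P' : Param} (hP : Admissible d e α P)
    (hP' : Admissible d e α P') {n n' : ℕ} (hn : n < 2 ^ α) (hn' : n' < 2 ^ α)
    (h : ∀ p, 1 ≤ p → p ≤ d → start W P n p ≡ start W P' n' p [ZMOD len d e p]) :
    P = P' ∧ n = n' := by
  have hd := H.hd
  obtain ⟨hl, hγ, ht, hp, hs, hoff⟩ := (H.admissible_iff P).1 hP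
  obtain ⟨hl', hγ', ht', hp', hs', hoff'⟩ := (H.admissible_iff P').1 hP'
  obtain ⟨Y, hY, hY2⟩ := H.two_pow_eq
  rw [hY] at hn hn'
  have d1 := four_dvd_len (by omega) H.he (p := 1) (by omega) (by omega)
  have hB4 := H.wid_four
  have hB := H.wid_pos
  have hBd : (W : ℤ) ∣ len d e 1 := dvd_trans (Dvd.intro_left _ rfl) H.wid_dvd
  generalize W = B at *
  obtain ⟨X, i, rfl, hi⟩ := exists_pass (n := n) hB
  obtain ⟨X', i', rfl, hi'⟩ := exists_pass (n := n') hB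
  rw [start_add hB P X hi.le, start_add hB P' X' hi'.le] at h
  have hX : X < Y := Nat.lt_of_mul_lt_mul_left (a := 2 * B) (by omega)
  have hX' : X' < Y := Nat.lt_of_mul_lt_mul_left (a := 2 * B) (by omega)
  have k1 := h 1 (by omega) (by omega)
  have k2 := h 2 (by omega) (by omega)
  obtain ⟨b, rfl⟩ := hB4
  have hpar : i % 2 = i' % 2 := by
    have := k1.of_dvd (dvd_trans (by norm_num) d1 : (2 : ℤ) ∣ _)
    simp only [node, if_true] at this
    rw [show P.l * ((4 * b : ℕ) : ℤ) = 2 * (P.l * (2 * b)) by push_cast; ring,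
      show P'.l * ((4 * b : ℕ) : ℤ) = 2 * (P'.l * (2 * b)) by push_cast; ring, Int.ModEq] at this
    split_ifs at this <;> omega
  have hss : P.s = P'.s := by
    funext k
    rcases (by omega : (k < 1 ∨ d - 2 < k) ∨ (1 ≤ k ∧ k ≤ d - 2)) with hk | hk
    · rw [hoff k hk, hoff' k hk]
    · have k4 := h (k + 2) (by omega) (by omega)
      simp only [node, ite_ge (show 3 ≤ k + 2 by omega),
        hpar] at k4
      have := hs k hk.1 hk.2
      have := hs' k hk.1 hk.2
      exact eq_of_modEq_of_lt (Int.ModEq.add_right_cancel' _ k4) (by omega) (by omega) (by omega)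
        (by omega)
  simp only [node, if_true, ite_two, hss] at k2
  have k2' : P.γ + 4 * (X : ℤ) + lift (4 * b) i ≡ P'.γ + 4 * (X' : ℤ) + lift (4 * b) i'
      [ZMOD len d e 2] := by
    refine Int.ModEq.add_left_cancel' (P'.s 1) ?_
    convert k2 using 1 <;> ring
  have k24 := k2'.of_dvd (hY2 ▸ Dvd.intro _ rfl : (4 : ℤ) ∣ _)
  have hγγ : P.γ = P'.γ := by
    unfold Int.ModEq lift at k24
    split_ifs at k24 <;> omega
  have kB := k1.of_dvd hBd
  rw [Int.ModEq, node_emod, node_emod] at kB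
  have hii : i = i' := by
    have k3 : lift (4 * b) i ≡ lift (4 * b) i' [ZMOD 4] := by
      rw [hγγ] at k24
      unfold Int.ModEq at k24 ⊢
      omega
    obtain ⟨r, hr⟩ := Int.ModEq.dvd kB
    have hb : (0 : ℤ) < (4 * b : ℕ) := by exact_mod_cast hB
    have hr1 : r ≤ 1 := by
      by_contra hr1
      have : ((4 * b : ℕ) : ℤ) * 2 ≤ (4 * b : ℕ) * r := by
        exact mul_le_mul_of_nonneg_left (by omega) hb.le
      split_ifs at hr <;> omega
    have hr2 : -1 ≤ r := by
      by_contra hr1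
      have : ((4 * b : ℕ) : ℤ) * r ≤ (4 * b : ℕ) * (-2) := by
        exact mul_le_mul_of_nonneg_left (by omega) hb.le
      split_ifs at hr <;> omega
    unfold Int.ModEq lift at k3
    rcases (by omega : r = -1 ∨ r = 0 ∨ r = 1) with rfl | rfl | rfl <;>
    split_ifs at hr k3 <;> omega
  subst hii
  have hXX : X = X' := by
    have := eq_of_modEq_of_lt (x := 4 * (X : ℤ)) (y := 4 * (X' : ℤ)) (N := len d e 2)
      (by
        refine Int.ModEq.add_left_cancel' P'.γ (Int.ModEq.add_right_cancel' (lift (4 * b) i) ?_)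
        rw [← hγγ]; rw [← hγγ] at k2'; exact k2')
      (by omega) (by omega) (by omega) (by omega)
    omega
  subst hXX
  refine ⟨Param.ext' ?_ hγγ (by rw [ht, ht']) (by funext k; rw [hp, hp']) hss, rfl⟩
  simp only [node, if_true] at k1
  obtain ⟨Z, hZ⟩ := hBd
  rw [hZ, Int.mul_ediv_cancel_left _ (by omega)] at hl hl'
  have k5 := Int.ModEq.add_right_cancel' _ k1
  rw [hZ, mul_comm P.l, mul_comm P'.l] at k5
  exact eq_of_modEq_of_lt (Int.ModEq.mul_left_cancel' (by omega) k5) (by omega) (by omega) (by omega)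
    (by omega)

theorem start_surj (H : Hyp d e α) {j : ℕ → ℤ}
    (hj : ∀ p, 1 ≤ p → p ≤ d → 0 ≤ j p ∧ j p < len d e p) :
    ∃ P, Admissible d e α P ∧ ∃ n < 2 ^ α, ∀ p, 1 ≤ p → p ≤ d →
      start W P n p ≡ j p [ZMOD len d e p] := by
  have hd := H.hd
  obtain ⟨Y, hY, hY2⟩ := H.two_pow_eq
  have d1 := four_dvd_len (by omega) H.he (p := 1) (by omega) (by omega)
  have hB4 := H.wid_four
  have hB := H.wid_pos
  have hBd : (W : ℤ) ∣ len d e 1 := dvd_trans (Dvd.intro_left _ rfl) H.wid_dvd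
  have hadm := H.admissible_iff
  generalize W = B at *
  obtain ⟨Z, hZ⟩ := hBd
  obtain ⟨b, rfl⟩ := hB4
  have j1 := hj 1 (by omega) (by omega)
  have l1 := len_pos (d := d) (e := e) 1
  have l2 := len_pos (d := d) (e := e) 2
  set s : ℕ → ℤ := fun k => if 1 ≤ k ∧ k ≤ d - 2 then (j (k + 2) - j 1 % 2) % len d e (k + 2) else 0
    with hs
  set g := (j 2 - s 1 - j 1 % 2) % 2 with hg
  set y := (j 2 - s 1 - g) % len d e 2 with hy
  have y0 := Int.emod_nonneg (j 2 - s 1 - g) l2.ne'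
  have y1 := Int.emod_lt_of_pos (j 2 - s 1 - g) l2
  have y2 : y % 2 = j 1 % 2 := by
    rw [hy, Int.emod_emod_of_dvd _ (hY2 ▸ dvd_trans (by norm_num) (Dvd.intro _ rfl) : (2 : ℤ) ∣ _)]
    omega
  obtain ⟨l, hl, X, hX, i, hi, hu, hv, hpar⟩ : ∃ l : ℤ, (0 ≤ l ∧ l < Z) ∧ ∃ X < Y, ∃ i < 2 * (4 * b),
      l * ((4 * b : ℕ) : ℤ) + (if i ≤ 4 * b then (i : ℤ) else 2 * ((4 * b : ℕ) : ℤ) - i) ≡ j 1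
        [ZMOD len d e 1] ∧
      4 * (X : ℤ) + lift (4 * b) i ≡ y [ZMOD len d e 2] ∧ ((i % 2 : ℕ) : ℤ) = j 1 % 2 := by
    have hb : (0 : ℤ) < (4 * b : ℕ) := by exact_mod_cast hB
    have hdiv := Int.mul_ediv_add_emod (j 1) (4 * b : ℕ)
    have r0 := Int.emod_nonneg (j 1) hb.ne'
    have r1 := Int.emod_lt_of_pos (j 1) hb
    have q0 : 0 ≤ j 1 / (4 * b : ℕ) := Int.ediv_nonneg j1.1 hb.le
    have q1 : j 1 / (4 * b : ℕ) < Z := by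
      refine Int.ediv_lt_of_lt_mul hb ?_
      rw [mul_comm, ← hZ]; exact j1.2
    have hZ' := hZ
    generalize j 1 / ((4 * b : ℕ) : ℤ) = q at *
    obtain ⟨r, hr⟩ := Int.eq_ofNat_of_zero_le r0
    rw [hr] at hdiv r0 r1
    obtain ⟨y', hy'⟩ := Int.eq_ofNat_of_zero_le y0
    rw [← hy] at hy' y1
    have hpar : j 1 % 2 = (r : ℤ) % 2 := by
      rw [← hdiv, show ((4 * b : ℕ) : ℤ) * q = 2 * (2 * b * q) by push_cast; ring]
      omega
    have hlen : ∀ x : ℤ, x + len d e 1 ≡ x [ZMOD len d e 1] := fun x => Int.add_modEq_right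
    have hlen2 : ∀ x : ℤ, x + len d e 2 ≡ x [ZMOD len d e 2] := fun x => Int.add_modEq_right
    rcases (by omega : (y' % 4 = 0 ∧ r = 0) ∨ (y' % 4 = 2 ∧ r = 0) ∨
      ((y' % 4 = 1 ∨ y' % 4 = 2) ∧ 0 < r) ∨ y' % 4 = 3 ∨ (y' % 4 = 0 ∧ 0 < r)) with
      h | h | h | h | h
    · refine ⟨q, ⟨q0, q1⟩, y' / 4, by omega, 0, by omega, ?_, ?_, by omega⟩
      · rw [if_pos (by omega), mul_comm]
        exact congrArg (· % _) (by omega)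
      · exact congrArg (· % _) (by simp only [lift, if_true]; omega)
    · by_cases hq : q = 0
      · refine ⟨Z - 1, ⟨by omega, by omega⟩, y' / 4, by omega, 4 * b, by omega, ?_, ?_, by omega⟩
        · rw [if_pos (by omega), sub_mul, mul_comm, ← hZ']
          rw [hq, h.2] at hdiv
          refine Int.ModEq.trans (congrArg (· % _) ?_) (hlen (j 1))
          rw [← hdiv]; simp
        · refine congrArg (· % _) ?_
          rw [lift, if_neg (by omega), if_pos (by omega), if_neg (by omega)]
          omega
      · refine ⟨q - 1, ⟨by omega, by omega⟩, y' / 4, by omega, 4 * b, by omega, ?_, ?_, by omega⟩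
        · rw [if_pos (by omega), sub_mul, mul_comm]
          exact congrArg (· % _) (by omega)
        · refine congrArg (· % _) ?_
          rw [lift, if_neg (by omega), if_pos (by omega), if_neg (by omega)]
          omega
    · refine ⟨q, ⟨q0, q1⟩, y' / 4, by omega, r, by omega, ?_, ?_, by omega⟩
      · rw [if_pos (by omega), mul_comm]
        exact congrArg (· % _) (by omega)
      · refine congrArg (· % _) ?_
        rw [lift, if_neg (by omega), if_pos (by omega)]
        split_ifs <;> omega
    · refine ⟨q, ⟨q0, q1⟩, y' / 4, by omega, 2 * (4 * b) - r, by omega, ?_, ?_, by omega⟩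
      · rw [if_neg (by omega), mul_comm]
        exact congrArg (· % _) (by omega)
      · refine congrArg (· % _) ?_
        rw [lift, if_neg (by omega), if_neg (by omega), if_pos (by omega)]
        omega
    · have hl : lift (4 * b) (2 * (4 * b) - r) = 4 := by
        rw [lift, if_neg (by omega), if_neg (by omega), if_neg (by omega)]
      by_cases hq : y' / 4 = 0
      · refine ⟨q, ⟨q0, q1⟩, Y - 1, by omega, 2 * (4 * b) - r, by omega, ?_, ?_, by omega⟩
        · rw [if_neg (by omega), mul_comm]
          exact congrArg (· % _) (by omega)
        · rw [hl]
          exact Int.ModEq.trans (congrArg (· % _) (by omega)) (hlen2 y)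
      · refine ⟨q, ⟨q0, q1⟩, y' / 4 - 1, by omega, 2 * (4 * b) - r, by omega, ?_, ?_, by omega⟩
        · rw [if_neg (by omega), mul_comm]
          exact congrArg (· % _) (by omega)
        · rw [hl]
          exact congrArg (· % _) (by omega)
  have hsk : ∀ k, 1 ≤ k → k ≤ d - 2 → s k = (j (k + 2) - j 1 % 2) % len d e (k + 2) :=
    fun k h1 h2 => if_pos ⟨h1, h2⟩
  refine ⟨⟨l, g, 0, fun _ => 0, s⟩, (hadm _).2 ⟨?_, ?_, rfl, fun _ => rfl, fun k hk hk' => ?_,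
    fun k hk => if_neg (by omega)⟩, 2 * (4 * b) * X + i, ?_, ?_⟩
  · rw [hZ, Int.mul_ediv_cancel_left _ (by omega)]; exact hl
  · dsimp only; omega
  · dsimp only
    rw [hsk k hk hk']
    exact ⟨Int.emod_nonneg _ (len_pos _).ne', Int.emod_lt_of_pos _ (len_pos _)⟩
  · rw [hY]
    calc 2 * (4 * b) * X + i < 2 * (4 * b) * (X + 1) := by rw [Nat.mul_succ]; omega
      _ ≤ _ := Nat.mul_le_mul_left _ hX
  · rw [start_add hB _ X hi.le]
    intro p hp1 hp2
    rcases (by omega : p = 1 ∨ p = 2 ∨ 3 ≤ p) with rfl | rfl | hp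
    · simpa only [node, if_true] using hu
    · simp only [node, if_true, ite_two]
      have h1 := (hv.trans (Int.mod_modEq _ _)).add_left (g + s 1)
      convert h1 using 1 <;> ring
    · simp only [node, ite_ge hp]
      rw [hsk _ (by omega) (by omega), show p - 2 + 2 = p by omega, hpar]
      refine ((Int.mod_modEq _ _).add_right _).trans (congrArg (· % _) ?_)
      ring

/-- The family of sequences of passes. -/
def stageData (H : Hyp d e α) : StageData d e (Index d e α) (2 ^ α) where
  bz P := start W P.1
  fl _ := false
  flag _ := false
  sg := sign W
  flag_off _ _ _ _ _ _ := rfl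
  sg_off p j j' h1 h2 h := by
    have hd := H.hd
    unfold sign
    split_ifs with hp1 hp2
    · rw [h 2 (by omega) (by omega) (by omega), h 3 (by omega) (by omega) (by omega)]
    · rw [h 1 (by omega) (by omega) (by omega)]
    · rw [h 1 (by omega) (by omega) (by omega)]
  pl_eq _ _ _ _ _ := rfl
  step_eq P n p h1 h2 := congrArg (· % _) (step_eq H P.2 n h1 h2)
  per P n p h1 h2 := by
    obtain ⟨Y, hY, hY2⟩ := H.two_pow_eq
    have hB := H.wid_pos
    obtain ⟨X, i, rfl, hi⟩ := exists_pass (n := n) hB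
    rw [hY, show 2 * W * X + i + 2 * W * Y = 2 * W * (X + Y) + i by ring,
      start_add hB _ _ hi.le, start_add hB _ _ hi.le]
    by_cases hp2 : p = 2
    · subst hp2
      simp only [node, if_true, ite_two]
      rw [hY2]
      push_cast
      exact Int.modEq_iff_dvd.2 ⟨-1, by ring⟩
    · simp only [node, if_neg hp2]
      rfl
  fl_per _ := rfl
  inj P P' n n' hn hn' h := by
    obtain ⟨h1, h2⟩ := start_inj H P.2 P'.2 hn hn' h
    exact ⟨Subtype.ext h1, h2⟩
  surj j hj := by
    obtain ⟨P, hP, n, hn, h⟩ := start_surj H hj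
    exact ⟨⟨P, hP⟩, n, hn, h⟩

theorem lift_zero {B i : ℕ} (h : i = 0) : lift B i = 0 := by simp [lift, h]

theorem lift_odd_le {B i : ℕ} (h : i % 2 = 1) (h' : i ≤ B) : lift B i = 1 := by
  rw [lift, if_neg (by omega), if_pos h', if_pos h]

theorem lift_even_le {B i : ℕ} (h0 : 0 < i) (h : i % 2 = 0) (h' : i ≤ B) : lift B i = 2 := by
  rw [lift, if_neg (by omega), if_pos h', if_neg (by omega)]

theorem lift_odd_gt {B i : ℕ} (h : i % 2 = 1) (h' : B < i) : lift B i = 3 := by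
  rw [lift, if_neg (by omega), if_neg (by omega), if_pos h]

theorem lift_even_gt {B i : ℕ} (h : i % 2 = 0) (h' : B < i) : lift B i = 4 := by
  rw [lift, if_neg (by omega), if_neg (by omega), if_neg (by omega)]

theorem lift_le {B i : ℕ} (h0 : 0 < i) (h : i ≤ B) : lift B i = if i % 2 = 1 then 1 else 2 := by
  rw [lift, if_neg (by omega), if_pos h]

theorem lift_gt {B i : ℕ} (h : B < i) : lift B i = if i % 2 = 1 then 3 else 4 := by
  rw [lift, if_neg (by omega), if_neg (by omega)]

/-- The step before the last one of a pass, in terms of the entries of a move. -/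
theorem last_states {c : ℕ} {m : ℕ → ℤ} (hd : 3 ≤ d)
    (hm : IsState d c m) (f : ℤ → ℤ → ℤ) :
    η d 3 * (1 - η d 4) * f (m 1) (m 3) + η d 4 * f (m (d - 1)) (m d) =
      f (stateAt d c (d - 2)) (stateAt d c (d - 1)) := by
  rw [η_of_le hd]
  rcases hd.lt_or_eq with h | rfl
  · rw [η_of_le h, state_ge hm (k := d - 1) (by omega) (by omega), state_ge hm hd le_rfl,
      show d - 1 - 1 = d - 2 by omega]
    ring
  · rw [η_of_lt (by omega), state_one (by omega) hm, state_ge hm le_rfl le_rfl]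
    ring

theorem Hyp.move_facts (H : Hyp d e α) {m : ℕ → ℤ} {c : ℕ} (hc : c < 2 * d) (hm : IsState d c m) :
    m 1 = stateAt d c 1 ∧ m 2 = stateAt d c 0 ∧ m d = stateAt d c (d - 1) ∧
      (allOne d m = if c = d then 1 else 0) ∧ (allZero d m = if c = 0 then 1 else 0) ∧
      A₁ d e α = 1 ∧ A₂ d e α = 0 ∧ η d 3 = 1 ∧ ∃ b, 0 < b ∧ W = 4 * b ∧
      A d e α 3 = (4 * b : ℕ) := by
  have hd := H.hd
  obtain ⟨b, hb⟩ := H.wid_four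
  have hB := H.wid_pos
  exact ⟨state_one (by omega) hm, state_two (by omega) hm, state_ge hm hd le_rfl,
    allOne_state (by omega) hm, allZero_state (by omega) hc hm, H.A₁_eq, H.A₂_eq, η_of_le hd, b,
    by omega, hb, hb ▸ H.A_three⟩

/-- The pass and the step of the arcs of the first set. -/
abbrev Pos₁ (d c x₁ i q : ℕ) : Prop :=
  (c < d ∧ i = 1 + 2 * x₁ ∧ q = c) ∨ (d ≤ c ∧ i = 2 + 2 * x₁ ∧ q = c - d)

/-- The pass and the step of the arcs of the second set. -/
abbrev Pos₂ (d B c x₁ i q : ℕ) : Prop :=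
  (c + 1 < d ∧ i = B + 2 + 2 * x₁ ∧ q = c + 1) ∨
  (d ≤ c + 1 ∧ c + 1 < 2 * d ∧ i = B + 3 + 2 * x₁ ∧ q = c + 1 - d) ∨
  (c + 1 = 2 * d ∧ 2 * x₁ + 4 < B ∧ i = B + 4 + 2 * x₁ ∧ q = 0) ∨
  (c + 1 = 2 * d ∧ 2 * x₁ + 4 = B ∧ i = B + 1 ∧ q = 0)

/-- The pass and the step of the arcs of the third set. -/
abbrev Pos₃ (d B c i q : ℕ) : Prop := (c < d ∧ i = 0 ∧ q = c) ∨ (d ≤ c ∧ i = B - 1 ∧ q = c - d)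

/-- The pass and the step of the arcs of the fourth set. -/
abbrev Pos₄ (d B c i q : ℕ) : Prop :=
  (c < d ∧ i = B ∧ q = c) ∨ (d ≤ c ∧ c + 1 < 2 * d ∧ i = B + 1 ∧ q = c - d + 1) ∨
  (c + 1 = 2 * d ∧ i = B + 2 ∧ q = 0)

theorem arcMatch₁ (H : Hyp d e α) {P : Param} (hP : Admissible d e α P) {m x : ℕ → ℤ} {c X x₁ : ℕ}
    (hc : c < 2 * d) (hm : IsState d c m) (hx : x 2 = X)
    (hx1 : x 1 = x₁) (hx1' : 2 * x₁ + 4 ≤ W) (hx3 : ∀ k, 3 ≤ k → k ≤ d → x k = 0)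
    {i q : ℕ} (hi : Pos₁ d c x₁ i q) :
    ArcMatch d e false (node W P X i) (node W P X (i + 1)) q
      (start₁ d e α P m x) (step₁ d e α P m) := by
  have hd := H.hd
  obtain ⟨hl, hγ, ht, hp0, -, -⟩ := (H.admissible_iff _).1 hP
  obtain ⟨m1, m2, md, a1, a0, e1, e2, e6, b, hB, hb, e3⟩ := H.move_facts hc hm
  refine ArcMatch.of_eq fun p hp hpd => ?_
  rw [hb] at hx1' ⊢
  rcases (by omega : p = 1 ∨ p = 2 ∨ 3 ≤ p) with rfl | rfl | hp3
  · simp only [start₁, step₁, if_true, e2, e3, e6, m1, m2, md, mix, node, hx1, show place false 1 = 1 from rfl]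
    clear m1 m2 md a0 a1 e1 e2 e3 e6
    rw [if_pos (by omega : i ≤ 4 * b), if_pos (by omega : i + 1 ≤ 4 * b)]
    rcases stateAt_cases d c 0 with ⟨v0, w0⟩ | ⟨v0, w0⟩ <;>
    rcases stateAt_cases d c 1 with ⟨v1, w1⟩ | ⟨v1, w1⟩ <;>
    rcases stateAt_cases d c (d - 1) with ⟨vd, wd⟩ | ⟨vd, wd⟩ <;> try omega
    all_goals
      rw [v0, v1, vd]
      simp [sgn]; (try split_ifs) <;> omega
  · simp only [start₁, step₁, if_true, ite_two, e2, e6, m2, χ, a0, a1, mix, node, hx, show place false 2 = 0 from rfl]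
    clear m1 m2 md a0 a1 e1 e2 e3 e6
    have c0 := stateAt_cases d c 0
    rw [lift_le (by omega) (by omega : i ≤ 4 * b), lift_le (by omega) (by omega : i + 1 ≤ 4 * b)]
    split_ifs <;> omega
  · have e4 := H.A_ge (k := p + 1) (by omega) (by omega)
    have e5 := H.ηα_eq (k := p - 1) (by omega) (by omega)
    have m3 := prev_state (by omega) hm hp3 hpd
    have m4 := state_ge hm hp3 hpd
    have c2 := stateAt_cases d c (p - 2)
    have c3 := stateAt_cases d c (p - 1)
    have hpl := place_ge (f := false) (p := p) (by omega)
    simp only [start₁, step₁, ite_ge hp3, e2,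
      e4, e5, m3, m4, hp0, mix, node, hx3 p (by omega) hpd, hpl]
    clear m1 m2 m3 m4 md a0 a1 e1 e2 e3 e4 e5 e6 hpl
    rcases c2 with ⟨v2, w2⟩ | ⟨v2, w2⟩ <;> rcases c3 with ⟨v1, w1⟩ | ⟨v1, w1⟩
    all_goals
      rw [v2, v1]
      simp [sgn]; (try split_ifs) <;> omega

set_option maxHeartbeats 800000 in
theorem arcMatch₂ (H : Hyp d e α) {P : Param} (hP : Admissible d e α P) {m x : ℕ → ℤ} {c X x₁ : ℕ}
    (hc : c < 2 * d) (hm : IsState d c m) (hx : x 2 = X)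
    (hx1 : x 1 = x₁) (hx1' : 2 * x₁ + 4 ≤ W)
    {i q : ℕ} (hi : Pos₂ d W c x₁ i q) :
    ArcMatch d e false (node W P X i) (node W P X (i + 1)) q
      (start₂ d e α P m x) (step₂ d e α P m x) := by
  have hd := H.hd
  obtain ⟨hl, hγ, ht, hp0, -, -⟩ := (H.admissible_iff _).1 hP
  obtain ⟨m1, m2, md, a1, a0, e1, e2, e6, b, hB, hb, e3⟩ := H.move_facts hc hm
  refine ArcMatch.of_eq fun p hp hpd => ?_
  rw [hb] at hi hx1' ⊢
  have hr : (r₁ d e α m x = 0 ∧ (c + 1 < 2 * d ∨ 2 * x₁ + 4 < 4 * b)) ∨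
      (r₁ d e α m x = 1 ∧ c + 1 = 2 * d ∧ 2 * x₁ + 4 = 4 * b) := by
    have hτ := last_states hd hm fun x y => (1 - x) * y
    have : r₁ d e α m x = ((2 * x 1 + 4) / A d e α 3) *
        ((1 - stateAt d c (d - 2)) * stateAt d c (d - 1)) := by
      rw [← hτ, r₁, e6]
      ring
    rw [this, e3, hx1]
    clear m1 m2 md a0 a1 e1 e2 e3 hτ hi
    rcases hx1'.lt_or_eq with h | h
    · rw [Int.ediv_eq_zero_of_lt (by omega) (by omega)]
      omega
    · rw [show (2 * (x₁ : ℤ) + 4) = (4 * b : ℕ) by omega, Int.ediv_self (by omega)]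
      rcases stateAt_cases d c (d - 1) with ⟨vd, wd⟩ | ⟨vd, wd⟩ <;> rcases stateAt_cases d c (d - 2) with ⟨ve, we⟩ | ⟨ve, we⟩ <;> rw [vd, ve] <;>
        simp <;> omega
  rcases (by omega : p = 1 ∨ p = 2 ∨ 3 ≤ p) with rfl | rfl | hp3
  · have hχ : |χ d m| = if c = 0 ∨ c = d then 1 else 0 := by
      rw [χ, a0, a1]
      split_ifs <;> first | omega | simp
    simp only [start₂, step₂, if_true, e3, e6, m1, m2, md, hχ, mix, node, hx1, show place false 1 = 1 from rfl]
    clear hχ m1 m2 md a0 a1 e1 e2 e3 e6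
    rcases stateAt_cases d c 0 with ⟨v0, w0⟩ | ⟨v0, w0⟩ <;>
    rcases stateAt_cases d c 1 with ⟨v1, w1⟩ | ⟨v1, w1⟩ <;>
    rcases stateAt_cases d c (d - 1) with ⟨vd, wd⟩ | ⟨vd, wd⟩ <;>
    rcases hr with ⟨vr, wr⟩ | ⟨vr, wr⟩ <;> rcases hi with hi | hi | hi | hi <;> try omega
    all_goals
      rw [v0, v1, vd, vr]
      simp [sgn, add_mul]; (try split_ifs) <;> omega
  · have hτ := last_states hd hm fun x y => x - y
    have hδ : step₂ d e α P m x 2 = sgn (r₁ d e α m x) *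
        (stateAt d c (d - 2) - stateAt d c (d - 1)) := by
      rw [← hτ]
      simp only [step₂, if_true, ite_two, e6]
      ring
    rw [hδ]
    simp only [start₂, if_true, ite_two, e6, m1, md, mix, node, hx,
      show place false 2 = 0 from rfl]
    clear hτ hδ m1 m2 md a0 a1 e1 e2 e3 e6
    rw [lift_gt (by omega : 4 * b < i), lift_gt (by omega : 4 * b < i + 1)]
    rcases stateAt_cases d c (d - 1) with ⟨vd, wd⟩ | ⟨vd, wd⟩ <;> rcases stateAt_cases d c (d - 2) with ⟨ve, we⟩ | ⟨ve, we⟩ <;>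
    rcases hr with ⟨vr, wr⟩ | ⟨vr, wr⟩ <;> rcases hi with hi | hi | hi | hi <;> try omega
    all_goals
      rw [vd, ve, vr]
      simp [sgn]; (try split_ifs) <;> omega
  · have m3 := prev_state (by omega) hm hp3 hpd
    have m5 := prev2_state (by omega) hm hp3 hpd
    have c2 := stateAt_cases d c (p - 2)
    have c4 := stateAt_cases d c (p - 3)
    have hpl := place_ge (f := false) (p := p) (by omega)
    simp only [start₂, step₂, ite_ge hp3, m3, m5,
      mix, node, hpl]
    clear m1 m2 m3 m5 md a0 a1 e1 e2 e3 e6 hpl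
    split_ifs <;> omega

theorem arcMatch₃ (H : Hyp d e α) {P : Param} (hP : Admissible d e α P) {m x : ℕ → ℤ} {c X : ℕ}
    (hc : c < 2 * d) (hm : IsState d c m) (hx : x 2 = X)
    (hx3 : ∀ k, 3 ≤ k → k ≤ d → x k = 0)
    {i q : ℕ} (hi : Pos₃ d W c i q) :
    ArcMatch d e false (node W P X i) (node W P X (i + 1)) q
      (start₃ d e α P m x) (step₃ d e α P m x) := by
  have hd := H.hd
  obtain ⟨hl, hγ, ht, hp0, -, -⟩ := (H.admissible_iff _).1 hP
  obtain ⟨m1, m2, md, a1, a0, e1, e2, e6, b, hB, hb, e3⟩ := H.move_facts hc hm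
  refine ArcMatch.of_eq fun p hp hpd => ?_
  rw [hb] at hi ⊢
  have e5 := H.ηα_eq (k := 2) (by omega) (by omega)
  have hR : R₁ d e α x = 1 := by simp [R₁, e5, e6]
  rcases (by omega : p = 1 ∨ p = 2 ∨ 3 ≤ p) with rfl | rfl | hp3
  · simp only [start₃, step₃, if_true, E₃, F₃, e1, e2, e3, e6, m1, m2, md, a1, mix, node, ht, show place false 1 = 1 from rfl]
    clear m1 m2 md a0 a1 e1 e2 e3 e6
    rcases stateAt_cases d c 0 with ⟨v0, w0⟩ | ⟨v0, w0⟩ <;>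
    rcases stateAt_cases d c 1 with ⟨v1, w1⟩ | ⟨v1, w1⟩ <;>
    rcases stateAt_cases d c (d - 1) with ⟨vd, wd⟩ | ⟨vd, wd⟩ <;> try omega
    all_goals
      rw [v0, v1, vd]
      simp [sgn, add_mul]; (try split_ifs) <;> omega
  · simp only [start₃, step₃, if_true, ite_two, E₃, F₃, e1, e2, e5, e6, m1, m2, md,
      a0, a1, mix, node, hx, hR, show place false 2 = 0 from rfl]
    clear m1 m2 md a0 a1 e1 e2 e3 e5 e6 hR
    replace hi : ((c < d ∧ i = 0 ∧ q = c) ∧ lift (4 * b) i = 0 ∧ lift (4 * b) (i + 1) = 1) ∨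
        ((d ≤ c ∧ i = 4 * b - 1 ∧ q = c - d) ∧ lift (4 * b) i = 1 ∧ lift (4 * b) (i + 1) = 2) := by
      rcases hi with h | h
      · exact Or.inl ⟨by omega, lift_zero (by omega), lift_odd_le (by omega) (by omega)⟩
      · exact Or.inr ⟨by omega, lift_odd_le (by omega) (by omega), lift_even_le (by omega) (by omega) (by omega)⟩
    rcases stateAt_cases d c 0 with ⟨v0, w0⟩ | ⟨v0, w0⟩ <;>
    rcases stateAt_cases d c 1 with ⟨v1, w1⟩ | ⟨v1, w1⟩ <;>
    rcases stateAt_cases d c (d - 1) with ⟨vd, wd⟩ | ⟨vd, wd⟩ <;> try omega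
    all_goals
      rw [v0, v1, vd]
      simp [sgn]; (try split_ifs) <;> omega
  · have e4 := H.A_ge (k := p + 1) (by omega) (by omega)
    have e7 := H.ηα_eq (k := p - 1) (by omega) (by omega)
    have m3 := prev_state (by omega) hm hp3 hpd
    have m4 := state_ge hm hp3 hpd
    have h1 : start₃ d e α P m x p = P.s (p - 2) + m p := by
      rcases hp3.lt_or_eq with h | rfl
      · simp [start₃, show p ≠ 1 by omega, show p ≠ 2 by omega, show p ≠ 3 by omega, e4, e7, hp0,
          hx3 p hp3 hpd]
      · simp [start₃, e1, e4, e5, hp0, hx3 3 le_rfl hpd, sgn]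
    have h2 : step₃ d e α P m x p = prev m p - m p := by
      rcases hp3.lt_or_eq with h | rfl
      · simp [step₃, show p ≠ 1 by omega, show p ≠ 2 by omega, show p ≠ 3 by omega, e7, sgn, prev]
      · simp [step₃, e1, e5, sgn, prev]
    have c2 := stateAt_cases d c (p - 2)
    have c3 := stateAt_cases d c (p - 1)
    have hpl := place_ge (f := false) (p := p) (by omega)
    rw [h1, h2, m3, m4]
    simp only [mix, node, ite_ge hp3, hpl]
    clear h1 h2 m1 m2 m3 m4 md a0 a1 e1 e2 e3 e4 e5 e6 e7 hpl hR
    split_ifs <;> omega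

theorem arcMatch₄ (H : Hyp d e α) {P : Param} (hP : Admissible d e α P) {m x : ℕ → ℤ} {c X : ℕ}
    (hc : c < 2 * d) (hm : IsState d c m) (hx : x 2 = X)
    {i q : ℕ} (hi : Pos₄ d W c i q) :
    ArcMatch d e false (node W P X i) (node W P X (i + 1)) q
      (start₄ d e α P m x) (step₄ d e α P m) := by
  have hd := H.hd
  obtain ⟨hl, hγ, ht, hp0, -, -⟩ := (H.admissible_iff _).1 hP
  obtain ⟨m1, m2, md, a1, a0, e1, e2, e6, b, hB, hb, e3⟩ := H.move_facts hc hm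
  refine ArcMatch.of_eq fun p hp hpd => ?_
  rw [hb] at hi ⊢
  rcases (by omega : p = 1 ∨ p = 2 ∨ 3 ≤ p) with rfl | rfl | hp3
  · simp only [start₄, step₄, if_true, G₄, e1, e3, e6, m1, m2, md, a1, mix, node, ht, show place false 1 = 1 from rfl]
    clear m1 m2 md a0 a1 e1 e2 e3 e6
    rcases stateAt_cases d c 0 with ⟨v0, w0⟩ | ⟨v0, w0⟩ <;>
    rcases stateAt_cases d c 1 with ⟨v1, w1⟩ | ⟨v1, w1⟩ <;>
    rcases stateAt_cases d c (d - 1) with ⟨vd, wd⟩ | ⟨vd, wd⟩ <;> try omega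
    all_goals
      rw [v0, v1, vd]
      simp [sgn, add_mul]; (try split_ifs) <;> omega
  · have hτ := last_states hd hm fun x y => (1 - x) * y
    have hδ : step₄ d e α P m 2 = sgn (m d) * (allZero d m +
        (1 - stateAt d c (d - 2)) * stateAt d c (d - 1)) := by
      rw [← hτ]
      simp only [step₄, if_true, ite_two, e1, e6]
      ring_nf
    rw [hδ]
    simp only [start₄, if_true, ite_two, e1, e6, m1, m2, md,
      a0, mix, node, hx, show place false 2 = 0 from rfl]
    clear hτ hδ m1 m2 md a0 a1 e1 e2 e3 e6
    replace hi : ((c < d ∧ i = 4 * b ∧ q = c) ∧ lift (4 * b) i = 2 ∧ lift (4 * b) (i + 1) = 3) ∨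
        ((d ≤ c ∧ c + 1 < 2 * d ∧ i = 4 * b + 1 ∧ q = c - d + 1) ∧ lift (4 * b) i = 3 ∧ lift (4 * b) (i + 1) = 4) ∨
        ((c + 1 = 2 * d ∧ i = 4 * b + 2 ∧ q = 0) ∧ lift (4 * b) i = 4 ∧ lift (4 * b) (i + 1) = 3) := by
      rcases hi with h | h | h
      · exact Or.inl ⟨by omega, lift_even_le (by omega) (by omega) (by omega), lift_odd_gt (by omega) (by omega)⟩
      · exact Or.inr <| Or.inl ⟨by omega, lift_odd_gt (by omega) (by omega), lift_even_gt (by omega) (by omega)⟩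
      · exact Or.inr <| Or.inr ⟨by omega, lift_even_gt (by omega) (by omega), lift_odd_gt (by omega) (by omega)⟩
    rcases stateAt_cases d c 0 with ⟨v0, w0⟩ | ⟨v0, w0⟩ <;>
    rcases stateAt_cases d c 1 with ⟨v1, w1⟩ | ⟨v1, w1⟩ <;>
    rcases stateAt_cases d c (d - 1) with ⟨vd, wd⟩ | ⟨vd, wd⟩ <;> rcases stateAt_cases d c (d - 2) with ⟨ve, we⟩ | ⟨ve, we⟩ <;> try omega
    all_goals
      rw [v0, v1, vd, ve]
      simp [sgn]; (try split_ifs) <;> omega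
  · have m3 := prev_state (by omega) hm hp3 hpd
    have m4 := state_ge hm hp3 hpd
    have m5 := prev2_state (by omega) hm hp3 hpd
    have h1 : start₄ d e α P m x p = P.s (p - 2) + prev m p * m p := by
      rcases hp3.lt_or_eq with h | rfl
      · simp [start₄, show p ≠ 1 by omega, show p ≠ 2 by omega, show p ≠ 3 by omega, e1, prev]
      · simp [start₄, e1, prev]
    have h2 : step₄ d e α P m p = (prev2 m p - m p) * prev m p := by
      rcases hp3.lt_or_eq with h | rfl
      · simp [step₄, show p ≠ 1 by omega, show p ≠ 2 by omega, show p ≠ 3 by omega, e1, prev]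
      · simp [step₄, e1, prev, prev2]
    have c2 := stateAt_cases d c (p - 2)
    have c3 := stateAt_cases d c (p - 1)
    have hpl := place_ge (f := false) (p := p) (by omega)
    have c4 := stateAt_cases d c (p - 3)
    rw [h1, h2, m3, m4, m5]
    simp only [mix, node, ite_ge hp3, hpl]
    clear h1 h2 m1 m2 m3 m4 m5 md a0 a1 e1 e2 e3 e6 hpl
    rcases c2 with ⟨v2, w2⟩ | ⟨v2, w2⟩ <;> rcases c3 with ⟨v1, w1⟩ | ⟨v1, w1⟩
    all_goals
      rw [v2, v1]
      simp only [mul_one, mul_zero, add_zero]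
      split_ifs <;> omega

theorem isCycleDecomposition (H : Hyp d e α) : Decomposes d e α := by
  have hd := H.hd
  obtain ⟨Y, hY, hY2⟩ := H.two_pow_eq
  have hB := H.wid_pos
  have hB4 := H.wid_four
  have hE : ∀ P : Index d e α, edges d e α P.1 =
      ((stageData H).toPassFamily (by omega)).edgesOf P := by
    intro P
    have hr2 : ∀ x, Range₂ d e α x ↔ 0 ≤ x 2 ∧ x 2 < Y := by
      intro x
      rw [len_two] at hY2
      rw [Range₂, H.A₂_eq, hY2]
      simp only [Int.toNat_zero, pow_zero, mul_one]
      omega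
    have hr1 : ∀ x, Range₁ d e α x ↔ 0 ≤ x 1 ∧ 2 * x 1 + 4 ≤ W := by
      intro x
      rw [Range₁, H.A_three]
      omega
    have hr3 : ∀ x, Range₃ d e α x ↔ ∀ k, 3 ≤ k → k ≤ d → x k = 0 := by
      intro x
      refine forall_congr' fun k => forall_congr' fun hk => forall_congr' fun hk' => ?_
      rw [H.A_ge (by omega) (by omega)]
      omega
    have key : ∀ {X i q : ℕ} {j δ : ℕ → ℤ}, i < 2 * W →
        (ArcMatch d e ((stageData H).fl (2 * W * X + i))
          ((stageData H).bz P (2 * W * X + i))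
          ((stageData H).bz P (2 * W * X + i + 1)) q j δ ↔
        ArcMatch d e false (node W P.1 X i) (node W P.1 X (i + 1)) q j δ) := by
      intro X i q j δ hi
      simp only [stageData]
      rw [add_assoc, start_add hB _ _ hi.le, start_add hB _ _ (by omega : i + 1 ≤ _)]
    have hlt : ∀ {X i : ℕ}, X < Y → i < 2 * W → 2 * W * X + i < 2 ^ α := by
      intro X i hX hi
      rw [hY]
      calc 2 * W * X + i < 2 * W * (X + 1) := by rw [Nat.mul_succ]; omega
        _ ≤ _ := Nat.mul_le_mul_left _ hX
    refine PassData.edges_eq _ _ P P.1 ?_ ?_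
    · rintro j δ ⟨m, x, hm, hx, h⟩
      obtain ⟨c, hc, hm⟩ := (isMove_iff (by omega) m).1 hm
      have hx := (hr2 x).1 hx
      obtain ⟨X, hX⟩ := Int.eq_ofNat_of_zero_le hx.1
      have hXY : X < Y := by omega
      have main : ∀ i < 2 * W, ∀ q < d,
          ArcMatch d e false (node W P.1 X i) (node W P.1 X (i + 1)) q j δ →
          ∃ n < 2 ^ α, ∃ q < d, ArcMatch d e ((stageData H).toPassData.fl n)
            ((stageData H).toPassData.bz P n) ((stageData H).toPassData.bz P (n + 1)) q j δ :=
        fun i hi q hq h => ⟨2 * W * X + i, hlt hXY hi, q, hq, (key hi).2 h⟩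
      rcases h with ⟨_, h1, h3, rfl, rfl⟩ | ⟨_, _, h1, rfl, rfl⟩ | ⟨h3, rfl, rfl⟩ | ⟨_, rfl, rfl⟩
      · have h1 := (hr1 x).1 h1
        obtain ⟨x₁, hx₁⟩ := Int.eq_ofNat_of_zero_le h1.1
        have h3 := (hr3 x).1 h3
        rcases lt_or_ge c d with h | h
        · exact main (1 + 2 * x₁) (by omega) c h
            (arcMatch₁ H P.2 hc hm hX hx₁ (by omega) h3 (Or.inl ⟨h, rfl, rfl⟩))
        · exact main (2 + 2 * x₁) (by omega) (c - d) (by omega)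
            (arcMatch₁ H P.2 hc hm hX hx₁ (by omega) h3 (Or.inr ⟨h, rfl, rfl⟩))
      · have h1 := (hr1 x).1 h1
        obtain ⟨x₁, hx₁⟩ := Int.eq_ofNat_of_zero_le h1.1
        obtain ⟨i, q, hi, hq, hiq⟩ : ∃ i q, i < 2 * W ∧ q < d ∧ Pos₂ d W c x₁ i q := by
          rcases (by omega : c + 1 < d ∨ (d ≤ c + 1 ∧ c + 1 < 2 * d) ∨
            (c + 1 = 2 * d ∧ 2 * x₁ + 4 < W) ∨ (c + 1 = 2 * d ∧ 2 * x₁ + 4 = W)) with h | h | h | h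
          · exact ⟨W + 2 + 2 * x₁, c + 1, by omega, by omega, by omega⟩
          · exact ⟨W + 3 + 2 * x₁, c + 1 - d, by omega, by omega, by omega⟩
          · exact ⟨W + 4 + 2 * x₁, 0, by omega, by omega, by omega⟩
          · exact ⟨W + 1, 0, by omega, by omega, by omega⟩
        exact main i hi q hq (arcMatch₂ H P.2 hc hm hX hx₁ (by omega) hiq)
      · have h3 := (hr3 x).1 h3
        rcases lt_or_ge c d with h | h
        · exact main 0 (by omega) c h (arcMatch₃ H P.2 hc hm hX h3 (Or.inl ⟨h, rfl, rfl⟩))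
        · exact main (W - 1) (by omega) (c - d) (by omega)
            (arcMatch₃ H P.2 hc hm hX h3 (Or.inr ⟨h, rfl, rfl⟩))
      · obtain ⟨i, q, hi, hq, hiq⟩ : ∃ i q, i < 2 * W ∧ q < d ∧ Pos₄ d W c i q := by
          rcases (by omega : c < d ∨ (d ≤ c ∧ c + 1 < 2 * d) ∨ c + 1 = 2 * d) with h | h | h
          · exact ⟨W, c, by omega, by omega, by omega⟩
          · exact ⟨W + 1, c - d + 1, by omega, by omega, by omega⟩
          · exact ⟨W + 2, 0, by omega, by omega, by omega⟩
        exact main i hi q hq (arcMatch₄ H P.2 hc hm hX hiq)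
    · intro n hn q hq
      obtain ⟨X, i, rfl, hi⟩ := exists_pass (n := n) hB
      have hXY : X < Y := by
        rw [hY] at hn
        exact Nat.lt_of_mul_lt_mul_left (a := 2 * W) (by omega)
      let S : Prop := ∃ j δ, IsArc d e α P.1 j δ ∧ ArcMatch d e false (node W P.1 X i)
          (node W P.1 X (i + 1)) q j δ
      suffices h : S from h.imp fun j h => h.imp fun δ h => ⟨h.1, (key hi).2 h.2⟩
      have hmove := fun c => isMove_stateAt (d := d) (c := c) (by omega)
      let x : ℕ → ℕ → ℤ := fun x₁ k => if k = 2 then X else if k = 1 then x₁ else 0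
      have hx1 : ∀ x₁, x x₁ 1 = x₁ := fun _ => rfl
      have hx2 : ∀ x₁, x x₁ 2 = X := fun _ => rfl
      have hx3 : ∀ x₁ k, 3 ≤ k → k ≤ d → x x₁ k = 0 := fun x₁ k hk _ => by
        simp only [x]; rw [if_neg (by omega), if_neg (by omega)]
      have hR2 : ∀ x₁, Range₂ d e α (x x₁) := fun x₁ => (hr2 _).2 (by rw [hx2]; omega)
      have hR3 : ∀ x₁, Range₃ d e α (x x₁) := fun x₁ => (hr3 _).2 (hx3 x₁)
      have hR1 : ∀ x₁ : ℕ, 2 * x₁ + 4 ≤ W → Range₁ d e α (x x₁) :=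
        fun x₁ h => (hr1 _).2 (by rw [hx1]; omega)
      have s1 : ∀ c x₁ : ℕ, c < 2 * d → 2 * x₁ + 4 ≤ W → Pos₁ d c x₁ i q → S := fun c x₁ hc h1 hi =>
        ⟨_, _, ⟨_, x x₁, hmove c hc, hR2 _, Or.inl ⟨H.A₁_eq, hR1 _ h1, hR3 _, rfl, rfl⟩⟩,
          arcMatch₁ H P.2 hc (fun _ _ _ => rfl) (hx2 _) (hx1 _) h1 (hx3 _) hi⟩
      have s2 : ∀ c x₁ : ℕ, c < 2 * d → 2 * x₁ + 4 ≤ W → Pos₂ d W c x₁ i q → S := fun c x₁ hc h1 hi =>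
        ⟨_, _, ⟨_, x x₁, hmove c hc, hR2 _, Or.inr (Or.inl ⟨H.A₁_eq, H.A₂_eq, hR1 _ h1, rfl, rfl⟩)⟩,
          arcMatch₂ H P.2 hc (fun _ _ _ => rfl) (hx2 _) (hx1 _) h1 hi⟩
      have s3 : ∀ c : ℕ, c < 2 * d → Pos₃ d W c i q → S := fun c hc hi =>
        ⟨_, _, ⟨_, x 0, hmove c hc, hR2 _, Or.inr (Or.inr (Or.inl ⟨hR3 _, rfl, rfl⟩))⟩,
          arcMatch₃ H P.2 hc (fun _ _ _ => rfl) (hx2 _) (hx3 _) hi⟩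
      have s4 : ∀ c : ℕ, c < 2 * d → Pos₄ d W c i q → S := fun c hc hi =>
        ⟨_, _, ⟨_, x 0, hmove c hc, hR2 _, Or.inr (Or.inr (Or.inr ⟨H.A₂_eq, rfl, rfl⟩))⟩,
          arcMatch₄ H P.2 hc (fun _ _ _ => rfl) (hx2 0) hi⟩
      generalize W = B at *
      rcases (by omega : i = 0 ∨ (1 ≤ i ∧ i ≤ B - 2 ∧ i % 2 = 1) ∨ (1 ≤ i ∧ i ≤ B - 2 ∧ i % 2 = 0) ∨
        i = B - 1 ∨ i = B ∨ (i = B + 1 ∧ q = 0) ∨ (i = B + 1 ∧ 0 < q) ∨ (i = B + 2 ∧ q = 0) ∨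
        (B + 2 < i ∧ i % 2 = 0 ∧ q = 0) ∨ (B + 2 ≤ i ∧ i % 2 = 0 ∧ 0 < q) ∨ (B + 2 < i ∧ i % 2 = 1))
        with h | h | h | h | h | h | h | h | h | h | h
      · exact s3 q (by omega) (by omega)
      · exact s1 q ((i - 1) / 2) (by omega) (by omega) (by omega)
      · exact s1 (d + q) ((i - 2) / 2) (by omega) (by omega) (by omega)
      · exact s3 (d + q) (by omega) (by omega)
      · exact s4 q (by omega) (by omega)
      · exact s2 (2 * d - 1) (B / 2 - 2) (by omega) (by omega) (by omega)
      · exact s4 (d + q - 1) (by omega) (by omega)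
      · exact s4 (2 * d - 1) (by omega) (by omega)
      · exact s2 (2 * d - 1) ((i - B - 4) / 2) (by omega) (by omega) (by omega)
      · exact s2 (q - 1) ((i - B - 2) / 2) (by omega) (by omega) (by omega)
      · exact s2 (d + q - 1) ((i - B - 3) / 2) (by omega) (by omega) (by omega)
  have := (stageData H).isCycleDecomposition (by omega)
    (by have h := Nat.one_lt_two_pow (n := α) (by have := H.lo; omega); omega) H.he
    (fun _ _ _ => rfl) (fun h => by omega)
  simp only [Decomposes, hE]
  exact this

end

end Medium

end LockAndKey

namespace PassFamily

variable {d : ℕ} {z : Fin d → ℕ} {ι : Type*} {M : ℕ}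

/-- If the cycles cover the torus and have no more edges together than the torus, then they
decompose the torus. -/
theorem isCycleDecomposition_of_card [Finite ι] (F : PassFamily z ι M) (hd : 2 ≤ d) (hM : 2 ≤ M)
    (hz : ∀ k, 3 ≤ z k)
    (hinj : ∀ c s t, s < d * M → t < d * M → F.a c s = F.a c t → s = t)
    (hcard : Nat.card ι * (d * M) ≤ (∏ k, z k) * d)
    (hcov : ∀ x k, ∃ c, s(x, x + Pi.single k 1) ∈ F.edgesOf c) :
    IsCycleDecomposition (cartesianProduct fun k => cyc (z k)) (d * M) F.edgesOf ∧
      ∀ c k, LockAndKey.numAlong (F.edgesOf c) k = M := by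
  refine F.isCycleDecomposition hd hM hz hinj (fun c c' hc => ?_) hcov
  have hne : ∀ k, NeZero (z k) := fun k => ⟨by have := hz k; omega⟩
  choose f g hg hf using hcov
  let h : (∀ k, ZMod (z k)) × Fin d → ι × Fin (d * M) := fun p => (f p.1 p.2, ⟨g p.1 p.2, hg _ _⟩)
  have hedge : ∀ p, s(p.1, p.1 + Pi.single p.2 1) =
      s(F.a (h p).1 (h p).2, F.a (h p).1 ((h p).2 + 1)) := fun p => hf p.1 p.2
  have hh : Function.Injective h := by
    intro p p' hp
    have h1 := hedge p
    rw [hp, ← hedge p'] at h1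
    obtain ⟨h2, h3⟩ := torus_edge_injective hz h1
    exact Prod.ext h3 h2
  have hb : Function.Bijective h := by
    refine hh.bijective_of_nat_card_le ?_
    rw [Nat.card_prod, Nat.card_prod, Nat.card_pi]
    simpa using hcard
  refine Set.disjoint_left.2 ?_
  rintro e ⟨t, ht, rfl⟩ ⟨t', ht', he⟩
  obtain ⟨p, hp⟩ := hb.2 (c, ⟨t, ht⟩)
  obtain ⟨p', hp'⟩ := hb.2 (c', ⟨t', ht'⟩)
  have h1 := hedge p
  have h2 := hedge p'
  rw [hp] at h1
  rw [hp'] at h2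
  obtain ⟨h3, h4⟩ := torus_edge_injective hz (h1.trans (he.trans h2.symm))
  have h5 : p = p' := Prod.ext h4 h3
  rw [h5, hp'] at hp
  exact hc (congrArg Prod.fst hp).symm

end PassFamily

namespace LockAndKey

/-! ### Two factors: `α < level 2` -/

namespace Pair

section

variable {e : ℕ → ℕ} {α : ℕ}

/-- The parameter `A₃` as a natural number. -/
def wid (e : ℕ → ℕ) (α : ℕ) : ℕ := 2 ^ (α - e 2 + 1)

local notation "W" => wid e α

/-- The relative first coordinate of the start of the `i`-th pass in a period. -/
def relU (B i : ℕ) : ℤ := if i ≤ B then i else 2 * B - i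

/-- The relative second coordinate of the start of the `i`-th pass in a period. -/
def relV (B i : ℕ) : ℤ := if i < B then (i % 2 : ℕ) else if i = 2 * B then 4 else 2 + (i % 2 : ℕ)

/-- Does the `i`-th pass in a period begin with the step along the first factor? -/
def swap (B i : ℕ) : Bool := decide (i + 1 = B ∨ B + 1 ≤ i)

/-- The vertex of the torus with relative coordinates `u`, `v` in the period `X`. -/
def place₂ (B : ℕ) (P : Param) (X : ℕ) (u v : ℤ) (p : ℕ) : ℤ :=
  if p = 1 then (if P.γ = 0 then P.l * B + u else (P.l + 1) * B - 1 - u)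
  else P.γ + 4 * X + v

/-- The start of the `n`-th pass. -/
def start (B : ℕ) (P : Param) (n : ℕ) : ℕ → ℤ :=
  place₂ B P (n / (2 * B)) (relU B (n % (2 * B))) (relV B (n % (2 * B)))

theorem start_add {B : ℕ} (hB : 1 < B) (P : Param) (X : ℕ) {i : ℕ} (hi : i ≤ 2 * B) :
    start B P (2 * B * X + i) = place₂ B P X (relU B i) (relV B i) := by
  funext p
  rcases hi.lt_or_eq with hi | rfl
  · rw [start, Nat.mul_add_div (by omega), Nat.div_eq_of_lt hi, Nat.mul_add_mod,
      Nat.mod_eq_of_lt hi, add_zero]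
  · rw [start, ← Nat.mul_succ, Nat.mul_div_cancel_left _ (by omega), Nat.mul_mod_right]
    simp only [place₂, relU, relV, Nat.succ_eq_add_one]
    split_ifs <;> push_cast <;> omega

structure Hyp (e : ℕ → ℕ) (α : ℕ) : Prop where
  he : ∀ k, 1 ≤ k → k ≤ 2 → 2 ≤ e k
  lo : e 2 ≤ α
  hi : (α : ℤ) < level 2 e 2

namespace Hyp

theorem A₂_eq (H : Hyp e α) : A₂ 2 e α = 0 := A₂_eq_zero H.hi

theorem A_three (H : Hyp e α) : A 2 e α 3 = W := by
  have := H.lo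
  simp only [A, H.A₂_eq, level_one, wid, if_true]
  push_cast
  congr 1
  omega

theorem A₁_eq_one_iff (H : Hyp e α) : A₁ 2 e α = 1 ↔ 4 ≤ W := by
  have := H.lo
  have h4 : (4 : ℕ) = 2 ^ 2 := by norm_num
  rw [A₁, ηα, level_one, wid, h4, Nat.pow_le_pow_iff_right (by norm_num)]
  split_ifs <;> omega

theorem α_le (H : Hyp e α) : α + 2 ≤ e 2 + e 1 := by
  have h := H.hi
  rw [level_succ le_rfl, level_one] at h
  omega

theorem wid_even (H : Hyp e α) : 2 ∣ W ∧ 2 ≤ W := by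
  have := H.lo
  have h : 2 ∣ W := dvd_pow_self 2 (by omega)
  exact ⟨h, Nat.le_of_dvd (by unfold wid; positivity) h⟩

theorem exists_len_one (H : Hyp e α) : ∃ Z : ℕ, 2 ≤ Z ∧ 2 ^ e 1 = W * Z := by
  have := H.α_le
  have := H.lo
  refine ⟨2 ^ (e 1 - (α - e 2 + 1)), ?_, ?_⟩
  · calc 2 = 2 ^ 1 := by norm_num
      _ ≤ _ := Nat.pow_le_pow_right (by norm_num) (by omega)
  · rw [wid, ← pow_add]
    congr 1
    omega

theorem exists_len_two (H : Hyp e α) :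
    ∃ Y, 2 ^ α = 2 * W * Y ∧ 2 ^ e 2 = 4 * Y ∧ 0 < Y := by
  have := H.lo
  have := H.he 2 (by omega) le_rfl
  refine ⟨2 ^ (e 2 - 2), ?_, ?_, by positivity⟩
  · rw [wid, ← pow_succ', ← pow_add]
    congr 1
    omega
  · rw [show (4 : ℕ) = 2 ^ 2 by norm_num, ← pow_add]
    congr 1
    omega

theorem admissible_iff (H : Hyp e α) {Z : ℕ} (hZ : 2 ^ e 1 = W * Z) (P : Param) :
    Admissible 2 e α P ↔ (0 ≤ P.l ∧ P.l < Z) ∧ (P.γ = 0 ∨ P.γ = 1) ∧ P.t = 0 ∧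
      (∀ k, P.p k = 0) ∧ (∀ k, P.s k = 0) := by
  have hB := H.wid_even
  have hZ' : z e 1 / A 2 e α 3 = Z := by
    rw [H.A_three, z]
    have : ((2 : ℤ) ^ e 1) = W * Z := by exact_mod_cast hZ
    rw [this, Int.mul_ediv_cancel_left _ (by omega)]
  unfold Admissible
  rw [hZ', η_of_lt (by omega)]
  simp only [mul_zero, Int.toNat_zero, pow_zero, sub_self]
  constructor
  · rintro ⟨hl, hγ, ht, -, -, -, hoff⟩
    exact ⟨by omega, by omega, by omega, fun k => (hoff k (by omega)).1,
      fun k => (hoff k (by omega)).2⟩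
  · rintro ⟨hl, hγ, ht, hp, hs⟩
    exact ⟨by omega, by omega, by omega, fun k _ _ => by omega, fun h => by omega,
      fun k _ _ => by omega, fun k _ => ⟨hp k, hs k⟩⟩

end Hyp

theorem exists_pass {B n : ℕ} (hB : 0 < B) : ∃ X i, n = 2 * B * X + i ∧ i < 2 * B :=
  ⟨n / (2 * B), n % (2 * B), (Nat.div_add_mod _ _).symm, Nat.mod_lt _ (by omega)⟩

/-- The relative coordinates of the vertex after `q` steps of the `i`-th pass. -/
def midU (B i q : ℕ) : ℤ := if place (swap B i) 1 < q then relU B (i + 1) else relU B i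

/-- The relative coordinates of the vertex after `q` steps of the `i`-th pass. -/
def midV (B i q : ℕ) : ℤ := if place (swap B i) 2 < q then relV B (i + 1) else relV B i

theorem mix_place₂ {B : ℕ} (P : Param) (X i q : ℕ) {p : ℕ} (hp : 1 ≤ p) (hp2 : p ≤ 2) :
    mix (swap B i) (place₂ B P X (relU B i) (relV B i))
      (place₂ B P X (relU B (i + 1)) (relV B (i + 1))) q p =
      place₂ B P X (midU B i q) (midV B i q) p := by
  rcases (by omega : p = 1 ∨ p = 2) with rfl | rfl
  · simp only [mix, midU, place₂, if_true]
    split_ifs <;> rfl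
  · simp only [mix, midV, place₂, ite_two]
    split_ifs <;> rfl

theorem len_one' : len 2 e 1 = ((2 ^ e 1 : ℕ) : ℤ) := by rw [len_one, z]; push_cast; rfl

theorem len_two' : len 2 e 2 = ((2 ^ e 2 : ℕ) : ℤ) := by rw [len_two, z]; push_cast; rfl

/-- The family of sequences of passes. -/
def passData (H : Hyp e α) : PassData 2 e (Index 2 e α) (2 ^ α) where
  bz P := start W P.1
  fl n := swap W (n % (2 * W))
  step P n p h1 h2 := by
    have hB := H.wid_even
    obtain ⟨X, i, rfl, hi⟩ := exists_pass (n := n) (B := W) (by omega)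
    rw [add_assoc, start_add (by omega) _ _ (by omega : i + 1 ≤ _), start_add (by omega) _ _ hi.le]
    suffices h : place₂ W P.1 X (relU W (i + 1)) (relV W (i + 1)) p =
        place₂ W P.1 X (relU W i) (relV W i) p + 1 ∨
        place₂ W P.1 X (relU W (i + 1)) (relV W (i + 1)) p =
        place₂ W P.1 X (relU W i) (relV W i) p - 1 from
      h.imp (congrArg (· % _)) (congrArg (· % _))
    generalize W = B at *
    obtain ⟨⟨b, rfl⟩, hB⟩ := hB
    rcases (by omega : p = 1 ∨ p = 2) with rfl | rfl
    · simp only [place₂, if_true, relU]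
      split_ifs <;> push_cast <;> omega
    · simp only [place₂, ite_two, relV]
      split_ifs <;> push_cast <;> omega
  per P n p h1 h2 := by
    obtain ⟨Y, hY, hY2, -⟩ := H.exists_len_two
    have hB := H.wid_even
    obtain ⟨X, i, rfl, hi⟩ := exists_pass (n := n) (B := W) (by omega)
    rw [hY, show 2 * W * X + i + 2 * W * Y = 2 * W * (X + Y) + i by ring,
      start_add (by omega) _ _ hi.le, start_add (by omega) _ _ hi.le]
    rcases (by omega : p = 1 ∨ p = 2) with rfl | rfl
    · simp only [place₂, if_true]
      rfl
    · simp only [place₂, ite_two]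
      rw [len_two', hY2]
      push_cast
      exact Int.modEq_iff_dvd.2 ⟨-1, by ring⟩
  fl_per n := by
    obtain ⟨Y, hY, -⟩ := H.exists_len_two
    rw [hY, Nat.add_mul_mod_self_left]

theorem a_eq (H : Hyp e α) (P : Index 2 e α) (X : ℕ) {i q : ℕ} (hi : i < 2 * W) (hq : q ≤ 2) :
    ((passData H).toPassFamily le_rfl).a P (2 * (2 * W * X + i) + q) =
      vertex 2 e (place₂ W P.1 X (midU W i q) (midV W i q)) := by
  have hB := H.wid_even
  rw [(passData H).a_eq le_rfl P _ hq, vertex_eq_iff le_rfl]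
  intro p hp1 hp2
  rw [← mix_place₂ P.1 X i q hp1 hp2]
  simp only [passData]
  rw [add_assoc, start_add (by omega) _ _ (by omega : i + 1 ≤ _), start_add (by omega) _ _ hi.le,
    Nat.mul_add_mod, Nat.mod_eq_of_lt hi]

theorem mid_cases {b i : ℕ} (hi : i < 4 * b) :
    (i + 1 < 2 * b ∧ midU (2 * b) i 0 = i ∧ midU (2 * b) i 1 = i ∧ midU (2 * b) i 2 = i + 1 ∧
      midV (2 * b) i 0 = (i % 2 : ℕ) ∧ midV (2 * b) i 1 = 1 - (i % 2 : ℕ) ∧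
      midV (2 * b) i 2 = 1 - (i % 2 : ℕ)) ∨
    (i + 1 = 2 * b ∧ midU (2 * b) i 0 = i ∧ midU (2 * b) i 1 = i + 1 ∧ midU (2 * b) i 2 = i + 1 ∧
      midV (2 * b) i 0 = 1 ∧ midV (2 * b) i 1 = 1 ∧ midV (2 * b) i 2 = 2) ∨
    (i = 2 * b ∧ midU (2 * b) i 0 = i ∧ midU (2 * b) i 1 = i ∧ midU (2 * b) i 2 = i - 1 ∧
      midV (2 * b) i 0 = 2 ∧ midV (2 * b) i 1 = 3 ∧ midV (2 * b) i 2 = 3) ∨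
    (2 * b < i ∧ midU (2 * b) i 0 = 4 * b - i ∧ midU (2 * b) i 1 = 4 * b - i - 1 ∧
      midU (2 * b) i 2 = 4 * b - i - 1 ∧ midV (2 * b) i 0 = 2 + (i % 2 : ℕ) ∧
      midV (2 * b) i 1 = 2 + (i % 2 : ℕ) ∧
      (i + 1 = 4 * b ∧ midV (2 * b) i 2 = 4 ∨
        i + 1 < 4 * b ∧ midV (2 * b) i 2 = 3 - (i % 2 : ℕ))) := by
  simp only [midU, midV, relU, relV, swap]
  rcases (by omega : i + 1 < 2 * b ∨ i + 1 = 2 * b ∨ i = 2 * b ∨ 2 * b < i) with h | h | h | h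
  · left
    simp only [decide_eq_false (by omega : ¬(i + 1 = 2 * b ∨ 2 * b + 1 ≤ i)), place]
    simp
    split_ifs <;> omega
  · right; left
    simp only [decide_eq_true (by omega : i + 1 = 2 * b ∨ 2 * b + 1 ≤ i), place]
    simp
    split_ifs <;> omega
  · right; right; left
    simp only [decide_eq_false (by omega : ¬(i + 1 = 2 * b ∨ 2 * b + 1 ≤ i)), place]
    simp
    split_ifs <;> omega
  · right; right; right
    simp only [decide_eq_true (by omega : i + 1 = 2 * b ∨ 2 * b + 1 ≤ i), place]
    simp
    split_ifs <;> omega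

theorem mid_bounds {B i q : ℕ} (hB : 2 ∣ B) (hB2 : 2 ≤ B) (hi : i < 2 * B) (hq : q < 2) :
    (0 ≤ midU B i q ∧ midU B i q ≤ B) ∧ 0 ≤ midV B i q ∧ midV B i q < 4 := by
  obtain ⟨b, rfl⟩ := hB
  have := mid_cases (b := b) (i := i) (by omega)
  rcases (by omega : q = 0 ∨ q = 1) with rfl | rfl <;> omega

theorem mid_inj {B i i' q q' : ℕ} (hB : 2 ∣ B) (hi : i < 2 * B) (hq : q < 2)
    (hi' : i' < 2 * B) (hq' : q' < 2) (hU : midU B i q = midU B i' q')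
    (hV : midV B i q = midV B i' q') : i = i' ∧ q = q' := by
  obtain ⟨b, rfl⟩ := hB
  have k1 := mid_cases (b := b) (i := i) (by omega)
  have k2 := mid_cases (b := b) (i := i') (by omega)
  rcases (by omega : q = 0 ∨ q = 1) with rfl | rfl <;>
  rcases (by omega : q' = 0 ∨ q' = 1) with rfl | rfl <;>
  rcases k1 with k1 | k1 | k1 | k1 <;> rcases k2 with k2 | k2 | k2 | k2 <;> omega

theorem a_inj (H : Hyp e α) (P : Index 2 e α) (s t : ℕ) (hs : s < 2 * 2 ^ α) (ht : t < 2 * 2 ^ α)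
    (h : ((passData H).toPassFamily le_rfl).a P s = ((passData H).toPassFamily le_rfl).a P t) :
    s = t := by
  have hB := H.wid_even
  obtain ⟨Y, hY, hY2, hY0⟩ := H.exists_len_two
  obtain ⟨Z, hZ, hZ2⟩ := H.exists_len_one
  obtain ⟨-, hγ, -⟩ := (H.admissible_iff hZ2 _).1 P.2
  obtain ⟨X, i, hn, hi⟩ := exists_pass (n := s / 2) (B := W) (by omega)
  obtain ⟨X', i', hn', hi'⟩ := exists_pass (n := t / 2) (B := W) (by omega)
  have hs' : s = 2 * (2 * W * X + i) + s % 2 := by omega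
  have ht' : t = 2 * (2 * W * X' + i') + t % 2 := by omega
  have hX : X < Y := Nat.lt_of_mul_lt_mul_left (a := 2 * W) (by omega)
  have hX' : X' < Y := Nat.lt_of_mul_lt_mul_left (a := 2 * W) (by omega)
  rw [hs', ht', a_eq H P X hi (by omega), a_eq H P X' hi' (by omega), vertex_eq_iff le_rfl] at h
  have k1 := h 1 le_rfl (by omega)
  have k2 := h 2 (by omega) le_rfl
  have b1 := mid_bounds hB.1 hB.2 hi (Nat.mod_lt s two_pos)
  have b2 := mid_bounds hB.1 hB.2 hi' (Nat.mod_lt t two_pos)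
  have hinj := mid_inj hB.1 hi (Nat.mod_lt s two_pos) hi' (Nat.mod_lt t two_pos)
  rw [len_one', hZ2] at k1
  rw [len_two', hY2] at k2
  simp only [place₂, if_true, ite_two] at k1 k2
  have hlt : (W : ℤ) * 2 ≤ (W * Z : ℕ) := by
    push_cast
    exact mul_le_mul_of_nonneg_left (by exact_mod_cast hZ) (by positivity)
  have hU : midU W i (s % 2) = midU W i' (t % 2) := by
    rcases hγ with hγ | hγ
    · simp only [hγ, if_true] at k1
      exact eq_of_modEq_of_lt (Int.ModEq.add_left_cancel' _ k1) (by omega) (by omega) (by omega)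
        (by omega)
    · simp only [hγ, one_ne_zero, if_false] at k1
      have k3 := k1.sub_left ((P.1.l + 1) * (W : ℤ) - 1)
      rw [sub_sub_cancel, sub_sub_cancel] at k3
      exact eq_of_modEq_of_lt k3 (by omega) (by omega) (by omega)
        (by omega)
  have hV := eq_of_modEq_of_lt (x := 4 * (X : ℤ) + midV W i (s % 2))
    (y := 4 * (X' : ℤ) + midV W i' (t % 2)) (N := (4 * Y : ℕ))
    (Int.ModEq.add_left_cancel' P.1.γ (by rw [← add_assoc, ← add_assoc]; exact k2))
    (by omega) (by omega) (by omega) (by omega)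
  have hXX : X = X' := by omega
  obtain ⟨h1, h2⟩ := hinj hU (by omega)
  rw [hs', ht', hXX, h1, h2]

/-- The edges that the cycles with `γ = 0` contain, in relative coordinates. -/
theorem exists_mid_horizontal {B : ℕ} (hB : 2 ∣ B) (hB2 : 2 ≤ B) {u v : ℤ} (hu : 0 ≤ u) (hu' : u < B)
    (hv : 0 ≤ v) (hv' : v < 4)
    (h : (v % 2 = 0 ∧ u % 2 = 1 ∧ u + 3 ≤ B) ∨ (v % 2 = 1 ∧ (u % 2 = 0 ∨ u + 1 = B))) :
    ∃ i < 2 * B, ∃ q < 2, midV B i q = v ∧ midV B i (q + 1) = v ∧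
      ((midU B i q = u ∧ midU B i (q + 1) = u + 1) ∨ (midU B i q = u + 1 ∧ midU B i (q + 1) = u)) := by
  obtain ⟨b, rfl⟩ := hB
  obtain ⟨u, rfl⟩ := Int.eq_ofNat_of_zero_le hu
  rcases (by omega : (v ≤ 1 ∧ u + 1 < 2 * b) ∨ (v ≤ 1 ∧ u + 1 = 2 * b) ∨ (2 ≤ v ∧ u + 1 < 2 * b) ∨
    (2 ≤ v ∧ u + 1 = 2 * b)) with h1 | h1 | h1 | h1
  · have := mid_cases (b := b) (i := u) (by omega)
    exact ⟨u, by omega, 1, by omega, by norm_num only; omega⟩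
  · have := mid_cases (b := b) (i := u) (by omega)
    exact ⟨u, by omega, 0, by omega, by norm_num only; omega⟩
  · have := mid_cases (b := b) (i := (4 * b - u - 1)) (by omega)
    exact ⟨4 * b - u - 1, by omega, 0, by omega, by norm_num only; omega⟩
  · have := mid_cases (b := b) (i := (2 * b)) (by omega)
    exact ⟨2 * b, by omega, 1, by omega, by norm_num only; omega⟩

/-- The edges that the cycles with `γ = 0` contain, in relative coordinates. -/
theorem exists_mid_vertical {B : ℕ} (hB : 2 ∣ B) (hB2 : 2 ≤ B) {u v : ℤ}
    (h : ((v = 0 ∨ v = 2) ∧ 1 ≤ u ∧ u + 2 ≤ B) ∨ ((v = 0 ∨ v = 3) ∧ u = 0) ∨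
      ((v = 1 ∨ v = 2) ∧ u = B)) :
    ∃ i < 2 * B, ∃ q < 2, midU B i q = u ∧ midU B i (q + 1) = u ∧
      ((midV B i q = v ∧ midV B i (q + 1) = v + 1) ∨ (midV B i q = v + 1 ∧ midV B i (q + 1) = v)) := by
  obtain ⟨b, rfl⟩ := hB
  obtain ⟨u, rfl⟩ := Int.eq_ofNat_of_zero_le (show 0 ≤ u by omega)
  rcases (by omega : (v = 0 ∧ u + 1 < 2 * b) ∨ (v = 2 ∧ 1 ≤ u ∧ u + 2 ≤ 2 * b) ∨ (v = 3 ∧ u = 0) ∨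
    (v = 1 ∧ u = 2 * b) ∨ (v = 2 ∧ u = 2 * b)) with h1 | h1 | h1 | h1 | h1
  · have := mid_cases (b := b) (i := u) (by omega)
    exact ⟨u, by omega, 0, by omega, by norm_num only; omega⟩
  · have := mid_cases (b := b) (i := (4 * b - u - 1)) (by omega)
    exact ⟨4 * b - u - 1, by omega, 1, by omega, by norm_num only; omega⟩
  · have := mid_cases (b := b) (i := (4 * b - 1)) (by omega)
    exact ⟨4 * b - 1, by omega, 1, by omega, by norm_num only; omega⟩
  · have := mid_cases (b := b) (i := (2 * b - 1)) (by omega)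
    exact ⟨2 * b - 1, by omega, 1, by omega, by norm_num only; omega⟩
  · have := mid_cases (b := b) (i := (2 * b)) (by omega)
    exact ⟨2 * b, by omega, 0, by omega, by norm_num only; omega⟩

/-- The edge with the ends `(U, V)` and `(U', V')` belongs to some cycle. -/
def Covered (e : ℕ → ℕ) (α : ℕ) (U V U' V' : ℤ) : Prop :=
  ∃ P, Admissible 2 e α P ∧ ∃ X i q, 2 * wid e α * X + i < 2 ^ α ∧ i < 2 * wid e α ∧ q < 2 ∧
    s(vertex 2 e (place₂ (wid e α) P X (midU (wid e α) i q) (midV (wid e α) i q)),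
      vertex 2 e (place₂ (wid e α) P X (midU (wid e α) i (q + 1)) (midV (wid e α) i (q + 1)))) =
    s(vertex 2 e fun p => if p = 1 then U else V, vertex 2 e fun p => if p = 1 then U' else V')

theorem Covered.symm {U V U' V' : ℤ} (h : Covered e α U V U' V') : Covered e α U' V' U V := by
  obtain ⟨P, hP, X, i, q, h1, h2, h3, h⟩ := h
  exact ⟨P, hP, X, i, q, h1, h2, h3, h.trans Sym2.eq_swap⟩

theorem vertex_place₂ {Z Y : ℕ} (hZ : 2 ^ e 1 = W * Z) (hY : 2 ^ e 2 = 4 * Y)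
    {γ l X u v U V : ℤ} {X' : ℕ} (hX' : (X' : ℤ) = X % Y)
    (hU : (γ = 0 ∧ U = l * W + u) ∨ (γ = 1 ∧ U = (l + 1) * W - 1 - u)) (hV : V = γ + 4 * X + v) :
    vertex 2 e (place₂ W ⟨l % Z, γ, 0, fun _ => 0, fun _ => 0⟩ X' u v) =
      vertex 2 e fun p => if p = 1 then U else V := by
  rw [vertex_eq_iff le_rfl]
  intro p hp1 hp2
  have hl : l % Z * W ≡ l * W [ZMOD len 2 e 1] := by
    rw [len_one', hZ, mul_comm W Z]
    push_cast
    exact (Int.mod_modEq l Z).mul_right'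
  rcases (by omega : p = 1 ∨ p = 2) with rfl | rfl
  · simp only [place₂, if_true]
    rcases hU with ⟨rfl, rfl⟩ | ⟨rfl, rfl⟩
    · simp only [if_true]
      exact hl.add_right _
    · simp only [one_ne_zero, if_false, add_mul]
      exact (((hl.add_right _).sub_right _).sub_right _)
  · simp only [place₂, ite_two]
    rw [hV, hX', len_two', hY]
    push_cast
    exact (((Int.mod_modEq X Y).mul_left').add_left _).add_right _

theorem covered_of_mid (H : Hyp e α) {γ l X U V U' V' : ℤ} {i q : ℕ} (hi : i < 2 * W) (hq : q < 2)
    (hU : (γ = 0 ∧ U = l * W + midU W i q) ∨ (γ = 1 ∧ U = (l + 1) * W - 1 - midU W i q))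
    (hV : V = γ + 4 * X + midV W i q)
    (hU' : (γ = 0 ∧ U' = l * W + midU W i (q + 1)) ∨
      (γ = 1 ∧ U' = (l + 1) * W - 1 - midU W i (q + 1)))
    (hV' : V' = γ + 4 * X + midV W i (q + 1)) : Covered e α U V U' V' := by
  obtain ⟨Y, hY, hY2, hY0⟩ := H.exists_len_two
  obtain ⟨Z, hZ, hZ2⟩ := H.exists_len_one
  have hX1 := Int.emod_lt_of_pos X (show (0 : ℤ) < Y by omega)
  obtain ⟨X', hX'⟩ := Int.eq_ofNat_of_zero_le (Int.emod_nonneg X (show (Y : ℤ) ≠ 0 by omega))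
  refine ⟨⟨l % Z, γ, 0, fun _ => 0, fun _ => 0⟩, (H.admissible_iff hZ2 _).2 ⟨⟨?_, ?_⟩, by
    dsimp only; omega, rfl, fun _ => rfl, fun _ => rfl⟩, X', i, q, ?_, hi, hq, ?_⟩
  · exact Int.emod_nonneg _ (by omega)
  · exact Int.emod_lt_of_pos _ (by omega)
  · rw [hY]
    calc 2 * W * X' + i < 2 * W * (X' + 1) := by rw [Nat.mul_succ]; omega
      _ ≤ _ := Nat.mul_le_mul_left _ (by omega)
  · rw [vertex_place₂ hZ2 hY2 hX'.symm hU hV, vertex_place₂ hZ2 hY2 hX'.symm hU' hV']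

theorem covered_horizontal (H : Hyp e α) {γ l X u v U V : ℤ} (hu : 0 ≤ u) (hu' : u < W)
    (hv : 0 ≤ v) (hv' : v < 4)
    (h : (v % 2 = 0 ∧ u % 2 = 1 ∧ u + 3 ≤ W) ∨ (v % 2 = 1 ∧ (u % 2 = 0 ∨ u + 1 = W)))
    (hU : (γ = 0 ∧ U = l * W + u) ∨ (γ = 1 ∧ U = (l + 1) * W - 2 - u))
    (hV : V = γ + 4 * X + v) : Covered e α U V (U + 1) V := by
  have hB := H.wid_even
  obtain ⟨i, hi, q, hq, h1, h2, h3⟩ := exists_mid_horizontal hB.1 hB.2 hu hu' hv hv' h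
  have key := fun {U V U' V'} => covered_of_mid H (γ := γ) (l := l) (X := X) (U := U) (V := V)
    (U' := U') (V' := V') hi hq
  rcases h3 with h3 | h3 <;> rcases hU with hU | hU <;>
  first
  | exact key (by omega) (by omega) (by omega) (by omega)
  | exact (key (by omega) (by omega) (by omega) (by omega)).symm

theorem covered_vertical (H : Hyp e α) {γ l X u v U V : ℤ}
    (h : ((v = 0 ∨ v = 2) ∧ 1 ≤ u ∧ u + 2 ≤ W) ∨ ((v = 0 ∨ v = 3) ∧ u = 0) ∨
      ((v = 1 ∨ v = 2) ∧ u = W))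
    (hU : (γ = 0 ∧ U = l * W + u) ∨ (γ = 1 ∧ U = (l + 1) * W - 1 - u))
    (hV : V = γ + 4 * X + v) : Covered e α U V U (V + 1) := by
  have hB := H.wid_even
  obtain ⟨i, hi, q, hq, h1, h2, h3⟩ := exists_mid_vertical hB.1 hB.2 h
  have key := fun {U V U' V'} => covered_of_mid H (γ := γ) (l := l) (X := X) (U := U) (V := V)
    (U' := U') (V' := V') hi hq
  rcases h3 with h3 | h3
  · exact key (by omega) (by omega) (by omega) (by omega)
  · exact (key (by omega) (by omega) (by omega) (by omega)).symm

theorem covered (H : Hyp e α) (U V : ℤ) : Covered e α U V (U + 1) V ∧ Covered e α U V U (V + 1) := by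
  have hB := H.wid_even
  have hdiv := Int.mul_ediv_add_emod U W
  have r0 := Int.emod_nonneg U (show (W : ℤ) ≠ 0 by omega)
  have r1 := Int.emod_lt_of_pos U (show (0 : ℤ) < W by omega)
  have hdiv' := Int.mul_ediv_add_emod V 4
  generalize U / (W : ℤ) = a at *
  generalize U % (W : ℤ) = r at *
  rw [mul_comm] at hdiv
  have hp : (a + 1) * (W : ℤ) = a * W + W := by ring
  have hpp : (a + 1 + 1) * (W : ℤ) = a * W + 2 * W := by ring
  have hm : (a - 1) * (W : ℤ) = a * W - W := by ring
  constructor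
  · have key := fun γ l X u v => covered_horizontal H (γ := γ) (l := l) (X := X) (u := u) (v := v)
      (U := U) (V := V)
    rcases (by omega : ((V % 2 = 0 ∧ r % 2 = 1 ∧ r + 3 ≤ W) ∨ (V % 2 = 1 ∧ (r % 2 = 0 ∨ r + 1 = W))) ∨
      ((V % 2 = 1 ∧ r % 2 = 1 ∧ r + 3 ≤ W) ∨ (V % 2 = 0 ∧ r % 2 = 0)) ∨ (V % 2 = 0 ∧ r + 1 = W))
      with h | h | h
    · apply key 0 a (V / 4) r (V % 4) <;> omega
    · apply key 1 a ((V - 1) / 4) (W - 2 - r) ((V - 1) % 4) <;> omega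
    · apply key 1 (a + 1) ((V - 1) / 4) (W - 1) ((V - 1) % 4) <;> omega
  · have key := fun γ l X u v => covered_vertical H (γ := γ) (l := l) (X := X) (u := u) (v := v)
      (U := U) (V := V)
    rcases (by omega : (r = 0 ∧ (V % 4 = 1 ∨ V % 4 = 2)) ∨ (r + 1 = W ∧ (V % 4 = 1 ∨ V % 4 = 0)) ∨
      (r + 1 = W ∧ (V % 4 = 2 ∨ V % 4 = 3)) ∨
      ((r = 0 ∧ (V % 4 = 0 ∨ V % 4 = 3)) ∨ (1 ≤ r ∧ r + 2 ≤ W ∧ V % 2 = 0)) ∨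
      (1 ≤ r ∧ r + 2 ≤ W ∧ V % 2 = 1)) with h | h | h | h | h
    · apply key 0 (a - 1) (V / 4) W (V % 4) <;> omega
    · apply key 1 a ((V - 1) / 4) 0 ((V - 1) % 4) <;> omega
    · apply key 1 (a + 1) ((V - 1) / 4) W ((V - 1) % 4) <;> omega
    · apply key 0 a (V / 4) r (V % 4) <;> omega
    · apply key 1 a ((V - 1) / 4) (W - 1 - r) ((V - 1) % 4) <;> omega

theorem edgesOf_decomposition (H : Hyp e α) :
    IsCycleDecomposition (torus 2 e) (2 * 2 ^ α) ((passData H).toPassFamily le_rfl).edgesOf ∧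
      ∀ P k, numAlong (((passData H).toPassFamily le_rfl).edgesOf P) k = 2 ^ α := by
  have hB := H.wid_even
  obtain ⟨Y, hY, hY2, hY0⟩ := H.exists_len_two
  obtain ⟨Z, hZ, hZ2⟩ := H.exists_len_one
  have hz : ∀ k : Fin 2, 4 ≤ 2 ^ e (k + 1) := fun k =>
    le_trans (by norm_num)
      (Nat.pow_le_pow_right (by norm_num : 0 < 2) (H.he (k + 1) (by omega) (by omega)))
  have hadm := fun P : Index 2 e α => (H.admissible_iff hZ2 P.1).1 P.2
  let f : Index 2 e α → Fin Z × Fin 2 := fun P =>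
    (⟨P.1.l.toNat, by have := hadm P; omega⟩, ⟨P.1.γ.toNat, by have := hadm P; omega⟩)
  have hf : Function.Injective f := by
    intro P P' h
    obtain ⟨h1, h2, h3, h4, h5⟩ := hadm P
    obtain ⟨h1', h2', h3', h4', h5'⟩ := hadm P'
    simp only [f, Prod.mk.injEq, Fin.mk.injEq] at h
    refine Subtype.ext (Param.ext' (by omega) (by omega) (by omega) ?_ ?_)
    · funext k; rw [h4, h4']
    · funext k; rw [h5, h5']
  have : Finite (Index 2 e α) := Finite.of_injective f hf
  refine PassFamily.isCycleDecomposition_of_card _ le_rfl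
    (by rw [hY]; nlinarith) (fun k => by have := hz k; omega) (a_inj H) ?_ ?_
  · have h1 := Nat.card_le_card_of_injective f hf
    rw [Nat.card_prod, Nat.card_fin, Nat.card_fin] at h1
    rw [Fin.prod_univ_two]
    simp only [Fin.val_zero, Fin.val_one, zero_add, Nat.reduceAdd]
    rw [hZ2, hY2, hY]
    calc _ ≤ Z * 2 * (2 * (2 * W * Y)) := Nat.mul_le_mul_right _ h1
      _ = _ := by ring
  · intro x k
    have key : ∀ {U' V' : ℤ}, Covered e α (coord 2 e x 1) (coord 2 e x 2) U' V' →
        (vertex 2 e fun p => if p = 1 then U' else V') = x + Pi.single k 1 →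
        ∃ P, s(x, x + Pi.single k 1) ∈ ((passData H).toPassFamily le_rfl).edgesOf P := by
      rintro U' V' ⟨P, hP, X, i, q, hn, hi, hq, h⟩ hx
      obtain ⟨c, rfl⟩ : ∃ c : Index 2 e α, c.1 = P := ⟨⟨P, hP⟩, rfl⟩
      refine ⟨c, _, PassFamily.time_lt hn hq, ?_⟩
      rw [add_assoc, a_eq H c X hi hq.le, a_eq H c X hi (by omega), h, hx]
      have : (vertex 2 e fun p => if p = 1 then coord 2 e x 1 else coord 2 e x 2) = x := by
        refine Eq.trans ((vertex_eq_iff le_rfl).2 fun p h1 h2 => ?_) (vertex_coord (e := e) le_rfl x)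
        rcases (by omega : p = 1 ∨ p = 2) with rfl | rfl <;> rfl
      rw [this]
    have hx := vertex_coord (e := e) le_rfl x
    have p0 : pos 2 (0 : Fin 2) = 1 := rfl
    have p1 : pos 2 (1 : Fin 2) = 2 := rfl
    fin_cases k
    · refine key (covered H _ _).1 (funext fun l => ?_)
      have hl := congrFun hx l
      fin_cases l <;> simp only [vertex] at hl ⊢ <;> simp [p0, p1] at hl ⊢ <;> exact hl
    · refine key (covered H _ _).2 (funext fun l => ?_)
      have hl := congrFun hx l
      fin_cases l <;> simp only [vertex] at hl ⊢ <;> simp [p0, p1] at hl ⊢ <;> exact hl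

/-- The values of the moves for two factors. -/
theorem moves {m : ℕ → ℤ} {c : ℕ} (hc : c < 4)
    (hm : IsState 2 c m) :
    (c = 0 ∧ m 1 = 0 ∧ m 2 = 0) ∨ (c = 1 ∧ m 1 = 0 ∧ m 2 = 1) ∨
    (c = 2 ∧ m 1 = 1 ∧ m 2 = 1) ∨ (c = 3 ∧ m 1 = 1 ∧ m 2 = 0) := by
  rw [state_one le_rfl hm, state_two le_rfl hm]
  interval_cases c <;> decide

theorem allOne_two (m : ℕ → ℤ) : allOne 2 m = m 1 * m 2 := by
  simp [allOne, Finset.prod_Icc_succ_top]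

theorem allZero_two (m : ℕ → ℤ) : allZero 2 m = (1 - m 1) * (1 - m 2) := by
  simp [allZero, Finset.prod_Icc_succ_top]

/-- The arc `(j, δ)` is the step `q` of the pass `i` in the period `X`. -/
abbrev ArcEq (B : ℕ) (P : Param) (X i q : ℕ) (j δ : ℕ → ℤ) : Prop :=
  ∀ p, p = 1 ∨ p = 2 → j p = place₂ B P X (midU B i q) (midV B i q) p ∧
    j p + δ p = place₂ B P X (midU B i (q + 1)) (midV B i (q + 1)) p

theorem arcMatch_of_eq (H : Hyp e α) (P : Index 2 e α) {X i q : ℕ} (hi : i < 2 * W)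
    {j δ : ℕ → ℤ} (h : ArcEq W P.1 X i q j δ) :
    ArcMatch 2 e ((passData H).fl (2 * W * X + i)) ((passData H).bz P (2 * W * X + i))
      ((passData H).bz P (2 * W * X + i + 1)) q j δ := by
  have hB := H.wid_even
  intro p hp1 hp2
  have h := h p (by omega)
  rw [← mix_place₂ P.1 X i q hp1 hp2, ← mix_place₂ P.1 X i (q + 1) hp1 hp2] at h
  simp only [passData]
  rw [add_assoc, start_add (by omega) _ _ (by omega : i + 1 ≤ _), start_add (by omega) _ _ hi.le,
    Nat.mul_add_mod, Nat.mod_eq_of_lt hi]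
  exact ⟨congrArg (· % _) h.1, congrArg (· % _) h.2⟩

variable {P : Param} {m x : ℕ → ℤ} {c X : ℕ}

theorem arc_eq₁ (H : Hyp e α) (hγ : P.γ = 0 ∨ P.γ = 1) (hc : c < 4)
    (hm : IsState 2 c m) (hX : x 2 = X) {x₁ : ℕ}
    (hx : x 1 = x₁) (hx1 : 2 * x₁ + 4 ≤ W) :
    ArcEq W P X (2 * x₁ + c / 2) (c % 2) (start₁ 2 e α P m x) (step₁ 2 e α P m) := by
  intro p hp
  have hs : ¬(2 * x₁ + c / 2 + 1 = W ∨ W + 1 ≤ 2 * x₁ + c / 2) := by omega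
  have h1 : 2 * x₁ + c / 2 + 1 < W := by omega
  have h2 : 2 * x₁ + c / 2 < W := by omega
  have hη := η_of_lt (show 2 < 3 by omega)
  have hA := H.A_three
  have hA₂ := H.A₂_eq
  generalize W = B at *
  simp only [midU, midV, swap, decide_eq_false hs, relU, relV, if_pos h1, if_pos h2, if_pos h1.le,
    if_pos h2.le, place]
  rcases hp with rfl | rfl
  · simp only [start₁, step₁, hη, hA, hA₂, place₂]
    rcases moves hc hm with ⟨rfl, e1, e2⟩ | ⟨rfl, e1, e2⟩ | ⟨rfl, e1, e2⟩ | ⟨rfl, e1, e2⟩ <;>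
    rcases hγ with hγ | hγ <;> simp [e1, e2, hx, hγ, sgn, add_mul] <;> omega
  · simp only [start₁, step₁, χ, allOne_two, allZero_two, hη, hA, hA₂, place₂]
    rcases moves hc hm with ⟨rfl, e1, e2⟩ | ⟨rfl, e1, e2⟩ | ⟨rfl, e1, e2⟩ | ⟨rfl, e1, e2⟩ <;>
    rcases hγ with hγ | hγ <;> simp [e1, e2, hX, hγ, Nat.add_mod] <;> omega

theorem arc_eq₃ (H : Hyp e α) (hγ : P.γ = 0 ∨ P.γ = 1) (ht : P.t = 0) (hc : c < 4)
    (hm : IsState 2 c m) (hX : x 2 = X) :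
    ArcEq W P X (W - 2 + c / 2) (c % 2) (start₃ 2 e α P m x) (step₃ 2 e α P m x) := by
  intro p hp
  obtain ⟨⟨b, hb⟩, hB⟩ := H.wid_even
  have hη := η_of_lt (show 2 < 3 by omega)
  have hA := H.A_three
  have hA₂ := H.A₂_eq
  generalize W = B at *
  subst hb
  obtain ⟨b, rfl⟩ : ∃ b', b = b' + 1 := ⟨b - 1, by omega⟩
  rw [show 2 * (b + 1) - 2 = 2 * b by omega]
  rcases hp with rfl | rfl
  · simp only [start₃, step₃, E₃, F₃, allOne_two, hη, hA, hA₂, place₂, midU, swap, place, relU]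
    rcases moves hc hm with ⟨rfl, e1, e2⟩ | ⟨rfl, e1, e2⟩ | ⟨rfl, e1, e2⟩ | ⟨rfl, e1, e2⟩ <;>
    rcases hγ with hγ | hγ <;> simp [e1, e2, ht, hγ, sgn, add_mul, mul_add, add_assoc] <;> omega
  · simp only [start₃, step₃, E₃, F₃, allOne_two, allZero_two, hη, hA, hA₂, place₂, midV, swap,
      place, relV]
    rcases moves hc hm with ⟨rfl, e1, e2⟩ | ⟨rfl, e1, e2⟩ | ⟨rfl, e1, e2⟩ | ⟨rfl, e1, e2⟩ <;>
    rcases hγ with hγ | hγ <;> simp [e1, e2, hX, hγ, Nat.add_mod, mul_add, add_assoc] <;> omega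

theorem arc_eq₄ (H : Hyp e α) (hγ : P.γ = 0 ∨ P.γ = 1) (ht : P.t = 0) (hc : c < 4)
    (hm : IsState 2 c m) (hX : x 2 = X) :
    ArcEq W P X (W + c / 2) (c % 2) (start₄ 2 e α P m x) (step₄ 2 e α P m) := by
  intro p hp
  obtain ⟨⟨b, hb⟩, hB⟩ := H.wid_even
  have hη := η_of_lt (show 2 < 3 by omega)
  have hη4 := η_of_lt (show 2 < 4 by omega)
  have hA := H.A_three
  have hA₁ := H.A₁_eq_one_iff
  have hA₁' : A₁ 2 e α = 0 ∨ A₁ 2 e α = 1 := by unfold A₁ ηα; split_ifs <;> simp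
  generalize W = B at *
  subst hb
  rcases hp with rfl | rfl
  · simp only [start₄, step₄, G₄, allOne_two, hη, hA, place₂, midU, swap, place, relU]
    rcases moves hc hm with ⟨rfl, e1, e2⟩ | ⟨rfl, e1, e2⟩ | ⟨rfl, e1, e2⟩ | ⟨rfl, e1, e2⟩ <;>
    rcases hγ with hγ | hγ <;> simp [e1, e2, ht, hγ, sgn, add_mul, add_assoc] <;> omega
  · simp only [start₄, step₄, allOne_two, allZero_two, hη, hη4, hA, place₂, midV, swap,
      place, relV]
    have hb1 : A₁ 2 e α = 0 ∧ b = 1 ∨ A₁ 2 e α = 1 ∧ 2 ≤ b := by omega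
    clear hA₁ hA₁'
    rcases hb1 with ⟨hA₁, hb1⟩ | ⟨hA₁, hb1⟩ <;>
    rcases moves hc hm with ⟨rfl, e1, e2⟩ | ⟨rfl, e1, e2⟩ | ⟨rfl, e1, e2⟩ | ⟨rfl, e1, e2⟩ <;>
    rcases hγ with hγ | hγ <;>
    simp [e1, e2, hX, hγ, Nat.add_mod, mul_add, add_assoc, hA₁, sgn] <;> (try split_ifs) <;> omega

theorem arc_eq₂ (H : Hyp e α) (hγ : P.γ = 0 ∨ P.γ = 1) (hc : c < 4)
    (hm : IsState 2 c m) (hX : x 2 = X) {x₁ : ℕ}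
    (hx : x 1 = x₁) (hx1 : 2 * x₁ + 4 ≤ W) :
    ArcEq W P X (W + 2 + 2 * x₁ + c / 2) (c % 2) (start₂ 2 e α P m x) (step₂ 2 e α P m x) := by
  intro p hp
  obtain ⟨⟨b, hb⟩, hB⟩ := H.wid_even
  have hη := η_of_lt (show 2 < 3 by omega)
  have hη4 := η_of_lt (show 2 < 4 by omega)
  have hA := H.A_three
  generalize W = B at *
  subst hb
  have hs : (2 * b + 2 + 2 * x₁ + c / 2 + 1 = 2 * b ∨ 2 * b + 1 ≤ 2 * b + 2 + 2 * x₁ + c / 2) := by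
    omega
  have hdiv : x₁ + 2 < b ∧ (2 * (x₁ : ℤ) + 4) / (2 * b : ℕ) = 0 ∨
      x₁ + 2 = b ∧ (2 * (x₁ : ℤ) + 4) / (2 * b : ℕ) = 1 := by
    rcases (by omega : x₁ + 2 < b ∨ x₁ + 2 = b) with h | h
    · exact Or.inl ⟨h, Int.ediv_eq_zero_of_lt (by omega) (by push_cast; omega)⟩
    · exact Or.inr ⟨h, by
        rw [show 2 * (x₁ : ℤ) + 4 = (2 * b : ℕ) by push_cast; omega]
        exact Int.ediv_self (by omega)⟩
  simp only [midU, midV, swap, decide_eq_true hs, place]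
  rcases hp with rfl | rfl
  · simp only [start₂, step₂, χ, allOne_two, allZero_two, hη, hA, place₂, relU]
    rcases moves hc hm with ⟨rfl, e1, e2⟩ | ⟨rfl, e1, e2⟩ | ⟨rfl, e1, e2⟩ | ⟨rfl, e1, e2⟩ <;>
    rcases hγ with hγ | hγ <;> simp [e1, e2, hx, hγ, sgn, add_mul, mul_add] <;>
    (try split_ifs) <;> omega
  · simp only [start₂, step₂, r₁, hη, hη4, hA, place₂, relV, hx]
    rcases hdiv with ⟨hb1, hdiv⟩ | ⟨hb1, hdiv⟩ <;> rw [hdiv] <;>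
    rcases moves hc hm with ⟨rfl, e1, e2⟩ | ⟨rfl, e1, e2⟩ | ⟨rfl, e1, e2⟩ | ⟨rfl, e1, e2⟩ <;>
    rcases hγ with hγ | hγ <;> simp [e1, e2, hX, hγ, sgn] <;> (try split_ifs) <;> omega

theorem isCycleDecomposition (H : Hyp e α) : Decomposes 2 e α := by
  have hB := H.wid_even
  obtain ⟨Y, hY, hY2, hY0⟩ := H.exists_len_two
  obtain ⟨Z, hZ, hZ2⟩ := H.exists_len_one
  have hE : ∀ P : Index 2 e α, edges 2 e α P.1 = ((passData H).toPassFamily le_rfl).edgesOf P := by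
    intro P
    obtain ⟨-, hγ, ht, -⟩ := (H.admissible_iff hZ2 _).1 P.2
    have hr2 : ∀ x, Range₂ 2 e α x ↔ 0 ≤ x 2 ∧ x 2 < Y := by
      intro x
      have hz : z e 2 = 4 * (Y : ℤ) := by rw [z]; exact_mod_cast hY2
      rw [Range₂, H.A₂_eq, hz]
      simp only [Int.toNat_zero, pow_zero, mul_one]
      omega
    have hlt : ∀ {X i : ℕ}, X < Y → i < 2 * W → 2 * W * X + i < 2 ^ α := by
      intro X i hX hi
      rw [hY]
      calc 2 * W * X + i < 2 * W * (X + 1) := by rw [Nat.mul_succ]; omega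
        _ ≤ _ := Nat.mul_le_mul_left _ hX
    refine PassData.edges_eq _ _ P P.1 ?_ ?_
    · rintro j δ ⟨m, x, hm, hx, h⟩
      obtain ⟨c, hc, hm⟩ := (isMove_iff le_rfl m).1 hm
      have hx := (hr2 x).1 hx
      obtain ⟨X, hX⟩ := Int.eq_ofNat_of_zero_le hx.1
      have hX' : X < Y := by omega
      rcases h with ⟨-, ⟨h0, h1⟩, -, rfl, rfl⟩ | ⟨-, -, ⟨h0, h1⟩, rfl, rfl⟩ | ⟨-, rfl, rfl⟩ |
        ⟨-, rfl, rfl⟩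
      · obtain ⟨x₁, hx₁⟩ := Int.eq_ofNat_of_zero_le h0
        rw [H.A_three] at h1
        exact ⟨_, hlt hX' (by omega), c % 2, by omega, arcMatch_of_eq H P (by omega)
          (arc_eq₁ H hγ hc hm hX hx₁ (by omega))⟩
      · obtain ⟨x₁, hx₁⟩ := Int.eq_ofNat_of_zero_le h0
        rw [H.A_three] at h1
        exact ⟨_, hlt hX' (by omega), c % 2, by omega, arcMatch_of_eq H P (by omega)
          (arc_eq₂ H hγ hc hm hX hx₁ (by omega))⟩
      · exact ⟨_, hlt hX' (by omega), c % 2, by omega, arcMatch_of_eq H P (by omega)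
          (arc_eq₃ H hγ ht hc hm hX)⟩
      · exact ⟨_, hlt hX' (by omega), c % 2, by omega, arcMatch_of_eq H P (by omega)
          (arc_eq₄ H hγ ht hc hm hX)⟩
    · intro n hn q hq
      obtain ⟨X, i, rfl, hi⟩ := exists_pass (n := n) (B := W) (by omega)
      have hX : X < Y := Nat.lt_of_mul_lt_mul_left (a := 2 * W) (by omega)
      set c := 2 * (i % 2) + q with hc
      have hc2 : c < 2 * 2 := by omega
      have hmove := isMove_stateAt le_rfl hc2
      let x : ℕ → ℤ := fun k => if k = 2 then X else
        ((if i < W then i / 2 else (i - W - 2) / 2 : ℕ) : ℤ)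
      have hx2 : x 2 = X := rfl
      have hx : Range₂ 2 e α x := (hr2 x).2 (by rw [hx2]; omega)
      have h3 : Range₃ 2 e α x := fun k h h' => by omega
      have hA₁ := H.A₁_eq_one_iff
      have hq' : q = c % 2 := by omega
      rcases (by omega : i + 2 < W ∨ i = W - 2 + c / 2 ∨ i = W + c / 2 ∨
        W + 2 ≤ i) with h | h | h | h
      · have hx1 : x 1 = (i / 2 : ℕ) := by
          simp only [x, if_neg (show 1 ≠ 2 by omega), if_pos (show i < W by omega)]
        have hr : Range₁ 2 e α x := by rw [Range₁, H.A_three, hx1]; omega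
        refine ⟨_, _, ⟨_, x, hmove, hx, Or.inl ⟨hA₁.2 (by omega), hr, h3, rfl, rfl⟩⟩,
          arcMatch_of_eq H P hi ?_⟩
        rw [hq', show i = 2 * (i / 2) + c / 2 by omega]
        exact arc_eq₁ H hγ hc2 (fun _ _ _ => rfl) hx2 hx1 (by omega)
      · refine ⟨_, _, ⟨_, x, hmove, hx, Or.inr (Or.inr (Or.inl ⟨h3, rfl, rfl⟩))⟩,
          arcMatch_of_eq H P hi ?_⟩
        rw [hq', h]
        exact arc_eq₃ H hγ ht hc2 (fun _ _ _ => rfl) hx2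
      · refine ⟨_, _, ⟨_, x, hmove, hx, Or.inr (Or.inr (Or.inr ⟨H.A₂_eq, rfl, rfl⟩))⟩,
          arcMatch_of_eq H P hi ?_⟩
        rw [hq', h]
        exact arc_eq₄ H hγ ht hc2 (fun _ _ _ => rfl) hx2
      · have hx1 : x 1 = ((i - W - 2) / 2 : ℕ) := by
          simp only [x, if_neg (show 1 ≠ 2 by omega), if_neg (show ¬i < W by omega)]
        have hr : Range₁ 2 e α x := by rw [Range₁, H.A_three, hx1]; omega
        refine ⟨_, _, ⟨_, x, hmove, hx, Or.inr (Or.inl ⟨hA₁.2 (by omega), H.A₂_eq, hr, rfl, rfl⟩)⟩,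
          arcMatch_of_eq H P hi ?_⟩
        rw [hq', show i = W + 2 + 2 * ((i - W - 2) / 2) + c / 2 by omega]
        exact arc_eq₂ H hγ hc2 (fun _ _ _ => rfl) hx2 hx1 (by omega)
  simp only [Decomposes, hE]
  exact edgesOf_decomposition H

end

end Pair

/-! ### `level 2 ≤ α` -/

namespace Long

section

variable {d : ℕ} {e : ℕ → ℕ} {α : ℕ}

structure Hyp (d : ℕ) (e : ℕ → ℕ) (α : ℕ) : Prop where
  hd : 2 ≤ d
  he : ∀ k, 1 ≤ k → k ≤ d → 2 ≤ e k
  lo : level d e 2 ≤ α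
  hi : (α : ℤ) ≤ level d e d

/-- The exponent of the radix at position `k`. -/
def ex (d : ℕ) (e : ℕ → ℕ) (α k : ℕ) : ℕ :=
  if level d e k < α then e (k - 1) - 1 else (α - level d e (k - 1)).toNat

/-- The radix at position `k`. -/
def dg (d : ℕ) (e : ℕ → ℕ) (α k : ℕ) : ℕ := 2 ^ ex d e α k

local notation "Radix" => dg d e α

/-- The spacing of the vertices of a cycle at position `k`. -/
def unit (d : ℕ) (e : ℕ → ℕ) (α k : ℕ) : ℕ := if level d e (k - 1) < α then 2 else 1

local notation "Gap" => unit d e α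

/-- The place value of the digit at position `k`. -/
def base (d : ℕ) (e : ℕ → ℕ) (α k : ℕ) : ℕ := ∏ j ∈ Finset.Ico 3 k, dg d e α j

local notation "Base" => base d e α

variable (d e α) in
theorem dg_pos (k : ℕ) : 0 < Radix k := by unfold dg; positivity

theorem base_pos (k : ℕ) : 0 < Base k := Finset.prod_pos fun j _ => dg_pos _ _ _ j

theorem base_three : Base 3 = 1 := by simp [base]

theorem base_succ {k : ℕ} (hk : 3 ≤ k) : Base (k + 1) = Base k * Radix k :=
  Finset.prod_Ico_succ_top hk _

theorem base_dvd {j k : ℕ} (hjk : j ≤ k) : Base j ∣ Base k :=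
  Finset.prod_dvd_prod_of_subset _ _ _ (Finset.Ico_subset_Ico_right hjk)

variable (d e α) in
theorem unit_cases (k : ℕ) : Gap k = 1 ∨ Gap k = 2 := by
  unfold unit
  split_ifs <;> simp

/-- The total number of values of the digits. -/
def tot (d : ℕ) (e : ℕ → ℕ) (α : ℕ) : ℕ := base d e α (d + 1)

local notation "Tot" => tot d e α

theorem tot_pos : 0 < Tot := base_pos _

namespace Hyp

theorem A₁_eq (H : Hyp d e α) : A₁ d e α = 1 := by
  have h1 := H.lo
  have h2 := H.he 1 le_rfl (by have := H.hd; omega)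
  rw [level_succ le_rfl, level_one] at h1
  exact ηα_eq_one (by rw [level_one]; omega)

theorem A₂_eq (H : Hyp d e α) : A₂ d e α = 1 := A₂_eq_one H.lo

theorem A_three (H : Hyp d e α) : A d e α 3 = (2 ^ e 1 : ℕ) := by
  have h2 := H.he 1 le_rfl (by have := H.hd; omega)
  rw [A, if_pos rfl, H.A₂_eq, level_succ le_rfl]
  push_cast
  congr 1
  omega

theorem level_step (H : Hyp d e α) {k : ℕ} (h3 : 2 ≤ k) (hk : k ≤ d) :
    level d e k = level d e (k - 1) + e (k - 1) - 1 ∧ 2 ≤ e (k - 1) := by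
  obtain ⟨k, rfl⟩ : ∃ l, k = l + 1 := ⟨k - 1, by omega⟩
  exact ⟨level_succ (by omega), H.he _ (by omega) (by omega)⟩

theorem A_ge (H : Hyp d e α) {k : ℕ} (h3 : 3 ≤ k) (hk : k ≤ d) : A d e α (k + 1) = Radix k := by
  obtain ⟨h1, h2⟩ := H.level_step (by omega) hk
  rw [A, if_neg (by omega), dg, ex]
  simp only [Nat.add_sub_cancel, show k + 1 - 2 = k - 1 by omega]
  push_cast
  congr 1
  simp only [ηα]
  split_ifs <;> simp <;> omega

theorem two_pow_unit {k : ℕ} : 2 ^ (ηα d e α (k - 1)).toNat = (Gap k : ℤ) := by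
  unfold ηα unit
  split_ifs <;> simp

theorem ηα_eq {k : ℕ} : ηα d e α (k - 1) = Gap k - 1 := by
  unfold ηα unit
  split_ifs <;> simp

theorem exists_len (H : Hyp d e α) {k : ℕ} (h3 : 3 ≤ k) (hk : k ≤ d) :
    ∃ N : ℕ, 0 < N ∧ len d e k = ((Gap k * Radix k * N : ℕ) : ℤ) := by
  obtain ⟨h1, h2⟩ := H.level_step (by omega) hk
  have hex : ex d e α k + 1 ≤ e (k - 1) := by unfold ex; split_ifs <;> omega
  rw [len_ge h3, z]
  have hu : Gap k ∣ 2 := by rcases unit_cases d e α k with h | h <;> simp [h]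
  obtain ⟨N, hN⟩ : Gap k * Radix k ∣ 2 ^ e (k - 1) := by
    refine (mul_dvd_mul_right hu _).trans ?_
    rw [dg, ← pow_succ']
    exact pow_dvd_pow _ hex
  refine ⟨N, Nat.pos_of_ne_zero ?_, by exact_mod_cast hN⟩
  rintro rfl
  have : 0 < 2 ^ e (k - 1) := by positivity
  omega

theorem dg_eq_one (H : Hyp d e α) {k : ℕ} (h3 : 3 ≤ k) (hk : k ≤ d) (h : Gap k = 1) :
    Radix k = 1 := by
  obtain ⟨h1, h2⟩ := H.level_step (by omega) hk
  have h4 : ¬level d e (k - 1) < α := by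
    intro h4
    rw [unit, if_pos h4] at h
    omega
  have : ex d e α k = 0 := by
    rw [ex, if_neg (by omega)]
    omega
  rw [dg, this, pow_zero]

/-- Only full factors precede an active one. -/
theorem len_of_lt (H : Hyp d e α) {k : ℕ} (h3 : 3 ≤ k) (hk : k ≤ d) (h : level d e k < α) :
    len d e k = 2 * Radix k ∧ Gap k = 2 := by
  obtain ⟨h1, h2⟩ := H.level_step (by omega) hk
  refine ⟨?_, ?_⟩
  · rw [len_ge h3, z, dg, ex, if_pos h]
    push_cast
    rw [← pow_succ']
    congr 1
    omega
  · rw [unit, if_pos (by omega)]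

theorem base_eq_of_le (H : Hyp d e α) {k l : ℕ} (h3 : 3 ≤ k) (hkl : k ≤ l) (hl : l ≤ d + 1)
    (h : (α : ℤ) ≤ level d e (k - 1)) : Base l = Base k := by
  induction l, hkl using Nat.le_induction with
  | base => rfl
  | succ l hkl ih =>
    rw [base_succ (by omega), ih (by omega)]
    have h1 := level_mono H.he (j := k - 1) (k := l - 1) (by omega) (by omega) (by omega)
    rw [H.dg_eq_one (by omega) (by omega), mul_one]
    rw [unit, if_neg]
    have : ((k - 1 : ℕ) : ℤ) ≤ ((l - 1 : ℕ) : ℤ) := by omega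
    omega

theorem unit_eq_two (H : Hyp d e α) {k t : ℕ} (h3 : 3 ≤ k) (hk : k ≤ d) (h : Base k ∣ t)
    (h' : ¬Tot ∣ t) : Gap k = 2 := by
  by_contra hu
  refine h' ?_
  rw [tot, H.base_eq_of_le h3 (by omega) le_rfl]
  · exact h
  · by_contra h4
    exact hu (if_pos (by omega))

theorem len_eq_two_mul (H : Hyp d e α) {k t : ℕ} (h3 : 3 ≤ k) (hk : k ≤ d) (h : Base (k + 1) ∣ t)
    (h' : ¬Tot ∣ t) : len d e k = 2 * Radix k := by
  refine (H.len_of_lt h3 hk ?_).1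
  by_contra h4
  refine h' ?_
  rw [tot, H.base_eq_of_le (k := k + 1) (by omega) (by omega) le_rfl]
  · exact h
  · simpa using h4

theorem base_eq (H : Hyp d e α) {k : ℕ} (h2 : 2 ≤ k) (hk : k ≤ d) :
    Base (k + 1) = 2 ^ (min (level d e k) α - level d e 2).toNat := by
  induction k, h2 using Nat.le_induction with
  | base =>
    rw [base_three, min_eq_left H.lo]
    simp
  | succ k h2 ih =>
    obtain ⟨h1, h3⟩ := H.level_step (k := k + 1) (by omega) hk
    have h4 := level_mono H.he (j := 2) (k := k) (by omega) (by omega) (by omega)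
    have h5 : (2 : ℤ) ≤ k := by omega
    have h6 := H.lo
    rw [base_succ (by omega), ih (by omega), dg, ← pow_add, ex]
    simp only [Nat.add_sub_cancel] at *
    congr 1
    push_cast at *
    split_ifs <;> omega

theorem two_pow_eq (H : Hyp d e α) : ∃ Y : ℕ, 0 < Y ∧ 2 ^ α = 2 ^ e 1 * (Tot * (2 * Y)) ∧
    2 ^ e d = 4 * Y := by
  have hd := H.hd
  have h1 := H.he d (by omega) le_rfl
  have h2 := H.he 1 le_rfl (by omega)
  have h3 := H.lo
  refine ⟨2 ^ (e d - 2), by positivity, ?_, ?_⟩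
  · rw [tot, H.base_eq hd le_rfl, min_eq_right H.hi, ← pow_succ', ← pow_add, ← pow_add]
    congr 1
    rw [level_succ le_rfl, level_one] at *
    omega
  · rw [show (4 : ℕ) = 2 ^ 2 by norm_num, ← pow_add]
    congr 1
    omega

theorem four_dvd (H : Hyp d e α) : 4 ∣ 2 ^ e 1 := by
  have h2 := H.he 1 le_rfl (by have := H.hd; omega)
  exact pow_dvd_pow 2 h2

theorem admissible_iff (H : Hyp d e α) (P : Param) : Admissible d e α P ↔
    P.l = 0 ∧ (P.γ = 0 ∨ P.γ = 1) ∧ P.t = 0 ∧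
    (∀ k, 3 ≤ k → k ≤ d → 0 ≤ P.p (k - 2) ∧ P.p (k - 2) < Gap k) ∧
    (∀ k, 3 ≤ k → k ≤ d → 0 ≤ P.s (k - 2) ∧
      P.s (k - 2) * (Radix k * Gap k) < len d e k) ∧
    (∀ k, k < 1 ∨ d - 2 < k → P.p k = 0 ∧ P.s k = 0) := by
  have hl : z e 1 / A d e α 3 = 1 := by
    rw [H.A_three, z]
    push_cast
    exact Int.ediv_self (by positivity)
  have hs : ∀ k, 3 ≤ k → k ≤ d → ∀ s, (s ≤ z e (k - 1) / (A d e α (k + 1) * Gap k) - 1 ↔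
      s * (Radix k * Gap k) < len d e k) := by
    intro k h3 hk s
    obtain ⟨N, hN, hlen⟩ := H.exists_len h3 hk
    have hp : (0 : ℤ) < Radix k * Gap k := by
      have := dg_pos d e α k
      rcases unit_cases d e α k with h | h <;> rw [h] <;> push_cast <;> omega
    rw [H.A_ge h3 hk, ← len_ge h3, hlen]
    push_cast
    rw [mul_comm (Gap k : ℤ) (Radix k), Int.mul_ediv_cancel_left _ hp.ne', mul_comm s,
      mul_lt_mul_iff_right₀ hp]
    omega
  unfold Admissible
  rw [hl, H.A₁_eq]
  constructor
  · rintro ⟨h1, h2, h3, h4, h5, h6, h7⟩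
    simp only [sub_self, zero_mul, Int.toNat_zero, pow_zero, add_zero] at h3 h5
    refine ⟨by omega, by omega, by omega, fun k hk hk' => ?_, fun k hk hk' => ?_, h7⟩
    · have := h4 (k - 2) (by omega) (by omega)
      rw [show k - 2 + 1 = k - 1 by omega, two_pow_unit] at this
      omega
    · rcases (by omega : k = 3 ∨ 4 ≤ k) with rfl | hk4
      · have := h5 (by omega)
        refine ⟨this.1, (hs 3 le_rfl hk' _).1 ?_⟩
        rw [← two_pow_unit (k := 3)]
        exact this.2
      · have := h6 (k - 2) (by omega) (by omega)
        refine ⟨this.1, (hs k hk hk' _).1 ?_⟩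
        rw [← two_pow_unit (k := k), show k - 1 = k - 2 + 1 by omega, show k + 1 = k - 2 + 3 by omega]
        exact this.2
  · rintro ⟨h1, h2, h3, h4, h5, h7⟩
    simp only [sub_self, zero_mul, Int.toNat_zero, pow_zero, add_zero]
    refine ⟨by omega, by omega, by omega, fun k hk hk' => ?_, fun hd => ?_, fun k hk hk' => ?_, h7⟩
    · have := h4 (k + 2) (by omega) (by omega)
      rw [Nat.add_sub_cancel, ← two_pow_unit, show k + 2 - 1 = k + 1 by omega] at this
      omega
    · have := h5 3 le_rfl (by omega)
      refine ⟨this.1, ?_⟩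
      have h := (hs 3 le_rfl (by omega) _).2 this.2
      rw [← two_pow_unit (k := 3)] at h
      exact h
    · have := h5 (k + 2) (by omega) (by omega)
      refine ⟨this.1, ?_⟩
      have h := (hs (k + 2) (by omega) (by omega) _).2 this.2
      rw [← two_pow_unit (k := k + 2)] at h
      exact h

end Hyp

/-! #### Digits -/

/-- The digit of `y` at position `k`. -/
def digit (d : ℕ) (e : ℕ → ℕ) (α y k : ℕ) : ℕ := y / base d e α k % dg d e α k

local notation "Digit" => digit d e α

variable (d e α) in
theorem digit_lt (y k : ℕ) : Digit y k < Radix k := Nat.mod_lt _ (dg_pos d e α k)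

theorem mod_base_succ (y : ℕ) {k : ℕ} (hk : 3 ≤ k) :
    y % Base (k + 1) = y % Base k + Base k * Digit y k := by
  rw [base_succ hk, Nat.mod_mul, digit]

theorem base_dvd_iff (y : ℕ) {k : ℕ} (hk : 3 ≤ k) :
    Base (k + 1) ∣ y ↔ Base k ∣ y ∧ Digit y k = 0 := by
  have h := mod_base_succ (d := d) (e := e) (α := α) y hk
  have hb := base_pos (d := d) (e := e) (α := α) k
  rw [Nat.dvd_iff_mod_eq_zero, h, Nat.add_eq_zero_iff, Nat.mul_eq_zero, ← Nat.dvd_iff_mod_eq_zero]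
  constructor
  · rintro ⟨h1, h2 | h2⟩
    · omega
    · exact ⟨h1, h2⟩
  · rintro ⟨h1, h2⟩
    exact ⟨h1, Or.inr h2⟩

theorem digit_succ_of_not_dvd {y k : ℕ} (h : ¬Base k ∣ y + 1) :
    Digit (y + 1) k = Digit y k := by
  rw [digit, Nat.succ_div, if_neg h, add_zero, digit]

theorem digit_succ_of_dvd {y k : ℕ} (h : Base k ∣ y + 1) :
    (Digit y k + 1 < Radix k ∧ Digit (y + 1) k = Digit y k + 1) ∨
    (Digit y k + 1 = Radix k ∧ Digit (y + 1) k = 0) := by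
  have hl := digit_lt d e α y k
  have : Digit (y + 1) k = (Digit y k + 1) % Radix k := by
    rw [digit, Nat.succ_div, if_pos h, digit, Nat.mod_add_mod]
  rw [this]
  rcases (by omega : Digit y k + 1 < Radix k ∨ Digit y k + 1 = Radix k) with h | h
  · exact Or.inl ⟨h, Nat.mod_eq_of_lt h⟩
  · exact Or.inr ⟨h, by rw [h, Nat.mod_self]⟩

theorem base_dvd_succ_iff (y : ℕ) {k : ℕ} (hk : 3 ≤ k) :
    Base (k + 1) ∣ y + 1 ↔ Base k ∣ y + 1 ∧ Digit y k + 1 = Radix k := by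
  rw [base_dvd_iff _ hk]
  constructor
  · rintro ⟨h1, h2⟩
    have := digit_succ_of_dvd h1
    exact ⟨h1, by omega⟩
  · rintro ⟨h1, h2⟩
    have := digit_succ_of_dvd h1
    exact ⟨h1, by omega⟩

theorem digit_add_mul {j k : ℕ} (hj : 3 ≤ j) (hjk : j < k) (y t : ℕ) :
    Digit (y + Base k * t) j = Digit y j := by
  obtain ⟨r, hr⟩ := base_dvd (d := d) (e := e) (α := α) hjk
  rw [base_succ hj] at hr
  rw [digit, hr, mul_assoc, mul_assoc, Nat.add_mul_div_left _ _ (base_pos j), Nat.add_mul_mod_self_left,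
    digit]

theorem digit_add_self {k y : ℕ} (hy : y < Base k) {t : ℕ} (ht : t < Radix k) :
    Digit (y + Base k * t) k = t := by
  rw [digit, Nat.add_mul_div_left _ _ (base_pos k), Nat.div_eq_of_lt hy, zero_add,
    Nat.mod_eq_of_lt ht]

/-- Digits can be chosen one by one, each depending on the lower ones. -/
theorem exists_digits (C : ℕ → Prop → ℕ → Prop)
    (hC : ∀ k b, 3 ≤ k → k ≤ d → ∃ t < Radix k, C k b t) :
    ∃ y < Tot, ∀ k, 3 ≤ k → k ≤ d → C k (Base k ∣ y) (Digit y k) := by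
  suffices h : ∀ l, 3 ≤ l → l ≤ d + 1 →
      ∃ y < Base l, ∀ k, 3 ≤ k → k < l → C k (Base k ∣ y) (Digit y k) by
    rcases (by omega : 3 ≤ d + 1 ∨ d < 3) with h3 | h3
    · obtain ⟨y, hy, h⟩ := h (d + 1) h3 le_rfl
      exact ⟨y, hy, fun k hk hk' => h k hk (by omega)⟩
    · exact ⟨0, tot_pos, fun k hk hk' => by
        obtain rfl : k = d := by omega
        obtain rfl : k = 3 := by omega
        omega⟩
  intro l hl
  induction l, hl using Nat.le_induction with
  | base => exact fun _ => ⟨0, base_pos _, fun k hk hk' => by omega⟩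
  | succ l hl ih =>
    intro hld
    obtain ⟨y, hy, h⟩ := ih (by omega)
    obtain ⟨t, ht, hCt⟩ := hC l (Base l ∣ y) hl (by omega)
    refine ⟨y + Base l * t, ?_, fun k hk hk' => ?_⟩
    · rw [base_succ hl]
      calc _ < Base l * (t + 1) := by rw [Nat.mul_succ]; omega
        _ ≤ _ := Nat.mul_le_mul_left _ ht
    · have hdvd : Base k ∣ y + Base l * t ↔ Base k ∣ y :=
        (Nat.dvd_add_left (Dvd.dvd.mul_right (base_dvd (by omega)) _))
      rw [hdvd]
      rcases (by omega : k < l ∨ k = l) with hkl | rfl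
      · rw [digit_add_mul hk hkl]
        exact h k hk hkl
      · rw [digit_add_self hy ht]
        exact hCt

theorem Hyp.digit_succ (H : Hyp d e α) {k y : ℕ} (h3 : 3 ≤ k) (hk : k ≤ d)
    (hy : ¬Tot ∣ y + 1) :
    (Gap k * Digit (y + 1) k : ℤ) ≡ Gap k * Digit y k +
      (if Base k ∣ y + 1 then 2 else 0) [ZMOD len d e k] := by
  split_ifs with h
  · have hu := H.unit_eq_two h3 hk h hy
    rw [hu]
    rcases digit_succ_of_dvd h with ⟨h1, h2⟩ | ⟨h1, h2⟩
    · rw [h2]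
      exact congrArg (· % _) (by push_cast; ring)
    · rw [H.len_eq_two_mul h3 hk ((base_dvd_succ_iff y h3).2 ⟨h, h1⟩) hy, h2, ← h1]
      exact Int.modEq_iff_dvd.2 ⟨1, by push_cast; ring⟩
  · rw [digit_succ_of_not_dvd h, add_zero]

/-- The vertex of the cycle `P` with coordinates given by `u`, `X` and the digits of `y`. -/
def node (d : ℕ) (e : ℕ → ℕ) (α : ℕ) (P : Param) (u X y k : ℕ) : ℤ :=
  if k = 1 then u else if k = 2 then P.γ + 2 * X + (u % 2 : ℕ)
  else P.p (k - 2) + P.s (k - 2) * (dg d e α k * unit d e α k) + unit d e α k * digit d e α y k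
    + (u % 2 : ℕ)
    - (if u + 1 = 2 ^ e 1 ∧ X % 2 = 1 ∧ base d e α k ∣ y ∧ unit d e α k = 2 then 2 else 0)

local notation "Node" => node d e α

/-- The value of the digits in the `n`-th pass: they run up and down alternately. -/
def yOf (d : ℕ) (e : ℕ → ℕ) (α n : ℕ) : ℕ :=
  if n / 2 ^ e 1 / tot d e α % 2 = 0 then n / 2 ^ e 1 % tot d e α
  else tot d e α - 1 - n / 2 ^ e 1 % tot d e α

local notation "YOf" => yOf d e α

/-- The start of the `n`-th pass. -/
def start (d : ℕ) (e : ℕ → ℕ) (α : ℕ) (P : Param) (n : ℕ) : ℕ → ℤ :=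
  node d e α P (n % 2 ^ e 1) (n / 2 ^ e 1 / tot d e α) (yOf d e α n)

variable (d e α) in
theorem yOf_lt (n : ℕ) : YOf n < Tot := by
  have h := tot_pos (d := d) (e := e) (α := α)
  have := Nat.mod_lt (n / 2 ^ e 1) h
  unfold yOf
  split_ifs <;> omega

/-- The pass with given coordinates. -/
def time (d : ℕ) (e : ℕ → ℕ) (α u X y : ℕ) : ℕ :=
  2 ^ e 1 * (tot d e α * X + if X % 2 = 0 then y else tot d e α - 1 - y) + u

local notation "Time" => time d e α

theorem time_spec {u X y : ℕ} (hu : u < 2 ^ e 1) (hy : y < Tot) :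
    Time u X y % 2 ^ e 1 = u ∧ Time u X y / 2 ^ e 1 / Tot = X ∧
      YOf (Time u X y) = y := by
  have hr : (if X % 2 = 0 then y else Tot - 1 - y) < Tot := by split_ifs <;> omega
  have h1 : Time u X y / 2 ^ e 1 = Tot * X + if X % 2 = 0 then y else Tot - 1 - y := by
    rw [time, Nat.mul_add_div (by omega), Nat.div_eq_of_lt hu, add_zero]
  have h2 : Time u X y / 2 ^ e 1 / Tot = X := by
    rw [h1, Nat.mul_add_div (by omega), Nat.div_eq_of_lt hr, add_zero]
  refine ⟨by rw [time, Nat.mul_add_mod, Nat.mod_eq_of_lt hu], h2, ?_⟩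
  rw [yOf, h2, h1, Nat.mul_add_mod, Nat.mod_eq_of_lt hr]
  split_ifs <;> omega

variable (d e α) in
theorem eq_time (n : ℕ) :
    n = Time (n % 2 ^ e 1) (n / 2 ^ e 1 / Tot) (YOf n) := by
  have h := tot_pos (d := d) (e := e) (α := α)
  have h1 := Nat.mod_lt (n / 2 ^ e 1) h
  have h2 : (if n / 2 ^ e 1 / Tot % 2 = 0 then YOf n else Tot - 1 - YOf n) =
      n / 2 ^ e 1 % Tot := by
    unfold yOf
    split_ifs <;> omega
  rw [time, h2, Nat.div_add_mod, Nat.div_add_mod]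

theorem start_time (P : Param) {u X y : ℕ} (hu : u < 2 ^ e 1) (hy : y < Tot) :
    start d e α P (Time u X y) = Node P u X y := by
  obtain ⟨h1, h2, h3⟩ := time_spec (X := X) hu hy
  rw [start, h1, h2, h3]

theorem time_lt {Y u X y : ℕ} (hY : 2 ^ α = 2 ^ e 1 * (Tot * (2 * Y))) (hu : u < 2 ^ e 1)
    (hX : X < 2 * Y) (hy : y < Tot) : Time u X y < 2 ^ α := by
  have hr : (if X % 2 = 0 then y else Tot - 1 - y) < Tot := by split_ifs <;> omega
  rw [hY, time]
  generalize (if X % 2 = 0 then y else Tot - 1 - y) = r at hr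
  have h1 : Tot * X + r < Tot * (2 * Y) := by
    calc _ < Tot * (X + 1) := by rw [Nat.mul_succ]; omega
      _ ≤ _ := Nat.mul_le_mul_left _ hX
  calc _ < 2 ^ e 1 * (Tot * X + r + 1) := by rw [Nat.mul_succ]; omega
    _ ≤ _ := Nat.mul_le_mul_left _ h1

theorem time_succ (u X y : ℕ) :
    Time u X y + 1 = Time (u + 1) X y := by
  rw [time, time, add_assoc]

/-- The digits run over after this value of `y`. -/
def Over (d : ℕ) (e : ℕ → ℕ) (α X y : ℕ) : Prop := tot d e α ∣ y + (X + 1) % 2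

local notation "Overflow" => Over d e α

/-- The values of `X` and of `y` before and after a full turn of the first coordinate. -/
def Wrap (d : ℕ) (e : ℕ → ℕ) (α X y X' y' : ℕ) : Prop :=
  (Over d e α X y ∧ X' = X + 1 ∧ y' = y) ∨ (¬Over d e α X y ∧ X % 2 = 0 ∧ X' = X ∧ y' = y + 1) ∨
  (¬Over d e α X y ∧ X % 2 = 1 ∧ X' = X ∧ y = y' + 1)

theorem exists_wrap {u X y : ℕ} (hu : u + 1 = 2 ^ e 1) (hy : y < Tot) :
    ∃ X' y', y' < Tot ∧ Time u X y + 1 = Time 0 X' y' ∧ Wrap d e α X y X' y' := by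
  have key : ∀ a b : ℕ, a + 1 = b → 2 ^ e 1 * a + u + 1 = 2 ^ e 1 * b + 0 := by
    rintro a b rfl
    rw [Nat.mul_succ]
    omega
  unfold Wrap time
  rcases Nat.mod_two_eq_zero_or_one X with hX | hX
  · by_cases h : Overflow X y
    · refine ⟨X + 1, y, hy, key _ _ ?_, Or.inl ⟨h, rfl, rfl⟩⟩
      rw [Over, show (X + 1) % 2 = 1 by omega] at h
      have := Nat.le_of_dvd (by omega) h
      rw [if_pos hX, if_neg (by omega), Nat.mul_succ]
      omega
    · have h' := h
      rw [Over, show (X + 1) % 2 = 1 by omega] at h'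
      have : y + 1 ≠ Tot := fun h => h' (h ▸ dvd_rfl)
      refine ⟨X, y + 1, by omega, key _ _ ?_, Or.inr (Or.inl ⟨h, hX, rfl, rfl⟩)⟩
      rw [if_pos hX, if_pos hX, add_assoc]
  · by_cases h : Overflow X y
    · refine ⟨X + 1, y, hy, key _ _ ?_, Or.inl ⟨h, rfl, rfl⟩⟩
      rw [Over, show (X + 1) % 2 = 0 by omega] at h
      have := Nat.eq_zero_of_dvd_of_lt h (by omega)
      rw [if_neg (by omega), if_pos (by omega), Nat.mul_succ]
      omega
    · have h' := h
      rw [Over, show (X + 1) % 2 = 0 by omega] at h'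
      have : y ≠ 0 := fun h => h' (by rw [h]; exact dvd_zero _)
      refine ⟨X, y - 1, by omega, key _ _ ?_, Or.inr (Or.inr ⟨h, hX, rfl, by omega⟩)⟩
      rw [if_neg (by omega), if_neg (by omega)]
      omega

open Classical in
/-- The direction of the step along the factor at position `p`. -/
noncomputable def sign (d : ℕ) (e : ℕ → ℕ) (α p : ℕ) (j : ℕ → ℤ) : Bool :=
  if p = 1 then true
  else if p = 2 then
    if j 1 + 1 = len d e 1 then
      decide (∀ k, 3 ≤ k → k ≤ d → (j k - 1) / 2 % dg d e α k = dg d e α k - 1)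
    else decide (j 1 % 2 = 0)
  else if j 1 = 0 then
    decide (j 2 / 2 % 2 = 0 ∧ unit d e α p = 2 ∧ ∀ k, 3 ≤ k → k < p → j k / 2 % dg d e α k = 0)
  else if j 1 + 1 = len d e 1 then
    decide (¬((j 2 - 1) / 2 % 2 = 1 ∧ unit d e α p = 2 ∧
      ∀ k, 3 ≤ k → k < p → (j k - 1) / 2 % dg d e α k = dg d e α k - 1))
  else decide (j 1 % 2 = 1)

theorem half_emod_congr {g a b : ℤ} (h : a ≡ b [ZMOD 2 * g]) : a / 2 % g = b / 2 % g := by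
  obtain ⟨t, ht⟩ := Int.modEq_iff_dvd.1 h
  rw [show b = a + 2 * (g * t) by linarith, Int.add_mul_ediv_left _ _ (by norm_num),
    Int.add_mul_emod_self_left]

theorem Hyp.half_emod (H : Hyp d e α) {k : ℕ} (h3 : 3 ≤ k) (hk : k ≤ d) (w r : ℤ) :
    (w % len d e k - r) / 2 % Radix k = (w - r) / 2 % Radix k := by
  obtain ⟨N, hN, hlen⟩ := H.exists_len h3 hk
  rcases unit_cases d e α k with hu | hu
  · rw [H.dg_eq_one h3 hk hu]
    simp
  · refine half_emod_congr (Int.ModEq.sub_right _ ?_)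
    refine Int.ModEq.of_dvd ?_ (Int.mod_modEq w (len d e k))
    rw [hlen, hu]
    push_cast
    exact Dvd.intro _ rfl

theorem node_ge (P : Param) {u X y k : ℕ} (h3 : 3 ≤ k)
    (h : u + 1 = 2 ^ e 1 → X % 2 = 1 → Gap k = 2 → ¬Base k ∣ y) :
    Node P u X y k = P.p (k - 2) + P.s (k - 2) * (Radix k * Gap k)
      + Gap k * Digit y k + (u % 2 : ℕ) := by
  rw [node, if_neg (by omega), if_neg (by omega), if_neg (fun h' => h h'.1 h'.2.1 h'.2.2.2 h'.2.2.1),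
    sub_zero]

theorem node_ge_of_dvd (P : Param) {u X y k : ℕ} (h3 : 3 ≤ k) (hu : u + 1 = 2 ^ e 1)
    (hX : X % 2 = 1) (h : Base k ∣ y) (hunit : Gap k = 2) :
    Node P u X y k = P.p (k - 2) + P.s (k - 2) * (Radix k * Gap k)
      + Gap k * Digit y k + (u % 2 : ℕ) - 2 := by
  rw [node, if_neg (by omega), if_neg (by omega), if_pos ⟨hu, hX, h, hunit⟩]

/-- The digits can be read off from the coordinates. -/
theorem half_digit {g p s x : ℤ} (hp : 0 ≤ p) (hp' : p < 2) (r : ℤ) :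
    (p + s * (g * 2) + 2 * x + 2 * r) / 2 % g = (x + r) % g := by
  have h1 : p + s * (g * 2) + 2 * x + 2 * r = p + 2 * (g * s + (x + r)) := by ring
  rw [h1, Int.add_mul_ediv_left _ _ (by norm_num), Int.ediv_eq_zero_of_lt hp hp', zero_add,
    Int.mul_add_emod_self_left]

variable {P : Param}

theorem Hyp.low_iff (H : Hyp d e α)
    (hp : ∀ k, 3 ≤ k → k ≤ d → 0 ≤ P.p (k - 2) ∧ P.p (k - 2) < Gap k) {X y : ℕ}
    {l : ℕ} (h3 : 3 ≤ l) (hl : l ≤ d + 1) :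
    (∀ k, 3 ≤ k → k < l → Node P 0 X y k / 2 % Radix k = 0) ↔ Base l ∣ y := by
  have h4 := Nat.le_of_dvd (by positivity) H.four_dvd
  induction l, h3 using Nat.le_induction with
  | base => exact ⟨fun _ => by rw [base_three]; exact one_dvd _, fun _ k hk hk' => by omega⟩
  | succ l h3 ih =>
    have ih := ih (by omega)
    rw [base_dvd_iff _ h3]
    have key : Node P 0 X y l / 2 % Radix l = 0 ↔ Digit y l = 0 := by
      rw [node_ge P h3 (fun h => by omega)]
      have hdl := digit_lt d e α y l
      rcases unit_cases d e α l with hu | hu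
      · have := H.dg_eq_one h3 (by omega) hu
        rw [this] at hdl ⊢
        simp
        omega
      · have hp := hp l h3 (by omega)
        rw [hu] at hp ⊢
        have := half_digit (g := Radix l) (s := P.s (l - 2)) (x := Digit y l) hp.1 hp.2 0
        simp only [mul_zero, add_zero] at this
        push_cast
        simp only [add_zero]
        rw [this, Int.emod_eq_of_lt (by omega) (by omega)]
        omega
    constructor
    · intro h
      exact ⟨ih.1 fun k hk hk' => h k hk (by omega), key.1 (h l h3 (by omega))⟩
    · rintro ⟨h1, h2⟩ k hk hk'
      rcases (by omega : k < l ∨ k = l) with h | rfl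
      · exact ih.2 h1 k hk h
      · exact key.2 h2

theorem Hyp.high_iff (H : Hyp d e α)
    (hp : ∀ k, 3 ≤ k → k ≤ d → 0 ≤ P.p (k - 2) ∧ P.p (k - 2) < Gap k) {u X y : ℕ}
    (hu1 : u + 1 = 2 ^ e 1) {l : ℕ} (h3 : 3 ≤ l) (hl : l ≤ d + 1) :
    (∀ k, 3 ≤ k → k < l → (Node P u X y k - 1) / 2 % Radix k = Radix k - 1) ↔
      Base l ∣ y + (X + 1) % 2 := by
  have h4 := H.four_dvd
  have hodd : u % 2 = 1 := by omega
  induction l, h3 using Nat.le_induction with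
  | base => exact ⟨fun _ => by rw [base_three]; exact one_dvd _, fun _ k hk hk' => by omega⟩
  | succ l h3 ih =>
    have key : Base l ∣ y + (X + 1) % 2 →
        ((Node P u X y l - 1) / 2 % Radix l = Radix l - 1 ↔
        Base (l + 1) ∣ y + (X + 1) % 2) := by
      intro hdvd
      have hdl := digit_lt d e α y l
      rcases unit_cases d e α l with hu | hu
      · have := H.dg_eq_one h3 (by omega) hu
        rw [base_succ h3, this, mul_one]
        simp [hdvd]
      · have hp := hp l h3 (by omega)
        rw [hu] at hp
        have hh := half_digit (g := Radix l) (s := P.s (l - 2)) (x := Digit y l) hp.1 hp.2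
        rcases Nat.mod_two_eq_zero_or_one X with hX | hX
        · have hX' : (X + 1) % 2 = 1 := by omega
          rw [hX'] at hdvd ⊢
          rw [node_ge P h3 (fun _ h => by omega), base_dvd_succ_iff y h3, hodd, hu]
          have := hh 0
          simp only [mul_zero, add_zero] at this
          push_cast
          rw [add_sub_cancel_right, this, Int.emod_eq_of_lt (by omega) (by omega)]
          simp only [hdvd, true_and]
          omega
        · have hX' : (X + 1) % 2 = 0 := by omega
          rw [hX', add_zero] at hdvd ⊢
          rw [node_ge_of_dvd P h3 hu1 hX hdvd hu, base_dvd_iff y h3, hodd, hu]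
          have := hh (-1)
          push_cast
          simp only [hdvd, true_and]
          rw [show P.p (l - 2) + P.s (l - 2) * (Radix l * 2) + 2 * Digit y l + 1 - 2 - 1 =
            P.p (l - 2) + P.s (l - 2) * (Radix l * 2) + 2 * Digit y l + 2 * -1 by ring, this]
          rcases Nat.eq_zero_or_pos (Digit y l) with h0 | h0
          · rw [h0]
            have : ((0 : ℕ) + -1 : ℤ) % Radix l = Radix l - 1 := by
              rw [show ((0 : ℕ) + -1 : ℤ) = (Radix l - 1) + Radix l * (-1) by push_cast; ring,
                Int.add_mul_emod_self_left, Int.emod_eq_of_lt (by omega) (by omega)]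
            exact ⟨fun _ => rfl, fun _ => this⟩
          · rw [Int.emod_eq_of_lt (by omega) (by omega)]
            omega
    constructor
    · intro h
      have h1 := (ih (by omega)).1 fun k hk hk' => h k hk (by omega)
      exact (key h1).1 (h l h3 (by omega))
    · intro h k hk hk'
      have h1 := (base_dvd (Nat.le_succ l)).trans h
      rcases (by omega : k < l ∨ k = l) with h2 | rfl
      · exact (ih (by omega)).2 h1 k hk h2
      · exact (key h1).2 h

theorem node_one (u X y : ℕ) : Node P u X y 1 = u := by rw [node, if_pos rfl]

theorem node_two (u X y : ℕ) : Node P u X y 2 = P.γ + 2 * X + (u % 2 : ℕ) := by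
  rw [node, if_neg (by omega), if_pos rfl]

theorem len_one' : len d e 1 = ((2 ^ e 1 : ℕ) : ℤ) := by rw [len_one, z]; push_cast; rfl

theorem Hyp.half_emod_two (H : Hyp d e α) (w r : ℤ) :
    (w % len d e 2 - r) / 2 % 2 = (w - r) / 2 % 2 := by
  have h4 := four_dvd_len H.hd H.he (p := 2) (by omega) H.hd
  exact half_emod_congr ((Int.ModEq.of_dvd h4 (Int.mod_modEq w _)).sub_right _)

theorem Hyp.sign_two (H : Hyp d e α) (hP : Admissible d e α P) {u : ℕ} (hu : u < 2 ^ e 1) (X y : ℕ)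
    (b' : ℕ → ℤ) : sign d e α 2 (fun r => mix false (Node P u X y) b' 0 r % len d e r) =
      true ↔ u + 1 < 2 ^ e 1 ∧ u % 2 = 0 ∨ u + 1 = 2 ^ e 1 ∧ Overflow X y := by
  obtain ⟨-, -, -, hp, -⟩ := (H.admissible_iff P).1 hP
  have hd := H.hd
  have hu' : (u : ℤ) % len d e 1 = u := by
    rw [len_one']; exact Int.emod_eq_of_lt (by omega) (by exact_mod_cast hu)
  simp only [sign, mix, Nat.not_lt_zero, if_false, if_true, ite_two, node_one, hu']
  rw [len_one']
  by_cases h : u + 1 = 2 ^ e 1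
  · have hh := H.high_iff hp (X := X) (y := y) h (l := d + 1) (by omega) le_rfl
    rw [if_pos (by exact_mod_cast h), decide_eq_true_eq, Over, tot, ← hh]
    simp only [h, lt_irrefl, false_and, true_and, false_or]
    constructor
    · intro h k hk hk'
      rw [← H.half_emod hk (by omega)]
      exact h k hk (by omega)
    · intro h k hk hk'
      rw [H.half_emod hk hk']
      exact h k hk (by omega)
  · rw [if_neg (by exact_mod_cast h), decide_eq_true_eq]
    omega

theorem mix_new {b b' : ℕ → ℤ} {p r : ℕ} (hp : 3 ≤ p) (hr : 1 ≤ r) (hrp : r < p) :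
    mix false b b' (p - 1) r = b' r := by
  rw [mix, if_pos]
  have := place_cases hr
  omega

theorem Hyp.sign_ge (H : Hyp d e α) (hP : Admissible d e α P) {u p : ℕ} (hu : u < 2 ^ e 1)
    (hp3 : 3 ≤ p) (hpd : p ≤ d) (X y : ℕ) (b : ℕ → ℤ) :
    sign d e α p (fun r => mix false b (Node P u X y) (p - 1) r % len d e r) = true ↔
      (u = 0 ∧ X % 2 = 0 ∧ Gap p = 2 ∧ Base p ∣ y) ∨
      (u + 1 < 2 ^ e 1 ∧ u % 2 = 1) ∨
      (u + 1 = 2 ^ e 1 ∧ ¬(X % 2 = 1 ∧ Gap p = 2 ∧ Base p ∣ y)) := by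
  obtain ⟨-, hγ, -, hp, -⟩ := (H.admissible_iff P).1 hP
  have hu' : (u : ℤ) % len d e 1 = u := by
    rw [len_one']; exact Int.emod_eq_of_lt (by omega) (by exact_mod_cast hu)
  have h4 := H.four_dvd
  have hpos : 0 < 2 ^ e 1 := by positivity
  have n1 := mix_new (b := b) (b' := Node P u X y) hp3 le_rfl (by omega)
  have n2 := mix_new (b := b) (b' := Node P u X y) hp3 (r := 2) (by omega) (by omega)
  simp only [sign, ite_ge hp3, n1, n2, node_one,
    node_two, hu']
  rw [len_one']
  by_cases h0 : u = 0
  · subst h0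
    have hl := H.low_iff hp (X := X) (y := y) hp3 (by omega)
    have hX := H.half_emod_two (P.γ + 2 * X + 0) 0
    rw [sub_zero] at hX
    rw [Nat.cast_zero, if_pos rfl, decide_eq_true_eq, ← hl, hX]
    have h1 : (P.γ + 2 * (X : ℤ) + 0 - 0) / 2 % 2 = 0 ↔ X % 2 = 0 := by omega
    have h2 : (∀ k, 3 ≤ k → k < p →
        mix false b (Node P 0 X y) (p - 1) k % len d e k / 2 % Radix k = 0) ↔
        ∀ k, 3 ≤ k → k < p → Node P 0 X y k / 2 % Radix k = 0 := by
      refine forall_congr' fun k => forall_congr' fun hk => forall_congr' fun hk' => ?_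
      have := H.half_emod hk (by omega) (Node P 0 X y k) 0
      rw [sub_zero, sub_zero] at this
      rw [mix_new hp3 (by omega) hk', this]
    rw [h1, h2]
    have h3 : ¬ 0 + 1 = 2 ^ e 1 := by omega
    simp [h3]
  · rw [if_neg (by exact_mod_cast h0)]
    by_cases h : u + 1 = 2 ^ e 1
    · have hh := H.high_iff hp (X := X) (y := y) h hp3 (by omega)
      have hX := H.half_emod_two (P.γ + 2 * X + (u % 2 : ℕ)) 1
      rw [if_pos (by exact_mod_cast h), decide_eq_true_eq, hX]
      have h1 : (P.γ + 2 * (X : ℤ) + (u % 2 : ℕ) - 1) / 2 % 2 = 1 ↔ X % 2 = 1 := by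
        have : u % 2 = 1 := by omega
        rw [this]
        push_cast
        omega
      have h2 : (∀ k, 3 ≤ k → k < p → (mix false b (Node P u X y) (p - 1) k % len d e k - 1) / 2
          % Radix k = Radix k - 1) ↔
          ∀ k, 3 ≤ k → k < p → (Node P u X y k - 1) / 2 % Radix k = Radix k - 1 := by
        refine forall_congr' fun k => forall_congr' fun hk => forall_congr' fun hk' => ?_
        rw [mix_new hp3 (by omega) hk', H.half_emod hk (by omega)]
      rw [h1, h2, hh]
      simp only [h0, h, lt_irrefl, false_and, true_and, false_or]
      refine not_congr (and_congr_right fun hX => ?_)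
      rw [show (X + 1) % 2 = 0 by omega, add_zero]
    · rw [if_neg (by exact_mod_cast h), decide_eq_true_eq]
      have h3 : u + 1 < 2 ^ e 1 := by omega
      simp only [h0, h3, h, false_and, true_and, false_or, or_false]
      omega

/-- The change of a coordinate in a turn of the first coordinate. -/
theorem Hyp.node_wrap (H : Hyp d e α) {u X y X' y' k : ℕ} (h3 : 3 ≤ k) (hk : k ≤ d)
    (hu : u + 1 = 2 ^ e 1)
    (h : Wrap d e α X y X' y') :
    Node P 0 X' y' k ≡ Node P u X y k +
      (if X' % 2 = 0 ∧ Gap k = 2 ∧ Base k ∣ y' then 1 else -1) [ZMOD len d e k] := by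
  have h4 := H.four_dvd
  have hodd : u % 2 = 1 := by omega
  rw [node_ge P h3 (u := 0) fun h => by omega]
  rcases h with ⟨hO, rfl, rfl⟩ | ⟨hO, hX, rfl, rfl⟩ | ⟨hO, hX, rfl, rfl⟩
  · rcases Nat.mod_two_eq_zero_or_one X with hX | hX
    · rw [node_ge P h3 (u := u) fun _ h => by omega, if_neg (by omega), hodd]
      exact congrArg (· % _) (by push_cast; ring)
    · rw [Over, show (X + 1) % 2 = 0 by omega, add_zero] at hO
      have hdvd : Base k ∣ y' := (base_dvd (by omega)).trans hO
      rcases unit_cases d e α k with hu1 | hu1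
      · rw [node_ge P h3 (u := u) fun _ _ h => by omega, if_neg (by omega), hodd]
        exact congrArg (· % _) (by push_cast; ring)
      · rw [node_ge_of_dvd P h3 hu hX hdvd hu1, if_pos ⟨by omega, hu1, hdvd⟩, hodd]
        exact congrArg (· % _) (by push_cast; ring)
  · rw [Over, show (X' + 1) % 2 = 1 by omega] at hO
    rw [node_ge P h3 (u := u) fun _ h => by omega, hodd]
    have hs := H.digit_succ h3 hk hO
    have hu2 := H.unit_eq_two h3 hk (t := y + 1)
    have : (if X' % 2 = 0 ∧ Gap k = 2 ∧ Base k ∣ y + 1 then (1 : ℤ) else -1) =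
        (if Base k ∣ y + 1 then 2 else 0) - 1 := by
      by_cases h : Base k ∣ y + 1
      · rw [if_pos h, if_pos ⟨hX, hu2 h hO, h⟩]; rfl
      · rw [if_neg h, if_neg (fun h' => h h'.2.2)]; rfl
    rw [this]
    refine ((hs.add_left _).add_right _).trans (congrArg (· % _) ?_)
    push_cast
    ring
  · rw [Over, show (X' + 1) % 2 = 0 by omega, add_zero] at hO
    have hs := H.digit_succ h3 hk hO
    rw [if_neg (by omega)]
    by_cases h : Base k ∣ y' + 1
    · rw [node_ge_of_dvd P h3 hu hX h (H.unit_eq_two h3 hk h hO), hodd]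
      rw [if_pos h] at hs
      refine Int.ModEq.trans ?_ ((((hs.add_left _).add_right _).sub_right _).add_right _).symm
      exact congrArg (· % _) (by push_cast; ring)
    · rw [node_ge P h3 (u := u) fun _ _ _ => h, hodd]
      rw [if_neg h] at hs
      refine Int.ModEq.trans ?_ (((hs.add_left _).add_right _).add_right _).symm
      exact congrArg (· % _) (by push_cast; ring)

theorem Hyp.step_eq (H : Hyp d e α) (hP : Admissible d e α P) (n : ℕ) {p : ℕ} (h1 : 1 ≤ p) (h2 : p ≤ d) :
    start d e α P (n + 1) p ≡ start d e α P n p + (if sign d e α p fun r =>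
      mix false (start d e α P n) (start d e α P (n + 1)) (place false p) r % len d e r then 1 else -1)
      [ZMOD len d e p] := by
  classical
  obtain ⟨u, X, y, hu, hy, rfl⟩ : ∃ u X y, u < 2 ^ e 1 ∧ y < Tot ∧ n = Time u X y :=
    ⟨_, _, _, Nat.mod_lt _ (by positivity), yOf_lt d e α n, eq_time d e α n⟩
  have hpos : 0 < 2 ^ e 1 := by positivity
  have h4 := H.four_dvd
  rcases (by omega : u + 1 < 2 ^ e 1 ∨ u + 1 = 2 ^ e 1) with hu1 | hu1
  · rw [time_succ, start_time P hu hy, start_time P hu1 hy]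
    rcases (by omega : p = 1 ∨ p = 2 ∨ 3 ≤ p) with rfl | rfl | h3
    · rw [sign, if_pos rfl, node_one, node_one]
      exact congrArg (· % _) (by push_cast; rfl)
    · have hs := H.sign_two hP hu X y (Node P (u + 1) X y)
      rw [show place false 2 = 0 from rfl, node_two, node_two]
      simp only [hs]
      refine congrArg (· % _) ?_
      split_ifs <;> omega
    · have hs := H.sign_ge hP hu1 h3 h2 X y (Node P u X y)
      rw [place_ge (by omega)]
      simp only [hs]
      rw [node_ge P (u := u) h3 fun h => by omega]
      refine congrArg (· % _) ?_
      by_cases h : u + 1 + 1 = 2 ^ e 1 ∧ X % 2 = 1 ∧ Gap p = 2 ∧ Base p ∣ y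
      · rw [node_ge_of_dvd P h3 h.1 h.2.1 h.2.2.2 h.2.2.1, if_neg (by omega)]
        have : (u + 1) % 2 = u % 2 + 1 := by omega
        rw [this]
        push_cast
        ring
      · rw [node_ge P h3 fun a b c d => h ⟨a, b, c, d⟩]
        have : ((u + 1 = 0 ∧ X % 2 = 0 ∧ Gap p = 2 ∧ Base p ∣ y) ∨
          (u + 1 + 1 < 2 ^ e 1 ∧ (u + 1) % 2 = 1) ∨
          (u + 1 + 1 = 2 ^ e 1 ∧ ¬(X % 2 = 1 ∧ Gap p = 2 ∧ Base p ∣ y))) ↔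
          (u + 1) % 2 = 1 := by
          clear hs
          by_cases h5 : u + 1 + 1 = 2 ^ e 1
          · have : ¬(X % 2 = 1 ∧ Gap p = 2 ∧ Base p ∣ y) := fun h6 => h ⟨h5, h6⟩
            simp only [this, h5]
            simp
            omega
          · have : u + 1 + 1 < 2 ^ e 1 := by omega
            simp [h5, this]
        simp only [this]
        split_ifs <;> omega
  · obtain ⟨X', y', hy', ht, hw⟩ := exists_wrap (X := X) hu1 hy
    rw [ht, start_time P hu hy, start_time P hpos hy']
    rcases (by omega : p = 1 ∨ p = 2 ∨ 3 ≤ p) with rfl | rfl | h3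
    · rw [sign, if_pos rfl, node_one, node_one, len_one', ← hu1]
      exact Int.modEq_iff_dvd.2 ⟨1, by push_cast; simp⟩
    · have hs := H.sign_two hP hu X y (Node P 0 X' y')
      rw [show place false 2 = 0 from rfl, node_two, node_two]
      simp only [hs]
      refine congrArg (· % _) ?_
      rcases hw with ⟨hO, rfl, rfl⟩ | ⟨hO, hX, rfl, rfl⟩ | ⟨hO, hX, rfl, rfl⟩
      · rw [if_pos (Or.inr ⟨hu1, hO⟩)]
        push_cast
        omega
      · rw [if_neg (fun h => h.elim (fun h => by omega) (fun h => hO h.2))]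
        push_cast
        omega
      · rw [if_neg (fun h => h.elim (fun h => by omega) (fun h => hO h.2))]
        push_cast
        omega
    · have hs := H.sign_ge hP hpos h3 h2 X' y' (Node P u X y)
      rw [place_ge (by omega)]
      have := H.node_wrap (P := P) h3 h2 hu1 hw
      have h5 : ¬0 + 1 = 2 ^ e 1 := by omega
      simp only [h5, true_and, Nat.zero_mod, zero_ne_one, and_false, false_and, or_false] at hs
      simp only [hs]
      exact this

theorem code_bounds {U g N p s x : ℤ} (hp : 0 ≤ p) (hp' : p < U) (hs : 0 ≤ s)
    (hs' : s * (g * U) < U * g * N) (hx : 0 ≤ x) (hx' : x < g) :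
    0 ≤ p + s * (g * U) + U * x ∧ p + s * (g * U) + U * x < U * g * N := by
  have hg : 0 < g := by omega
  have hU : 0 < U := by omega
  have hgU : 0 < g * U := mul_pos hg hU
  have h1 : s < N := by
    rw [show U * g * N = N * (g * U) by ring] at hs'
    exact lt_of_mul_lt_mul_right hs' hgU.le
  have h2 : (s + 1) * (g * U) ≤ N * (g * U) := mul_le_mul_of_nonneg_right (by omega) hgU.le
  have h3 : U * (x + 1) ≤ U * g := mul_le_mul_of_nonneg_left (by omega) hU.le
  refine ⟨by positivity, ?_⟩
  nlinarith

theorem code_inj {U g N p s x p' s' x' : ℤ} (hp : 0 ≤ p ∧ p < U) (hs : 0 ≤ s ∧ s * (g * U) < U * g * N)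
    (hx : 0 ≤ x ∧ x < g) (hp' : 0 ≤ p' ∧ p' < U) (hs' : 0 ≤ s' ∧ s' * (g * U) < U * g * N)
    (hx' : 0 ≤ x' ∧ x' < g)
    (h : p + s * (g * U) + U * x ≡ p' + s' * (g * U) + U * x' [ZMOD U * g * N]) :
    p = p' ∧ s = s' ∧ x = x' := by
  have b := code_bounds hp.1 hp.2 hs.1 hs.2 hx.1 hx.2
  have b' := code_bounds hp'.1 hp'.2 hs'.1 hs'.2 hx'.1 hx'.2
  have h1 := eq_of_modEq_of_lt h b.1 b.2 b'.1 b'.2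
  have key : ∀ {p s x : ℤ}, 0 ≤ p ∧ p < U → 0 ≤ x ∧ x < g →
      (p + s * (g * U) + U * x) % U = p ∧ (p + s * (g * U) + U * x) / U % g = x ∧
      (p + s * (g * U) + U * x) / U / g = s := by
    intro p s x hp hx
    have h2 : p + s * (g * U) + U * x = p + U * (x + g * s) := by ring
    have h3 : (p + s * (g * U) + U * x) / U = x + g * s := by
      rw [h2, Int.add_mul_ediv_left _ _ (by omega), Int.ediv_eq_zero_of_lt hp.1 hp.2, zero_add]
    refine ⟨?_, ?_, ?_⟩
    · rw [h2, Int.add_mul_emod_self_left, Int.emod_eq_of_lt hp.1 hp.2]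
    · rw [h3, Int.add_mul_emod_self_left, Int.emod_eq_of_lt hx.1 hx.2]
    · rw [h3, Int.add_mul_ediv_left _ _ (by omega), Int.ediv_eq_zero_of_lt hx.1 hx.2, zero_add]
  obtain ⟨a1, a2, a3⟩ := key (s := s) hp hx
  obtain ⟨b1, b2, b3⟩ := key (s := s') hp' hx'
  rw [h1] at a1 a2 a3
  exact ⟨a1.symm.trans b1, a3.symm.trans b3, a2.symm.trans b2⟩

theorem code_surj {U g N W : ℤ} (hU : 0 < U) (hg : 0 < g) (hN : 0 < N) :
    ∃ p s x, (0 ≤ p ∧ p < U) ∧ (0 ≤ s ∧ s * (g * U) < U * g * N) ∧ (0 ≤ x ∧ x < g) ∧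
      p + s * (g * U) + U * x ≡ W [ZMOD U * g * N] := by
  have hpos : 0 < U * g * N := by positivity
  set V := W % (U * g * N) with hV
  have hV0 : 0 ≤ V := Int.emod_nonneg _ hpos.ne'
  have hV1 : V < U * g * N := Int.emod_lt_of_pos _ hpos
  have h1 := Int.mul_ediv_add_emod V U
  have h2 := Int.mul_ediv_add_emod (V / U) g
  have hp0 := Int.emod_nonneg V hU.ne'
  have hx0 := Int.emod_nonneg (V / U) hg.ne'
  have heq : V % U + V / U / g * (g * U) + U * (V / U % g) = V := by
    linear_combination h1 + U * h2
  refine ⟨V % U, V / U / g, V / U % g, ⟨hp0, Int.emod_lt_of_pos _ hU⟩, ⟨?_, ?_⟩,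
    ⟨hx0, Int.emod_lt_of_pos _ hg⟩, ?_⟩
  · exact Int.ediv_nonneg (Int.ediv_nonneg hV0 hU.le) hg.le
  · nlinarith [mul_nonneg hU.le hx0]
  · rw [heq]
    exact Int.mod_modEq _ _

theorem Hyp.start_inj (H : Hyp d e α) {P' : Param} (hP : Admissible d e α P)
    (hP' : Admissible d e α P') {n n' : ℕ} (hn : n < 2 ^ α) (hn' : n' < 2 ^ α)
    (h : ∀ p, 1 ≤ p → p ≤ d → start d e α P n p ≡ start d e α P' n' p [ZMOD len d e p]) :
    P = P' ∧ n = n' := by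
  classical
  have hd := H.hd
  obtain ⟨hl, hγ, ht, hp, hs, hoff⟩ := (H.admissible_iff P).1 hP
  obtain ⟨hl', hγ', ht', hp', hs', hoff'⟩ := (H.admissible_iff P').1 hP'
  obtain ⟨Y, hY0, hY, hY2⟩ := H.two_pow_eq
  have hlt : ∀ n < 2 ^ α, n / 2 ^ e 1 / Tot < 2 * Y := by
    intro n hn
    rw [hY, ← mul_assoc] at hn
    rw [Nat.div_div_eq_div_mul]
    exact Nat.div_lt_of_lt_mul hn
  have hX := hlt n hn
  have hX' := hlt n' hn'
  have hy := yOf_lt d e α n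
  have hy' := yOf_lt d e α n'
  have hu := Nat.mod_lt n (show 0 < 2 ^ e 1 by positivity)
  have hu' := Nat.mod_lt n' (show 0 < 2 ^ e 1 by positivity)
  have en := eq_time d e α n
  have en' := eq_time d e α n'
  simp only [start] at h
  generalize n / 2 ^ e 1 / Tot = X at *
  generalize n' / 2 ^ e 1 / Tot = X' at *
  generalize YOf n = y at *
  generalize YOf n' = y' at *
  generalize n % 2 ^ e 1 = u at *
  generalize n' % 2 ^ e 1 = u' at *
  have hu1 : u = u' := by
    have := h 1 le_rfl (by omega)
    rw [node_one, node_one, len_one'] at this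
    exact_mod_cast eq_of_modEq_of_lt this (by omega) (by exact_mod_cast hu) (by omega)
      (by exact_mod_cast hu')
  subst hu1
  have h2 : P.γ + 2 * (X : ℤ) = P'.γ + 2 * X' := by
    have := h 2 (by omega) hd
    rw [node_two, node_two, len_two, z] at this
    have h4 : (2 : ℤ) ^ e d = 4 * (Y : ℤ) := by exact_mod_cast hY2
    rw [h4] at this
    exact eq_of_modEq_of_lt (Int.ModEq.add_right_cancel' _ this) (by omega) (by omega) (by omega)
      (by omega)
  have hXX : X = X' := by omega
  subst hXX
  have key : ∀ l, 3 ≤ l → l ≤ d + 1 → y % Base l = y' % Base l ∧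
      ∀ k, 3 ≤ k → k < l → P.p (k - 2) = P'.p (k - 2) ∧ P.s (k - 2) = P'.s (k - 2) := by
    intro l hl
    induction l, hl using Nat.le_induction with
    | base => exact fun _ => ⟨by rw [base_three, Nat.mod_one, Nat.mod_one], fun k hk hk' => by omega⟩
    | succ l hl ih =>
      intro hld
      obtain ⟨h3, h4⟩ := ih (by omega)
      have hdvd : Base l ∣ y ↔ Base l ∣ y' := by
        rw [Nat.dvd_iff_mod_eq_zero, Nat.dvd_iff_mod_eq_zero, h3]
      obtain ⟨N, hN, hlen⟩ := H.exists_len hl (by omega)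
      have h5 := h l (by omega) (by omega)
      simp only [node, ite_ge (show 3 ≤ l by omega), hdvd] at h5
      have h6 := Int.ModEq.add_right_cancel' _
        (Int.ModEq.add_right_cancel' _ (by simpa only [sub_eq_add_neg] using h5))
      have b1 := hs l hl (by omega)
      have b2 := hs' l hl (by omega)
      rw [hlen] at h6 b1 b2
      push_cast at h6 b1 b2
      have c1 := digit_lt d e α y l
      have c2 := digit_lt d e α y' l
      obtain ⟨g1, g2, g3⟩ := code_inj (hp l hl (by omega)) b1 ⟨by omega, by omega⟩
        (hp' l hl (by omega)) b2 ⟨by omega, by omega⟩ h6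
      refine ⟨?_, fun k hk hk' => ?_⟩
      · rw [mod_base_succ _ hl, mod_base_succ _ hl, h3, Int.ofNat_inj.1 g3]
      · rcases (by omega : k < l ∨ k = l) with hkl | rfl
        · exact h4 k hk hkl
        · exact ⟨g1, g2⟩
  obtain ⟨k1, k2⟩ := key (d + 1) (by omega) le_rfl
  have hyy : y = y' := by
    rw [← tot, Nat.mod_eq_of_lt hy, Nat.mod_eq_of_lt hy'] at k1
    exact k1
  subst hyy
  refine ⟨Param.ext' (by omega) (by omega) (by omega) ?_ ?_, en.trans en'.symm⟩ <;> funext k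
  · by_cases hk : k < 1 ∨ d - 2 < k
    · rw [(hoff k hk).1, (hoff' k hk).1]
    · exact (k2 (k + 2) (by omega) (by omega)).1
  · by_cases hk : k < 1 ∨ d - 2 < k
    · rw [(hoff k hk).2, (hoff' k hk).2]
    · exact (k2 (k + 2) (by omega) (by omega)).2

theorem Hyp.start_surj (H : Hyp d e α) {j : ℕ → ℤ}
    (hj : ∀ p, 1 ≤ p → p ≤ d → 0 ≤ j p ∧ j p < len d e p) :
    ∃ P, Admissible d e α P ∧ ∃ n < 2 ^ α, ∀ p, 1 ≤ p → p ≤ d →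
      start d e α P n p ≡ j p [ZMOD len d e p] := by
  classical
  have hd := H.hd
  obtain ⟨Y, hY0, hY, hY2⟩ := H.two_pow_eq
  have h1 := hj 1 le_rfl (by omega)
  obtain ⟨u, hu⟩ := Int.eq_ofNat_of_zero_le h1.1
  have hul : u < 2 ^ e 1 := by
    rw [hu, len_one'] at h1
    exact_mod_cast h1.2
  have hlen2 : len d e 2 = 4 * (Y : ℤ) := by
    rw [len_two, z]
    exact_mod_cast hY2
  have hV0 := Int.emod_nonneg (j 2 - (u % 2 : ℕ)) (show (4 * Y : ℤ) ≠ 0 by omega)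
  have hV1 := Int.emod_lt_of_pos (j 2 - (u % 2 : ℕ)) (show (0 : ℤ) < 4 * Y by omega)
  have hV2 := Int.mod_modEq (j 2 - (u % 2 : ℕ)) (4 * Y)
  generalize (j 2 - (u % 2 : ℕ)) % (4 * Y) = V at *
  obtain ⟨X, hX⟩ := Int.eq_ofNat_of_zero_le (show 0 ≤ V / 2 by omega)
  let C : ℕ → Prop → ℕ → Prop := fun k b t => ∃ p s : ℤ, (0 ≤ p ∧ p < Gap k) ∧
    (0 ≤ s ∧ s * (Radix k * Gap k) < len d e k) ∧
    p + s * (Radix k * Gap k) + Gap k * t + (u % 2 : ℕ)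
    - (if u + 1 = 2 ^ e 1 ∧ X % 2 = 1 ∧ b ∧ Gap k = 2 then 2 else 0) ≡ j k [ZMOD len d e k]
  obtain ⟨y, hy, hC⟩ := exists_digits (d := d) (e := e) (α := α) C (by
    intro k b h3 hk
    obtain ⟨N, hN, hlen⟩ := H.exists_len h3 hk
    have hU : 0 < Gap k := by
      rcases unit_cases d e α k with h | h <;> omega
    obtain ⟨p, s, x, hp, hs, hx, h⟩ := code_surj (U := Gap k) (g := Radix k) (N := N)
      (W := j k - (u % 2 : ℕ) +
        (if u + 1 = 2 ^ e 1 ∧ X % 2 = 1 ∧ b ∧ Gap k = 2 then 2 else 0))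
      (by omega) (by have := dg_pos d e α k; omega) (by omega)
    obtain ⟨t, rfl⟩ := Int.eq_ofNat_of_zero_le hx.1
    refine ⟨t, by omega, p, s, hp, ?_, ?_⟩
    · rw [hlen]; push_cast; exact hs
    · rw [hlen]
      push_cast
      refine ((h.add_right _).sub_right _).trans (congrArg (· % _) ?_)
      push_cast
      ring)
  choose! p s hp hs hc using hC
  let P : Param := ⟨0, V % 2, 0, fun k => if k < 1 ∨ d - 2 < k then 0 else p (k + 2),
    fun k => if k < 1 ∨ d - 2 < k then 0 else s (k + 2)⟩
  have hPp : ∀ k, 3 ≤ k → k ≤ d → P.p (k - 2) = p k ∧ P.s (k - 2) = s k := by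
    intro k hk hk'
    simp only [P]
    rw [if_neg (by omega), if_neg (by omega), Nat.sub_add_cancel (by omega)]
    exact ⟨rfl, rfl⟩
  refine ⟨P, (H.admissible_iff P).2 ⟨rfl, by simp only [P]; omega, rfl, fun k hk hk' => ?_,
    fun k hk hk' => ?_, fun k hk => ⟨if_pos hk, if_pos hk⟩⟩, Time u X y,
    time_lt hY hul (by omega) hy, fun k hk hk' => ?_⟩
  · rw [(hPp k hk hk').1]; exact hp k hk hk'
  · rw [(hPp k hk hk').2]; exact hs k hk hk'
  · rw [start_time P hul hy]
    rcases (by omega : k = 1 ∨ k = 2 ∨ 3 ≤ k) with rfl | rfl | h3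
    · rw [node_one, hu]
    · rw [node_two, hlen2, show P.γ + 2 * (X : ℤ) = V by simp only [P]; omega]
      exact (hV2.add_right _).trans (congrArg (· % _) (by ring))
    · rw [node, if_neg (by omega), if_neg (by omega), (hPp k h3 hk').1, (hPp k h3 hk').2]
      convert hc k h3 hk'

/-- The family of sequences of passes. -/
noncomputable def stageData (H : Hyp d e α) : StageData d e (Index d e α) (2 ^ α) where
  bz P := start d e α P.1
  fl _ := false
  flag _ := false
  sg := sign d e α
  flag_off _ _ _ _ _ _ := rfl
  sg_off p j j' h1 h2 h := by
    have hd := H.hd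
    unfold sign
    rcases (by omega : p = 1 ∨ p = 2 ∨ 3 ≤ p) with rfl | rfl | h3
    · rfl
    · rw [h 1 (by omega) (by omega) (by omega)]
      have : (∀ k, 3 ≤ k → k ≤ d → (j k - 1) / 2 % Radix k = Radix k - 1) ↔
          ∀ k, 3 ≤ k → k ≤ d → (j' k - 1) / 2 % Radix k = Radix k - 1 :=
        forall_congr' fun k => forall_congr' fun hk => forall_congr' fun hk' => by
          rw [h k (by omega) hk' (by omega)]
      simp only [this, ite_two, if_true]
      split_ifs <;> rw [decide_eq_decide]
    · rw [h 1 (by omega) (by omega) (by omega), h 2 (by omega) (by omega) (by omega)]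
      have t1 : (∀ k, 3 ≤ k → k < p → (j k - 1) / 2 % Radix k = Radix k - 1) ↔
          ∀ k, 3 ≤ k → k < p → (j' k - 1) / 2 % Radix k = Radix k - 1 :=
        forall_congr' fun k => forall_congr' fun hk => forall_congr' fun hk' => by
          rw [h k (by omega) (by omega) (by omega)]
      have t2 : (∀ k, 3 ≤ k → k < p → j k / 2 % Radix k = 0) ↔
          ∀ k, 3 ≤ k → k < p → j' k / 2 % Radix k = 0 :=
        forall_congr' fun k => forall_congr' fun hk => forall_congr' fun hk' => by
          rw [h k (by omega) (by omega) (by omega)]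
      simp only [t1, t2, ite_ge h3]
      split_ifs <;> rw [decide_eq_decide]
  pl_eq _ _ _ _ _ := rfl
  step_eq P n p h1 h2 := H.step_eq P.2 n h1 h2
  per P n p h1 h2 := by
    obtain ⟨Y, hY0, hY, hY2⟩ := H.two_pow_eq
    have e1 : n + 2 ^ α = 2 ^ e 1 * (Tot * (2 * Y)) + n := by rw [hY]; ring
    have e2 : (n + 2 ^ α) / 2 ^ e 1 = Tot * (2 * Y) + n / 2 ^ e 1 := by
      rw [e1, Nat.mul_add_div (by positivity)]
    have e3 : (n + 2 ^ α) / 2 ^ e 1 / Tot = 2 * Y + n / 2 ^ e 1 / Tot := by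
      rw [e2, Nat.mul_add_div tot_pos]
    have e4 : YOf (n + 2 ^ α) = YOf n := by
      rw [yOf, e3, e2, Nat.mul_add_mod, Nat.mul_add_mod, yOf]
    rw [start, start, e4, e3]
    have e5 : (n + 2 ^ α) % 2 ^ e 1 = n % 2 ^ e 1 := by rw [e1, Nat.mul_add_mod]
    rw [e5]
    rcases (by omega : p = 1 ∨ p = 2 ∨ 3 ≤ p) with rfl | rfl | h3
    · rw [node_one, node_one]
    · rw [node_two, node_two, len_two, z]
      have h4 : (2 : ℤ) ^ e d = 4 * (Y : ℤ) := by exact_mod_cast hY2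
      rw [h4]
      exact Int.modEq_iff_dvd.2 ⟨-1, by push_cast; ring⟩
    · simp only [node, Nat.mul_add_mod, ite_ge h3]
      rfl
  fl_per _ := rfl
  inj P P' n n' hn hn' h := by
    obtain ⟨h1, h2⟩ := H.start_inj P.2 P'.2 hn hn' h
    exact ⟨Subtype.ext h1, h2⟩
  surj j hj := by
    obtain ⟨P, hP, n, hn, h⟩ := H.start_surj hj
    exact ⟨⟨P, hP⟩, n, hn, h⟩

/-- The counters `x k` are the digits of `y`. -/
abbrev HasDigits (d : ℕ) (e : ℕ → ℕ) (α : ℕ) (x : ℕ → ℤ) (y : ℕ) : Prop :=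
  ∀ k, 3 ≤ k → k ≤ d → x k = digit d e α y k

local notation "Digits" => HasDigits d e α

theorem Hyp.X_eq (H : Hyp d e α) {x : ℕ → ℤ} {y : ℕ}
    (hx : Digits x y) {l : ℕ} (h3 : 3 ≤ l) (hl : l ≤ d + 1) :
    X d e α x (l - 3) = if Base l ∣ y + 1 then 1 else 0 := by
  induction l, h3 using Nat.le_induction with
  | base => simp [X, base_three]
  | succ l h3 ih =>
    have hdl := digit_lt d e α y l
    have ih := ih (by omega)
    rw [X, show l + 1 - 3 + 2 = l - 3 + 2 + 1 by omega, Finset.prod_Icc_succ_top (by omega), ← X, ih,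
      show l - 3 + 2 + 1 = l by omega, hx l h3 (by omega), H.A_ge h3 (by omega)]
    have : ((Digit y l : ℤ) + 1) / Radix l = if Digit y l + 1 = Radix l then 1 else 0 := by
      split_ifs with h
      · rw [← h]; push_cast; exact Int.ediv_self (by omega)
      · exact Int.ediv_eq_zero_of_lt (by omega) (by omega)
    rw [this]
    have := base_dvd_succ_iff (d := d) (e := e) (α := α) y h3
    simp only [this]
    split_ifs <;> simp_all

theorem Hyp.Ψ_eq (H : Hyp d e α) {x : ℕ → ℤ} {y : ℕ}
    (hx : Digits x y) {l : ℕ} (h3 : 3 ≤ l) (hl : l ≤ d + 1) :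
    Ψ d e α x (l - 3) = if Base l ∣ y then 1 else 0 := by
  induction l, h3 using Nat.le_induction with
  | base => simp [Ψ, base_three]
  | succ l h3 ih =>
    have hdl := digit_lt d e α y l
    have ih := ih (by omega)
    rw [Ψ, show l + 1 - 3 + 2 = l - 3 + 2 + 1 by omega, Finset.prod_Icc_succ_top (by omega), ← Ψ, ih,
      show l - 3 + 2 + 1 = l by omega, hx l h3 (by omega), H.A_ge h3 (by omega)]
    have : 1 - -(-(Digit y l : ℤ) / Radix l) = if Digit y l = 0 then 1 else 0 := by
      split_ifs with h
      · rw [h]; simp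
      · have : -(Digit y l : ℤ) / Radix l = -1 := by
          rw [Int.ediv_eq_iff_of_pos (by omega)]
          constructor <;> omega
        rw [this]; rfl
    rw [this]
    have := base_dvd_iff (d := d) (e := e) (α := α) y h3
    simp only [this]
    split_ifs <;> simp_all

theorem r₂_eq {x : ℕ → ℤ} {w : ℕ} (h : x 2 = w) : r₂ x = (w % 2 : ℕ) := by
  rw [r₂, h]
  omega

open Classical in
theorem Hyp.R₁_eq (H : Hyp d e α) {x : ℕ → ℤ} {w y : ℕ} (hw : x 2 = w)
    (hx : Digits x y) :
    R₁ d e α x = if Overflow w y then 1 else 0 := by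
  have hd := H.hd
  have one_over : Tot = 1 → Overflow w y := fun h => by rw [Over, h]; exact one_dvd _
  rw [R₁, r₂_eq hw]
  rcases (by omega : d = 2 ∨ 3 ≤ d) with rfl | hd3
  · rw [η_of_lt (by omega), if_pos (one_over base_three)]
    ring
  · rw [η_of_le hd3, Hyp.ηα_eq (k := 3)]
    rcases unit_cases d e α 3 with hu | hu
    · rw [hu, if_pos]
      · push_cast; ring
      · refine one_over ?_
        rw [tot, H.base_eq_of_le (k := 3) le_rfl (by omega) le_rfl, base_three]
        by_contra h
        rw [unit, if_pos (by omega)] at hu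
        omega
    · have h1 := H.X_eq hx (l := d + 1) (by omega) le_rfl
      have h2 := H.Ψ_eq hx (l := d + 1) (by omega) le_rfl
      rw [show d + 1 - 3 = d - 2 by omega] at h1 h2
      rw [hu, h1, h2, ← tot, Over]
      rcases Nat.mod_two_eq_zero_or_one w with h | h
      · rw [h, show (w + 1) % 2 = 1 by omega]
        push_cast
        ring_nf
      · rw [h, show (w + 1) % 2 = 0 by omega]
        push_cast
        ring_nf

theorem Hyp.R₁_cases (H : Hyp d e α) {x : ℕ → ℤ} {w y : ℕ} (hw : x 2 = w)
    (hx : Digits x y) :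
    (R₁ d e α x = 1 ∧ Overflow w y) ∨ (R₁ d e α x = 0 ∧ ¬Overflow w y ∧ 3 ≤ d ∧ ηα d e α 2 = 1) := by
  classical
  have h := H.R₁_eq hw hx
  have hd := H.hd
  by_cases hO : Overflow w y
  · exact Or.inl ⟨by rw [h, if_pos hO], hO⟩
  · rw [if_neg hO] at h
    have h' := h
    have hd3 : 3 ≤ d := by
      by_contra h3
      rw [R₁, η_of_lt (by omega)] at h
      norm_num at h
    refine Or.inr ⟨h', hO, hd3, ?_⟩
    by_contra h2
    have h0 : ηα d e α 2 = 0 := by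
      unfold ηα at h2 ⊢
      split_ifs at h2 ⊢ <;> simp_all
    rw [R₁, η_of_le hd3, h0] at h
    norm_num at h

theorem Hyp.two_mul_digit (H : Hyp d e α) {y k : ℕ} (h3 : 3 ≤ k) (hk : k ≤ d) :
    (Gap k * Digit y k : ℤ) = 2 * Digit y k := by
  rcases unit_cases d e α k with hu | hu
  · have := digit_lt d e α y k
    rw [H.dg_eq_one h3 hk hu] at this
    rw [show Digit y k = 0 by omega]
    simp
  · rw [hu]; rfl

theorem Hyp.start₁_ge (H : Hyp d e α) {m x : ℕ → ℤ} {p : ℕ} (h3 : 3 ≤ p) (hp : p ≤ d) :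
    start₁ d e α P m x p =
      P.p (p - 2) + P.s (p - 2) * (Radix p * Gap p) + m p + 2 * x p := by
  simp only [start₁, ite_ge h3, H.A₂_eq,
    H.A_ge h3 hp, two_pow_unit]
  simp [sgn]
  ring

theorem Hyp.step₁_ge (H : Hyp d e α) {m : ℕ → ℤ} {p : ℕ} (h3 : 3 ≤ p) :
    step₁ d e α P m p = prev m p - m p := by
  simp only [step₁, ite_ge h3, H.A₂_eq]
  simp [sgn]

theorem Hyp.arcMatch₁ (H : Hyp d e α) (hP : Admissible d e α P) {m x : ℕ → ℤ} {c w x₁ y : ℕ}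
    (hc : c < 2 * d) (hm : IsState d c m) (hw : x 2 = w)
    (hx1 : x 1 = x₁) (hx1' : 2 * x₁ + 4 ≤ 2 ^ e 1)
    (hx : Digits x y)
    {u q : ℕ} (hu : (c < d ∧ u = 2 * x₁ ∧ q = c) ∨ (d ≤ c ∧ u = 2 * x₁ + 1 ∧ q = c - d)) :
    ArcMatch d e false (Node P u w y) (Node P (u + 1) w y) q
      (start₁ d e α P m x) (step₁ d e α P m) := by
  have hd := H.hd
  obtain ⟨hl, hγ, ht, -, -, -⟩ := (H.admissible_iff _).1 hP
  intro p hp hpd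
  have m1 := state_one (by omega) hm
  have m2 := state_two (by omega) hm
  have a1 := allOne_state (by omega) hm
  have a0 := allZero_state (by omega) hc hm
  have e2 := H.A₂_eq
  suffices h : start₁ d e α P m x p = mix false (Node P u w y) (Node P (u + 1) w y) q p ∧
      start₁ d e α P m x p + step₁ d e α P m p =
        mix false (Node P u w y) (Node P (u + 1) w y) (q + 1) p by
    exact ⟨congrArg (· % _) h.1, congrArg (· % _) h.2⟩
  rcases (by omega : p = 1 ∨ p = 2 ∨ 3 ≤ p) with rfl | rfl | hp3
  · have c0 := stateAt_cases d c 0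
    have c1 := stateAt_cases d c 1
    rcases (by omega : d = 2 ∨ 3 ≤ d) with hd2 | hd3
    · simp only [start₁, step₁, if_true, e2, η_of_lt (show d < 3 by omega), m1, m2, mix, node_one, hx1,
        hl, show place false 1 = 1 from rfl]
      clear m1 m2 a0 a1 e2 hm
      rcases c0 with ⟨v0, w0⟩ | ⟨v0, w0⟩ <;> rcases c1 with ⟨v1, w1⟩ | ⟨v1, w1⟩ <;> try omega
      all_goals
        rw [v0, v1]
        simp [sgn]; (try split_ifs) <;> omega
    · have cd := stateAt_cases d c (d - 1)
      have md := state_ge hm hd3 le_rfl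
      simp only [start₁, step₁, if_true, e2, η_of_le hd3, m1, m2, md, mix, node_one, hx1,
        hl, show place false 1 = 1 from rfl]
      clear m1 m2 md a0 a1 e2 hm
      rcases c0 with ⟨v0, w0⟩ | ⟨v0, w0⟩ <;> rcases c1 with ⟨v1, w1⟩ | ⟨v1, w1⟩ <;>
      rcases cd with ⟨vd, wd⟩ | ⟨vd, wd⟩ <;> try omega
      all_goals
        rw [v0, v1, vd]
        simp [sgn]; (try split_ifs) <;> omega
  · simp only [start₁, step₁, if_true, ite_two, e2, m2, χ, a0, a1, mix, node_two,
      hw, show place false 2 = 0 from rfl]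
    clear m1 m2 a0 a1 e2 hm
    have c0 := stateAt_cases d c 0
    rcases c0 with ⟨v0, w0⟩ | ⟨v0, w0⟩ <;> rw [v0] <;> simp <;> split_ifs <;> omega
  · have m3 := prev_state (by omega) hm hp3 hpd
    have m4 := state_ge hm hp3 hpd
    have hdg := H.two_mul_digit (y := y) hp3 hpd
    have c2 := stateAt_cases d c (p - 2)
    have c3 := stateAt_cases d c (p - 1)
    rw [H.start₁_ge hp3 hpd, H.step₁_ge hp3, mix, mix, place_ge hp3, node_ge P hp3 fun h => by omega,
      node_ge P hp3 fun h => by omega, m3, m4, hx p hp3 hpd, hdg]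
    clear m1 m2 m3 m4 a0 a1 e2 hm hdg
    generalize P.s (p - 2) * (↑(Radix p) * ↑(Gap p)) = D
    split_ifs <;> omega

/-- The first coordinate of the arcs of the third set for `k ≥ 3`. -/
theorem Hyp.start₃_ge (H : Hyp d e α) {m x : ℕ → ℤ} {p : ℕ} (h3 : 3 ≤ p) (hp : p ≤ d) :
    start₃ d e α P m x p =
      P.p (p - 2) + P.s (p - 2) * (Radix p * Gap p)
      + (1 - 2 * (Gap p - 1) * r₂ x * Ψ d e α x (p - 3)) * m p + 2 * x p
      + 2 * η d (p + 1) * (Gap p - 1) * (1 - R₁ d e α x)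
        * ((1 - r₂ x) * X d e α x (p - 3) - r₂ x * Ψ d e α x (p - 3)) * (1 - m p) * m d := by
  rcases h3.lt_or_eq with h | rfl
  · simp only [start₃, ite_ge h3,
      if_neg (show p ≠ 3 by omega), H.A_ge h3 hp, two_pow_unit]
    rw [ηα_eq (k := p)]
    ring
  · have h2 : ηα d e α 2 = Gap 3 - 1 := ηα_eq (k := 3)
    have h4 : (2 : ℤ) ^ (ηα d e α 2).toNat = Gap 3 := two_pow_unit (k := 3)
    simp only [start₃, ite_ge le_rfl, if_true,
      H.A_ge (k := 3) le_rfl hp, H.A₁_eq, sub_self, add_zero, h4, zero_mul, Nat.reduceSub]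
    rw [h2, show sgn 0 = 1 from rfl]
    ring

theorem Hyp.step₃_ge (H : Hyp d e α) {m x : ℕ → ℤ} {p : ℕ} (h3 : 3 ≤ p) :
    step₃ d e α P m x p = sgn ((Gap p - 1) * ((1 - R₁ d e α x) *
      ((1 - r₂ x) * X d e α x (p - 3) + r₂ x * Ψ d e α x (p - 3)) *
      ((1 - r₂ x) * m p + r₂ x * (1 - m p)) + R₁ d e α x * r₂ x)) * (prev m p - m p) := by
  rcases h3.lt_or_eq with h | rfl
  · simp only [step₃, ite_ge h3,
      if_neg (show p ≠ 3 by omega), ηα_eq (k := p), R, S, prev, show p - 1 - 2 = p - 3 by omega,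
      Nat.sub_add_cancel (show 1 ≤ p by omega)]
  · have h2 : ηα d e α 2 = Gap 3 - 1 := ηα_eq (k := 3)
    simp only [step₃, ite_ge le_rfl, if_true, h2, R, S,
      prev, H.A₁_eq, sub_self, zero_mul, add_zero]

variable {m x : ℕ → ℤ} {c w y : ℕ}

theorem Hyp.start₃_one (H : Hyp d e α) (hl : P.l = 0) (ht : P.t = 0) :
    start₃ d e α P m x 1 = (2 ^ e 1 : ℕ) - 2 + m 1 + η d 3 * (2 * m d * (1 - m 1)) := by
  simp only [start₃, if_true, E₃, H.A₁_eq, H.A₂_eq, H.A_three, hl, ht]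
  simp [sgn]
  ring

theorem Hyp.step₃_one (H : Hyp d e α) :
    step₃ d e α P m x 1 = (1 - m 1) * m 2 + (1 - m 2) * m 1 := by
  simp only [step₃, if_true, E₃, F₃, H.A₁_eq, H.A₂_eq]
  simp [sgn]

theorem Hyp.start₃_two (H : Hyp d e α) :
    start₃ d e α P m x 2 = m 2 + P.γ + 2 * x 2 + 2 * (1 - m 2) * m 1 +
      η d 3 * (2 * ((1 - m 1) * m d
        - ηα d e α 2 * (1 - R₁ d e α x) * (m 1 * (1 - m 2) + m d * (1 - m 1)))) := by
  simp only [start₃, if_true, ite_two, E₃, F₃, H.A₁_eq, H.A₂_eq]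
  ring

theorem Hyp.step₃_two (H : Hyp d e α) :
    step₃ d e α P m x 2 = allZero d m + sgn (R₁ d e α x + 1) * allOne d m := by
  simp only [step₃, if_true, ite_two, E₃, F₃, H.A₁_eq, H.A₂_eq]
  ring

theorem Hyp.node_last (H : Hyp d e α) {u p : ℕ} (hp3 : 3 ≤ p) (hpd : p ≤ d) (hu : u + 1 = 2 ^ e 1) :
    Node P u w y p = P.p (p - 2) + P.s (p - 2) * (Radix p * Gap p) + 2 * Digit y p + 1
      - 2 * (Gap p - 1) * (w % 2 : ℕ) * (if Base p ∣ y then 1 else 0) := by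
  have h4 := H.four_dvd
  have hodd : u % 2 = 1 := by omega
  have hdg := H.two_mul_digit (y := y) hp3 hpd
  by_cases h : w % 2 = 1 ∧ Base p ∣ y ∧ Gap p = 2
  · rw [node_ge_of_dvd P hp3 hu h.1 h.2.1 h.2.2, hodd, hdg, h.1, if_pos h.2.1, h.2.2]
    push_cast; ring
  · rw [node_ge P hp3 fun _ a b c => h ⟨a, c, b⟩, hodd, hdg]
    have : ((Gap p : ℤ) - 1) * (w % 2 : ℕ) * (if Base p ∣ y then 1 else 0) = 0 := by
      rcases unit_cases d e α p with hu1 | hu1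
      · rw [hu1]; simp
      · rcases Nat.mod_two_eq_zero_or_one w with h' | h'
        · rw [h']; simp
        · rw [if_neg (fun h2 => h ⟨h', h2, hu1⟩)]; simp
    rw [Nat.cast_one]
    linear_combination 2 * this

/-- The value of the last move, for the two halves of a period of the state. -/
theorem state_last (hd : 2 ≤ d) (hm : IsState d c m) {r : ℤ} (hr : stateAt d c (d - 1) = r) :
    d = 2 ∧ η d 3 = 0 ∨ 3 ≤ d ∧ η d 3 = 1 ∧ m d = r := by
  rcases (by omega : d = 2 ∨ 3 ≤ d) with h | h
  · exact Or.inl ⟨h, η_of_lt (by omega)⟩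
  · exact Or.inr ⟨h, η_of_le h, by rw [state_ge hm h le_rfl, hr]⟩

theorem Hyp.arcMatch₃_fst (H : Hyp d e α) (hP : Admissible d e α P) (hc : c < d)
    (hm : IsState d c m) (hw : x 2 = w)
    (hx : Digits x y) {u : ℕ} (hu : u + 2 = 2 ^ e 1) :
    ArcMatch d e false (Node P u w y) (Node P (u + 1) w y) c
      (start₃ d e α P m x) (step₃ d e α P m x) := by
  have hd := H.hd
  have h4 := H.four_dvd
  obtain ⟨hl, hγ, ht, -, -, -⟩ := (H.admissible_iff _).1 hP
  have m1 := state_one (by omega) hm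
  have m2 := state_two (by omega) hm
  have a1 := allOne_state (by omega) hm
  have a0 := allZero_state (by omega) (by omega : c < 2 * d) hm
  have hmd := state_last hd hm (r := 0) (if_neg (by omega))
  refine ArcMatch.of_eq fun p hp hpd => ?_
  have c0 := stateAt_cases d c 0
  have c1 := stateAt_cases d c 1
  rcases (by omega : p = 1 ∨ p = 2 ∨ 3 ≤ p) with rfl | rfl | hp3
  · rw [H.start₃_one hl ht, H.step₃_one, mix, mix, show place false 1 = 1 from rfl, node_one, node_one,
      m1, m2, ← hu]
    clear m1 m2 a1 a0 hm hx
    have : η d 3 * (2 * m d * (1 - stateAt d c 1)) = 0 := by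
      rcases hmd with h | h
      · rw [h.2, zero_mul]
      · rw [h.2.2]; ring
    rw [this]
    rcases c0 with ⟨v0, w0⟩ | ⟨v0, w0⟩ <;> rcases c1 with ⟨v1, w1⟩ | ⟨v1, w1⟩ <;> try omega
    all_goals
      rw [v0, v1]
      push_cast
      split_ifs <;> omega
  · rw [H.start₃_two, H.step₃_two, mix, mix, show place false 2 = 0 from rfl, node_two, node_two,
      m1, m2, a0, a1, hw, if_neg (by omega : c ≠ d)]
    clear m1 m2 a1 a0 hm hx
    have : (η d 3 * (2 * ((1 - stateAt d c 1) * m d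
        - ηα d e α 2 * (1 - R₁ d e α x) * (stateAt d c 1 * (1 - stateAt d c 0) +
          m d * (1 - stateAt d c 1))))) = 0 := by
      have : stateAt d c 1 * (1 - stateAt d c 0) = 0 := by
        rcases c0 with ⟨v0, w0⟩ | ⟨v0, w0⟩
        · rw [v0]; ring
        · rw [show stateAt d c 1 = 0 from if_neg (by omega)]; ring
      rw [this]
      rcases hmd with h | h
      · rw [h.2, zero_mul]
      · rw [h.2.2]; ring
    rw [this]
    rcases c0 with ⟨v0, w0⟩ | ⟨v0, w0⟩ <;> rcases c1 with ⟨v1, w1⟩ | ⟨v1, w1⟩ <;> try omega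
    all_goals
      rw [v0, v1]
      split_ifs <;> omega
  · have m3 := prev_state (by omega) hm hp3 hpd
    have m4 := state_ge hm hp3 hpd
    have hdg := H.two_mul_digit (y := y) hp3 hpd
    have c2 := stateAt_cases d c (p - 2)
    have c3 := stateAt_cases d c (p - 1)
    have hmd : m d = 0 := by omega
    have hΨ := H.Ψ_eq hx hp3 (by omega)
    have hX := H.X_eq hx hp3 (by omega)
    have hR := H.R₁_cases hw hx
    have hr := r₂_eq hw
    have hO : w % 2 = 1 → Overflow w y → Base p ∣ y := by
      intro hw h
      rw [Over, show (w + 1) % 2 = 0 by omega] at h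
      exact (base_dvd (by omega)).trans h
    rw [H.start₃_ge hp3 hpd, H.step₃_ge hp3, mix, mix, place_ge hp3,
      node_ge P (u := u) hp3 fun h => by omega, m3, m4, hx p hp3 hpd, hdg, hmd, hΨ, hX, hr]
    rw [H.node_last hp3 hpd hu]
    have heven : u % 2 = 0 := by omega
    rw [heven]
    clear m1 m2 m3 m4 a0 a1 hm hdg hX hΨ hx hP H hmd c0 c1 hγ h4 hr
    generalize P.s (p - 2) * (↑(Radix p) * ↑(Gap p)) = D
    have hcase : (c + 1 < p ∧ stateAt d c (p - 2) = 0 ∧ stateAt d c (p - 1) = 0) ∨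
        (c + 1 = p ∧ stateAt d c (p - 2) = 1 ∧ stateAt d c (p - 1) = 0) ∨
        (p ≤ c ∧ stateAt d c (p - 2) = 1 ∧ stateAt d c (p - 1) = 1) := by omega
    clear c2 c3
    rcases hcase with ⟨h1, h2, h3⟩ | ⟨h1, h2, h3⟩ | ⟨h1, h2, h3⟩
    · rw [h2, h3, if_neg (show ¬p - 1 < c by omega), if_neg (show ¬p - 1 < c + 1 by omega)]
      constructor <;> push_cast <;> ring
    · rw [h2, h3, if_neg (show ¬p - 1 < c by omega), if_pos (show p - 1 < c + 1 by omega)]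
      refine ⟨by push_cast; ring, ?_⟩
      rcases unit_cases d e α p with hu1 | hu1
      · rw [hu1]; norm_num [sgn]
      · rw [hu1]
        rcases Nat.mod_two_eq_zero_or_one w with hw2 | hw2
        · rw [hw2]; norm_num [sgn]
        · rw [hw2]
          by_cases hy : Base p ∣ y
          · rw [if_pos hy]
            rcases hR with ⟨hR, -⟩ | ⟨hR, -⟩ <;> rw [hR] <;> norm_num [sgn]
            all_goals ring
          · rw [if_neg hy]
            rcases hR with ⟨hR, hR'⟩ | ⟨hR, -⟩
            · exact absurd (hO hw2 hR') hy
            · rw [hR]; norm_num [sgn]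
    · rw [h2, h3, if_pos (show p - 1 < c by omega), if_pos (show p - 1 < c + 1 by omega)]
      constructor <;> ring

/-- The values that govern a step in a turn of the first coordinate. -/
theorem Hyp.wrap_cases (H : Hyp d e α) (hw : x 2 = w)
    (hx : Digits x y) {w' y' p : ℕ} (hp3 : 3 ≤ p) (hpd : p ≤ d)
    (h : Wrap d e α w y w' y') {ρ r ξ ψ U ε : ℤ}
    (hρ : R₁ d e α x = ρ) (hr : (w % 2 : ℕ) = r) (hξ : (if Base p ∣ y + 1 then 1 else 0) = ξ)
    (hψ : (if Base p ∣ y then 1 else 0) = ψ) (hU : (Gap p : ℤ) = U)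
    (hε : (if w' % 2 = 0 ∧ Gap p = 2 ∧ Base p ∣ y' then 1 else -1) = ε) :
    (ρ = 1 ∧ r = 0 ∧ ε = -1) ∨ (ρ = 1 ∧ r = 1 ∧ ψ = 1 ∧ ε = 2 * U - 3) ∨
    (ρ = 0 ∧ r = 0 ∧ ξ = 1 ∧ U = 2 ∧ ε = 1) ∨ (ρ = 0 ∧ r = 0 ∧ ξ = 0 ∧ ε = -1) ∨
    (ρ = 0 ∧ r = 1 ∧ ψ = 1 ∧ U = 2 ∧ ε = -1) ∨ (ρ = 0 ∧ r = 1 ∧ ψ = 0 ∧ ε = -1) := by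
  subst hρ hr hξ hψ hU hε
  have hR := H.R₁_cases hw hx
  have hu2 : ∀ t, Base p ∣ t → ¬Tot ∣ t → Gap p = 2 :=
    fun t => H.unit_eq_two hp3 hpd
  rcases h with ⟨h, rfl, rfl⟩ | ⟨h, h6, rfl, rfl⟩ | ⟨h, h6, rfl, rfl⟩
  · have hR : R₁ d e α x = 1 := by
      rcases hR with ⟨hR, -⟩ | ⟨-, hR, -⟩
      · exact hR
      · exact absurd h hR
    rcases Nat.mod_two_eq_zero_or_one w with hw2 | hw2
    · rw [if_neg (show ¬((w + 1) % 2 = 0 ∧ _) from fun h => by omega), hw2]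
      exact Or.inl ⟨hR, rfl, rfl⟩
    · rw [Over, show (w + 1) % 2 = 0 by omega] at h
      have hy : Base p ∣ y' := (base_dvd (by omega)).trans h
      rw [if_pos hy, hw2]
      refine Or.inr (Or.inl ⟨hR, rfl, rfl, ?_⟩)
      rcases unit_cases d e α p with hu1 | hu1
      · rw [if_neg (fun h => by omega), hu1]; rfl
      · rw [if_pos ⟨by omega, hu1, hy⟩, hu1]; rfl
  · have hR : R₁ d e α x = 0 := by
      rcases hR with ⟨-, hR⟩ | ⟨hR, -⟩
      · exact absurd hR h
      · exact hR
    rw [Over, show (w' + 1) % 2 = 1 by omega] at h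
    rw [h6]
    by_cases hy : Base p ∣ y + 1
    · have := hu2 _ hy h
      rw [if_pos hy, if_pos ⟨rfl, this, hy⟩, this]
      exact Or.inr (Or.inr (Or.inl ⟨hR, rfl, rfl, rfl, rfl⟩))
    · rw [if_neg hy, if_neg (fun h => hy h.2.2)]
      exact Or.inr (Or.inr (Or.inr (Or.inl ⟨hR, rfl, rfl, rfl⟩)))
  · have hR : R₁ d e α x = 0 := by
      rcases hR with ⟨-, hR⟩ | ⟨hR, -⟩
      · exact absurd hR h
      · exact hR
    rw [Over, show (w' + 1) % 2 = 0 by omega] at h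
    rw [if_neg (show ¬(w' % 2 = 0 ∧ _) from fun h => by omega), h6]
    by_cases hy : Base p ∣ y' + 1
    · rw [if_pos hy, hu2 _ hy h]
      exact Or.inr (Or.inr (Or.inr (Or.inr (Or.inl ⟨hR, rfl, rfl, rfl, rfl⟩))))
    · rw [if_neg hy]
      exact Or.inr (Or.inr (Or.inr (Or.inr (Or.inr ⟨hR, rfl, rfl, rfl⟩))))

theorem wrap_arith {ρ r ξ ψ U ε : ℤ} (hU : U = 1 ∨ U = 2)
    (h : (ρ = 1 ∧ r = 0 ∧ ε = -1) ∨ (ρ = 1 ∧ r = 1 ∧ ψ = 1 ∧ ε = 2 * U - 3) ∨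
    (ρ = 0 ∧ r = 0 ∧ ξ = 1 ∧ U = 2 ∧ ε = 1) ∨ (ρ = 0 ∧ r = 0 ∧ ξ = 0 ∧ ε = -1) ∨
    (ρ = 0 ∧ r = 1 ∧ ψ = 1 ∧ U = 2 ∧ ε = -1) ∨ (ρ = 0 ∧ r = 1 ∧ ψ = 0 ∧ ε = -1)) :
    sgn ((U - 1) * ((1 - ρ) * ((1 - r) * ξ + r * ψ) * ((1 - r) * 1 + r * (1 - 1)) + ρ * r)) = -ε ∧
    2 * (U - 1) * (1 - ρ) * ((1 - r) * ξ - r * ψ) = 1 - 2 * (U - 1) * r * ψ + ε := by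
  rcases h with ⟨rfl, rfl, rfl⟩ | ⟨rfl, rfl, rfl, rfl⟩ | ⟨rfl, rfl, rfl, rfl, rfl⟩ | ⟨rfl, rfl, rfl, rfl⟩ |
    ⟨rfl, rfl, rfl, rfl, rfl⟩ | ⟨rfl, rfl, rfl, rfl⟩ <;> rcases hU with hU | hU <;>
  norm_num [sgn, hU]

theorem Hyp.arcMatch₃_snd (H : Hyp d e α) (hP : Admissible d e α P) (hcd : d ≤ c) (hc : c < 2 * d)
    (hm : IsState d c m) (hw : x 2 = w)
    (hx : Digits x y) {u w' y' : ℕ} (hu : u + 1 = 2 ^ e 1)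
    (h : Wrap d e α w y w' y') :
    ArcMatch d e false (Node P u w y) (Node P 0 w' y') (c - d)
      (start₃ d e α P m x) (step₃ d e α P m x) := by
  have hd := H.hd
  have h4 := H.four_dvd
  obtain ⟨hl, hγ, ht, -, -, -⟩ := (H.admissible_iff _).1 hP
  have m1 := state_one (by omega) hm
  have m2 := state_two (by omega) hm
  have a1 := allOne_state (by omega) hm
  have a0 := allZero_state (by omega) hc hm
  have hmd := state_last hd hm (r := 1) (if_pos (by omega))
  have c0 := stateAt_cases d c 0
  have c1 := stateAt_cases d c 1
  have hR := H.R₁_cases hw hx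
  have hodd : u % 2 = 1 := by omega
  refine ArcMatch.congr (T := fun p => if p = 1 then (2 ^ e 1 : ℕ) else if p = 2 then P.γ + 2 * w' else
    Node P u w y p + (if w' % 2 = 0 ∧ Gap p = 2 ∧ Base p ∣ y' then 1 else -1))
    (fun p hp hpd => ?_) fun p hp hpd => ?_
  · rcases (by omega : p = 1 ∨ p = 2 ∨ 3 ≤ p) with rfl | rfl | hp3
    · rw [if_pos rfl, node_one, len_one']
      exact Int.modEq_iff_dvd.2 ⟨-1, by simp⟩
    · rw [if_neg (by omega), if_pos rfl, node_two]
      exact congrArg (· % _) (by simp)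
    · rw [if_neg (by omega), if_neg (by omega)]
      exact (H.node_wrap hp3 hpd hu h).symm
  rcases (by omega : p = 1 ∨ p = 2 ∨ 3 ≤ p) with rfl | rfl | hp3
  · rw [H.start₃_one hl ht, H.step₃_one, mix, mix, show place false 1 = 1 from rfl, node_one,
      m1, m2, if_pos rfl, ← hu]
    clear m1 m2 a1 a0 hm hx hR h
    have hz : η d 3 * (2 * m d * (1 - stateAt d c 1)) = 2 * (1 - stateAt d c 1) := by
      rcases hmd with h | h
      · rw [h.2, show stateAt d c 1 = 1 from if_pos (by omega)]; ring
      · rw [h.2.2, h.2.1]; ring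
    rw [hz]
    rcases c0 with ⟨v0, w0⟩ | ⟨v0, w0⟩ <;> rcases c1 with ⟨v1, w1⟩ | ⟨v1, w1⟩ <;> try omega
    all_goals
      rw [v0, v1]
      push_cast
      split_ifs <;> omega
  · rw [H.start₃_two, H.step₃_two, mix, mix, show place false 2 = 0 from rfl, node_two,
      m1, m2, a0, a1, hw, if_neg (by omega : c ≠ 0), ite_two, if_pos rfl, hodd]
    have hw' : (w' : ℤ) = w + R₁ d e α x := by
      rcases hR with ⟨hR, hR'⟩ | ⟨hR, hR', -⟩ <;> rw [hR] <;>
      rcases h with ⟨h, h2, -⟩ | ⟨h, -, h2, -⟩ | ⟨h, -, h2, -⟩ <;>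
      first | exact absurd hR' h | exact absurd h hR' | (rw [h2]; push_cast; ring)
    have hz : (η d 3 * (2 * ((1 - stateAt d c 1) * m d
        - ηα d e α 2 * (1 - R₁ d e α x) * (stateAt d c 1 * (1 - stateAt d c 0) +
          m d * (1 - stateAt d c 1))))) = 2 * ((1 - stateAt d c 1) - (1 - R₁ d e α x) *
            (stateAt d c 1 * (1 - stateAt d c 0) + (1 - stateAt d c 1))) := by
      rcases hmd with h | h
      · rw [h.2, show stateAt d c 1 = 1 from if_pos (by omega)]
        rcases hR with ⟨hR, -⟩ | ⟨-, -, h3, -⟩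
        · rw [hR]; ring
        · omega
      · rw [h.2.2, h.2.1]
        rcases hR with ⟨hR, -⟩ | ⟨hR, -, -, h3⟩
        · rw [hR]; ring
        · rw [hR, h3]; ring
    rw [hz, hw']
    clear m1 m2 a1 a0 hm hx h hz hw'
    rcases hR with ⟨hR, -⟩ | ⟨hR, -⟩ <;> rw [hR] <;>
    rcases c0 with ⟨v0, w0⟩ | ⟨v0, w0⟩ <;> rcases c1 with ⟨v1, w1⟩ | ⟨v1, w1⟩ <;> try omega
    all_goals
      rw [v0, v1]
      simp [sgn]
      (try split_ifs) <;> omega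
  · have m3 := prev_state (by omega) hm hp3 hpd
    have m4 := state_ge hm hp3 hpd
    have c2 := stateAt_cases d c (p - 2)
    have c3 := stateAt_cases d c (p - 1)
    have hmd : m d = 1 := by omega
    have hΨ := H.Ψ_eq hx hp3 (by omega)
    have hX := H.X_eq hx hp3 (by omega)
    have hr := r₂_eq hw
    rw [H.start₃_ge hp3 hpd, H.step₃_ge hp3, mix, mix, place_ge hp3, m3, m4, hx p hp3 hpd, hmd, hΨ,
      hX, hr, ite_ge hp3]
    have hcase : (c - d + 1 < p ∧ stateAt d c (p - 2) = 1 ∧ stateAt d c (p - 1) = 1) ∨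
        (c - d + 1 = p ∧ stateAt d c (p - 2) = 0 ∧ stateAt d c (p - 1) = 1) ∨
        (p ≤ c - d ∧ stateAt d c (p - 2) = 0 ∧ stateAt d c (p - 1) = 0 ∧ η d (p + 1) = 1) := by
      rcases (by omega : p ≤ c - d ∨ c - d < p) with h | h
      · exact Or.inr (Or.inr ⟨h, by omega, by omega, η_of_le (by omega)⟩)
      · omega
    have hwrap := H.wrap_cases hw hx hp3 hpd h rfl rfl rfl rfl rfl rfl
    clear m1 m2 m3 m4 a0 a1 hm hX hΨ hx hP hmd c0 c1 c2 c3 hγ hr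
    have hU : (Gap p : ℤ) = 1 ∨ (Gap p : ℤ) = 2 := by
      exact_mod_cast unit_cases d e α p
    obtain ⟨k1, k2⟩ := wrap_arith hU hwrap
    rw [H.node_last hp3 hpd hu]
    clear hwrap hR h
    generalize P.s (p - 2) * (↑(Radix p) * ↑(Gap p)) = D
    generalize (if w' % 2 = 0 ∧ Gap p = 2 ∧ Base p ∣ y' then (1 : ℤ) else -1) = ε at *
    generalize (if Base p ∣ y then (1 : ℤ) else 0) = ψ at *
    generalize (if Base p ∣ y + 1 then (1 : ℤ) else 0) = ξ at *
    rcases hcase with ⟨h1, h2, h3⟩ | ⟨h1, h2, h3⟩ | ⟨h1, h2, h3, h5⟩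
    · rw [h2, h3, if_neg (show ¬p - 1 < c - d by omega), if_neg (show ¬p - 1 < c - d + 1 by omega)]
      constructor <;> ring
    · rw [h2, h3, if_neg (show ¬p - 1 < c - d by omega), if_pos (show p - 1 < c - d + 1 by omega), k1]
      constructor <;> ring
    · rw [h2, h3, if_pos (show p - 1 < c - d by omega), if_pos (show p - 1 < c - d + 1 by omega), h5]
      constructor <;> linear_combination k2

theorem isCycleDecomposition (H : Hyp d e α) : Decomposes d e α := by
  have hd := H.hd
  have h4 := H.four_dvd
  have hpos : 0 < 2 ^ e 1 := by positivity
  obtain ⟨Y, hY0, hY, hY2⟩ := H.two_pow_eq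
  have hE : ∀ P : Index d e α, edges d e α P.1 =
      ((stageData H).toPassFamily (by omega)).edgesOf P := by
    intro P
    have hr2 : ∀ x, Range₂ d e α x ↔ 0 ≤ x 2 ∧ x 2 < 2 * Y := by
      intro x
      have hz : z e d = 4 * (Y : ℤ) := by rw [z]; exact_mod_cast hY2
      rw [Range₂, H.A₂_eq, hz]
      simp only [Int.toNat_one, pow_one]
      omega
    have hdigit : ∀ x, Range₃ d e α x →
        ∃ y < Tot, Digits x y := by
      intro x hx
      refine exists_digits (fun k _ t => x k = t) fun k _ h3 hk => ?_
      have := hx k h3 hk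
      rw [H.A_ge h3 hk] at this
      obtain ⟨t, ht⟩ := Int.eq_ofNat_of_zero_le this.1
      exact ⟨t, by omega, ht⟩
    have hrange : ∀ (x : ℕ → ℤ) (y : ℕ), (Digits x y) → Range₃ d e α x := by
      intro x y hx k h3 hk
      have := digit_lt d e α y k
      rw [hx k h3 hk, H.A_ge h3 hk]
      omega
    have hmatch : ∀ {u w y u' w' y' q j δ}, u < 2 ^ e 1 → u' < 2 ^ e 1 → y < Tot →
        y' < Tot → Time u w y + 1 = Time u' w' y' →
        ArcMatch d e false (Node P.1 u w y) (Node P.1 u' w' y') q j δ →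
        ArcMatch d e ((stageData H).toPassData.fl (Time u w y))
          ((stageData H).toPassData.bz P (Time u w y))
          ((stageData H).toPassData.bz P (Time u w y + 1)) q j δ := by
      intro u w y u' w' y' q j δ hu hu' hy hy' ht h
      change ArcMatch d e false (start d e α P.1 _) (start d e α P.1 _) q j δ
      rwa [ht, start_time _ hu hy, start_time _ hu' hy']
    refine PassData.edges_eq _ _ P P.1 ?_ ?_
    · rintro j δ ⟨m, x, hm, hx, h⟩
      obtain ⟨c, hc, hm⟩ := (isMove_iff (by omega) m).1 hm
      have hx := (hr2 x).1 hx
      obtain ⟨w, hw⟩ := Int.eq_ofNat_of_zero_le hx.1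
      have hA₂ := H.A₂_eq
      have hw2 : w < 2 * Y := by omega
      rcases h with ⟨-, h1, h3, rfl, rfl⟩ | ⟨-, h, -⟩ | ⟨h3, rfl, rfl⟩ | ⟨h, -⟩
      · obtain ⟨y, hy, hx3⟩ := hdigit x h3
        obtain ⟨x₁, hx₁⟩ := Int.eq_ofNat_of_zero_le h1.1
        have h1 := h1.2
        rw [H.A_three] at h1
        have hx1 : 2 * x₁ + 4 ≤ 2 ^ e 1 := by omega
        rcases (by omega : c < d ∨ d ≤ c) with hcd | hcd
        · exact ⟨_, time_lt hY (by omega) hw2 hy, c, hcd, hmatch (by omega) (by omega) hy hy (time_succ ..)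
            (H.arcMatch₁ P.2 hc hm hw hx₁ hx1 hx3 (Or.inl ⟨hcd, rfl, rfl⟩))⟩
        · exact ⟨_, time_lt hY (by omega) hw2 hy, c - d, by omega, hmatch (by omega) (by omega) hy hy (time_succ ..)
            (H.arcMatch₁ P.2 hc hm hw hx₁ hx1 hx3 (Or.inr ⟨hcd, rfl, rfl⟩))⟩
      · omega
      · obtain ⟨y, hy, hx3⟩ := hdigit x h3
        rcases (by omega : c < d ∨ d ≤ c) with hcd | hcd
        · exact ⟨_, time_lt (u := 2 ^ e 1 - 2) hY (by omega) hw2 hy, c, hcd, hmatch (by omega) (by omega) hy hy (time_succ ..)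
            (H.arcMatch₃_fst P.2 hcd hm hw hx3 (by omega))⟩
        · obtain ⟨w', y', hy', ht, hor⟩ := exists_wrap (u := 2 ^ e 1 - 1) (X := w) (by omega) hy
          exact ⟨_, time_lt hY (by omega) hw2 hy, c - d, by omega, hmatch (by omega) hpos hy hy' ht
            (H.arcMatch₃_snd P.2 hcd hc hm hw hx3 (by omega) hor)⟩
      · omega
    · intro n hn q hq
      obtain ⟨u, w, y, hu, hy, rfl⟩ : ∃ u X y, u < 2 ^ e 1 ∧ y < Tot ∧ n = Time u X y :=
        ⟨_, _, _, Nat.mod_lt _ hpos, yOf_lt d e α n, eq_time d e α n⟩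
      have hw : w < 2 * Y := by
        rw [hY, ← mul_assoc] at hn
        have := Nat.div_lt_of_lt_mul hn
        rw [← Nat.div_div_eq_div_mul, (time_spec hu hy).2.1] at this
        exact this
      let x : ℕ → ℤ := fun k => if k = 1 then (u / 2 : ℕ) else if k = 2 then w else Digit y k
      have hx1 : x 1 = (u / 2 : ℕ) := rfl
      have hx2 : x 2 = w := rfl
      have hx3 : Digits x y := fun k h3 hk => by
        simp only [x, ite_ge h3]
      have hr : Range₂ d e α x := (hr2 x).2 (by rw [hx2]; omega)
      rcases (by omega : u + 2 < 2 ^ e 1 ∨ u + 2 = 2 ^ e 1 ∨ u + 1 = 2 ^ e 1) with hu1 | hu1 | hu1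
      · have hr1 : Range₁ d e α x := by rw [Range₁, H.A_three, hx1]; omega
        set c := u % 2 * d + q with hc
        have hcase : (c < d ∧ u = 2 * (u / 2) ∧ q = c) ∨
            (d ≤ c ∧ u = 2 * (u / 2) + 1 ∧ q = c - d) := by
          rcases Nat.mod_two_eq_zero_or_one u with h | h <;> rw [h] at hc <;> omega
        have hc2 : c < 2 * d := by omega
        exact ⟨_, _, ⟨_, x, isMove_stateAt hd hc2, hr,
          Or.inl ⟨H.A₁_eq, hr1, hrange x y hx3, rfl, rfl⟩⟩, hmatch (by omega) (by omega) hy hy (time_succ ..)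
          (H.arcMatch₁ P.2 hc2 (fun _ _ _ => rfl) hx2 hx1 (by omega) hx3 hcase)⟩
      · exact ⟨_, _, ⟨_, x, isMove_stateAt hd (by omega : q < 2 * d), hr,
          Or.inr (Or.inr (Or.inl ⟨hrange x y hx3, rfl, rfl⟩))⟩, hmatch (by omega) (by omega) hy hy (time_succ ..)
          (H.arcMatch₃_fst P.2 hq (fun _ _ _ => rfl) hx2 hx3 hu1)⟩
      · obtain ⟨w', y', hy', ht, hor⟩ := exists_wrap (X := w) hu1 hy
        have := H.arcMatch₃_snd P.2 (c := d + q) (by omega) (by omega) (fun _ _ _ => rfl) hx2 hx3 hu1 hor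
        rw [Nat.add_sub_cancel_left] at this
        exact ⟨_, _, ⟨_, x, isMove_stateAt hd (by omega : d + q < 2 * d), hr,
          Or.inr (Or.inr (Or.inl ⟨hrange x y hx3, rfl, rfl⟩))⟩, hmatch hu hpos hy hy' ht this⟩
  have hM : 2 ≤ 2 ^ α := by
    rw [hY]
    have h1 : 1 ≤ Tot * (2 * Y) := Nat.mul_pos tot_pos (by omega)
    calc 2 ≤ 2 ^ e 1 * 1 := by omega
      _ ≤ _ := Nat.mul_le_mul_left _ h1
  have := (stageData H).isCycleDecomposition (by omega) hM H.he (fun _ _ _ => rfl) (fun _ _ => rfl)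
  simp only [Decomposes, hE]
  exact this

end

end Long

/-- The Lock-and-Key edge sets decompose the torus. -/
theorem isCycleDecomposition_edges {d : ℕ} {e : ℕ → ℕ} {α : ℕ} (hd : 2 ≤ d)
    (he : ∀ k, 1 ≤ k → k ≤ d → 2 ≤ e k) (lo : e d ≤ α) (hi : (α : ℤ) ≤ level d e d) : Decomposes d e α := by
  rcases lt_or_ge (α : ℤ) (level d e 2) with h2 | h2
  · rcases hd.lt_or_eq with hd3 | rfl
    · rcases lo.lt_or_eq with h | h
      · exact Medium.isCycleDecomposition ⟨hd3, he, h, h2⟩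
      · exact Short.isCycleDecomposition ⟨hd3, he, by rw [h]⟩
    · exact Pair.isCycleDecomposition ⟨he, lo, h2⟩
  · exact Long.isCycleDecomposition ⟨hd, he, h2, hi⟩

end LockAndKey

/-! ### Subdivided cycles -/

section Glue

variable {V W : Type*} {G : SimpleGraph V} {H : SimpleGraph W}

/-- The walk obtained by replacing every step of a walk by a walk of another graph. -/
def glueWalk (φ : V → W) (p : ∀ D : G.Dart, H.Walk (φ D.fst) (φ D.snd)) :
    ∀ {u v : V}, G.Walk u v → H.Walk (φ u) (φ v)
  | _, _, .nil => .nil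
  | _, _, .cons h w => (p ⟨(_, _), h⟩).append (glueWalk φ p w)

theorem glueWalk_edges (φ : V → W) (p : ∀ D : G.Dart, H.Walk (φ D.fst) (φ D.snd)) {u v : V}
    (w : G.Walk u v) : (glueWalk φ p w).edges = w.darts.flatMap fun D => (p D).edges := by
  induction w with
  | nil => rfl
  | cons h w ih => simp [glueWalk, SimpleGraph.Walk.edges_append, ih]

theorem glueWalk_support_tail (φ : V → W) (p : ∀ D : G.Dart, H.Walk (φ D.fst) (φ D.snd)) {u v : V}
    (w : G.Walk u v) :
    (glueWalk φ p w).support.tail = w.darts.flatMap fun D => (p D).support.tail := by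
  induction w with
  | nil => rfl
  | cons h w ih => simp [glueWalk, SimpleGraph.Walk.tail_support_append, ih]

theorem IsCycleEdgeSet.ncard_eq {L : ℕ} {E : Set (Sym2 V)} (h : IsCycleEdgeSet G L E) :
    E.ncard = L := by
  classical
  obtain ⟨v, w, hw, rfl, rfl⟩ := h
  have : {e | e ∈ w.edges} = (w.edges.toFinset : Set (Sym2 V)) := by ext; simp
  rw [this, Set.ncard_coe_finset, List.toFinset_card_of_nodup hw.edges_nodup,
    SimpleGraph.Walk.length_edges]

theorem IsCycleEdgeSet.glue (φ : V → W) (hφ : Function.Injective φ)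
    (p : ∀ D : G.Dart, H.Walk (φ D.fst) (φ D.snd)) (hp : ∀ D, (p D).IsPath)
    (F : Sym2 V → Set (Sym2 W)) (hF : ∀ D e, e ∈ (p D).edges ↔ e ∈ F D.edge)
    (hdis : ∀ e ∈ G.edgeSet, ∀ e' ∈ G.edgeSet, e ≠ e' → Disjoint (F e) (F e'))
    (hsup : ∀ D D' : G.Dart, D.edge ≠ D'.edge → ∀ x ∈ (p D).support, x ∈ (p D').support →
      ∃ v, x = φ v)
    (hend : ∀ (D : G.Dart) v, φ v ∈ (p D).support → v = D.fst ∨ v = D.snd)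
    {L : ℕ} {E : Set (Sym2 V)} (hE : IsCycleEdgeSet G L E) :
    IsCycleEdgeSet H (⋃ e ∈ E, F e).ncard (⋃ e ∈ E, F e) := by
  obtain ⟨v, w, hw, rfl, rfl⟩ := hE
  have hmem : {e | e ∈ (glueWalk φ p w).edges} = ⋃ e ∈ {e | e ∈ w.edges}, F e := by
    ext e
    rw [Set.mem_ofPred_eq, glueWalk_edges, List.mem_flatMap]
    simp only [Set.mem_ofPred_eq, Set.mem_iUnion, SimpleGraph.Walk.edges, List.mem_map,
      exists_prop]
    constructor
    · rintro ⟨D, hD, he⟩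
      exact ⟨D.edge, ⟨D, hD, rfl⟩, (hF D e).1 (List.mem_map.2 he)⟩
    · rintro ⟨_, ⟨D, hD, rfl⟩, he⟩
      exact ⟨D, hD, List.mem_map.1 ((hF D e).2 he)⟩
  have hpw : w.darts.Pairwise fun D D' => D.edge ≠ D'.edge := by
    have := hw.edges_nodup
    rwa [SimpleGraph.Walk.edges, List.Nodup, List.pairwise_map] at this
  have hpw' : w.darts.Pairwise fun D D' => D.snd ≠ D'.snd := by
    have := hw.support_nodup
    rwa [← SimpleGraph.Walk.map_snd_darts, List.Nodup, List.pairwise_map] at this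
  have htrail : (glueWalk φ p w).edges.Nodup := by
    rw [glueWalk_edges, List.nodup_flatMap]
    refine ⟨fun D _ => (hp D).isTrail.edges_nodup, hpw.imp fun {D D'} h => ?_⟩
    refine List.disjoint_left.2 fun e he he' => ?_
    exact Set.disjoint_left.1 (hdis _ D.edge_mem _ D'.edge_mem h) ((hF D e).1 he)
      ((hF D' e).1 he')
  have hsn : ∀ (D : G.Dart) v, φ v ∈ (p D).support.tail → v = D.snd := by
    intro D v hv
    rcases hend D v (List.mem_of_mem_tail hv) with rfl | h
    · have := (hp D).support_nodup
      rw [← SimpleGraph.Walk.cons_tail_support] at this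
      exact absurd hv (List.nodup_cons.1 this).1
    · exact h
  have hcyc : (glueWalk φ p w).IsCycle := by
    rw [SimpleGraph.Walk.isCycle_def]
    refine ⟨⟨htrail⟩, ?_, ?_⟩
    · intro h
      have h2 := glueWalk_support_tail φ p w
      rw [h] at h2
      cases w with
      | nil => exact hw.ne_nil rfl
      | cons hh w =>
        simp only [SimpleGraph.Walk.support_nil, List.tail_cons, SimpleGraph.Walk.darts_cons,
          List.flatMap_cons] at h2
        have h3 := (List.append_eq_nil_iff.1 h2.symm).1
        have h4 := SimpleGraph.Walk.length_support (p ⟨(_, _), hh⟩)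
        have h5 : (p ⟨(_, _), hh⟩).length = 0 := by
          have := congrArg List.length h3
          rw [List.length_tail, h4] at this
          simpa using this
        exact hh.ne (hφ (SimpleGraph.Walk.eq_of_length_eq_zero h5))
    · rw [glueWalk_support_tail, List.nodup_flatMap]
      refine ⟨fun D _ => (hp D).support_nodup.tail, (hpw.and hpw').imp fun {D D'} h => ?_⟩
      refine List.disjoint_left.2 fun x hx hx' => ?_
      obtain ⟨v, rfl⟩ := hsup D D' h.1 x (List.mem_of_mem_tail hx) (List.mem_of_mem_tail hx')
      exact h.2 ((hsn D v hx).symm.trans (hsn D' v hx'))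
  have h : IsCycleEdgeSet H (glueWalk φ p w).length (⋃ e ∈ {e | e ∈ w.edges}, F e) :=
    ⟨_, _, hcyc, rfl, hmem⟩
  rwa [h.ncard_eq]

end Glue

namespace LockAndKey

section Subdivision

variable {d : ℕ} {z y q : Fin d → ℕ}

local notation "AnchVert" => AnchoredVertex fun k => everyNth (y k) (q k)
local notation "AnchProd" => anchoredProduct (fun k => cyc (y k)) fun k => everyNth (y k) (q k)

theorem three_le_mul (hz : ∀ k, 3 ≤ z k) (hq : ∀ k, 0 < q k) (hy : ∀ k, y k = q k * z k) (k : Fin d) :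
    3 ≤ y k := by
  have := Nat.mul_le_mul (hq k) (hz k)
  rw [hy]; omega

/-- The `r`-th vertex after the image of `u` along the `k`-th factor. -/
def subPoint (u : ∀ k, ZMod (z k)) (k : Fin d) (r : ℕ) : AnchVert :=
  ⟨fun l => ((q l * (u l).val + if l = k then r else 0 : ℕ) : ZMod (y l)), k,
    fun j hj => ⟨(u j).val, by simp [hj]⟩⟩

theorem subPoint_zero (u : ∀ k, ZMod (z k)) (k l : Fin d) :
    (subPoint u k 0 : AnchVert) = subPoint u l 0 := by
  apply Subtype.ext
  simp [subPoint]

theorem subPoint_succ (u : ∀ k, ZMod (z k)) (k : Fin d) (r : ℕ) :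
    (subPoint u k (r + 1) : AnchVert).1
      = (subPoint u k r : AnchVert).1 + Pi.single k 1 := by
  funext l
  by_cases h : l = k
  · subst h
    simp [subPoint]
    ring
  · simp [subPoint, h]

theorem subPoint_adj (hy : ∀ k, 3 ≤ y k) (u : ∀ k, ZMod (z k)) (k : Fin d) (r : ℕ) :
    (AnchProd).Adj
      (subPoint u k r) (subPoint u k (r + 1)) := by
  refine ⟨k, (cyc_adj_iff (by have := hy k; omega) _ _).2 (Or.inl ?_), fun j hj => ⟨?_, ?_⟩⟩
  · rw [subPoint_succ]; simp
  · rw [subPoint_succ]; simp [hj]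
  · exact ⟨(u j).val, by simp [subPoint, hj]⟩

theorem subPoint_full (hz : ∀ k, 3 ≤ z k) (hy : ∀ k, y k = q k * z k) (u : ∀ k, ZMod (z k))
    (k l : Fin d) : (subPoint u k (q k) : AnchVert)
      = subPoint (u + Pi.single k 1) l 0 := by
  apply Subtype.ext
  funext j
  by_cases h : j = k
  · subst h
    have : NeZero (z j) := ⟨by have := hz j; omega⟩
    have : Fact (1 < z j) := ⟨by have := hz j; omega⟩
    simp only [subPoint, if_true, ite_self, add_zero, Pi.add_apply, Pi.single_eq_same]
    rw [ZMod.natCast_eq_natCast_iff, hy, ZMod.val_add, ZMod.val_one]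
    unfold Nat.ModEq
    rw [Nat.mul_mod_mul_left, Nat.mod_mod, ← Nat.mul_mod_mul_left, mul_add, mul_one]
  · simp [subPoint, h]

theorem subPoint_injective (hz : ∀ k, 3 ≤ z k) (hy : ∀ k, y k = q k * z k)
    {u v : ∀ k, ZMod (z k)} {k l : Fin d} {r s : ℕ} (hr : r < q k) (hs : s < q l)
    (hq : ∀ k, 0 < q k)
    (h : (subPoint u k r : AnchVert) = subPoint v l s) :
    u = v ∧ r = s ∧ (r = 0 ∨ k = l) := by
  have key : ∀ j, u j = v j ∧ (if j = k then r else 0) = if j = l then s else 0 := by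
    intro j
    have : NeZero (z j) := ⟨by have := hz j; omega⟩
    have h1 := congrFun (congrArg Subtype.val h) j
    simp only [subPoint] at h1
    have hr' : (if j = k then r else 0) < q j := by
      split_ifs with h
      · exact h ▸ hr
      · exact hq j
    have hs' : (if j = l then s else 0) < q j := by
      split_ifs with h
      · exact h ▸ hs
      · exact hq j
    generalize (if j = k then r else 0) = r' at *
    generalize (if j = l then s else 0) = s' at *
    rw [ZMod.natCast_eq_natCast_iff] at h1
    have bound : ∀ (a : ZMod (z j)) b, b < q j → q j * a.val + b < y j := by
      intro a b hb
      have h3 : a.val + 1 ≤ z j := ZMod.val_lt a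
      have := Nat.mul_le_mul_left (q j) h3
      rw [hy]
      linarith
    have h2 := Nat.ModEq.eq_of_lt_of_lt h1 (bound _ _ hr') (bound _ _ hs')
    have h4 := congrArg (· / q j) h2
    simp only [Nat.mul_add_div (hq j), Nat.div_eq_of_lt hr', Nat.div_eq_of_lt hs',
      add_zero] at h4
    refine ⟨ZMod.val_injective _ h4, ?_⟩
    rw [h4] at h2
    omega
  refine ⟨funext fun j => (key j).1, ?_⟩
  have h1 := (key k).2
  have h2 := (key l).2
  rw [if_pos rfl] at h1 h2
  by_cases hkl : k = l
  · rw [if_pos hkl] at h1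
    exact ⟨h1, Or.inr hkl⟩
  · rw [if_neg hkl] at h1
    rw [if_neg (Ne.symm hkl)] at h2
    omega

/-- The `r`-th edge of the subdivision of the edge from `u` along the `k`-th factor. -/
def subEdge (u : ∀ k, ZMod (z k)) (k : Fin d) (r : ℕ) :
    Sym2 AnchVert :=
  s(subPoint u k r, subPoint u k (r + 1))

theorem mem_subdivide_iff (E : Set (Sym2 (∀ k, ZMod (z k))))
    (a : Sym2 AnchVert) :
    a ∈ subdivide E ↔ ∃ u k r, s(u, u + Pi.single k 1) ∈ E ∧ r < q k ∧ a = subEdge u k r := by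
  constructor
  · rintro ⟨u, k, r, v, w, hE, hr, hv, hw, hl, rfl⟩
    have h1 : v = subPoint u k r := by
      apply Subtype.ext
      funext l
      by_cases h : l = k
      · subst h; rw [hv]; simp [subPoint]
      · rw [(hl l h).1]; simp [subPoint, h]
    have h2 : w = subPoint u k (r + 1) := by
      apply Subtype.ext
      funext l
      by_cases h : l = k
      · subst h; rw [hw]; simp [subPoint, add_assoc]
      · rw [(hl l h).2, (hl l h).1]; simp [subPoint, h]
    exact ⟨u, k, r, hE, hr, by rw [h1, h2]; rfl⟩
  · rintro ⟨u, k, r, hE, hr, rfl⟩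
    refine ⟨u, k, r, _, _, hE, hr, ?_, ?_, fun l h => ⟨?_, ?_⟩, rfl⟩
    · simp [subPoint]
    · simp [subPoint, add_assoc]
    · simp [subPoint, h]
    · simp [subPoint, h]

theorem subEdge_injective (hz : ∀ k, 3 ≤ z k) (hq : ∀ k, 0 < q k) (hy : ∀ k, y k = q k * z k)
    {u v : ∀ k, ZMod (z k)} {k l : Fin d} {r s : ℕ} (hr : r < q k) (hs : s < q l)
    (h : (subEdge u k r : Sym2 AnchVert) = subEdge v l s) :
    u = v ∧ k = l ∧ r = s := by
  have hy3 := three_le_mul hz hq hy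
  have h1 : s((subPoint u k r : AnchVert).1,
      (subPoint u k (r + 1) : AnchVert).1)
      = s((subPoint v l s : AnchVert).1,
      (subPoint v l (s + 1) : AnchVert).1) :=
    congrArg (Sym2.map fun x : AnchVert => x.1) h
  rw [subPoint_succ, subPoint_succ] at h1
  obtain ⟨rfl, h2⟩ := torus_edge_injective hy3 h1
  obtain ⟨h3, h4, _⟩ := subPoint_injective hz hy hr hs hq (Subtype.ext h2)
  exact ⟨h3, rfl, h4⟩

theorem exists_subPath (hz : ∀ k, 3 ≤ z k) (hq : ∀ k, 0 < q k) (hy : ∀ k, y k = q k * z k)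
    (k₀ : Fin d) (u : ∀ k, ZMod (z k)) (k : Fin d) :
    ∃ p : (AnchProd).Walk
        (subPoint u k₀ 0) (subPoint (u + Pi.single k 1) k₀ 0),
      p.IsPath ∧ (∀ e, e ∈ p.edges ↔ ∃ r < q k, e = subEdge u k r) ∧
      ∀ x ∈ p.support, x = subPoint (u + Pi.single k 1) k₀ 0 ∨ ∃ r < q k, x = subPoint u k r := by
  have hy3 := three_le_mul hz hq hy
  refine ⟨(seqWalk (subPoint u k) (subPoint_adj hy3 u k) (q k)).copy (subPoint_zero _ _ _)
    (subPoint_full hz hy _ _ _), ?_, ?_, ?_⟩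
  · rw [SimpleGraph.Walk.isPath_copy, SimpleGraph.Walk.isPath_def, seqWalk_support,
      List.nodup_map_iff_inj_on List.nodup_range]
    have hne : ∀ r < q k, (subPoint u k r : AnchVert)
        ≠ subPoint u k (q k) := by
      intro r hr h
      rw [subPoint_full hz hy u k k] at h
      have h1 := congrFun (subPoint_injective hz hy hr (hq k) hq h).1 k
      have : Fact (1 < z k) := ⟨by have := hz k; omega⟩
      simp at h1
    intro r hr s hs h
    rw [List.mem_range, Nat.lt_succ_iff_lt_or_eq] at hr hs
    rcases hr with hr | rfl <;> rcases hs with hs | rfl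
    · exact (subPoint_injective hz hy hr hs hq h).2.1
    · exact absurd h (hne _ hr)
    · exact absurd h.symm (hne _ hs)
    · rfl
  · intro e
    simp only [SimpleGraph.Walk.edges_copy, seqWalk_edges, List.mem_map, List.mem_range]
    exact ⟨fun ⟨r, h, h'⟩ => ⟨r, h, h'.symm⟩, fun ⟨r, h, h'⟩ => ⟨r, h, h'.symm⟩⟩
  · intro x
    simp only [SimpleGraph.Walk.support_copy, seqWalk_support, List.mem_map, List.mem_range,
      Nat.lt_succ_iff_lt_or_eq]
    rintro ⟨r, hr | rfl, rfl⟩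
    · exact Or.inr ⟨r, hr, rfl⟩
    · exact Or.inl (subPoint_full hz hy _ _ _)

theorem ncard_subdivide (hz : ∀ k, 3 ≤ z k) (hq : ∀ k, 0 < q k) (hy : ∀ k, y k = q k * z k)
    (E : Set (Sym2 (∀ k, ZMod (z k)))) :
    (subdivide (y := y) (q := q) E).ncard = ∑ k, q k * numAlong E k := by
  classical
  have : ∀ k, NeZero (z k) := fun k => ⟨by have := hz k; omega⟩
  let T := Σ k : Fin d, {u : ∀ k, ZMod (z k) // s(u, u + Pi.single k 1) ∈ E} × Fin (q k)
  have hr : subdivide (y := y) (q := q) E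
      = Set.range fun t : T => subEdge (y := y) (q := q) t.2.1.1 t.1 t.2.2 := by
    ext a
    rw [mem_subdivide_iff]
    constructor
    · rintro ⟨u, k, r, h1, h2, rfl⟩
      exact ⟨⟨k, ⟨u, h1⟩, ⟨r, h2⟩⟩, rfl⟩
    · rintro ⟨⟨k, ⟨u, h1⟩, ⟨r, h2⟩⟩, rfl⟩
      exact ⟨u, k, r, h1, h2, rfl⟩
  rw [hr, Set.ncard_range_of_injective, Nat.card_sigma]
  · refine Finset.sum_congr rfl fun k _ => ?_
    rw [Nat.card_prod, Nat.card_eq_fintype_card (α := Fin _), Fintype.card_fin, mul_comm]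
    rfl
  · rintro ⟨k, ⟨u, h1⟩, ⟨r, h2⟩⟩ ⟨l, ⟨v, h3⟩, ⟨s, h4⟩⟩ h
    obtain ⟨rfl, rfl, rfl⟩ := subEdge_injective hz hq hy h2 h4 h
    rfl

theorem exists_subPoint (hz : ∀ k, 3 ≤ z k) (hq : ∀ k, 0 < q k) (hy : ∀ k, y k = q k * z k)
    (x : AnchVert) (k : Fin d)
    (hx : ∀ j, j ≠ k → x.1 j ∈ everyNth (y j) (q j)) :
    ∃ (u : ∀ k, ZMod (z k)) (r : ℕ), r < q k ∧ x = subPoint u k r := by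
  have key : ∀ j, ∃ (c : ZMod (z j)) (r : ℕ), r < q j ∧ (j ≠ k → r = 0) ∧
      x.1 j = ((q j * c.val + r : ℕ) : ZMod (y j)) := by
    intro j
    have : NeZero (z j) := ⟨by have := hz j; omega⟩
    have hy0 : 0 < y j := by rw [hy]; exact Nat.mul_pos (hq j) (by have := hz j; omega)
    have : NeZero (y j) := ⟨hy0.ne'⟩
    have hlt : (x.1 j).val / q j < z j := by
      rw [Nat.div_lt_iff_lt_mul (hq j), mul_comm, ← hy]
      exact ZMod.val_lt _
    refine ⟨((x.1 j).val / q j : ℕ), (x.1 j).val % q j, Nat.mod_lt _ (hq j), fun h => ?_, ?_⟩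
    · obtain ⟨t, ht⟩ := hx j h
      rw [← ht]
      show (ZMod.val ((q j * t : ℕ) : ZMod (y j))) % q j = 0
      rw [ZMod.val_natCast, hy, Nat.mod_mul_right_mod, Nat.mul_mod_right]
    · rw [ZMod.val_natCast_of_lt hlt, Nat.div_add_mod, ZMod.natCast_zmod_val]
  choose c r h1 h2 h3 using key
  refine ⟨c, r k, h1 k, Subtype.ext (funext fun j => ?_)⟩
  rw [h3]
  by_cases h : j = k
  · subst h; simp [subPoint]
  · simp [subPoint, h, h2 j h]

/-- The subdivisions of the cycles of a decomposition of a torus decompose the anchored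
product. -/
theorem isCycleDecomposition_subdivide {ι : Type*} {L M : ℕ} (k₀ : Fin d) (hz : ∀ k, 3 ≤ z k)
    (hq : ∀ k, 0 < q k) (hy : ∀ k, y k = q k * z k) (E : ι → Set (Sym2 (∀ k, ZMod (z k))))
    (hE : IsCycleDecomposition (cartesianProduct fun k => cyc (z k)) L E)
    (hM : ∀ c k, numAlong (E c) k = M) :
    IsCycleDecomposition AnchProd
      ((∑ k, q k) * M) fun c => subdivide (E c) := by
  have hy3 := three_le_mul hz hq hy
  have hz2 : ∀ k, 2 ≤ z k := fun k => by have := hz k; omega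
  obtain ⟨hcyc, hdis, hun, hcov⟩ := hE
  have hmem : ∀ u k, ∃ c, s(u, u + Pi.single k 1) ∈ E c := fun u k => by
    have : s(u, u + Pi.single k 1) ∈ ⋃ c, E c := by
      rw [hun]
      exact cartesianProduct_cyc_adj_single hz2 u k
    simpa using this
  refine ⟨fun c => ?_, fun c c' hc => ?_, ?_, fun x => ?_⟩
  · have hpath : ∀ D : (cartesianProduct fun k => cyc (z k)).Dart,
        ∃ (u : ∀ k, ZMod (z k)) (k : Fin d)
          (p : (AnchProd).Walk
            (subPoint D.fst k₀ 0) (subPoint D.snd k₀ 0)),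
          D.edge = s(u, u + Pi.single k 1) ∧ p.IsPath ∧
          (∀ e, e ∈ p.edges ↔ ∃ r < q k, e = subEdge u k r) ∧
          ∀ x ∈ p.support,
            x = subPoint (u + Pi.single k 1) k₀ 0 ∨ ∃ r < q k, x = subPoint u k r := by
      rintro ⟨⟨a, b⟩, h⟩
      obtain ⟨u, k, hu⟩ := cartesianProduct_cyc_edge hz2 s(a, b) h
      obtain ⟨p, h1, h2, h3⟩ := exists_subPath hz hq hy k₀ u k
      rcases Sym2.eq_iff.1 hu with ⟨rfl, rfl⟩ | ⟨rfl, rfl⟩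
      · exact ⟨a, k, p, rfl, h1, h2, h3⟩
      · refine ⟨b, k, p.reverse, Sym2.eq_swap, h1.reverse, fun e => ?_, fun x hx => h3 x ?_⟩
        · rw [SimpleGraph.Walk.edges_reverse, List.mem_reverse, h2]
        · rwa [SimpleGraph.Walk.support_reverse, List.mem_reverse] at hx
    choose U K p hD hp hpe hps using hpath
    have hinj : Function.Injective fun u : ∀ k, ZMod (z k) =>
        (subPoint u k₀ 0 : AnchVert) :=
      fun u v h => (subPoint_injective hz hy (hq k₀) (hq k₀) hq h).1
    have h := (hcyc c).glue _ hinj p hp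
      (fun e => {a | ∃ u k r, e = s(u, u + Pi.single k 1) ∧ r < q k ∧ a = subEdge u k r})
      ?_ ?_ ?_ ?_
    · have hs : (⋃ e ∈ E c, {a | ∃ u k r, e = s(u, u + Pi.single k 1) ∧ r < q k ∧
          a = subEdge u k r}) = subdivide (y := y) (q := q) (E c) := by
        ext a
        rw [mem_subdivide_iff]
        simp only [Set.mem_iUnion, Set.mem_ofPred_eq, exists_prop]
        constructor
        · rintro ⟨e, he, u, k, r, rfl, h1, h2⟩
          exact ⟨u, k, r, he, h1, h2⟩
        · rintro ⟨u, k, r, he, h1, h2⟩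
          exact ⟨_, he, u, k, r, rfl, h1, h2⟩
      rw [hs, ncard_subdivide hz hq hy] at h
      simpa only [hM, ← Finset.sum_mul] using h
    · intro D e
      rw [hpe]
      constructor
      · rintro ⟨r, h1, h2⟩
        exact ⟨U D, K D, r, hD D, h1, h2⟩
      · rintro ⟨u, k, r, h0, h1, h2⟩
        obtain ⟨rfl, rfl⟩ := torus_edge_injective hz ((hD D).symm.trans h0)
        exact ⟨r, h1, h2⟩
    · intro e _ e' _ hne
      refine Set.disjoint_left.2 ?_
      rintro a ⟨u, k, r, rfl, h1, rfl⟩ ⟨v, l, s, rfl, h2, h3⟩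
      obtain ⟨rfl, rfl, rfl⟩ := subEdge_injective hz hq hy h1 h2 h3
      exact hne rfl
    · intro D D' hne x hx hx'
      rcases hps D x hx with h | ⟨r, hr, rfl⟩
      · exact ⟨_, h⟩
      rcases hps D' _ hx' with h | ⟨s, hs, h⟩
      · exact ⟨_, h⟩
      obtain ⟨h1, rfl, h3 | h3⟩ := subPoint_injective hz hy hr hs hq h
      · subst h3
        exact ⟨U D, subPoint_zero _ _ _⟩
      · exact absurd (by rw [hD D, hD D', h1, h3]) hne
    · intro D v hv
      have hv' : v ∈ D.edge := by
        rw [hD D, Sym2.mem_iff]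
        rcases hps D _ hv with h | ⟨r, hr, h⟩
        · exact Or.inr (hinj h)
        · exact Or.inl (subPoint_injective hz hy (hq k₀) hr hq h).1
      exact Sym2.mem_iff.1 hv'
  · refine Set.disjoint_left.2 fun a ha ha' => ?_
    obtain ⟨u, k, r, h1, h2, rfl⟩ := (mem_subdivide_iff _ _).1 ha
    obtain ⟨v, l, s, h3, h4, h5⟩ := (mem_subdivide_iff _ _).1 ha'
    obtain ⟨rfl, rfl, rfl⟩ := subEdge_injective hz hq hy h2 h4 h5
    exact Set.disjoint_left.1 (hdis c c' hc) h1 h3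
  · ext a
    simp only [Set.mem_iUnion, mem_subdivide_iff]
    constructor
    · rintro ⟨c, u, k, r, _, _, rfl⟩
      exact subPoint_adj hy3 u k r
    · induction a using Sym2.ind with
      | _ x x' =>
        intro h
        have key : ∀ x x' : AnchVert, ∀ k : Fin d,
            x'.1 k = x.1 k + 1 → (∀ j, j ≠ k → x.1 j = x'.1 j ∧ x.1 j ∈ everyNth (y j) (q j)) →
            ∃ c u k r, s(u, u + Pi.single k 1) ∈ E c ∧ r < q k ∧ s(x, x') = subEdge u k r := by
          intro x x' k h1 h2
          obtain ⟨u, r, hr, rfl⟩ := exists_subPoint hz hq hy x k fun j hj => (h2 j hj).2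
          obtain ⟨c, hc⟩ := hmem u k
          have : x' = subPoint u k (r + 1) := by
            apply Subtype.ext
            rw [subPoint_succ]
            funext j
            by_cases hj : j = k
            · subst hj; simp [h1]
            · simp [hj, (h2 j hj).1]
          exact ⟨c, u, k, r, hc, hr, by rw [this]; rfl⟩
        obtain ⟨k, h1, h2⟩ := h
        rcases (cyc_adj_iff (by have := hy3 k; omega) _ _).1 h1 with h3 | h3
        · exact key x x' k h3 h2
        · rw [Sym2.eq_swap]
          exact key x' x k h3 fun j hj => ⟨(h2 j hj).1.symm, (h2 j hj).1 ▸ (h2 j hj).2⟩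
  · obtain ⟨k, hk⟩ := x.2
    obtain ⟨u, r, hr, rfl⟩ := exists_subPoint hz hq hy x k hk
    obtain ⟨c, hc⟩ := hmem u k
    exact ⟨c, subEdge u k r, (mem_subdivide_iff _ _).2 ⟨u, k, r, hc, hr, rfl⟩, by simp [subEdge]⟩

end Subdivision

end LockAndKey

/-! ### Cycles as periodic sequences -/

section CycSeq

variable {V W : Type*} {G : SimpleGraph V} {H : SimpleGraph W} {L : ℕ} {f : ℕ → V}

/-- The sequence `f` runs with period `L` through a cycle of `G`. -/
structure CycSeq (G : SimpleGraph V) (L : ℕ) (f : ℕ → V) : Prop where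
  pos : 0 < L
  adj : ∀ t, G.Adj (f t) (f (t + 1))
  per : ∀ t, f (t + L) = f t
  inj : ∀ s t, s < L → t < L → f s = f t → s = t

/-- The edges between consecutive members of a sequence. -/
def seqEdges (f : ℕ → V) : Set (Sym2 V) := {e | ∃ t, e = s(f t, f (t + 1))}

theorem succ_mod (hL : 0 < L) (t : ℕ) : (t + 1) % L = if t % L + 1 = L then 0 else t % L + 1 := by
  have := Nat.mod_lt t hL
  split_ifs with h1
  · rw [← Nat.mod_add_mod, h1, Nat.mod_self]
  · rw [← Nat.mod_add_mod, Nat.mod_eq_of_lt (by omega)]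

theorem CycSeq.mod (h : CycSeq G L f) (t : ℕ) : f (t % L) = f t := by
  have key : ∀ q r, f (r + L * q) = f r := by
    intro q r
    induction q with
    | zero => rfl
    | succ q ih => rw [Nat.mul_succ, ← add_assoc, h.per, ih]
  conv_rhs => rw [← Nat.mod_add_div t L]
  rw [key]

theorem CycSeq.eq_iff (h : CycSeq G L f) (s t : ℕ) : f s = f t ↔ s % L = t % L := by
  constructor
  · intro hst
    rw [← h.mod s, ← h.mod t] at hst
    exact h.inj _ _ (Nat.mod_lt _ h.pos) (Nat.mod_lt _ h.pos) hst
  · intro hst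
    rw [← h.mod s, ← h.mod t, hst]

theorem CycSeq.surj [Finite V] (h : CycSeq G L f) (hV : Nat.card V = L) (v : V) :
    ∃ t < L, f t = v := by
  have hb : Function.Bijective fun t : Fin L => f t := by
    rw [Nat.bijective_iff_injective_and_card]
    exact ⟨fun s t hst => Fin.ext (h.inj _ _ s.2 t.2 hst), by simp [hV]⟩
  obtain ⟨t, ht⟩ := hb.2 v
  exact ⟨t, t.2, ht⟩

theorem CycSeq.mem_edges (h : CycSeq G L f) {e : Sym2 V} (he : e ∈ seqEdges f) :
    ∃ t < L, e = s(f t, f (t + 1)) := by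
  obtain ⟨t, rfl⟩ := he
  refine ⟨t % L, Nat.mod_lt _ h.pos, ?_⟩
  rw [h.mod, (h.eq_iff (t % L + 1) (t + 1)).2 (by rw [Nat.mod_add_mod])]

theorem CycSeq.map (h : CycSeq G L f) (φ : G →g H) (hφ : Function.Injective φ) :
    CycSeq H L fun t => φ (f t) :=
  ⟨h.pos, fun t => φ.map_adj (h.adj t), fun t => congrArg φ (h.per t),
    fun s t hs ht hst => h.inj s t hs ht (hφ hst)⟩

theorem mk_mem_seqEdges_map (φ : V → W) {x y : V} (h : s(x, y) ∈ seqEdges f) :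
    s(φ x, φ y) ∈ seqEdges fun t => φ (f t) := by
  obtain ⟨t, ht⟩ := h
  exact ⟨t, congrArg (Sym2.map φ) ht⟩

/-- A cycle may be started and oriented so that a given edge is its closing edge. -/
theorem CycSeq.exists_closing (h : CycSeq G L f) {u v : V} (he : s(u, v) ∈ seqEdges f) :
    ∃ g, CycSeq G L g ∧ g 0 = u ∧ g (L - 1) = v ∧ (∀ t, ∃ s, g t = f s) ∧
      ∀ e ∈ seqEdges f, e ∈ seqEdges g := by
  have hL := h.pos
  obtain ⟨t, ht⟩ := he
  rcases Sym2.eq_iff.1 ht with ⟨rfl, rfl⟩ | ⟨rfl, rfl⟩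
  · have hstep : ∀ s, f (t + (L - (s + 1) % L) + 1) = f (t + (L - s % L)) := by
      intro s
      have := Nat.mod_lt s hL
      rw [succ_mod hL]
      split_ifs
      · rw [show t + (L - 0) + 1 = t + 1 + L by omega, h.per]
        congr 1; omega
      · congr 1; omega
    refine ⟨fun s => f (t + (L - s % L)), ⟨hL, fun s => ?_, fun s => ?_, fun r s hr hs hrs => ?_⟩,
      ?_, ?_, fun s => ⟨_, rfl⟩, ?_⟩
    · show G.Adj (f (t + (L - s % L))) (f (t + (L - (s + 1) % L)))
      rw [← hstep s]
      exact (h.adj _).symm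
    · simp
    · simp only [Nat.mod_eq_of_lt hr, Nat.mod_eq_of_lt hs] at hrs
      have h1 : (t + (L - r)) ≡ (t + (L - s)) [MOD L] := (h.eq_iff _ _).1 hrs
      have h2 : L - r ≡ L - s [MOD L] := Nat.ModEq.add_left_cancel' t h1
      rcases Nat.eq_zero_or_pos r with rfl | hr0 <;> rcases Nat.eq_zero_or_pos s with rfl | hs0
      · rfl
      · have h4 : (L - 0) % L = (L - s) % L := h2
        rw [Nat.sub_zero, Nat.mod_self, Nat.mod_eq_of_lt (by omega)] at h4
        omega
      · have h4 : (L - r) % L = (L - 0) % L := h2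
        rw [Nat.sub_zero, Nat.mod_self, Nat.mod_eq_of_lt (by omega)] at h4
        omega
      · have h4 : (L - r) % L = (L - s) % L := h2
        rw [Nat.mod_eq_of_lt (by omega), Nat.mod_eq_of_lt (by omega)] at h4
        omega
    · simp [h.per]
    · simp only [Nat.mod_eq_of_lt (show L - 1 < L by omega)]
      congr 1; omega
    · rintro _ ⟨r, rfl⟩
      have h5 : ∃ s, f (t + (L - (s + 1) % L)) = f r := by
        refine ⟨t + 2 * L - r % L - 1, (h.eq_iff _ _).2 ?_⟩
        have hr := Nat.mod_lt r hL
        rw [show t + 2 * L - r % L - 1 + 1 = t + 2 * L - r % L by omega]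
        have hm := Nat.mod_lt (t + 2 * L - r % L) hL
        have h6 := Nat.div_add_mod (t + 2 * L - r % L) L
        have h7 := Nat.div_add_mod r L
        generalize (t + 2 * L - r % L) / L = Q at *
        have h8 : t + (L - (t + 2 * L - r % L) % L) + L = r % L + L * Q := by omega
        have h9 := congrArg (· % L) h8
        simpa using h9
      obtain ⟨s, hs⟩ := h5
      refine ⟨s, ?_⟩
      have h10 := hstep s
      show s(f r, f (r + 1)) = s(f (t + (L - s % L)), f (t + (L - (s + 1) % L)))
      have h11 : f (t + (L - (s + 1) % L) + 1) = f (r + 1) := by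
        rw [h.eq_iff, Nat.add_mod, (h.eq_iff _ _).1 hs, ← Nat.add_mod]
      rw [← h10, hs, h11, Sym2.eq_swap]
  · refine ⟨fun s => f (s + (t + 1)), ⟨hL, fun s => ?_, fun s => ?_, fun r s hr hs hrs => ?_⟩,
      ?_, ?_, fun s => ⟨_, rfl⟩, ?_⟩
    · have := h.adj (s + (t + 1))
      rwa [show s + (t + 1) + 1 = s + 1 + (t + 1) by omega] at this
    · show f (s + L + (t + 1)) = f (s + (t + 1))
      rw [show s + L + (t + 1) = s + (t + 1) + L by omega, h.per]
    · have h1 : r ≡ s [MOD L] := Nat.ModEq.add_right_cancel' _ ((h.eq_iff _ _).1 hrs)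
      exact Nat.ModEq.eq_of_lt_of_lt h1 hr hs
    · simp
    · show f (L - 1 + (t + 1)) = f t
      rw [show L - 1 + (t + 1) = t + L by omega, h.per]
    · rintro _ ⟨r, rfl⟩
      have hk : (t + 1) * 1 ≤ (t + 1) * L := Nat.mul_le_mul_left _ hL
      have key : ∀ r, f (r + (t + 1) * L - (t + 1) + (t + 1)) = f r := fun r => by
        rw [h.eq_iff, Nat.sub_add_cancel (by omega), Nat.add_mul_mod_self_right]
      refine ⟨r + (t + 1) * L - (t + 1), ?_⟩
      have h2 := key (r + 1)
      rw [show r + 1 + (t + 1) * L - (t + 1) = r + (t + 1) * L - (t + 1) + 1 by omega] at h2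
      show _ = s(f (r + (t + 1) * L - (t + 1) + (t + 1)),
        f (r + (t + 1) * L - (t + 1) + 1 + (t + 1)))
      rw [key, h2]

/-- Two disjoint cycles are merged by exchanging two opposite edges of a square. -/
theorem CycSeq.merge {K : ℕ} {g : ℕ → V} (hf : CycSeq G L f) (hg : CycSeq G K g)
    (hdis : ∀ s t, f s ≠ g t) {u v u' v' : V} (he : s(u, v) ∈ seqEdges f)
    (he' : s(u', v') ∈ seqEdges g) (hu : G.Adj u u') (hv : G.Adj v v') :
    ∃ h, CycSeq G (L + K) h ∧ (∀ t, (∃ s, h t = f s) ∨ ∃ s, h t = g s) ∧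
      (∀ e ∈ seqEdges f, e ≠ s(u, v) → e ∈ seqEdges h) ∧
      (∀ e ∈ seqEdges g, e ≠ s(u', v') → e ∈ seqEdges h) ∧
      s(u, u') ∈ seqEdges h ∧ s(v, v') ∈ seqEdges h := by
  obtain ⟨f', hf', rfl, rfl, hff, hfe⟩ := hf.exists_closing he
  obtain ⟨g', hg', rfl, rfl, hgg, hge⟩ := hg.exists_closing he'
  have hL := hf.pos
  have hK := hg.pos
  have hdis' : ∀ s t, f' s ≠ g' t := by
    intro s t hst
    obtain ⟨a, ha⟩ := hff s
    obtain ⟨b, hb⟩ := hgg t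
    exact hdis a b (by rw [← ha, ← hb, hst])
  set ρ : ℕ → V := fun τ => if τ < L then f' τ else g' (L + K - 1 - τ) with hρ
  have hval : ∀ τ, τ + 1 < L → ρ τ = f' τ ∧ ρ (τ + 1) = f' (τ + 1) := fun τ h1 =>
    ⟨if_pos (by omega), if_pos h1⟩
  have hval' : ∀ τ, τ + 1 < K → ρ (L + K - 1 - (τ + 1)) = g' (τ + 1) ∧
      ρ (L + K - 1 - (τ + 1) + 1) = g' τ := fun τ h1 => by
    constructor <;> exact (if_neg (by omega)).trans (congrArg g' (by omega))
  have hLm : ρ (L - 1) = f' (L - 1) := if_pos (by omega)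
  have hL0 : ρ L = g' (K - 1) := (if_neg (by omega)).trans (congrArg g' (by omega))
  have hEnd : ρ (L + K - 1) = g' 0 := (if_neg (by omega)).trans (congrArg g' (by omega))
  have h00 : ρ 0 = f' 0 := if_pos hL
  have hcases : ∀ τ, τ < L + K → τ + 1 < L ∨ τ = L - 1 ∨
      (∃ σ, σ + 1 < K ∧ τ = L + K - 1 - (σ + 1)) ∨ τ = L + K - 1 := by
    intro τ hτ
    by_cases h1 : τ + 1 < L
    · exact Or.inl h1
    by_cases h2 : τ = L - 1
    · exact Or.inr (Or.inl h2)
    by_cases h3 : τ = L + K - 1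
    · exact Or.inr (Or.inr (Or.inr h3))
    · exact Or.inr (Or.inr (Or.inl ⟨L + K - 2 - τ, by omega, by omega⟩))
  have hedge : ∀ τ, τ + 1 < L + K → s(ρ τ, ρ (τ + 1)) ∈ seqEdges fun t => ρ (t % (L + K)) := by
    intro τ hτ
    refine ⟨τ, ?_⟩
    simp only [Nat.mod_eq_of_lt hτ, Nat.mod_eq_of_lt (show τ < L + K by omega)]
  refine ⟨fun t => ρ (t % (L + K)), ⟨by omega, fun t => ?_, fun t => ?_, fun s t hs ht hst => ?_⟩,
    fun t => ?_, fun e he2 hne => ?_, fun e he2 hne => ?_, ?_, ?_⟩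
  · show G.Adj (ρ (t % (L + K))) (ρ ((t + 1) % (L + K)))
    rw [succ_mod (by omega)]
    have hlt := Nat.mod_lt t (show 0 < L + K by omega)
    generalize t % (L + K) = τ at *
    rcases hcases τ hlt with h1 | rfl | ⟨σ, h1, rfl⟩ | rfl
    · rw [if_neg (by omega), (hval τ h1).1, (hval τ h1).2]
      exact hf'.adj τ
    · rw [if_neg (by omega), hLm, show L - 1 + 1 = L by omega, hL0]
      exact hv
    · rw [if_neg (by omega), (hval' σ h1).1, (hval' σ h1).2]
      exact (hg'.adj σ).symm
    · rw [if_pos (by omega), hEnd, h00]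
      exact hu.symm
  · simp
  · simp only [Nat.mod_eq_of_lt hs, Nat.mod_eq_of_lt ht, hρ] at hst
    split_ifs at hst with h1 h2 h2
    · exact hf'.inj s t h1 h2 hst
    · exact absurd hst (hdis' _ _)
    · exact absurd hst.symm (hdis' _ _)
    · have := hg'.inj _ _ (by omega) (by omega) hst
      omega
  · simp only [hρ]
    split_ifs
    · exact Or.inl (hff _)
    · exact Or.inr (hgg _)
  · obtain ⟨τ, h1, rfl⟩ := hf'.mem_edges (hfe e he2)
    have h2 : τ + 1 < L := by
      by_contra h2
      apply hne
      have h3 : τ = L - 1 := by omega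
      rw [h3, show L - 1 + 1 = 0 + L by omega, hf'.per, Sym2.eq_swap]
    have h3 := hedge τ (by omega)
    rwa [(hval τ h2).1, (hval τ h2).2] at h3
  · obtain ⟨τ, h1, rfl⟩ := hg'.mem_edges (hge e he2)
    have h2 : τ + 1 < K := by
      by_contra h2
      apply hne
      have h3 : τ = K - 1 := by omega
      rw [h3, show K - 1 + 1 = 0 + K by omega, hg'.per, Sym2.eq_swap]
    have h3 := hedge (L + K - 1 - (τ + 1)) (by omega)
    rwa [(hval' τ h2).1, (hval' τ h2).2, Sym2.eq_swap] at h3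
  · refine ⟨L + K - 1, ?_⟩
    simp only [Nat.mod_eq_of_lt (show L + K - 1 < L + K by omega),
      show L + K - 1 + 1 = L + K by omega, Nat.mod_self, hEnd, h00]
    exact Sym2.eq_swap
  · have h3 := hedge (L - 1) (by omega)
    rwa [hLm, show L - 1 + 1 = L by omega, hL0] at h3

/-- Reversing the part of a cycle between two of its edges. -/
theorem CycSeq.exists_reverse (h : CycSeq G L f) {a b : ℕ} (hab : a < b) (hb : b + 1 < L)
    (h1 : G.Adj (f a) (f b)) (h2 : G.Adj (f (a + 1)) (f (b + 1))) :
    ∃ g, CycSeq G L g ∧ (∀ t, b < t → t < L → g t = f t) ∧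
      (∀ e ∈ seqEdges f, e ≠ s(f a, f (a + 1)) → e ≠ s(f b, f (b + 1)) → e ∈ seqEdges g) ∧
      s(f a, f b) ∈ seqEdges g ∧ s(f (a + 1), f (b + 1)) ∈ seqEdges g := by
  set ρ : ℕ → ℕ := fun τ => if a < τ ∧ τ ≤ b then a + 1 + b - τ else τ with hρ
  have hout : ∀ τ, τ ≤ a ∨ b < τ → ρ τ = τ := fun τ hτ => if_neg (by omega)
  have hin : ∀ τ, a < τ → τ ≤ b → ρ τ = a + 1 + b - τ := fun τ h3 h4 => if_pos ⟨h3, h4⟩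
  have hstep : ∀ τ, τ + 1 < L → s(f (ρ τ), f (ρ (τ + 1))) ∈ seqEdges fun t => f (ρ (t % L)) := by
    intro τ hτ
    refine ⟨τ, ?_⟩
    simp only [Nat.mod_eq_of_lt hτ, Nat.mod_eq_of_lt (show τ < L by omega)]
  refine ⟨fun t => f (ρ (t % L)), ⟨h.pos, fun t => ?_, fun t => ?_, fun s t hs ht hst => ?_⟩,
    fun t h3 h4 => ?_, fun e he hne hne' => ?_, ?_, ?_⟩
  · show G.Adj (f (ρ (t % L))) (f (ρ ((t + 1) % L)))
    rw [succ_mod h.pos]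
    have hlt := Nat.mod_lt t h.pos
    generalize t % L = τ at *
    split_ifs with h3
    · rw [hout τ (by omega), hout 0 (by omega)]
      have := h.adj τ
      rwa [show τ + 1 = 0 + L by omega, h.per] at this
    · rcases lt_trichotomy τ a with h4 | rfl | h4
      · rw [hout τ (by omega), hout (τ + 1) (by omega)]
        exact h.adj τ
      · rw [hout τ (by omega), hin (τ + 1) (by omega) (by omega),
          show τ + 1 + b - (τ + 1) = b by omega]
        exact h1
      · rcases lt_trichotomy τ b with h5 | rfl | h5
        · rw [hin τ (by omega) (by omega), hin (τ + 1) (by omega) (by omega),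
            show a + 1 + b - τ = a + 1 + b - (τ + 1) + 1 by omega]
          exact (h.adj _).symm
        · rw [hin τ (by omega) (by omega), hout (τ + 1) (by omega),
            show a + 1 + τ - τ = a + 1 by omega]
          exact h2
        · rw [hout τ (by omega), hout (τ + 1) (by omega)]
          exact h.adj τ
  · simp
  · simp only [Nat.mod_eq_of_lt hs, Nat.mod_eq_of_lt ht] at hst
    have hlt : ∀ τ < L, ρ τ < L := fun τ h3 => by simp only [hρ]; split_ifs <;> omega
    have := h.inj _ _ (hlt s hs) (hlt t ht) hst
    simp only [hρ] at this
    split_ifs at this <;> omega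
  · simp only [Nat.mod_eq_of_lt h4, hout t (Or.inr h3)]
  · obtain ⟨τ, h3, rfl⟩ := h.mem_edges he
    have ha : τ ≠ a := fun h4 => hne (by rw [h4])
    have hb' : τ ≠ b := fun h4 => hne' (by rw [h4])
    by_cases hl : τ + 1 = L
    · refine ⟨τ, ?_⟩
      simp only [Nat.mod_eq_of_lt h3, hl, Nat.mod_self, hout τ (by omega), hout 0 (by omega)]
      rw [← hl, show f (τ + 1) = f 0 by rw [hl, ← h.per 0, Nat.zero_add]]
    by_cases h4 : a < τ ∧ τ < b
    · have := hstep (a + b - τ) (by omega)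
      rw [hin _ (by omega) (by omega), hin _ (by omega) (by omega),
        show a + 1 + b - (a + b - τ) = τ + 1 by omega,
        show a + 1 + b - (a + b - τ + 1) = τ by omega, Sym2.eq_swap] at this
      exact this
    · have := hstep τ (by omega)
      rwa [hout _ (by omega), hout _ (by omega)] at this
  · have := hstep a (by omega)
    rwa [hout _ (by omega), hin _ (by omega) (by omega),
      show a + 1 + b - (a + 1) = b by omega] at this
  · have := hstep b (by omega)
    rwa [hin _ (by omega) (by omega), hout _ (by omega),
      show a + 1 + b - b = a + 1 by omega] at this

/-- Reversing successive parts of a cycle. -/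
theorem CycSeq.exists_reverses (h : CycSeq G L f) (a b : ℕ → ℕ) (R : ℕ)
    (hab : ∀ r < R, a r < b r) (hb : ∀ r < R, b r + 1 < L) (hba : ∀ r, r + 1 < R → b r < a (r + 1))
    (h1 : ∀ r < R, G.Adj (f (a r)) (f (b r)))
    (h2 : ∀ r < R, G.Adj (f (a r + 1)) (f (b r + 1))) :
    ∃ g, CycSeq G L g ∧ (∀ t, (∀ r < R, b r < t) → t < L → g t = f t) ∧
      (∀ e ∈ seqEdges f, (∀ r < R, e ≠ s(f (a r), f (a r + 1)) ∧ e ≠ s(f (b r), f (b r + 1))) →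
        e ∈ seqEdges g) ∧
      ∀ r < R, s(f (a r), f (b r)) ∈ seqEdges g ∧ s(f (a r + 1), f (b r + 1)) ∈ seqEdges g := by
  induction R with
  | zero => exact ⟨f, h, fun _ _ _ => rfl, fun e he _ => he, fun r hr => absurd hr (by omega)⟩
  | succ R ih =>
    obtain ⟨g, hg, hgf, hge, hgn⟩ := ih (fun r hr => hab r (by omega)) (fun r hr => hb r (by omega))
      (fun r hr => hba r (by omega)) (fun r hr => h1 r (by omega)) (fun r hr => h2 r (by omega))
    have hlt : ∀ r < R, b r < a R := by
      clear hge hgn hgf ih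
      intro r hr
      induction R with
      | zero => omega
      | succ R ih2 =>
        have h3 := hba R (by omega)
        rcases Nat.lt_succ_iff_lt_or_eq.1 hr with h4 | rfl
        · have := ih2 (fun r hr => hab r (by omega)) (fun r hr => hb r (by omega))
            (fun r hr => hba r (by omega)) (fun r hr => h1 r (by omega))
            (fun r hr => h2 r (by omega)) h4
          have := hab R (by omega)
          omega
        · exact h3
    have hR1 := hab R (by omega)
    have hR2 := hb R (by omega)
    have e1 := hgf (a R) hlt (by omega)
    have e2 := hgf (b R) (fun r hr => by have := hlt r hr; omega) (by omega)
    have e3 := hgf (a R + 1) (fun r hr => by have := hlt r hr; omega) (by omega)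
    have e4 := hgf (b R + 1) (fun r hr => by have := hlt r hr; omega) (by omega)
    obtain ⟨k, hk, hkg, hke, hk1, hk2⟩ := hg.exists_reverse hR1 hR2
      (by rw [e1, e2]; exact h1 R (by omega)) (by rw [e3, e4]; exact h2 R (by omega))
    rw [e1, e3, e2, e4] at hke
    rw [e1, e2] at hk1
    rw [e3, e4] at hk2
    have hfar : ∀ s t u, s < a R → (t = a R ∨ t = b R) → s(f s, u) ≠ s(f t, f (t + 1)) := by
      intro s t u hs ht heq
      rcases Sym2.eq_iff.1 heq with ⟨h5, _⟩ | ⟨h5, _⟩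
      · have := h.inj _ _ (by omega) (by omega) h5
        omega
      · have := h.inj _ _ (by omega) (by omega) h5
        omega
    refine ⟨k, hk, fun t ht htL => ?_, fun e he hne => ?_, fun r hr => ?_⟩
    · rw [hkg t (ht R (by omega)) htL, hgf t (fun r hr => ht r (by omega)) htL]
    · exact hke e (hge e he fun r hr => hne r (by omega)) (hne R (by omega)).1 (hne R (by omega)).2
    · rcases Nat.lt_succ_iff_lt_or_eq.1 hr with h4 | rfl
      · have h5 := hlt r h4
        have h6 := hab r (by omega)
        exact ⟨hke _ (hgn r h4).1 (hfar _ _ _ (by omega) (Or.inl rfl))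
            (hfar _ _ _ (by omega) (Or.inr rfl)),
          hke _ (hgn r h4).2 (hfar _ _ _ (by omega) (Or.inl rfl))
            (hfar _ _ _ (by omega) (Or.inr rfl))⟩
      · exact ⟨hk1, hk2⟩

end CycSeq

open scoped SimpleGraph

/-! ### Hamilton cycles of Cartesian products -/

section Product

variable {V W : Type*} {G : SimpleGraph V} {H : SimpleGraph W}

/-- All `f i` run through Hamilton cycles of `G`, and these cover all edges. -/
def IsHamCover {ι : Type*} (G : SimpleGraph V) (f : ι → ℕ → V) : Prop :=
  (∀ i, CycSeq G (Nat.card V) (f i)) ∧ ∀ x y, G.Adj x y → ∃ i, s(x, y) ∈ seqEdges (f i)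

section

open Classical in
/-- The number of the `j < t` with `S j`. -/
noncomputable def cnt (S : ℕ → Prop) (t : ℕ) : ℕ := Nat.count S t

theorem cnt_succ_of_pos {S : ℕ → Prop} {t : ℕ} (h : S t) : cnt S (t + 1) = cnt S t + 1 := by
  simp [cnt, Nat.count_succ, h]

theorem cnt_succ_of_neg {S : ℕ → Prop} {t : ℕ} (h : ¬ S t) : cnt S (t + 1) = cnt S t := by
  simp [cnt, Nat.count_succ, h]

/-- The sequence in a product that at time `t` makes a step along `u` if `S (t % B)`, and a step
along `v` otherwise. -/
noncomputable def prodSeq (u : ℕ → V) (v : ℕ → W) (B : ℕ) (S : ℕ → Prop) (t : ℕ) : V × W :=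
  (u (cnt (fun j => S (j % B)) t), v (cnt (fun j => ¬ S (j % B)) t))

theorem cnt_add_cnt_not (S : ℕ → Prop) (t : ℕ) : cnt S t + cnt (fun j => ¬ S j) t = t := by
  induction t with
  | zero => rfl
  | succ t ih =>
    by_cases h : S t
    · rw [cnt_succ_of_pos h, cnt_succ_of_neg (not_not.2 h)]
      omega
    · rw [cnt_succ_of_neg h, cnt_succ_of_pos (S := fun j => ¬ S j) h]
      omega

theorem cnt_mod_add (S : ℕ → Prop) (B q r : ℕ) :
    cnt (fun j => S (j % B)) (B * q + r)
      = cnt (fun j => S (j % B)) B * q + cnt (fun j => S (j % B)) r := by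
  induction q with
  | zero => simp
  | succ q ih =>
    have h : ∀ r, cnt (fun j => S (j % B)) (B + r)
        = cnt (fun j => S (j % B)) B + cnt (fun j => S (j % B)) r := by
      intro r
      induction r with
      | zero => rfl
      | succ r ih =>
        by_cases h : S (r % B)
        · rw [← add_assoc, cnt_succ_of_pos (S := fun j => S (j % B)) (by simpa using h), ih,
            cnt_succ_of_pos (S := fun j => S (j % B)) h, add_assoc]
        · rw [← add_assoc, cnt_succ_of_neg (S := fun j => S (j % B)) (by simpa using h), ih,
            cnt_succ_of_neg (S := fun j => S (j % B)) h]
    rw [show B * (q + 1) + r = B + (B * q + r) by ring, h, ih]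
    ring

theorem prodSeq_succ_of_pos (u : ℕ → V) (v : ℕ → W) {B : ℕ} {S : ℕ → Prop} {t : ℕ}
    (h : S (t % B)) : prodSeq u v B S (t + 1)
      = (u (cnt (fun j => S (j % B)) t + 1), (prodSeq u v B S t).2) := by
  rw [prodSeq, cnt_succ_of_pos (S := fun j => S (j % B)) h,
    cnt_succ_of_neg (S := fun j => ¬ S (j % B)) (not_not.2 h)]
  rfl

theorem prodSeq_succ_of_neg (u : ℕ → V) (v : ℕ → W) {B : ℕ} {S : ℕ → Prop} {t : ℕ}
    (h : ¬ S (t % B)) : prodSeq u v B S (t + 1)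
      = ((prodSeq u v B S t).1, v (cnt (fun j => ¬ S (j % B)) t + 1)) := by
  rw [prodSeq, cnt_succ_of_neg (S := fun j => S (j % B)) h,
    cnt_succ_of_pos (S := fun j => ¬ S (j % B)) h]
  rfl

variable {A B : ℕ} {u : ℕ → V} {v : ℕ → W} {S : ℕ → Prop}

theorem CycSeq.prod (hu : CycSeq G A u) (hv : CycSeq H B v) (hBA : B ∣ A)
    (hS : (cnt (fun j => S (j % B)) B).Coprime A) :
    CycSeq (G □ H) (A * B) (prodSeq u v B S) := by
  have hA := hu.pos
  have hB := hv.pos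
  refine ⟨Nat.mul_pos hA hB, fun t => ?_, fun t => ?_, fun s t hs ht h => ?_⟩
  · by_cases h : S (t % B)
    · rw [prodSeq_succ_of_pos u v h, SimpleGraph.boxProd_adj]
      exact Or.inl ⟨hu.adj _, rfl⟩
    · rw [prodSeq_succ_of_neg u v h, SimpleGraph.boxProd_adj]
      exact Or.inr ⟨hv.adj _, rfl⟩
  · rw [show t + A * B = B * A + t by ring]
    refine Prod.ext ?_ ?_
    · show u _ = u _
      rw [cnt_mod_add, hu.eq_iff, Nat.mul_add_mod_self_right]
    · show v _ = v _
      rw [cnt_mod_add (fun j => ¬ S j), hv.eq_iff]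
      obtain ⟨c, rfl⟩ := hBA
      rw [mul_left_comm, Nat.mul_add_mod]
  · have h1 : _ ≡ _ [MOD A] := (hu.eq_iff _ _).1 (Prod.ext_iff.1 h).1
    have h2 : _ ≡ _ [MOD B] := (hv.eq_iff _ _).1 (Prod.ext_iff.1 h).2
    have h3 := (h1.of_dvd hBA).add h2
    simp only [cnt_add_cnt_not fun j => S (j % B)] at h3
    have h3 : s % B = t % B := h3
    rw [← Nat.div_add_mod s B, ← Nat.div_add_mod t B, cnt_mod_add, cnt_mod_add, h3] at h1
    have h4 := Nat.ModEq.cancel_left_of_coprime (Nat.gcd_comm _ _ ▸ hS)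
      (Nat.ModEq.add_right_cancel' _ h1)
    have h5 := Nat.ModEq.eq_of_lt_of_lt h4 ((Nat.div_lt_iff_lt_mul hB).2 hs)
      ((Nat.div_lt_iff_lt_mul hB).2 ht)
    rw [← Nat.div_add_mod s B, ← Nat.div_add_mod t B, h3, h5]

variable [Finite V] [Finite W]

theorem exists_prodSeq_eq (hu : CycSeq G A u) (hv : CycSeq H B v) (hBA : B ∣ A)
    (hS : (cnt (fun j => S (j % B)) B).Coprime A) (hV : Nat.card V = A)
    (hW : Nat.card W = B) (a b : ℕ) :
    ∃ t < A * B, prodSeq u v B S t = (u a, v b) ∧ t % B = (a + b) % B ∧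
      u (cnt (fun j => S (j % B)) t + 1) = u (a + 1) ∧
      v (cnt (fun j => ¬ S (j % B)) t + 1) = v (b + 1) := by
  obtain ⟨t, htl, ht⟩ := (hu.prod hv hBA hS).surj (by rw [Nat.card_prod, hV, hW]) (u a, v b)
  have h1 : _ ≡ _ [MOD A] := (hu.eq_iff _ _).1 (Prod.ext_iff.1 ht).1
  have h2 : _ ≡ _ [MOD B] := (hv.eq_iff _ _).1 (Prod.ext_iff.1 ht).2
  have h3 := (h1.of_dvd hBA).add h2
  simp only [cnt_add_cnt_not fun j => S (j % B)] at h3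
  exact ⟨t, htl, ht, h3, (hu.eq_iff _ _).2 (h1.add_right 1), (hv.eq_iff _ _).2 (h2.add_right 1)⟩

theorem left_mem_seqEdges_prodSeq (hu : CycSeq G A u) (hv : CycSeq H B v) (hBA : B ∣ A)
    (hS : (cnt (fun j => S (j % B)) B).Coprime A) (hV : Nat.card V = A)
    (hW : Nat.card W = B) {a b : ℕ} (h : S ((a + b) % B)) :
    s((u a, v b), (u (a + 1), v b)) ∈ seqEdges (prodSeq u v B S) := by
  obtain ⟨t, _, h1, h2, h3, h4⟩ := exists_prodSeq_eq hu hv hBA hS hV hW a b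
  refine ⟨t, ?_⟩
  rw [prodSeq_succ_of_pos u v (h2 ▸ h), h1, h3]

theorem right_mem_seqEdges_prodSeq (hu : CycSeq G A u) (hv : CycSeq H B v) (hBA : B ∣ A)
    (hS : (cnt (fun j => S (j % B)) B).Coprime A) (hV : Nat.card V = A)
    (hW : Nat.card W = B) {a b : ℕ} (h : ¬ S ((a + b) % B)) :
    s((u a, v b), (u a, v (b + 1))) ∈ seqEdges (prodSeq u v B S) := by
  obtain ⟨t, _, h1, h2, h3, h4⟩ := exists_prodSeq_eq hu hv hBA hS hV hW a b
  refine ⟨t, ?_⟩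
  rw [prodSeq_succ_of_neg u v (h2 ▸ h), h1, h4]

theorem cnt_coprime {p q : ℕ} (hq : 1 ≤ q) (S : ℕ → Prop)
    (hS : Odd (cnt (fun j => S (j % 2 ^ q)) (2 ^ q))) :
    (cnt (fun j => S (j % 2 ^ q)) (2 ^ q)).Coprime (2 ^ p) ∧
      (cnt (fun j => ¬ S (j % 2 ^ q)) (2 ^ q)).Coprime (2 ^ p) := by
  have h := cnt_add_cnt_not (fun j => S (j % 2 ^ q)) (2 ^ q)
  have h2 : Odd (cnt (fun j => ¬ S (j % 2 ^ q)) (2 ^ q)) := by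
    have he : Even (2 ^ q) := (Nat.even_pow.2 ⟨even_two, by omega⟩)
    rw [← h] at he
    rw [← Nat.not_even_iff_odd] at hS ⊢
    exact fun h3 => hS (by rwa [Nat.even_add, iff_true_right h3] at he)
  exact ⟨(Nat.coprime_two_right.2 hS).pow_right p, (Nat.coprime_two_right.2 h2).pow_right p⟩

end

end Product

section Extension

variable {V Z : Type*} {X : SimpleGraph V} {Q : SimpleGraph Z} {M : ℕ}

theorem mk_fst_eq {y y' w w' : V} {a a' b b' : Z} (h : s((y, a), (y', a')) = s((w, b), (w', b'))) :
    s(y, y') = s(w, w') := congrArg (Sym2.map Prod.fst) h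

theorem mk_snd_eq {y y' w w' : V} {a a' b b' : Z} (h : s((y, a), (y', a')) = s((w, b), (w', b'))) :
    s(a, a') = s(b, b') := congrArg (Sym2.map Prod.snd) h

/-- The four copies of a cycle in its product with a 4-cycle, merged into one cycle by three
exchanges of opposite edges of squares. -/
theorem exists_merge_layers {f : ℕ → V} {v : ℕ → Z} (hf : CycSeq X M f) (hv : CycSeq Q 4 v)
    (c : ℕ) (y y' : ℕ → V) (hy : ∀ b < 3, s(y b, y' b) ∈ seqEdges f)
    (hne : ∀ b < 3, ∀ b' < 3, b ≠ b' → s(y b, y' b) ≠ s(y b', y' b')) :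
    ∃ h, CycSeq (X □ Q) (M * 4) h ∧
      (∀ x x' l, s(x, x') ∈ seqEdges f → (∀ b < 3, s(x, x') = s(y b, y' b) →
        v l ≠ v (c + 2 - b) ∧ v l ≠ v (c + 2 - b + 1)) → s((x, v l), (x', v l)) ∈ seqEdges h) ∧
      ∀ b < 3, s((y b, v (c + 2 - b)), (y b, v (c + 2 - b + 1))) ∈ seqEdges h ∧
        s((y' b, v (c + 2 - b)), (y' b, v (c + 2 - b + 1))) ∈ seqEdges h := by
  have hlay : ∀ l, CycSeq (X □ Q) M fun t => (f t, v l) := fun l =>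
    hf.map (SimpleGraph.boxProdLeft X Q (v l)).toHom (SimpleGraph.boxProdLeft X Q (v l)).injective
  have hlm : ∀ {x x'} l, s(x, x') ∈ seqEdges f →
      s((x, v l), (x', v l)) ∈ seqEdges fun t => (f t, v l) := fun l h =>
    mk_mem_seqEdges_map (fun x => (x, v l)) h
  have hdiff : ∀ i j, i < 4 → j < 4 → i ≠ j → v (c + i) ≠ v (c + j) := by
    intro i j hi hj hij h
    have := (hv.eq_iff _ _).1 h
    omega
  have hup : ∀ x l, (X □ Q).Adj (x, v l) (x, v (l + 1)) := fun x l =>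
    SimpleGraph.boxProd_adj.2 (Or.inr ⟨hv.adj l, rfl⟩)
  have hyy : ∀ b < 3, y b ≠ y' b := by
    intro b hb h
    obtain ⟨t, ht⟩ := hy b hb
    rw [h] at ht
    have := hf.adj t
    rcases Sym2.eq_iff.1 ht with ⟨h1, h2⟩ | ⟨h1, h2⟩ <;>
      exact this.ne (by rw [← h1, ← h2])
  have hvh : ∀ b < 3, ∀ x l l' m, s((x, v l), (x, v l')) ≠ s((y b, v m), (y' b, v m)) := by
    intro b hb x l l' m h
    rcases Sym2.eq_iff.1 (mk_fst_eq h) with ⟨h1, h2⟩ | ⟨h1, h2⟩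
    · exact hyy b hb (h1.symm.trans h2)
    · exact hyy b hb (h2.symm.trans h1)
  have hll : ∀ (x x' y y' : V) (l m : ℕ), v l ≠ v m →
      s((x, v l), (x', v l)) ≠ s((y, v m), (y', v m)) := by
    intro x x' y y' l m hlm h
    rcases Sym2.eq_iff.1 (mk_snd_eq h) with ⟨h1, h2⟩ | ⟨h1, h2⟩ <;> exact hlm h1
  obtain ⟨g, hg, hgr, hge, hge', hg1, hg2⟩ := (hlay c).merge (hlay (c + 1))
    (fun s t h => hdiff 0 1 (by omega) (by omega) (by omega) (Prod.ext_iff.1 h).2)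
    (hlm c (hy 2 (by omega))) (hlm (c + 1) (hy 2 (by omega))) (hup _ _) (hup _ _)
  obtain ⟨k, hk, hkr, hke, hke', hk1, hk2⟩ := hg.merge (hlay (c + 2))
    (fun s t h => by
      rcases hgr s with ⟨r, hr⟩ | ⟨r, hr⟩ <;> rw [hr] at h
      · exact hdiff 0 2 (by omega) (by omega) (by omega) (Prod.ext_iff.1 h).2
      · exact hdiff 1 2 (by omega) (by omega) (by omega) (Prod.ext_iff.1 h).2)
    (hge' _ (hlm (c + 1) (hy 1 (by omega))) fun h =>
      hne 1 (by omega) 2 (by omega) (by omega) (mk_fst_eq h))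
    (hlm (c + 2) (hy 1 (by omega))) (hup _ _) (hup _ _)
  obtain ⟨h, hh, hhr, hhe, hhe', hh1, hh2⟩ := hk.merge (hlay (c + 3))
    (fun s t h => by
      rcases hkr s with ⟨r, hr⟩ | ⟨r, hr⟩ <;> rw [hr] at h
      · rcases hgr r with ⟨r', hr'⟩ | ⟨r', hr'⟩ <;> rw [hr'] at h
        · exact hdiff 0 3 (by omega) (by omega) (by omega) (Prod.ext_iff.1 h).2
        · exact hdiff 1 3 (by omega) (by omega) (by omega) (Prod.ext_iff.1 h).2
      · exact hdiff 2 3 (by omega) (by omega) (by omega) (Prod.ext_iff.1 h).2)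
    (hke' _ (hlm (c + 2) (hy 0 (by omega))) fun h =>
      hne 0 (by omega) 1 (by omega) (by omega) (mk_fst_eq h))
    (hlm (c + 3) (hy 0 (by omega))) (hup _ _) (hup _ _)
  refine ⟨h, by rwa [show M * 4 = M + M + M + M by ring], fun x x' l hx hb => ?_, fun b hb => ?_⟩
  · have hl : v l = v c ∨ v l = v (c + 1) ∨ v l = v (c + 2) ∨ v l = v (c + 3) := by
      simp only [hv.eq_iff]
      omega
    have hb0 := hb 0 (by omega)
    have hb1 := hb 1 (by omega)
    have hb2 := hb 2 (by omega)
    simp only [Nat.sub_zero, show c + 2 - 1 = c + 1 by omega, show c + 2 - 2 = c by omega]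
      at hb0 hb1 hb2
    rcases hl with hl | hl | hl | hl <;> rw [hl] at hb0 hb1 hb2 ⊢
    · refine hhe _ (hke _ (hge _ (hlm c hx) fun h => (hb2 (mk_fst_eq h)).1 rfl) ?_) ?_
      · exact hll _ _ _ _ _ _ (hdiff 0 1 (by omega) (by omega) (by omega))
      · exact hll _ _ _ _ _ _ (hdiff 0 2 (by omega) (by omega) (by omega))
    · refine hhe _ (hke _ (hge' _ (hlm _ hx) fun h => (hb2 (mk_fst_eq h)).2 rfl) ?_) ?_
      · exact fun h => (hb1 (mk_fst_eq h)).1 rfl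
      · exact hll _ _ _ _ _ _ (hdiff 1 2 (by omega) (by omega) (by omega))
    · refine hhe _ (hke' _ (hlm _ hx) fun h => (hb1 (mk_fst_eq h)).2 rfl) ?_
      exact fun h => (hb0 (mk_fst_eq h)).1 rfl
    · exact hhe' _ (hlm _ hx) fun h => (hb0 (mk_fst_eq h)).2 rfl
  · have h0 := hvh 0 (by omega)
    have h1 := hvh 1 (by omega)
    interval_cases b
    · exact ⟨hh1, hh2⟩
    · exact ⟨hhe _ hk1 (h0 _ _ _ _), hhe _ hk2 (h0 _ _ _ _)⟩
    · exact ⟨hhe _ (hke _ hg1 (h1 _ _ _ _)) (h0 _ _ _ _),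
        hhe _ (hke _ hg2 (h1 _ _ _ _)) (h0 _ _ _ _)⟩

theorem cnt_mod_eq_pred {B : ℕ} (hB : 0 < B) (t : ℕ) :
    cnt (fun j => j % B = B - 1) t = t / B := by
  induction t with
  | zero => simp [cnt]
  | succ t ih =>
    have h : (t + 1) / B = t / B + if t % B = B - 1 then 1 else 0 := by
      rw [Nat.succ_div]
      congr 2
      rw [Nat.dvd_iff_mod_eq_zero, ← Nat.mod_add_mod]
      have := Nat.mod_lt t hB
      apply propext
      constructor
      · intro h
        by_contra h2
        rw [Nat.mod_eq_of_lt (by omega)] at h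
        omega
      · intro h
        rw [h, Nat.sub_add_cancel hB, Nat.mod_self]
    by_cases h2 : t % B = B - 1
    · rw [cnt_succ_of_pos (S := fun j => j % B = B - 1) h2, ih, h, if_pos h2]
    · rw [cnt_succ_of_neg (S := fun j => j % B = B - 1) h2, ih, h, if_neg h2, add_zero]

theorem prodSeq_pred (u : ℕ → V) (v : ℕ → Z) {B : ℕ} (hB : 0 < B) (t : ℕ) :
    prodSeq u v B (fun j => j = B - 1) t = (u (t / B), v (t - t / B)) := by
  have h := cnt_add_cnt_not (fun j => j % B = B - 1) t
  rw [cnt_mod_eq_pred hB] at h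
  rw [prodSeq, cnt_mod_eq_pred hB, ← Nat.eq_sub_of_add_eq' h]

/-- A cover by Hamilton cycles is extended to the product with a 4-cycle if suitable squares for
exchanges are available: they come in consecutive intervals of the first cycle. -/
theorem exists_hamCover_boxProd_square [Finite V] [Finite Z] {p : ℕ} (hp : 2 ≤ p)
    (hV : Nat.card V = 2 ^ p) (hZ : Nat.card Z = 4) {g : ℕ → V} {v : ℕ → Z}
    (hg : CycSeq X (2 ^ p) g) (hv : CycSeq Q 4 v)
    (hvc : ∀ x y, Q.Adj x y → s(x, y) ∈ seqEdges v) {K : ℕ} (J : Fin K → ℕ → V)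
    (hJ : ∀ j, CycSeq X (2 ^ p) (J j))
    (hcov : ∀ x y, X.Adj x y → s(x, y) ∈ seqEdges g ∨ ∃ j, s(x, y) ∈ seqEdges (J j))
    (a b : ℕ → ℕ) (c : ℕ → ℕ) (hab : ∀ r < 3 * K, a r < b r) (hb : ∀ r < 3 * K, b r < 2 ^ p)
    (hba : ∀ r, r + 1 < 3 * K → b r < a (r + 1))
    (hx : ∀ r < 3 * K, (c (r / 3) + 2 - r % 3 + a r) % 4 ≠ 3 ∧
      (c (r / 3) + 2 - r % 3 + b r) % 4 ≠ 3)
    (he : ∀ j : Fin K, ∀ i < 3, s(g (a (3 * j + i)), g (b (3 * j + i))) ∈ seqEdges (J j)) :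
    ∃ F : Option (Option (Fin K)) → ℕ → V × Z, IsHamCover (X □ Q) F := by
  have h4 : 4 ∣ 2 ^ p := pow_dvd_pow 2 hp
  let D := prodSeq g v 4 fun j => j = 3
  let D' := prodSeq g v 4 fun j => ¬ j = 3
  have hodd : Odd (cnt (fun j => j % 2 ^ 2 = 2 ^ 2 - 1) (2 ^ 2)) := by
    rw [cnt_mod_eq_pred (by norm_num)]; norm_num
  have hcop := cnt_coprime (p := p) (q := 2) (by norm_num) (fun j => j = 3) hodd
  have hc1 : (cnt (fun j => j % 4 = 3) 4).Coprime (2 ^ p) := hcop.1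
  have hc2 : (cnt (fun j => ¬ j % 4 = 3) 4).Coprime (2 ^ p) := hcop.2
  have hW : CycSeq (X □ Q) (2 ^ p * 4) D := hg.prod (S := fun j => j = 3) hv h4 hc1
  have hF : CycSeq (X □ Q) (2 ^ p * 4) D' := hg.prod (S := fun j => ¬ j = 3) hv h4 hc2
  have hWt : ∀ t, D t = (g (t / 4), v (t - t / 4)) :=
    prodSeq_pred g v (by norm_num)
  set x : ℕ → ℕ := fun r => c (r / 3) + 2 - r % 3 with hxdef
  replace hx : ∀ r < 3 * K, (x r + a r) % 4 ≠ 3 ∧ (x r + b r) % 4 ≠ 3 := hx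
  have hpos : ∀ r u, (x r + u) % 4 ≠ 3 →
      D (4 * u + (x r + u) % 4) = (g u, v (x r)) ∧
      D (4 * u + (x r + u) % 4 + 1) = (g u, v (x r + 1)) := by
    intro r u hu
    constructor
    · rw [hWt, show (4 * u + (x r + u) % 4) / 4 = u by omega]
      exact Prod.ext rfl ((hv.eq_iff _ _).2 (by omega))
    · rw [hWt, show (4 * u + (x r + u) % 4 + 1) / 4 = u by omega]
      exact Prod.ext rfl ((hv.eq_iff _ _).2 (by omega))
  have hadj : ∀ r < 3 * K, X.Adj (g (a r)) (g (b r)) := by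
    intro r hr
    have h := he ⟨r / 3, by omega⟩ (r % 3) (Nat.mod_lt _ (by norm_num))
    simp only [Nat.div_add_mod] at h
    obtain ⟨t, ht⟩ := h
    rw [← SimpleGraph.mem_edgeSet, ht]
    exact (hJ _).adj t
  obtain ⟨W, hWc, -, hWe, hWn⟩ := hW.exists_reverses (fun r => 4 * a r + (x r + a r) % 4)
    (fun r => 4 * b r + (x r + b r) % 4) (3 * K)
    (fun r hr => by have := hab r hr; show 4 * a r + _ < 4 * b r + _; omega)
    (fun r hr => by
      have := hb r hr
      have := (hx r hr).2
      show 4 * b r + (x r + b r) % 4 + 1 < _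
      omega)
    (fun r hr => by
      have := hba r hr
      show 4 * b r + _ < 4 * a (r + 1) + _
      omega)
    (fun r hr => by
      rw [(hpos r _ (hx r hr).1).1, (hpos r _ (hx r hr).2).1]
      exact SimpleGraph.boxProd_adj.2 (Or.inl ⟨hadj r hr, rfl⟩))
    (fun r hr => by
      rw [(hpos r _ (hx r hr).1).2, (hpos r _ (hx r hr).2).2]
      exact SimpleGraph.boxProd_adj.2 (Or.inl ⟨hadj r hr, rfl⟩))
  have hlt : ∀ r s, r < s → s < 3 * K → b r < a s := by
    intro r s hrs
    induction s with
    | zero => omega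
    | succ s ih =>
      intro hs
      have h1 := hba s hs
      rcases Nat.lt_succ_iff_lt_or_eq.1 hrs with h2 | rfl
      · have := ih h2 (by omega)
        have := hab s (by omega)
        omega
      · exact h1
  have hne : ∀ r < 3 * K, ∀ s < 3 * K, r ≠ s → s(g (a r), g (b r)) ≠ s(g (a s), g (b s)) := by
    intro r hr s hs hrs h
    have h1 := hab r hr
    have h2 := hab s hs
    have h3 := hb r hr
    have h4 := hb s hs
    have h5 : b r < a s ∨ b s < a r := by
      rcases lt_or_gt_of_ne hrs with h5 | h5
      · exact Or.inl (hlt r s h5 hs)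
      · exact Or.inr (hlt s r h5 hr)
    rcases Sym2.eq_iff.1 h with ⟨h6, _⟩ | ⟨h6, _⟩
    · have := hg.inj _ _ (by omega) (by omega) h6
      omega
    · have := hg.inj _ _ (by omega) (by omega) h6
      omega
  have hmerge := fun j : Fin K => exists_merge_layers (hJ j) hv (c j)
    (fun i => g (a (3 * j + i))) (fun i => g (b (3 * j + i))) (he j)
    (fun i hi i' hi' hii => hne _ (by omega) _ (by omega) (by omega))
  choose J' hJ'c hJ'e hJ'n using hmerge
  have hxj : ∀ (j : Fin K) i, i < 3 → c j + 2 - i = x (3 * j + i) := by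
    intro j i hi
    simp only [hxdef]
    rw [show (3 * (j : ℕ) + i) / 3 = j by omega, show (3 * (j : ℕ) + i) % 3 = i by omega]
  have hcard : Nat.card (V × Z) = 2 ^ p * 4 := by rw [Nat.card_prod, hV, hZ]
  refine ⟨fun i => i.elim W fun i => i.elim D' J', ?_, ?_⟩
  · rw [hcard]
    rintro (_ | _ | j)
    · exact hWc
    · exact hF
    · exact hJ'c j
  rintro ⟨y, z⟩ ⟨y', z'⟩ hyz
  have hbase : s((y, z), (y', z')) ∈ seqEdges D →
      ∃ i : Option (Option (Fin K)), s((y, z), (y', z')) ∈ seqEdges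
        ((fun i => i.elim W fun i => i.elim D' J') i) := by
    intro hmem
    by_cases hrem : ∀ r < 3 * K, s((y, z), (y', z')) ≠
        s(D (4 * a r + (x r + a r) % 4), D (4 * a r + (x r + a r) % 4 + 1)) ∧ s((y, z), (y', z')) ≠
        s(D (4 * b r + (x r + b r) % 4), D (4 * b r + (x r + b r) % 4 + 1))
    · exact ⟨none, hWe _ hmem hrem⟩
    · push Not at hrem
      obtain ⟨r, hr, hrem⟩ := hrem
      have hj := hJ'n ⟨r / 3, by omega⟩ (r % 3) (Nat.mod_lt _ (by norm_num))
      rw [hxj _ _ (Nat.mod_lt _ (by norm_num))] at hj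
      simp only [Nat.div_add_mod] at hj
      refine ⟨some (some ⟨r / 3, by omega⟩), ?_⟩
      rw [(hpos r _ (hx r hr).1).1, (hpos r _ (hx r hr).1).2, (hpos r _ (hx r hr).2).1,
        (hpos r _ (hx r hr).2).2] at hrem
      by_cases h1 : s((y, z), (y', z')) = s((g (a r), v (x r)), (g (a r), v (x r + 1)))
      · rw [h1]; exact hj.1
      · rw [hrem h1]; exact hj.2
  have hor : s((y, z), (y', z')) ∈ seqEdges D ∨
      s((y, z), (y', z')) ∈ seqEdges D' ∨
      ∃ j l, z = v l ∧ z' = v l ∧ s(y, y') ∈ seqEdges (J j) := by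
    rcases SimpleGraph.boxProd_adj.1 hyz with ⟨h1, h2⟩ | ⟨h1, h2⟩
    · simp only at h1 h2
      subst h2
      obtain ⟨l, -, rfl⟩ := hv.surj hZ z
      rcases hcov y y' h1 with ⟨t, ht⟩ | ⟨j, hj⟩
      · have ht2 : s((y, v l), (y', v l)) = s((g t, v l), (g (t + 1), v l)) :=
          congrArg (Sym2.map fun x => (x, v l)) ht
        rw [ht2]
        by_cases hS : (t + l) % 4 = 3
        · exact Or.inl (left_mem_seqEdges_prodSeq (S := fun j => j = 3) hg hv h4 hc1 hV hZ hS)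
        · exact Or.inr (Or.inl (left_mem_seqEdges_prodSeq (S := fun j => ¬ j = 3) hg hv h4 hc2 hV hZ hS))
      · exact Or.inr (Or.inr ⟨j, l, rfl, rfl, hj⟩)
    · simp only at h1 h2
      subst h2
      obtain ⟨t, -, rfl⟩ := hg.surj hV y
      obtain ⟨l, hl⟩ := hvc _ _ h1
      have ht2 : s((g t, z), (g t, z')) = s((g t, v l), (g t, v (l + 1))) :=
        congrArg (Sym2.map fun x => (g t, x)) hl
      rw [ht2]
      by_cases hS : (t + l) % 4 = 3
      · exact Or.inr (Or.inl (right_mem_seqEdges_prodSeq (S := fun j => ¬ j = 3) hg hv h4 hc2 hV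
          hZ (not_not.2 hS)))
      · exact Or.inl (right_mem_seqEdges_prodSeq (S := fun j => j = 3) hg hv h4 hc1 hV hZ hS)
  rcases hor with h | h | ⟨j, l, rfl, rfl, hj⟩
  · exact hbase h
  · exact ⟨some none, h⟩
  · by_cases hd : ∀ i < 3, s(y, y') = s(g (a (3 * j + i)), g (b (3 * j + i))) →
        v l ≠ v (c j + 2 - i) ∧ v l ≠ v (c j + 2 - i + 1)
    · exact ⟨some (some j), hJ'e j y y' l hj hd⟩
    · push Not at hd
      obtain ⟨i, hi, hyi, hd⟩ := hd
      rw [hxj j i hi] at hd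
      have hr : 3 * (j : ℕ) + i < 3 * K := by omega
      refine ⟨none, ?_⟩
      have hn := hWn _ hr
      rw [(hpos _ _ (hx _ hr).1).1, (hpos _ _ (hx _ hr).2).1,
        (hpos _ _ (hx _ hr).1).2, (hpos _ _ (hx _ hr).2).2] at hn
      have ht2 : ∀ m, s((y, v m), (y', v m))
          = s((g (a (3 * j + i)), v m), (g (b (3 * j + i)), v m)) := fun m =>
        congrArg (Sym2.map fun x => (x, v m)) hyi
      rw [ht2]
      by_cases h1 : v l = v (x (3 * j + i))
      · rw [h1]; exact hn.1
      · rw [hd h1]; exact hn.2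

end Extension

section Square

variable {V : Type*} {G : SimpleGraph V}

/-- The two Hamilton cycles of the square of a cycle, given by a set `S` of residues. -/
noncomputable def squareSeq (u : ℕ → V) (B : ℕ) (S : ℕ → Prop) (β : Bool) : ℕ → V × V :=
  cond β (prodSeq u u B S) (prodSeq u u B fun j => ¬ S j)

theorem squareSeq_cycSeq {q : ℕ} (hq : 1 ≤ q) {u : ℕ → V} (hu : CycSeq G (2 ^ q) u)
    {S : ℕ → Prop} (hS : Odd (cnt (fun j => S (j % 2 ^ q)) (2 ^ q))) (β : Bool) :
    CycSeq (G □ G) (2 ^ q * 2 ^ q) (squareSeq u (2 ^ q) S β) := by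
  obtain ⟨h1, h2⟩ := cnt_coprime (p := q) hq S hS
  cases β
  · exact hu.prod (S := fun j => ¬ S j) hu dvd_rfl h2
  · exact hu.prod hu dvd_rfl h1

theorem left_mem_squareSeq [Finite V] {q : ℕ} (hq : 1 ≤ q) (hV : Nat.card V = 2 ^ q) {u : ℕ → V}
    (hu : CycSeq G (2 ^ q) u) {S : ℕ → Prop} (hS : Odd (cnt (fun j => S (j % 2 ^ q)) (2 ^ q)))
    {β : Bool} {a b : ℕ} (h : β = true ↔ S ((a + b) % 2 ^ q)) :
    s((u a, u b), (u (a + 1), u b)) ∈ seqEdges (squareSeq u (2 ^ q) S β) := by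
  obtain ⟨h1, h2⟩ := cnt_coprime (p := q) hq S hS
  cases β
  · exact left_mem_seqEdges_prodSeq (S := fun j => ¬ S j) hu hu dvd_rfl h2 hV hV (by simpa using h)
  · exact left_mem_seqEdges_prodSeq hu hu dvd_rfl h1 hV hV (by simpa using h)

theorem right_mem_squareSeq [Finite V] {q : ℕ} (hq : 1 ≤ q) (hV : Nat.card V = 2 ^ q) {u : ℕ → V}
    (hu : CycSeq G (2 ^ q) u) {S : ℕ → Prop} (hS : Odd (cnt (fun j => S (j % 2 ^ q)) (2 ^ q)))
    {β : Bool} {a b : ℕ} (h : β = false ↔ S ((a + b) % 2 ^ q)) :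
    s((u a, u b), (u a, u (b + 1))) ∈ seqEdges (squareSeq u (2 ^ q) S β) := by
  obtain ⟨h1, h2⟩ := cnt_coprime (p := q) hq S hS
  cases β
  · exact right_mem_seqEdges_prodSeq (S := fun j => ¬ S j) hu hu dvd_rfl h2 hV hV
      (by simpa using h)
  · exact right_mem_seqEdges_prodSeq hu hu dvd_rfl h1 hV hV (by simpa using h)

/-- A cover by Hamilton cycles gives one of the square of the graph. -/
theorem IsHamCover.square [Finite V] {ι : Type*} {q : ℕ} (hq : 1 ≤ q) (hV : Nat.card V = 2 ^ q)
    {f : ι → ℕ → V} (hf : IsHamCover G f) (S : ι → ℕ → Prop)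
    (hS : ∀ i, Odd (cnt (fun j => S i (j % 2 ^ q)) (2 ^ q))) :
    IsHamCover (G □ G) fun i : ι × Bool => squareSeq (f i.1) (2 ^ q) (S i.1) i.2 := by
  obtain ⟨hc, hcov⟩ := hf
  rw [hV] at hc
  refine ⟨fun i => ?_, ?_⟩
  · rw [Nat.card_prod, hV]
    exact squareSeq_cycSeq hq (hc _) (hS _) _
  rintro ⟨x, y⟩ ⟨x', y'⟩ h
  rcases SimpleGraph.boxProd_adj.1 h with ⟨h1, h2⟩ | ⟨h1, h2⟩ <;> simp only at h1 h2 <;> subst h2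
  · obtain ⟨i, t, ht⟩ := hcov _ _ h1
    obtain ⟨l, -, rfl⟩ := (hc i).surj hV y
    have ht2 : s((x, f i l), (x', f i l)) = s((f i t, f i l), (f i (t + 1), f i l)) :=
      congrArg (Sym2.map fun x => (x, f i l)) ht
    rw [ht2]
    by_cases h3 : S i ((t + l) % 2 ^ q)
    · exact ⟨(i, true), left_mem_squareSeq hq hV (hc i) (hS i) (by simpa using h3)⟩
    · exact ⟨(i, false), left_mem_squareSeq hq hV (hc i) (hS i) (by simpa using h3)⟩
  · obtain ⟨i, t, ht⟩ := hcov _ _ h1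
    obtain ⟨l, -, rfl⟩ := (hc i).surj hV x
    have ht2 : s((f i l, y), (f i l, y')) = s((f i l, f i t), (f i l, f i (t + 1))) :=
      congrArg (Sym2.map fun x => (f i l, x)) ht
    rw [ht2]
    by_cases h3 : S i ((l + t) % 2 ^ q)
    · exact ⟨(i, false), right_mem_squareSeq hq hV (hc i) (hS i) (by simpa using h3)⟩
    · exact ⟨(i, true), right_mem_squareSeq hq hV (hc i) (hS i) (by simpa using h3)⟩

theorem odd_cnt_pred {B : ℕ} (hB : 0 < B) : Odd (cnt (fun j => j % B = B - 1) B) := by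
  rw [cnt_mod_eq_pred hB, Nat.div_self hB]
  exact odd_one

theorem cnt_eq_card {S : ℕ → Prop} {B : ℕ} (T : Finset ℕ) (hT : ∀ j, j ∈ T ↔ j < B ∧ S j) :
    cnt (fun j => S (j % B)) B = T.card := by
  classical
  rw [cnt, Nat.count_eq_card_filter_range]
  congr 1
  ext j
  rw [Finset.mem_filter, Finset.mem_range, hT]
  exact and_congr_right fun h => by rw [Nat.mod_eq_of_lt h]

/-- Squares for three exchanges along the same edge of the second factor in the blocks
`4 * j`, `4 * j + 1`, `4 * j + 2`. -/
theorem exists_chords [Finite V] {w : ℕ} (hw : 4 ∣ w) (hV : Nat.card V = w) {u : ℕ → V}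
    (hu : CycSeq G w u) {y y' : V} (hy : y ≠ y') (E : Set (Sym2 (V × V))) (j : ℕ)
    (hE : ∀ i < 3, s((u (4 * j + i), y), (u (4 * j + i), y')) ∈ E) :
    ∃ c, ∀ i < 3, ∃ a b, w * (4 * j + i) ≤ a ∧ a < b ∧ b < w * (4 * j + i + 1) ∧
      (c + 2 - i + a) % 4 ≠ 3 ∧ (c + 2 - i + b) % 4 ≠ 3 ∧
      s((u (a / w), u (a - a / w)), (u (b / w), u (b - b / w))) ∈ E := by
  have hw0 := hu.pos
  obtain ⟨e, he, rfl⟩ := hu.surj hV y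
  obtain ⟨e', he', rfl⟩ := hu.surj hV y'
  have hee : e ≠ e' := fun h => hy (by rw [h])
  obtain ⟨c, hc⟩ : ∃ c, (c + 2 + e) % 4 ≠ 3 ∧ (c + 2 + e') % 4 ≠ 3 := by
    by_cases h0 : (0 + 2 + e) % 4 ≠ 3 ∧ (0 + 2 + e') % 4 ≠ 3
    · exact ⟨0, h0⟩
    by_cases h1 : (1 + 2 + e) % 4 ≠ 3 ∧ (1 + 2 + e') % 4 ≠ 3
    · exact ⟨1, h1⟩
    · exact ⟨2, by omega⟩
  refine ⟨c, fun i hi => ?_⟩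
  have key : ∀ e, e < w → (c + 2 + e) % 4 ≠ 3 →
      (w * (4 * j + i) + (4 * j + i + e) % w) / w = 4 * j + i ∧
      u (w * (4 * j + i) + (4 * j + i + e) % w - (4 * j + i)) = u e ∧
      (c + 2 - i + (w * (4 * j + i) + (4 * j + i + e) % w)) % 4 ≠ 3 := by
    intro e _ h
    have hlt := Nat.mod_lt (4 * j + i + e) hw0
    refine ⟨?_, ?_, ?_⟩
    · rw [Nat.mul_add_div hw0, Nat.div_eq_of_lt hlt, add_zero]
    · rw [hu.eq_iff]
      have h1 : 4 * j + i ≤ w * (4 * j + i) := Nat.le_mul_of_pos_left _ hw0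
      have h2 : w * (4 * j + i) + (4 * j + i + e) % w - (4 * j + i) + (4 * j + i)
          ≡ e + (4 * j + i) [MOD w] := by
        rw [Nat.sub_add_cancel (by omega)]
        show _ % _ = _ % _
        rw [Nat.mul_add_mod, Nat.mod_mod, add_comm e]
      exact Nat.ModEq.add_right_cancel' _ h2
    · have h3 : (4 * j + i + e) % w % 4 = (4 * j + i + e) % 4 := Nat.mod_mod_of_dvd _ hw
      obtain ⟨k, rfl⟩ := hw
      rw [mul_assoc]
      generalize k * (4 * j + i) = z
      omega
  have hlt := Nat.mod_lt (4 * j + i + e) hw0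
  have hlt' := Nat.mod_lt (4 * j + i + e') hw0
  obtain ⟨h1, h2, h3⟩ := key e he hc.1
  obtain ⟨h1', h2', h3'⟩ := key e' he' hc.2
  have hne : (4 * j + i + e) % w ≠ (4 * j + i + e') % w := fun h =>
    hee (Nat.ModEq.eq_of_lt_of_lt (Nat.ModEq.add_left_cancel' _ h) he he')
  have hmul : w * (4 * j + i + 1) = w * (4 * j + i) + w := by ring
  rcases lt_or_gt_of_ne hne with h | h
  · refine ⟨_, _, Nat.le_add_right _ _, Nat.add_lt_add_left h _, by omega, h3, h3', ?_⟩
    rw [h1, h1', h2, h2']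
    exact hE i hi
  · refine ⟨_, _, Nat.le_add_right _ _, Nat.add_lt_add_left h _, by omega, h3', h3, ?_⟩
    rw [h1, h1', h2, h2', Sym2.eq_swap]
    exact hE i hi

/-- Squares for three exchanges with the second Hamilton cycle of the square of a cycle. -/
theorem exists_chords_self [Finite V] {q : ℕ} (hq : 2 ≤ q) (hV : Nat.card V = 2 ^ q) {u : ℕ → V}
    (hu : CycSeq G (2 ^ q) u) :
    ∀ i < 3, ∃ a b, 2 ^ q * i ≤ a ∧ a < b ∧ b < 2 ^ q * (i + 1 + i / 2) ∧
      (0 + 2 - i + a) % 4 ≠ 3 ∧ (0 + 2 - i + b) % 4 ≠ 3 ∧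
      s((u (a / 2 ^ q), u (a - a / 2 ^ q)), (u (b / 2 ^ q), u (b - b / 2 ^ q)))
        ∈ seqEdges (squareSeq u (2 ^ q) (fun t => t = 2 ^ q - 1) false) := by
  have hw0 : 0 < 2 ^ q := by positivity
  have hodd := odd_cnt_pred hw0
  obtain ⟨k, hk⟩ : 4 ∣ 2 ^ q := pow_dvd_pow 2 hq
  have hleft := fun a b => left_mem_squareSeq (S := fun t => t = 2 ^ q - 1) (by omega) hV hu
    hodd (β := false) (a := a) (b := b)
  have hright := fun a b => right_mem_squareSeq (S := fun t => t = 2 ^ q - 1) (by omega) hV hu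
    hodd (β := false) (a := a) (b := b)
  generalize 2 ^ q = w at *
  have hfull : ∀ i, i ≤ 1 → s((u ((w * i) / w), u (w * i - w * i / w)),
      (u ((w * i + (w - 1)) / w), u (w * i + (w - 1) - (w * i + (w - 1)) / w)))
        ∈ seqEdges (squareSeq u w (fun t => t = w - 1) false) := by
    intro i hi
    have h1 : w * i / w = i := Nat.mul_div_cancel_left _ hw0
    have h2 : (w * i + (w - 1)) / w = i := by
      rw [Nat.mul_add_div hw0, Nat.div_eq_of_lt (by omega), add_zero]
    have h3 : i ≤ w * i := Nat.le_mul_of_pos_left _ hw0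
    have h4 := hright i (w * i + (w - 1) - i) (by
      rw [show i + (w * i + (w - 1) - i) = w * i + (w - 1) by omega, Nat.mul_add_mod,
        Nat.mod_eq_of_lt (by omega)]
      simp)
    rw [show w * i + (w - 1) - i + 1 = w * i - i + w by omega, hu.per, Sym2.eq_swap] at h4
    rw [h1, h2]
    exact h4
  intro i hi
  interval_cases i
  · exact ⟨w * 0, w * 0 + (w - 1), le_rfl, by omega, by omega, by omega, by omega,
      hfull 0 (by omega)⟩
  · exact ⟨w * 1, w * 1 + (w - 1), le_rfl, by omega, by omega, by omega, by omega,
      hfull 1 (by omega)⟩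
  · refine ⟨w * 2, w * 3 + 1, le_rfl, by omega, by omega, by omega, by omega, ?_⟩
    have h1 : w * 2 / w = 2 := Nat.mul_div_cancel_left _ hw0
    have h2 : (w * 3 + 1) / w = 3 := by
      rw [Nat.mul_add_div hw0, Nat.div_eq_of_lt (by omega), add_zero]
    have h4 := hleft 2 (w * 2 - 2) (by
      rw [show 2 + (w * 2 - 2) = w * 2 by omega, Nat.mul_mod_right]
      simp; omega)
    rw [h1, h2, show w * 3 + 1 - 3 = w * 2 - 2 + w by omega, hu.per]
    exact h4

theorem eight_mul_le (m : ℕ) (hm : 1 ≤ m) : 8 * m ≤ 4 ^ m + 4 := by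
  induction m, hm using Nat.le_induction with
  | base => norm_num
  | succ m hm ih => rw [pow_succ]; omega

/-- A cover of a graph by `m` Hamilton cycles of length `4 ^ m` gives a cover by `2 * m + 1`
Hamilton cycles of the product of its square with a 4-cycle. -/
theorem IsHamCover.square_boxProd [Finite V] {Z : Type*} [Finite Z] {Q : SimpleGraph Z} {m : ℕ}
    (hm : 1 ≤ m) (hV : Nat.card V = 2 ^ (2 * m)) {f : Fin m → ℕ → V} (hf : IsHamCover G f)
    (hZ : Nat.card Z = 4) {v : ℕ → Z} (hv : CycSeq Q 4 v)
    (hvc : ∀ x y, Q.Adj x y → s(x, y) ∈ seqEdges v) :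
    ∃ F : Option (Option (Fin (2 * m - 1))) → ℕ → (V × V) × Z, IsHamCover ((G □ G) □ Q) F := by
  have h8 : 8 * m ≤ 2 ^ (2 * m) + 4 := by
    have := eight_mul_le m hm
    rwa [show 4 = 2 ^ 2 by norm_num, ← pow_mul] at this
  have h4 : 4 ∣ 2 ^ (2 * m) := pow_dvd_pow 2 (show 2 ≤ 2 * m by omega)
  have hc := hf.1
  rw [hV] at hc
  let o : Fin m := ⟨0, hm⟩
  have hlt : ∀ i : Fin m, i ≠ o → 8 * (i : ℕ) + 4 ≤ 2 ^ (2 * m) := fun i _ => by omega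
  set S : Fin m → ℕ → Prop := fun i t =>
    if i = o then t = 2 ^ (2 * m) - 1 else ∃ b < 3, f i t = f o (8 * i + b) with hSdef
  have hSo : S o = fun t => t = 2 ^ (2 * m) - 1 := by funext t; simp [hSdef]
  have hSi : ∀ i, i ≠ o → ∀ t, S i t ↔ ∃ b < 3, f i t = f o (8 * i + b) := fun i hi t => by
    simp [hSdef, hi]
  have hSm : ∀ i, i ≠ o → ∀ t, S i (t % 2 ^ (2 * m)) ↔ S i t := fun i hi t => by
    rw [hSi i hi, hSi i hi, (hc i).mod]
  have hS : ∀ i, Odd (cnt (fun j => S i (j % 2 ^ (2 * m))) (2 ^ (2 * m))) := by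
    intro i
    by_cases hi : i = o
    · rw [hi, hSo]
      exact odd_cnt_pred (by positivity)
    · choose τ hτ1 hτ2 using fun b : ℕ => (hc i).surj hV (f o (8 * i + b))
      have := hlt i hi
      have hinj : ∀ b b', b < 3 → b' < 3 → τ b = τ b' → b = b' := by
        intro b b' hb hb' h
        have h1 := hτ2 b
        rw [h, hτ2 b'] at h1
        have := (hc o).inj _ _ (by omega) (by omega) h1
        omega
      rw [cnt_eq_card ((Finset.range 3).image τ), Finset.card_image_of_injOn]
      · exact ⟨1, rfl⟩
      · intro b hb b' hb' h
        exact hinj b b' (by simpa using hb) (by simpa using hb') h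
      · intro t
        rw [hSi i hi, Finset.mem_image]
        constructor
        · rintro ⟨b, hb, rfl⟩
          exact ⟨hτ1 b, b, Finset.mem_range.1 hb, hτ2 b⟩
        · rintro ⟨ht, b, hb, h⟩
          exact ⟨b, Finset.mem_range.2 hb, (hc i).inj _ _ (hτ1 b) ht (by rw [hτ2, h])⟩
  obtain ⟨hsc, hscov⟩ := hf.square (by omega) hV S hS
  have hcard : Nat.card (V × V) = 2 ^ (2 * m + 2 * m) := by rw [Nat.card_prod, hV, pow_add]
  rw [hcard] at hsc
  let idx : Fin (2 * m - 1) → Fin m := fun j => ⟨(j + 1) / 2, by omega⟩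
  let J : Fin (2 * m - 1) → ℕ → V × V := fun j =>
    squareSeq (f (idx j)) (2 ^ (2 * m)) (S (idx j)) (decide ((j : ℕ) % 2 = 1))
  let g := squareSeq (f o) (2 ^ (2 * m)) (S o) true
  have hgt : ∀ t, g t = (f o (t / 2 ^ (2 * m)), f o (t - t / 2 ^ (2 * m))) := fun t => by
    show prodSeq _ _ _ (S o) t = _
    rw [hSo]
    exact prodSeq_pred _ _ (by positivity) t
  have hchord : ∀ j : Fin (2 * m - 1), ∃ c : ℕ, ∀ i < 3, ∃ a b : ℕ, 2 ^ (2 * m) * (4 * j + i) ≤ a ∧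
      a < b ∧ b < 2 ^ (2 * m) * (4 * j + i + 1 + i / 2) ∧
      (c + 2 - i + a) % 4 ≠ 3 ∧ (c + 2 - i + b) % 4 ≠ 3 ∧ s(g a, g b) ∈ seqEdges (J j) := by
    intro j
    by_cases hj : (j : ℕ) = 0
    · have hi : idx j = o := Fin.ext (by simp [idx, o, hj])
      refine ⟨0, fun i hi3 => ?_⟩
      obtain ⟨a, b, h1, h2, h3, h4, h5, h6⟩ := exists_chords_self (by omega) hV (hc o) i hi3
      refine ⟨a, b, by simpa [hj] using h1, h2, by simpa [hj] using h3, h4, h5, ?_⟩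
      rw [hgt, hgt]
      show _ ∈ seqEdges (squareSeq _ _ _ _)
      rw [hi, hSo, hj]
      exact h6
    · have hi : idx j ≠ o := fun h => by
        have := congrArg Fin.val h
        simp only [idx, o] at this
        omega
      have hi8 := hlt _ hi
      have hdef : ((idx j : Fin m) : ℕ) = (j + 1) / 2 := rfl
      obtain ⟨c, h⟩ := exists_chords h4 hV (hc o) (y := f (idx j) 0) (y' := f (idx j) 1)
        ((hc (idx j)).adj 0).ne (seqEdges (J j)) j (fun i hi3 => by
          obtain ⟨t, ht, htf⟩ := (hc (idx j)).surj hV (f o (4 * j + i))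
          rw [← htf]
          refine right_mem_squareSeq (by omega) hV (hc _) (hS _) (b := 0) ?_
          rw [hSm _ hi, hSi _ hi, add_zero, decide_eq_false_iff_not, htf]
          constructor
          · intro h
            exact ⟨i, hi3, by rw [show 4 * (j : ℕ) + i = 8 * (idx j : ℕ) + i by omega]⟩
          · rintro ⟨b, hb, h⟩ h2
            have := (hc o).inj _ _ (by omega) (by omega) h
            omega)
      refine ⟨c, fun i hi3 => ?_⟩
      obtain ⟨a, b, h1, h2, h3, h4, h5, h6⟩ := h i hi3
      refine ⟨a, b, h1, h2, h3.trans_le (Nat.mul_le_mul_left _ (by omega)), h4, h5, ?_⟩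
      rw [hgt, hgt]
      exact h6
  choose c hchord using hchord
  have hr3 : ∀ r, r % 3 < 3 := fun r => Nat.mod_lt _ (by norm_num)
  have hex : ∀ r, ∃ a b, ∀ hr : r < 3 * (2 * m - 1),
      2 ^ (2 * m) * (4 * (r / 3) + r % 3) ≤ a ∧ a < b ∧
      b < 2 ^ (2 * m) * (4 * (r / 3) + r % 3 + 1 + r % 3 / 2) ∧
      (c ⟨r / 3, by omega⟩ + 2 - r % 3 + a) % 4 ≠ 3 ∧
      (c ⟨r / 3, by omega⟩ + 2 - r % 3 + b) % 4 ≠ 3 ∧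
      s(g a, g b) ∈ seqEdges (J ⟨r / 3, by omega⟩) := by
    intro r
    by_cases hr : r < 3 * (2 * m - 1)
    · obtain ⟨a, b, h⟩ := hchord ⟨r / 3, by omega⟩ (r % 3) (hr3 r)
      exact ⟨a, b, fun _ => h⟩
    · exact ⟨0, 0, fun h => absurd h hr⟩
  choose a b hab using hex
  refine exists_hamCover_boxProd_square (p := 2 * m + 2 * m) (by omega) hcard hZ (g := g)
    (hsc (o, true)) hv hvc J (fun j => hsc (idx j, _)) ?_ a b
    (fun k => if h : k < 2 * m - 1 then c ⟨k, h⟩ else 0)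
    (fun r hr => (hab r hr).2.1) (fun r hr => ?_) (fun r hr => ?_) (fun r hr => ?_)
    (fun j i hi => ?_)
  · intro x y hxy
    obtain ⟨⟨i, β⟩, h⟩ := hscov x y hxy
    have hi := i.2
    cases β
    · refine Or.inr ⟨⟨2 * i, by omega⟩, ?_⟩
      have h1 : idx ⟨2 * i, by omega⟩ = i := Fin.ext (by simp only [idx]; omega)
      have h2 : decide (2 * (i : ℕ) % 2 = 1) = false := by simp
      show _ ∈ seqEdges (squareSeq _ _ _ _)
      rw [h1, h2]
      exact h
    · by_cases hio : i = o
      · subst hio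
        exact Or.inl h
      · have hi0 : (i : ℕ) ≠ 0 := fun h => hio (Fin.ext h)
        refine Or.inr ⟨⟨2 * i - 1, by omega⟩, ?_⟩
        have h1 : idx ⟨2 * i - 1, by omega⟩ = i := Fin.ext (by simp only [idx]; omega)
        have h2 : decide ((2 * (i : ℕ) - 1) % 2 = 1) = true := by
          rw [decide_eq_true_eq]; omega
        show _ ∈ seqEdges (squareSeq _ _ _ _)
        rw [h1, h2]
        exact h
  · refine (hab r hr).2.2.1.trans_le ?_
    rw [pow_add]
    exact Nat.mul_le_mul_left _ (by omega)
  · refine (hab r (by omega)).2.2.1.trans_le (le_trans (Nat.mul_le_mul_left _ ?_) (hab (r + 1) hr).1)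
    omega
  · rw [dif_pos (show r / 3 < 2 * m - 1 by omega)]
    exact ⟨(hab r hr).2.2.2.1, (hab r hr).2.2.2.2.1⟩
  · have hlt : 3 * (j : ℕ) + i < 3 * (2 * m - 1) := by omega
    have h := (hab _ hlt).2.2.2.2.2
    have hj : (⟨(3 * (j : ℕ) + i) / 3, by omega⟩ : Fin (2 * m - 1)) = j :=
      Fin.ext (by simp only; omega)
    rwa [hj] at h

end Square

/-! ### Hamilton decompositions of hypercubes -/

section Cube

/-- The hypercube with components indexed by `ι`. -/
def cube (ι : Type*) : SimpleGraph (ι → Bool) :=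
  cartesianProduct fun _ : ι => (⊤ : SimpleGraph Bool)

theorem cube_adj {ι : Type*} {x y : ι → Bool} :
    (cube ι).Adj x y ↔ ∃ k, x k ≠ y k ∧ ∀ j, j ≠ k → x j = y j := Iff.rfl

theorem hypercube_eq_cube (N : ℕ) : hypercube N = cube (Fin N) := by
  ext x y
  rw [cube_adj]
  show hammingDist x y = 1 ↔ _
  rw [hammingDist, Finset.card_eq_one]
  refine exists_congr fun k => ?_
  simp only [Finset.ext_iff, Finset.mem_filter_univ, Finset.mem_singleton]
  refine ⟨fun h => ⟨(h k).2 rfl, fun j hj => ?_⟩, fun h j => ⟨fun hj => ?_, ?_⟩⟩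
  · exact not_ne_iff.1 fun h2 => hj ((h j).1 h2)
  · exact by_contra fun h2 => hj (h.2 j h2)
  · rintro rfl; exact h.1

/-- Renaming the components. -/
def cubeCongr {ι κ : Type*} (e : ι ≃ κ) : cube ι ≃g cube κ where
  toEquiv := e.arrowCongr (Equiv.refl Bool)
  map_rel_iff' := by
    intro x y
    constructor
    · rintro ⟨k, h1, h2⟩
      refine ⟨e.symm k, h1, fun j hj => ?_⟩
      simpa using h2 (e j) fun h => hj (by rw [← h, e.symm_apply_apply])
    · rintro ⟨k, h1, h2⟩
      refine ⟨e k, by simpa using h1, fun j hj => ?_⟩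
      exact h2 (e.symm j) fun h => hj (by rw [← h, e.apply_symm_apply])

/-- Splitting off components. -/
def cubeSum (ι κ : Type*) : (cube ι).boxProd (cube κ) ≃g cube (ι ⊕ κ) where
  toEquiv := (Equiv.sumArrowEquivProdArrow ι κ Bool).symm
  map_rel_iff' := by
    rintro ⟨x, x'⟩ ⟨y, y'⟩
    rw [SimpleGraph.boxProd_adj, cube_adj, cube_adj, cube_adj]
    simp only [Sum.exists, Sum.forall, Equiv.sumArrowEquivProdArrow_symm_apply_inl,
      Equiv.sumArrowEquivProdArrow_symm_apply_inr, ne_eq, Sum.inl.injEq, Sum.inr.injEq,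
      reduceCtorEq, not_false_eq_true, forall_const, funext_iff]
    constructor
    · rintro (⟨k, h1, h2, h3⟩ | ⟨k, h1, h2, h3⟩)
      · exact Or.inl ⟨⟨k, h1, h2⟩, h3⟩
      · exact Or.inr ⟨⟨k, h1, h3⟩, h2⟩
    · rintro (⟨⟨k, h1, h2⟩, h3⟩ | ⟨⟨k, h1, h3⟩, h2⟩)
      · exact Or.inl ⟨k, h1, h2, h3⟩
      · exact Or.inr ⟨k, h1, h2, h3⟩

/-- Grouping the components. -/
def cubeSigma {ι : Type*} (κ : ι → Type*) :
    (cartesianProduct fun k => cube (κ k)) ≃g cube (Σ k, κ k) where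
  toEquiv := (Equiv.piCurry fun (_ : ι) (_ : κ _) => Bool).symm
  map_rel_iff' := by
    intro x y
    constructor
    · rintro ⟨⟨k, i⟩, h1, h2⟩
      refine ⟨k, ⟨i, h1, fun j hj => h2 ⟨k, j⟩ fun h => hj (by simpa using h)⟩,
        fun j hj => funext fun l => h2 ⟨j, l⟩ fun h => hj (congrArg Sigma.fst h)⟩
    · rintro ⟨k, ⟨i, h1, h2⟩, h3⟩
      refine ⟨⟨k, i⟩, h1, ?_⟩
      rintro ⟨j, l⟩ hj
      by_cases h : j = k
      · subst h
        exact h2 l fun h => hj (by rw [h])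
      · exact congrFun (h3 j h) l

theorem card_edgeSet_cube {ι : Type*} [Fintype ι] :
    2 * Nat.card (cube ι).edgeSet = Fintype.card ι * 2 ^ Fintype.card ι := by
  classical
  have hb : Function.Bijective fun p : (ι → Bool) × ι => (⟨(p.1, Function.update p.1 p.2
      (!p.1 p.2)), p.2, by simp, fun j hj => by simp [hj]⟩ : (cube ι).Dart) := by
    constructor
    · rintro ⟨x, i⟩ ⟨y, j⟩ h
      have h1 := congrArg (fun D : (cube ι).Dart => D.fst) h
      have h2 := congrArg (fun D : (cube ι).Dart => D.snd) h
      simp only at h1 h2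
      subst h1
      by_contra hij
      have h3 : i ≠ j := fun h => hij (by rw [h])
      have := congrFun h2 i
      simp [h3] at this
    · rintro ⟨⟨x, y⟩, k, h1, h2⟩
      refine ⟨(x, k), ?_⟩
      have : Function.update x k (!x k) = y := by
        funext j
        by_cases hj : j = k
        · subst hj
          simp only [Function.update_self]
          cases hx : x j <;> cases hy : y j <;> simp_all
        · rw [Function.update_of_ne hj]
          exact h2 j hj
      simp only [this]
  have h1 := Nat.card_congr (Equiv.ofBijective _ hb)
  have h2 := (cube ι).dart_card_eq_twice_card_edges
  rw [Nat.card_eq_fintype_card, ← SimpleGraph.edgeFinset_card, ← h2,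
    ← Nat.card_eq_fintype_card, ← h1]
  simp [mul_comm]

theorem IsHamCover.map_iso {V W ι : Type*} {G : SimpleGraph V} {H : SimpleGraph W}
    {f : ι → ℕ → V} (hf : IsHamCover G f) (φ : G ≃g H) :
    IsHamCover H fun i t => φ (f i t) := by
  refine ⟨fun i => ?_, fun x y h => ?_⟩
  · rw [← Nat.card_congr φ.toEquiv]
    exact (hf.1 i).map φ.toHom φ.injective
  · obtain ⟨i, hi⟩ := hf.2 (φ.symm x) (φ.symm y) (φ.symm.map_adj_iff.2 h)
    refine ⟨i, ?_⟩
    simpa using mk_mem_seqEdges_map φ hi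

theorem IsHamCover.reindex {V ι κ : Type*} {G : SimpleGraph V} {f : ι → ℕ → V}
    (hf : IsHamCover G f) (e : κ ≃ ι) : IsHamCover G fun k => f (e k) := by
  refine ⟨fun k => hf.1 _, fun x y h => ?_⟩
  obtain ⟨i, hi⟩ := hf.2 x y h
  exact ⟨e.symm i, by simpa using hi⟩

theorem card_cube_fin (N : ℕ) : Nat.card (Fin N → Bool) = 2 ^ N := by simp

/-- The sequence through the vertices of a square. -/
def squareCycle (t : ℕ) : Fin 2 → Bool := ![t % 4 = 1 ∨ t % 4 = 2, t % 4 = 2 ∨ t % 4 = 3]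

theorem squareCycle_cycSeq : CycSeq (cube (Fin 2)) 4 squareCycle := by
  have hper : ∀ t, squareCycle (t + 4) = squareCycle t := fun t => by
    simp [squareCycle]
  refine ⟨by norm_num, fun t => ?_, hper, fun s t hs ht => ?_⟩
  · have h4 := Nat.mod_lt t (show 0 < 4 by norm_num)
    have h1 : squareCycle t = squareCycle (t % 4) := by simp [squareCycle]
    have h2 : squareCycle (t + 1) = squareCycle (t % 4 + 1) := by simp [squareCycle]
    rw [h1, h2, cube_adj]
    generalize t % 4 = r at h4
    interval_cases r <;> decide
  · interval_cases s <;> interval_cases t <;> decide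

theorem mem_squareCycle (x y : Fin 2 → Bool) (h : (cube (Fin 2)).Adj x y) :
    s(x, y) ∈ seqEdges squareCycle := by
  rw [cube_adj] at h
  have : ∀ x y : Fin 2 → Bool, (∃ k, x k ≠ y k ∧ ∀ j, j ≠ k → x j = y j) →
      ∃ t : Fin 4, s(x, y) = s(squareCycle t, squareCycle (t + 1)) := by decide
  obtain ⟨t, ht⟩ := this x y h
  exact ⟨t, ht⟩

/-- The hypercube of dimension `2 * n` is covered by `n` Hamilton cycles. -/
theorem exists_hamCover_cube (n : ℕ) (hn : 1 ≤ n) :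
    ∃ f : Fin n → ℕ → Fin (2 * n) → Bool, IsHamCover (cube (Fin (2 * n))) f := by
  induction n using Nat.strong_induction_on with
  | _ n ih =>
    rcases Nat.even_or_odd' n with ⟨m, rfl | rfl⟩
    · obtain ⟨f, hf⟩ := ih m (by omega) (by omega)
      have h := hf.square (q := 2 * m) (by omega) (card_cube_fin _)
        (fun _ t => t = 2 ^ (2 * m) - 1) fun _ => odd_cnt_pred (by positivity)
      have e : Fin (2 * m) ≃ Fin m × Bool := Fintype.equivOfCardEq (by simp [mul_comm])
      have e' : Fin (2 * m) ⊕ Fin (2 * m) ≃ Fin (2 * (2 * m)) :=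
        Fintype.equivOfCardEq (by simp; ring)
      exact ⟨_, ((h.map_iso (cubeSum _ _)).map_iso (cubeCongr e')).reindex e⟩
    · rcases Nat.eq_zero_or_pos m with rfl | hm
      · refine ⟨fun _ => squareCycle, fun _ => ?_, fun x y h => ⟨0, mem_squareCycle x y h⟩⟩
        rw [card_cube_fin]
        exact squareCycle_cycSeq
      · obtain ⟨f, hf⟩ := ih m (by omega) (by omega)
        obtain ⟨F, hF⟩ := hf.square_boxProd hm (card_cube_fin _) (card_cube_fin 2)
          squareCycle_cycSeq mem_squareCycle
        have e : Fin (2 * m + 1) ≃ Option (Option (Fin (2 * m - 1))) :=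
          Fintype.equivOfCardEq (by simp; omega)
        have e' : (Fin (2 * m) ⊕ Fin (2 * m)) ⊕ Fin 2 ≃ Fin (2 * (2 * m + 1)) :=
          Fintype.equivOfCardEq (by simp; ring)
        let ψ : ((cube (Fin (2 * m))).boxProd (cube (Fin (2 * m)))).boxProd (cube (Fin 2))
            ≃g (cube (Fin (2 * m) ⊕ Fin (2 * m))).boxProd (cube (Fin 2)) :=
          { toEquiv := (cubeSum _ _).toEquiv.prodCongr (Equiv.refl _)
            map_rel_iff' := by
              rintro ⟨x, z⟩ ⟨y, z'⟩
              rw [SimpleGraph.boxProd_adj, SimpleGraph.boxProd_adj]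
              exact or_congr (and_congr (cubeSum _ _).map_adj_iff Iff.rfl)
                (and_congr Iff.rfl (cubeSum _ _).injective.eq_iff) }
        exact ⟨_, (((hF.map_iso ψ).map_iso (cubeSum _ _)).map_iso (cubeCongr e')).reindex e⟩

/-- A cover of a hypercube by as few Hamilton cycles as possible is a decomposition. -/
theorem IsHamCover.existsUnique {N : ℕ} {ι : Type*} [Fintype ι]
    {f : ι → ℕ → Fin N → Bool} (hf : IsHamCover (cube (Fin N)) f) (hι : 2 * Fintype.card ι = N)
    {x y : Fin N → Bool} (h : (cube (Fin N)).Adj x y) : ∃! i, s(x, y) ∈ seqEdges (f i) := by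
  have hc := hf.1
  rw [card_cube_fin] at hc
  have hb : Function.Bijective fun p : ι × Fin (2 ^ N) =>
      (⟨s(f p.1 p.2, f p.1 (p.2 + 1)), (hc p.1).adj p.2⟩ : (cube (Fin N)).edgeSet) := by
    rw [Nat.bijective_iff_surjective_and_card]
    constructor
    · rintro ⟨e, he⟩
      induction e using Sym2.ind with
      | _ x y =>
        obtain ⟨i, hi⟩ := hf.2 x y he
        obtain ⟨t, ht, h2⟩ := (hc i).mem_edges hi
        exact ⟨(i, ⟨t, ht⟩), Subtype.ext h2.symm⟩
    · have h1 := card_edgeSet_cube (ι := Fin N)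
      have h2 : 2 * (Fintype.card ι * 2 ^ N) = N * 2 ^ N := by rw [← mul_assoc, hι]
      rw [Fintype.card_fin, ← h2] at h1
      rw [Nat.card_prod, Nat.card_eq_fintype_card, Nat.card_eq_fintype_card, Fintype.card_fin]
      exact (Nat.eq_of_mul_eq_mul_left (by norm_num) h1).symm
  obtain ⟨i, hi⟩ := hf.2 x y h
  refine ⟨i, hi, fun j hj => ?_⟩
  obtain ⟨t, ht, h1⟩ := (hc i).mem_edges hi
  obtain ⟨t', ht', h2⟩ := (hc j).mem_edges hj
  have := hb.1 (a₁ := (j, ⟨t', ht'⟩)) (a₂ := (i, ⟨t, ht⟩)) (Subtype.ext (h2.symm.trans h1))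
  exact congrArg Prod.fst this

end Cube

/-! ### Repeated squaring of hypercubes -/

section Squaring

variable {V W : Type*} {G : SimpleGraph V}

theorem CycSeq.invFun_modEq {L : ℕ} {f : ℕ → V} (h : CycSeq G L f) (t : ℕ) :
    Function.invFun f (f t) ≡ t [MOD L] :=
  (h.eq_iff _ _).1 (Function.invFun_eq ⟨t, rfl⟩)

theorem CycSeq.invFun_eq [Finite V] {L : ℕ} {f : ℕ → V} (h : CycSeq G L f) (hV : Nat.card V = L)
    (v : V) : f (Function.invFun f v) = v := by
  obtain ⟨t, -, ht⟩ := h.surj hV v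
  exact Function.invFun_eq ⟨t, ht⟩

theorem exists_prodSeq_apply (u : ℕ → V) (v : ℕ → W) (B : ℕ) (S : ℕ → Prop) (t : ℕ) :
    ∃ a b, prodSeq u v B S t = (u a, v b) ∧ a + b = t :=
  ⟨_, _, rfl, cnt_add_cnt_not (fun j => S (j % B)) t⟩

theorem squareSeq_invFun_modEq [Finite V] {q : ℕ} (hq : 1 ≤ q) (hV : Nat.card V = 2 ^ q)
    {u : ℕ → V} (hu : CycSeq G (2 ^ q) u) {S : ℕ → Prop}
    (hS : Odd (cnt (fun j => S (j % 2 ^ q)) (2 ^ q))) (β : Bool) (x : V × V) :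
    Function.invFun (squareSeq u (2 ^ q) S β) x
      ≡ Function.invFun u x.1 + Function.invFun u x.2 [MOD 2 ^ q] := by
  have hc := squareSeq_cycSeq hq hu hS β
  have h1 := hc.invFun_eq (by rw [Nat.card_prod, hV]) x
  have key : ∀ t, ∃ a b, squareSeq u (2 ^ q) S β t = (u a, u b) ∧ a + b = t := by
    intro t
    cases β
    · exact exists_prodSeq_apply u u (2 ^ q) (fun j => ¬ S j) t
    · exact exists_prodSeq_apply u u (2 ^ q) S t
  obtain ⟨a, b, h2, h3⟩ := key (Function.invFun (squareSeq u (2 ^ q) S β) x)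
  rw [h1] at h2
  rw [← h3, show x.1 = u a from congrArg Prod.fst h2, show x.2 = u b from congrArg Prod.snd h2]
  exact ((hu.invFun_modEq a).add (hu.invFun_modEq b)).symm

theorem sum_map_modEq {α : Type*} {q : ℕ} (l : List α) (f g : α → ℕ)
    (h : ∀ x, f x ≡ g x [MOD q]) : (l.map f).sum ≡ (l.map g).sum [MOD q] := by
  induction l with
  | nil => rfl
  | cons x l ih => simpa using (h x).add ih

theorem sum_map_flatMap_pair (l : List (V × V)) (g : V → ℕ) :
    ((l.flatMap fun x => [x.1, x.2]).map g).sum = (l.map fun x => g x.1 + g x.2).sum := by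
  induction l with
  | nil => rfl
  | cons x l ih => simp [ih, add_assoc]

theorem existsUnique_bool_modEq {s c k : ℕ} (h : s ≡ c [MOD 2 ^ k]) :
    ∃! β : Bool, s ≡ c + (if β then 2 ^ k else 0) [MOD 2 ^ (k + 1)] := by
  have hp : 0 < 2 ^ k := by positivity
  have h2 : 2 ^ (k + 1) = 2 ^ k * 2 := pow_succ 2 k
  unfold Nat.ModEq at *
  rw [h2]
  generalize 2 ^ k = w at *
  have key : ∀ s c, s % w = c % w → (s % (w * 2) = c % (w * 2) ↔ s / w % 2 = c / w % 2) := by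
    intro s c hsc
    rw [Nat.mod_mul, Nat.mod_mul, hsc]
    constructor
    · intro h
      exact Nat.eq_of_mul_eq_mul_left hp (by omega)
    · intro h
      rw [h]
  have ht : s % (w * 2) = (c + w) % (w * 2) ↔ s / w % 2 = (c / w + 1) % 2 := by
    rw [key s (c + w) (by simpa using h), Nat.add_div_right c hp]
  have hf := key s c h
  by_cases hsc : s / w % 2 = c / w % 2
  · refine ⟨false, by simpa using hf.2 hsc, fun β hβ => ?_⟩
    cases β
    · rfl
    · have := ht.1 (by simpa using hβ)
      omega
  · refine ⟨true, ?_, fun β hβ => ?_⟩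
    · simpa using ht.2 (by omega)
    · cases β
      · exact absurd (hf.1 (by simpa using hβ)) hsc
      · rfl

/-- The hypercube of dimension `n * 2 ^ (i + 1)` is covered by `n` groups of `2 ^ i` Hamilton
cycles; in every group, each vertex has a prescribed position modulo `2 ^ i` on exactly one
cycle. The position property is stated for sums over lists of vertices, in order to be
preserved by squaring. -/
theorem exists_hamCover_groups (n : ℕ) (hn : 1 ≤ n) (i : ℕ) :
    ∃ (f : Fin n → Fin (2 ^ i) → ℕ → Fin (n * 2 ^ (i + 1)) → Bool) (c : Fin n → Fin (2 ^ i) → ℕ),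
      IsHamCover (cube (Fin (n * 2 ^ (i + 1)))) (fun p : Fin n × Fin (2 ^ i) => f p.1 p.2) ∧
      ∀ r (l : List (Fin (n * 2 ^ (i + 1)) → Bool)),
        ∃! h, (l.map (Function.invFun (f r h))).sum ≡ c r h [MOD 2 ^ i] := by
  induction i with
  | zero =>
    obtain ⟨f, hf⟩ := exists_hamCover_cube n hn
    have e : Fin (2 * n) ≃ Fin (n * 2 ^ (0 + 1)) := Fintype.equivOfCardEq (by simp [mul_comm])
    have e' : Fin n × Fin (2 ^ 0) ≃ Fin n := Fintype.equivOfCardEq (by simp)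
    refine ⟨fun r h t => cubeCongr e (f (e' (r, h)) t), fun _ _ => 0,
      (hf.map_iso (cubeCongr e)).reindex e', fun r l => ?_⟩
    have hone : ∀ h : Fin (2 ^ 0), h = 0 := fun h => Fin.ext (by have := h.2; simp at this; omega)
    exact ⟨0, Nat.modEq_one, fun h _ => hone h⟩
  | succ i ih =>
    obtain ⟨N, hN⟩ : ∃ N, N = n * 2 ^ (i + 1) := ⟨_, rfl⟩
    rw [← hN] at ih
    obtain ⟨f, c, hf, hc⟩ := ih
    have hiN : i + 1 ≤ N := by
      have h1 : i + 1 < 2 ^ (i + 1) := Nat.lt_two_pow_self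
      have h2 : 1 * 2 ^ (i + 1) ≤ n * 2 ^ (i + 1) := Nat.mul_le_mul_right _ hn
      omega
    let S : ℕ → Prop := fun t => t = 2 ^ N - 1
    have hS : Odd (cnt (fun j => S (j % 2 ^ N)) (2 ^ N)) := odd_cnt_pred (by positivity)
    have e : Fin (2 ^ (i + 1)) ≃ Fin (2 ^ i) × Bool :=
      Fintype.equivOfCardEq (by simp [pow_succ])
    have e' : Fin N ⊕ Fin N ≃ Fin (n * 2 ^ (i + 1 + 1)) :=
      Fintype.equivOfCardEq (by simp [hN]; ring)
    let φ : (cube (Fin N)).boxProd (cube (Fin N)) ≃g cube (Fin (n * 2 ^ (i + 1 + 1))) :=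
      (cubeSum (Fin N) (Fin N)).trans (cubeCongr e')
    have hsq := hf.square (by omega) (card_cube_fin N) (fun _ => S) fun _ => hS
    have hfc := hf.1
    rw [card_cube_fin] at hfc
    refine ⟨fun r h t => φ (squareSeq (f r (e h).1) (2 ^ N) S (e h).2 t),
      fun r h => c r (e h).1 + if (e h).2 then 2 ^ i else 0, ?_, fun r l => ?_⟩
    · let ε : Fin n × Fin (2 ^ (i + 1)) ≃ (Fin n × Fin (2 ^ i)) × Bool :=
        ((Equiv.refl _).prodCongr e).trans (Equiv.prodAssoc _ _ _).symm
      exact (hsq.map_iso φ).reindex ε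
    · have hpos : ∀ h, (l.map (Function.invFun fun t =>
            φ (squareSeq (f r (e h).1) (2 ^ N) S (e h).2 t))).sum
          ≡ (((l.map φ.symm).flatMap fun x => [x.1, x.2]).map
            (Function.invFun (f r (e h).1))).sum [MOD 2 ^ (i + 1)] := by
        intro h
        rw [sum_map_flatMap_pair, List.map_map]
        refine sum_map_modEq _ _ _ fun x => ?_
        have h1 := squareSeq_invFun_modEq (by omega) (card_cube_fin N) (hfc (r, (e h).1)) hS (e h).2
          (φ.symm x)
        have hcyc := squareSeq_cycSeq (by omega) (hfc (r, (e h).1)) hS (e h).2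
        have h2 := (hcyc.map φ.toHom φ.injective).invFun_modEq
          (Function.invFun (squareSeq (f r (e h).1) (2 ^ N) S (e h).2) (φ.symm x))
        have h3 : φ.toHom (squareSeq (f r (e h).1) (2 ^ N) S (e h).2
            (Function.invFun (squareSeq (f r (e h).1) (2 ^ N) S (e h).2) (φ.symm x))) = x := by
          rw [hcyc.invFun_eq (by rw [Nat.card_prod, card_cube_fin])]
          exact φ.apply_symm_apply x
        rw [h3] at h2
        exact ((h2.of_mul_left _).trans h1).of_dvd (pow_dvd_pow 2 hiN)
      obtain ⟨h₀, hh₀, huniq⟩ := hc r ((l.map φ.symm).flatMap fun x => [x.1, x.2])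
      obtain ⟨β₀, hβ₀, hβu⟩ := existsUnique_bool_modEq hh₀
      refine ⟨e.symm (h₀, β₀), ?_, fun h hh => ?_⟩
      · have := hpos (e.symm (h₀, β₀))
        simp only [Equiv.apply_symm_apply] at this ⊢
        exact this.trans hβ₀
      · have h1 := (hpos h).symm.trans hh
        have h2 : (e h).1 = h₀ := by
          apply huniq
          refine (h1.of_dvd (pow_dvd_pow 2 (Nat.le_succ i))).trans ?_
          simp only
          split_ifs
          · exact Nat.add_mod_right _ _
          · rfl
        have h3 : (e h).2 = β₀ := by
          apply hβu
          rw [← h2]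
          exact h1
        rw [← h2, ← h3, Prod.mk.eta, Equiv.symm_apply_apply]

end Squaring

/-! ### Decompositions of products of Hamilton decomposable graphs -/

section Assemble

theorem IsCycleEdgeSet.map {V W : Type*} {G : SimpleGraph V} {H : SimpleGraph W} {L : ℕ}
    {E : Set (Sym2 V)} (hE : IsCycleEdgeSet G L E) (φ : G →g H) (hφ : Function.Injective φ) :
    IsCycleEdgeSet H L (Sym2.map φ '' E) := by
  obtain ⟨v, w, hw, rfl, rfl⟩ := hE
  refine ⟨φ v, w.map φ, hw.map hφ, by simp, ?_⟩
  ext e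
  simp [SimpleGraph.Walk.edges_map]

theorem IsCycleDecomposition.map_iso {V W ι : Type*} {G : SimpleGraph V} {H : SimpleGraph W}
    {L : ℕ} {E : ι → Set (Sym2 V)} (hE : IsCycleDecomposition G L E) (φ : G ≃g H) :
    IsCycleDecomposition H L fun c => Sym2.map φ '' E c := by
  obtain ⟨h1, h2, h3, h4⟩ := hE
  refine ⟨fun c => (h1 c).map φ.toHom φ.injective,
    fun c c' hc => (Set.disjoint_image_iff (Sym2.map.injective φ.injective)).2 (h2 c c' hc), ?_,
    fun v => ?_⟩
  · rw [← Set.image_iUnion, h3]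
    ext e
    induction e using Sym2.ind with
    | _ x y =>
      constructor
      · rintro ⟨e, he, hxy⟩
        induction e using Sym2.ind with
        | _ a b =>
          rw [← hxy]
          exact φ.map_adj_iff.2 he
      · intro h
        refine ⟨s(φ.symm x, φ.symm y), φ.symm.map_adj_iff.2 h, ?_⟩
        simp
  · obtain ⟨c, e, he, hv⟩ := h4 (φ.symm v)
    exact ⟨c, _, ⟨e, he, rfl⟩, Sym2.mem_map.2 ⟨_, hv, φ.apply_symm_apply v⟩⟩

/-- A cycle decomposition may be numbered by the natural numbers below its size. -/
theorem IsCycleDecomposition.exists_fin {V ι : Type*} [Finite V] {G : SimpleGraph V} {L M : ℕ}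
    (hL : 0 < L) {E : ι → Set (Sym2 V)} (hE : IsCycleDecomposition G L E)
    (hM : Nat.card G.edgeSet = M * L) :
    ∃ E' : Fin M → Set (Sym2 V), IsCycleDecomposition G L E' := by
  obtain ⟨h1, h2, h3, h4⟩ := hE
  have hne : ∀ c, (E c).Nonempty := fun c => by
    rw [← Set.ncard_pos, (h1 c).ncard_eq]
    exact hL
  have hinj : Function.Injective E := by
    intro c c' h
    by_contra hc
    have := h2 c c' hc
    rw [← h, disjoint_self] at this
    exact (hne c).ne_empty this
  have : Finite ι := Finite.of_injective E hinj
  have : Fintype ι := Fintype.ofFinite ι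
  have hsum : Nat.card G.edgeSet = Nat.card ι * L := by
    rw [← h3, Nat.card_congr (Set.unionEqSigmaOfDisjoint fun c c' hc => h2 c c' hc),
      Nat.card_sigma, Nat.card_eq_fintype_card]
    simp [Nat.card_coe_set_eq, (h1 _).ncard_eq]
  have hcard : Nat.card ι = M := Nat.eq_of_mul_eq_mul_right hL (hsum.symm.trans hM)
  let e : Fin M ≃ ι := (Finite.equivFinOfCardEq hcard).symm
  refine ⟨fun k => E (e k), fun k => h1 _, fun k k' hk => h2 _ _ (e.injective.ne hk), ?_,
    fun v => ?_⟩
  · rw [← h3]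
    exact e.surjective.iUnion_comp E
  · obtain ⟨c, h⟩ := h4 v
    exact ⟨e.symm c, by simpa using h⟩

variable {d : ℕ} {V : Fin d → Type*} {G : ∀ k, SimpleGraph (V k)}
  {y q : Fin d → ℕ} {R : Type*} {κ : Fin d → Type*}

local notation "AnchVert" => AnchoredVertex fun k => everyNth (y k) (q k)
local notation "AnchProd" => anchoredProduct (fun k => cyc (y k)) fun k => everyNth (y k) (q k)

/-- The vertex of a product of graphs that corresponds to a vertex of an anchored product of
Hamilton cycles `f k` of the factors, shifted by `c k`. -/
def anchorMap (f : ∀ k, ℕ → V k) (c : Fin d → ℕ)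
    (x : AnchVert) : ∀ k, V k :=
  fun k => f k ((x.1 k).val + c k)

theorem anchorMap_injective (hy : ∀ k, 3 ≤ y k) {f : ∀ k, ℕ → V k} (c : Fin d → ℕ)
    (hf : ∀ k, CycSeq (G k) (y k) (f k)) :
    Function.Injective (anchorMap (y := y) (q := q) f c) := by
  intro x x' h
  apply Subtype.ext
  funext k
  have : NeZero (y k) := ⟨by have := hy k; omega⟩
  have h1 : _ ≡ _ [MOD y k] := ((hf k).eq_iff _ _).1 (congrFun h k)
  have h2 := Nat.ModEq.eq_of_lt_of_lt (Nat.ModEq.add_right_cancel' _ h1) (ZMod.val_lt _)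
    (ZMod.val_lt _)
  exact ZMod.val_injective _ h2

theorem anchorMap_of_adj (hy : ∀ k, 3 ≤ y k) (hqy : ∀ k, q k ∣ y k) {f : ∀ k, ℕ → V k}
    (c : Fin d → ℕ) (hf : ∀ k, CycSeq (G k) (y k) (f k))
    {x x' : AnchVert}
    (h : (AnchProd).Adj x x') :
    ∃ k, s(anchorMap f c x k, anchorMap f c x' k) ∈ seqEdges (f k) ∧
      ∀ j, j ≠ k → anchorMap f c x j = anchorMap f c x' j ∧
        Function.invFun (f j) (anchorMap f c x j) ≡ c j [MOD q j] := by
  obtain ⟨k, h1, h2⟩ := h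
  have : Fact (1 < y k) := ⟨by have := hy k; omega⟩
  have hstep : ∀ a b : ZMod (y k), b = a + 1 → f k (b.val + c k) = f k (a.val + c k + 1) := by
    rintro a _ rfl
    rw [(hf k).eq_iff, ZMod.val_add, ZMod.val_one, Nat.mod_add_mod, add_right_comm]
  refine ⟨k, ?_, fun j hj => ⟨?_, ?_⟩⟩
  · rcases (cyc_adj_iff (by have := hy k; omega) _ _).1 h1 with h3 | h3
    · exact ⟨(x.1 k).val + c k, by rw [anchorMap, anchorMap, hstep _ _ h3]⟩
    · exact ⟨(x'.1 k).val + c k, by rw [anchorMap, anchorMap, hstep _ _ h3, Sym2.eq_swap]⟩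
  · rw [anchorMap, anchorMap, (h2 j hj).1]
  · refine (((hf j).invFun_modEq _).of_dvd (hqy j)).trans ?_
    obtain ⟨t, ht⟩ := (h2 j hj).2
    rw [← ht]
    show (ZMod.val ((q j * t : ℕ) : ZMod (y j)) + c j) % q j = c j % q j
    rw [ZMod.val_natCast, Nat.add_mod, Nat.mod_mod_of_dvd _ (hqy j), Nat.mul_mod_right]
    simp

theorem exists_anchorMap_eq [∀ k, Finite (V k)] (hy : ∀ k, 3 ≤ y k) (hqy : ∀ k, q k ∣ y k)
    (hV : ∀ k, Nat.card (V k) = y k) {f : ∀ k, ℕ → V k}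
    (c : Fin d → ℕ) (hf : ∀ k, CycSeq (G k) (y k) (f k)) {X X' : ∀ k, V k} {k : Fin d}
    (h : s(X k, X' k) ∈ seqEdges (f k)) (hj : ∀ j, j ≠ k → X j = X' j ∧
        Function.invFun (f j) (X j) ≡ c j [MOD q j]) :
    ∃ x x' : AnchVert,
      (AnchProd).Adj x x' ∧
      s(anchorMap f c x, anchorMap f c x') = s(X, X') := by
  have hpos : ∀ (j : Fin d) (t : ℕ), f j (((t + y j * c j - c j : ℕ) : ZMod (y j)).val + c j)
      = f j t := by
    intro j t
    have : c j ≤ y j * c j := Nat.le_mul_of_pos_left _ (by have := hy j; omega)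
    rw [(hf j).eq_iff, ZMod.val_natCast, Nat.mod_add_mod, Nat.sub_add_cancel (by omega),
      Nat.add_mul_mod_self_left]
  have hmem : ∀ j, j ≠ k → ((Function.invFun (f j) (X j) + y j * c j - c j : ℕ) : ZMod (y j))
      ∈ everyNth (y j) (q j) := by
    intro j hjk
    have h1 : c j ≤ y j * c j := Nat.le_mul_of_pos_left _ (by have := hy j; omega)
    have h2 : q j ∣ Function.invFun (f j) (X j) + y j * c j - c j := by
      rw [← Nat.modEq_iff_dvd' (by omega)]
      have h3 : y j * c j ≡ 0 [MOD q j] :=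
        Nat.modEq_zero_iff_dvd.2 (Dvd.dvd.mul_right (hqy j) _)
      exact ((hj j hjk).2.add h3).symm
    obtain ⟨t, ht⟩ := h2
    exact ⟨t, by rw [ht]⟩
  have key : ∀ X X' : ∀ k, V k, ∀ t, X k = f k t → X' k = f k (t + 1) →
      (∀ j, j ≠ k → X j = X' j) → (∀ j, j ≠ k →
        ((Function.invFun (f j) (X j) + y j * c j - c j : ℕ) : ZMod (y j))
          ∈ everyNth (y j) (q j)) →
      ∃ x x' : AnchVert,
        (AnchProd).Adj x x' ∧
        s(anchorMap f c x, anchorMap f c x') = s(X, X') := by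
    intro X X' t hX hX' hne hm
    classical
    let P : ℕ → AnchVert := fun s =>
      ⟨fun j => if j = k then ((s + y j * c j - c j : ℕ) : ZMod (y j))
        else ((Function.invFun (f j) (X j) + y j * c j - c j : ℕ) : ZMod (y j)), k,
        fun j hj => by simpa only [if_neg hj] using hm j hj⟩
    have hPk : ∀ s, (P s).1 k = ((s + y k * c k - c k : ℕ) : ZMod (y k)) := fun s => if_pos rfl
    have hPj : ∀ s j, j ≠ k → (P s).1 j
        = ((Function.invFun (f j) (X j) + y j * c j - c j : ℕ) : ZMod (y j)) :=
      fun s j hj => if_neg hj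
    have hA : ∀ s Y, Y k = f k s → (∀ j, j ≠ k → Y j = X j) → anchorMap f c (P s) = Y := by
      intro s Y h1 h2
      funext j
      by_cases hjk : j = k
      · subst hjk
        rw [anchorMap, hPk, hpos, h1]
      · rw [anchorMap, hPj s j hjk, hpos, (hf j).invFun_eq (hV j), h2 j hjk]
    refine ⟨P t, P (t + 1), ⟨k, (cyc_adj_iff (by have := hy k; omega) _ _).2 (Or.inl ?_),
      fun j hjk => ⟨?_, ?_⟩⟩, ?_⟩
    · have h1 : c k ≤ y k * c k := Nat.le_mul_of_pos_left _ (by have := hy k; omega)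
      rw [hPk, hPk, show t + 1 + y k * c k - c k = t + y k * c k - c k + 1 by omega]
      push_cast
      rfl
    · rw [hPj _ _ hjk, hPj _ _ hjk]
    · rw [hPj _ _ hjk]
      exact hm j hjk
    · rw [hA t X hX fun j _ => rfl, hA (t + 1) X' hX' fun j hj => (hne j hj).symm]
  obtain ⟨t, ht⟩ := h
  rcases Sym2.eq_iff.1 ht with ⟨h1, h2⟩ | ⟨h1, h2⟩
  · exact key X X' t h1 h2 (fun j hjk => (hj j hjk).1) hmem
  · rw [Sym2.eq_swap (a := X)]
    exact key X' X t h2 h1 (fun j hjk => (hj j hjk).1.symm)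
      fun j hjk => (hj j hjk).1 ▸ hmem j hjk

/-- A decomposition of the anchored product gives a decomposition of the product of graphs with
Hamilton decompositions, if in every group of Hamilton cycles the shifted representing sets
partition the vertices. -/
theorem isCycleDecomposition_cartesianProduct [∀ k, Finite (V k)] [Nonempty R]
    [∀ k, Nonempty (κ k)] (k₀ : Fin d) (hy : ∀ k, 3 ≤ y k) (hqy : ∀ k, q k ∣ y k)
    (hV : ∀ k, Nat.card (V k) = y k) (f : ∀ k, R → κ k → ℕ → V k) (c : ∀ k, R → κ k → ℕ)
    (hf : ∀ k r h, CycSeq (G k) (y k) (f k r h))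
    (hedge : ∀ k x x', (G k).Adj x x' → ∃! p : R × κ k, s(x, x') ∈ seqEdges (f k p.1 p.2))
    (hc : ∀ k r v, ∃! h, Function.invFun (f k r h) v ≡ c k r h [MOD q k])
    {ι : Type*} {L : ℕ} {E : ι → Set (Sym2 AnchVert)}
    (hE : IsCycleDecomposition
      AnchProd L E) :
    IsCycleDecomposition (cartesianProduct G) L fun p : (R × ∀ k, κ k) × ι =>
      Sym2.map (anchorMap (fun k => f k p.1.1 (p.1.2 k)) fun k => c k p.1.1 (p.1.2 k)) ''
        E p.2 := by
  classical
  obtain ⟨hcyc, hdis, hun, -⟩ := hE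
  have hcov : ∀ X X', (cartesianProduct G).Adj X X' →
      ∃ p : (R × ∀ k, κ k) × ι, s(X, X') ∈ Sym2.map (anchorMap (fun k => f k p.1.1 (p.1.2 k))
        fun k => c k p.1.1 (p.1.2 k)) '' E p.2 := by
    rintro X X' ⟨k, h1, h2⟩
    obtain ⟨⟨r, h⟩, hk, -⟩ := hedge k _ _ h1
    choose H hH using fun j => (hc j r (X j)).exists
    have hHk : ∀ j, j ≠ k → Function.update H k h j = H j := fun j hj => Function.update_of_ne hj _ _
    obtain ⟨x, x', hxx, hX⟩ := exists_anchorMap_eq hy hqy hV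
      (fun j => c j r (Function.update H k h j)) (fun j => hf j r (Function.update H k h j))
      (X := X) (X' := X') (k := k) (by simpa using hk)
      (fun j hj => ⟨h2 j hj, by rw [hHk j hj]; exact hH j⟩)
    have hm : s(x, x') ∈ ⋃ c, E c := by rw [hun]; exact hxx
    obtain ⟨a, ha⟩ := Set.mem_iUnion.1 hm
    exact ⟨((r, Function.update H k h), a), s(x, x'), ha, hX⟩
  have hown : ∀ (p : R × ∀ k, κ k) X X', s(X, X') ∈ Sym2.map (anchorMap (fun k => f k p.1 (p.2 k))
      fun k => c k p.1 (p.2 k)) ''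
        (AnchProd).edgeSet →
      ∃ k, s(X k, X' k) ∈ seqEdges (f k p.1 (p.2 k)) ∧ ∀ j, j ≠ k → X j = X' j ∧
        Function.invFun (f j p.1 (p.2 j)) (X j) ≡ c j p.1 (p.2 j) [MOD q j] := by
    rintro p X X' ⟨e, he, hX⟩
    induction e using Sym2.ind with
    | _ x x' =>
      obtain ⟨k, h1, h2⟩ := anchorMap_of_adj hy hqy (fun k => c k p.1 (p.2 k))
        (fun k => hf k p.1 (p.2 k)) he
      rcases Sym2.eq_iff.1 hX with ⟨rfl, rfl⟩ | ⟨rfl, rfl⟩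
      · exact ⟨k, h1, h2⟩
      · refine ⟨k, by rwa [Sym2.eq_swap], fun j hj => ⟨(h2 j hj).1.symm, ?_⟩⟩
        rw [← (h2 j hj).1]
        exact (h2 j hj).2
  have hadj : ∀ (p : R × ∀ k, κ k) (X X' : ∀ k, V k) (k : Fin d), s(X k, X' k) ∈ seqEdges (f k p.1 (p.2 k)) →
      (G k).Adj (X k) (X' k) := by
    rintro p X X' k ⟨t, ht⟩
    rw [← SimpleGraph.mem_edgeSet, ht]
    exact (hf _ _ _).adj t
  have hsub : ∀ a, E a ⊆
      (AnchProd).edgeSet := fun a => by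
    rw [← hun]
    exact Set.subset_iUnion E a
  refine ⟨fun p => ?_, fun p p' hp => ?_, ?_, fun X => ?_⟩
  · let φ : AnchProd
        →g cartesianProduct G :=
      { toFun := anchorMap (fun k => f k p.1.1 (p.1.2 k)) fun k => c k p.1.1 (p.1.2 k)
        map_rel' := fun {x x'} h => by
          obtain ⟨k, h1, h2⟩ := hown p.1 _ _ ⟨s(x, x'), h, rfl⟩
          exact ⟨k, hadj p.1 _ _ k h1, fun j hj => (h2 j hj).1⟩ }
    exact (hcyc p.2).map φ (anchorMap_injective hy _ fun k => hf k _ _)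
  · refine Set.disjoint_left.2 fun e he he' => ?_
    have hpp : p.1 = p'.1 := by
      induction e using Sym2.ind with
      | _ X X' =>
        obtain ⟨k, h1, h2⟩ := hown p.1 X X' (Set.image_mono (hsub _) he)
        obtain ⟨l, h3, h4⟩ := hown p'.1 X X' (Set.image_mono (hsub _) he')
        have hkl : l = k := by
          by_contra hlk
          exact (hadj _ _ _ _ h3).ne (h2 l hlk).1
        subst hkl
        have h5 := (hedge l _ _ (hadj _ _ _ _ h1)).unique (y₁ := (p.1.1, p.1.2 l))
          (y₂ := (p'.1.1, p'.1.2 l)) h1 h3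
        have hr : p.1.1 = p'.1.1 := (Prod.ext_iff.1 h5).1
        refine Prod.ext hr (funext fun j => ?_)
        by_cases hj : j = l
        · subst hj
          exact (Prod.ext_iff.1 h5).2
        · have h6 := (h2 j hj).2
          have h7 := (h4 j hj).2
          rw [← hr] at h7
          exact (hc j _ _).unique h6 h7
    have h2 : p.2 ≠ p'.2 := fun h => hp (Prod.ext hpp h)
    simp only [← hpp] at he'
    exact Set.disjoint_left.1 ((Set.disjoint_image_iff (Sym2.map.injective
      (anchorMap_injective hy _ fun k => hf k _ _))).2 (hdis _ _ h2)) he he'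
  · ext e
    induction e using Sym2.ind with
    | _ X X' =>
      rw [Set.mem_iUnion]
      refine ⟨?_, fun h => hcov X X' h⟩
      rintro ⟨p, hp⟩
      obtain ⟨k, h1, h2⟩ := hown p.1 X X' (Set.image_mono (hsub _) hp)
      exact ⟨k, hadj p.1 _ _ k h1, fun j hj => (h2 j hj).1⟩
  · obtain ⟨r⟩ := ‹Nonempty R›
    obtain ⟨h⟩ := (inferInstance : Nonempty (κ k₀))
    obtain ⟨t, -, ht⟩ := (hf k₀ r h).surj (hV k₀) (X k₀)
    obtain ⟨p, hp⟩ := hcov X (Function.update X k₀ (f k₀ r h (t + 1)))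
      ⟨k₀, by simpa [← ht] using (hf k₀ r h).adj t, fun j hj => by simp [hj]⟩
    exact ⟨p, _, hp, by simp⟩

end Assemble

theorem mul_two_pow_sub_ge (n i : ℕ) (hn : 1 ≤ n) : i + 2 ≤ n * 2 ^ (i + 1) := by
  have h1 : i + 1 ≤ 2 ^ i := Nat.lt_two_pow_self
  have h2 : 1 * 2 ^ (i + 1) ≤ n * 2 ^ (i + 1) := Nat.mul_le_mul_right _ hn
  rw [pow_succ] at h2 ⊢
  omega

/-- A decomposition of the anchored product of cycles of lengths `2 ^ (n * 2 ^ (i k + 1))` gives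
a decomposition of the hypercube. -/
theorem exists_isCycleDecomposition_hypercube {d n N L M : ℕ} (hn : 1 ≤ n) (k₀ : Fin d)
    (i : Fin d → ℕ) (hN : ∑ k, n * 2 ^ (i k + 1) = N) {ι : Type*}
    {E : ι → Set (Sym2 (AnchoredVertex fun k =>
      everyNth (2 ^ (n * 2 ^ (i k + 1))) (2 ^ i k)))}
    (hE : IsCycleDecomposition (anchoredProduct (fun k => cyc (2 ^ (n * 2 ^ (i k + 1)))) fun k =>
      everyNth (2 ^ (n * 2 ^ (i k + 1))) (2 ^ i k)) L E)
    (hL : 0 < L) (hM : N * 2 ^ N = 2 * (M * L)) :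
    ∃ E' : Fin M → Set (Sym2 (Fin N → Bool)), IsCycleDecomposition (hypercube N) L E' := by
  choose f c hf hc using fun k => exists_hamCover_groups n hn (i k)
  have hge : ∀ k, i k + 2 ≤ n * 2 ^ (i k + 1) := fun k => mul_two_pow_sub_ge n (i k) hn
  have hfc := fun k => (hf k).1
  simp only [card_cube_fin] at hfc
  have : Nonempty (Fin n) := ⟨⟨0, hn⟩⟩
  have h := isCycleDecomposition_cartesianProduct k₀
    (fun k => le_trans (by norm_num) (Nat.pow_le_pow_right (n := 2) (by norm_num)
      (show 2 ≤ n * 2 ^ (i k + 1) by have := hge k; omega)))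
    (fun k => pow_dvd_pow 2 (show i k ≤ n * 2 ^ (i k + 1) by have := hge k; omega))
    (fun k => card_cube_fin _) f c (fun k r h => hfc k (r, h))
    (fun k x x' hx => (hf k).existsUnique (by
      rw [Fintype.card_prod, Fintype.card_fin, Fintype.card_fin, pow_succ]; ring) hx)
    (fun k r v => by simpa using hc k r [v]) hE
  have e : (Σ k, Fin (n * 2 ^ (i k + 1))) ≃ Fin N := Fintype.equivOfCardEq (by simp [← hN])
  have h2 := (h.map_iso (cubeSigma _)).map_iso (cubeCongr e)
  rw [hypercube_eq_cube]
  refine h2.exists_fin hL ?_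
  have h3 := card_edgeSet_cube (ι := Fin N)
  rw [Fintype.card_fin, hM] at h3
  exact Nat.eq_of_mul_eq_mul_left (by norm_num) h3

theorem sum_fin_eq_sum_Icc {M : Type*} [AddCommMonoid M] (g : ℕ → M) (d : ℕ) :
    ∑ k : Fin d, g (k + 1) = ∑ k ∈ Finset.Icc 1 d, g k := by
  induction d with
  | zero => simp
  | succ d ih => rw [Fin.sum_univ_castSucc, Finset.sum_Icc_succ_top (by omega), ← ih]; simp

theorem corollary7 (n d a α : ℕ) (i : ℕ → ℕ) (hn : 1 ≤ n) (hd : 2 ≤ d)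
    (hi : ∀ j k, 1 ≤ j → j < k → k ≤ d → i k < i j) (hid : i d = 0)
    (ha : a = ∑ k ∈ Finset.Icc 1 d, 2 ^ i k)
    (hα : 2 * n ≤ α)
    (hα' : (α : ℤ) ≤ 2 * a * n - (d - 1) - ∑ k ∈ Finset.Icc 1 d, (i k : ℤ)) :
    -- the Lock-and-Key edge sets decompose the underlying torus, with `2 ^ α` edges of every
    -- cycle along every factor
    (IsCycleDecomposition (LockAndKey.torus d fun k => n * 2 ^ (i k + 1) - i k) (d * 2 ^ α)
        (fun P : LockAndKey.Index d (fun k => n * 2 ^ (i k + 1) - i k) α =>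
          LockAndKey.edges d (fun k => n * 2 ^ (i k + 1) - i k) α P.1) ∧
      ∀ (P : LockAndKey.Index d (fun k => n * 2 ^ (i k + 1) - i k) α) (k : Fin d),
        LockAndKey.numAlong
          (LockAndKey.edges d (fun k => n * 2 ^ (i k + 1) - i k) α P.1) k = 2 ^ α) ∧
    -- their subdivisions decompose the anchored product
    IsCycleDecomposition
      (anchoredProduct (fun k : Fin d => cyc (2 ^ (n * 2 ^ (i (k + 1) + 1))))
        (fun k : Fin d => everyNth (2 ^ (n * 2 ^ (i (k + 1) + 1))) (2 ^ i (k + 1))))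
      (a * 2 ^ α)
      (fun P : LockAndKey.Index d (fun k => n * 2 ^ (i k + 1) - i k) α =>
        LockAndKey.subdivide (LockAndKey.edges d (fun k => n * 2 ^ (i k + 1) - i k) α P.1)) ∧
    -- the hypercube
    ∃ E : Fin (n * 2 ^ (2 * a * n - α)) → Set (Sym2 (Fin (2 * a * n) → Bool)),
      IsCycleDecomposition (hypercube (2 * a * n)) (a * 2 ^ α) E := by
  have hge := fun k => mul_two_pow_sub_ge n (i k) hn
  have hsumN : ∑ k ∈ Finset.Icc 1 d, n * 2 ^ (i k + 1) = 2 * a * n := by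
    simp only [pow_succ]
    rw [← Finset.mul_sum, ← Finset.sum_mul, ← ha]
    ring
  have hlevel : LockAndKey.level d (fun k => n * 2 ^ (i k + 1) - i k) d
      = 2 * a * n - (d - 1) - ∑ k ∈ Finset.Icc 1 d, (i k : ℤ) := by
    have h1 : ∑ k ∈ Finset.Icc 1 d, ((n * 2 ^ (i k + 1) - i k : ℕ) : ℤ)
        = 2 * a * n - ∑ k ∈ Finset.Icc 1 d, (i k : ℤ) := by
      have h2 : ((∑ k ∈ Finset.Icc 1 d, n * 2 ^ (i k + 1) : ℕ) : ℤ) = 2 * a * n := by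
        rw [hsumN]
        push_cast
        ring
      rw [← h2, Nat.cast_sum, ← Finset.sum_sub_distrib]
      refine Finset.sum_congr rfl fun k _ => Nat.cast_sub ?_
      have := hge k
      omega
    obtain ⟨d', rfl⟩ : ∃ d', d = d' + 1 := ⟨d - 1, by omega⟩
    rw [Finset.sum_Icc_succ_top (by omega) fun k => ((n * 2 ^ (i k + 1) - i k : ℕ) : ℤ)] at h1
    rw [LockAndKey.level, Nat.add_sub_cancel, h1]
    ring
  have hA := LockAndKey.isCycleDecomposition_edges (e := fun k => n * 2 ^ (i k + 1) - i k)
    (α := α) hd (fun k _ _ => by have := hge k; show 2 ≤ n * 2 ^ (i k + 1) - i k; omega)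
    (by simpa [hid, mul_comm] using hα) (by rw [hlevel]; exact hα')
  have hsumq : ∑ k : Fin d, 2 ^ i (k + 1) = a := by
    rw [sum_fin_eq_sum_Icc (fun k => 2 ^ i k), ha]
  have hB := LockAndKey.isCycleDecomposition_subdivide (M := 2 ^ α)
    (z := fun k : Fin d => 2 ^ (n * 2 ^ (i (k + 1) + 1) - i (k + 1)))
    (q := fun k : Fin d => 2 ^ i (k + 1)) (y := fun k : Fin d => 2 ^ (n * 2 ^ (i (k + 1) + 1)))
    ⟨0, by omega⟩
    (fun k => le_trans (by norm_num) (Nat.pow_le_pow_right (n := 2) (by norm_num)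
      (show 2 ≤ n * 2 ^ (i (k + 1) + 1) - i (k + 1) by have := hge (k + 1); omega)))
    (fun k => by positivity)
    (fun k => by
      rw [← pow_add]
      congr 1
      have := hge (k + 1)
      omega)
    _ hA.1 hA.2
  rw [hsumq] at hB
  refine ⟨hA, hB, exists_isCycleDecomposition_hypercube hn ⟨0, by omega⟩ (fun k => i (k + 1)) ?_
    hB ?_ ?_⟩
  · rw [sum_fin_eq_sum_Icc (fun k => n * 2 ^ (i k + 1)), hsumN]
  · rw [ha]
    exact Nat.mul_pos (Finset.sum_pos (fun k _ => by positivity) ⟨1, by simp; omega⟩)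
      (by positivity)
  · have hle : α ≤ 2 * a * n := by
      have h1 : (0 : ℤ) ≤ ∑ k ∈ Finset.Icc 1 d, (i k : ℤ) := Finset.sum_nonneg fun k _ => by simp
      have h2 : (2 : ℤ) ≤ d := by exact_mod_cast hd
      have h3 : (α : ℤ) ≤ ((2 * a * n : ℕ) : ℤ) := by push_cast; linarith
      exact_mod_cast h3
    have h4 : 2 ^ (2 * a * n) = 2 ^ (2 * a * n - α) * 2 ^ α := by
      rw [← pow_add, Nat.sub_add_cancel hle]
    rw [h4]
    ring
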